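/- Let $f:\mathbb R^n\to\mathbb R^n$ and $B:\mathbb R^n\to\mathbb R^{n\times n}$ be $C^2$, and let $\bar u$ be a nonconstant, $T$-periodic ($T>0$) stationary solution of $u_t+f(u)_x=(B(u)u_x)_x$ satisfying the traveling-wave equation $$u'=B(u)^{-1}\big(f(u)-f(u_-)-s(u-u_-)\big)\tag{1}$$ with $s=0$ and some rest point $u_-\in\mathbb R^n$. Assume $\operatorname{Re}\sigma(B(\bar u(x)))>0$ for all $x$ and $\det df(u_-)\ne0$. For $(v,a,s)$ near $(u_-,\bar u(0),0)$ let $u^{(v,a,s)}$ be the solution on $[0,T]$ of (1) with $u_-$ replaced by $v$ and $u(0)=a$, and let $d(v,a,s)=u^{(v,a,s)}(T)-u^{(v,a,s)}(0)$. Assume that $\bar u$ is transversal: $\partial d/\partial(a,s)$ has full rank $n$ at $(u_-,\bar u(0),0)$. Assume finally that (1) is quasi-Hamiltonian at $s=0$: there is a $C^1$ function $H(v,u)$, defined for $(v,u)$ near $\{u_-\}\times\bar u(\mathbb R)$, that is constant along solutions of (1) with rest point $v$ and $s=0$, and $\nabla_uH(u_-,\bar u(0))\neq0$. Then for $v$ near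 $u_-$ there are locally unique $(a(v),s(v))$, continuous at $u_-$, with $(a,s)(u_-)=(\bar u(0),0)$, $d(v,a(v),s(v))=0$ and $a(v)-\bar u(0)\perp\bar u'(0)$; and the mass map $\bar u_m(v)=\int_0^Tu^{(v,a(v),s(v))}(x)\,dx$ is differentiable at $u_-$. Write $\partial\bar u_m/\partial u_-$ for its derivative there and $\Delta=\det(\partial\bar u_m/\partial u_-)$. Let $Lw=(Bw')'-(Aw)'$ with $B=B(\bar u(x))$ and $A(x)w=df(\bar u)w-(dB(\bar u)w)\bar u'$, regarded on $L^p(\mathbb R;\mathbb C^n)$ with domain $W^{2,p}$. A $k$-eigenvalue ($k\in\mathbb R$) is a $\lambda\in\mathbb C$ for which $Lw=\lambda w$ has a nonzero solution with $w(x+T)=e^{ikT}w(x)$; its multiplicity is the order of vanishing at $\lambda$ of the Evans function $D(k,\cdot)$, $D(k,\lambda)=\det(M(\lambda)-e^{ikT})$, where $M(\lambda)$ is the monodromy matrix over $[0,T]$ of $Lw=\lambda w$ written as a first-order system for $(w,w')$. We say that the spectrum of $L$ near the origin consists of curves $\lambda_i(k)$ if for some $\delta,\varepsilon>0$ and all $|k|<\delta$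 the $k$-eigenvalues in $|\lambda|<\varepsilon$ are exactly the $\lambda_i(k)$, counted with multiplicity; all $\lambda_i(k)$ are then to lie in $\sigma(L)$ on $L^p$, for every $1\le p\le\infty$. **(i)** Suppose $\Delta\neq0$ and let $\alpha_1,\dots,\alpha_n$ be the eigenvalues, with algebraic multiplicity, of $df(u_-)(\partial\bar u_m/\partial u_-)^{-1}$. Then the spectrum of $L$ near the origin consists of $n+1$ curves, $\lambda_0(k)=o(k)$ and $\lambda_j(k)=-i\alpha_jkT+o(k)$ for $j=1,\dots,n$. Here $\lambda_0$, and each $\lambda_j$ with $\alpha_j$ simple, is $C^\infty$ on $(-\delta,\delta)$; a $\lambda_j$ with repeated $\alpha_j$ is $C^1$ on $(-\delta,\delta)$ and $C^\infty$ away from $k=0$. In particular, for each $1\le p\le\infty$, reality of $\sigma\big(df(u_-)(\partial\bar u_m/\partial u_-)^{-1}\big)$ is necessary for weak spectral stability, $\sigma(L)\subset\{\operatorname{Re}\lambda\le0\}$ on $L^p$. **(ii)** Suppose $\Delta=0$ and let $\beta_1,\dots,\beta_r$ be the nonzero eigenvalues, with algebraic multiplicity, of $(\partial\bar u_m/\partial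 u_-)\,df(u_-)^{-1}$. Then the spectrum of $L$ near the origin consists of $r+1$ curves $\lambda_0,\dots,\lambda_r$ exactly as in (i), with $\alpha_j=\beta_j^{-1}$, together with $m\ge n-r$ continuous nonsmooth curves $\nu_i$, where $\nu_i(k)\sim c_i^\pm|k|^{p_i/q_i}$ as $k\to0^\pm$ with $c_i^\pm\ne0$ and rational $0<p_i/q_i<1$. In particular $\bar u$ is spectrally unstable: for each $1\le p\le\infty$, $\sigma(L)$ on $L^p$ contains some $\lambda$ with $\operatorname{Re}\lambda>0$. -/

import Mathlib

open Filter Topology MeasureTheory Asymptotics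
open scoped ContDiff Matrix ENNReal NNReal

noncomputable section

namespace PeriodicWave

variable {n : ℕ}

/-- The Jacobian matrix of `g : ℝⁿ → ℝⁿ` at `v`. -/
def jac (g : (Fin n → ℝ) → (Fin n → ℝ)) (v : Fin n → ℝ) : Matrix (Fin n) (Fin n) ℝ :=
  LinearMap.toMatrix' (fderiv ℝ g v : (Fin n → ℝ) →ₗ[ℝ] (Fin n → ℝ))

/-- A real matrix regarded as a complex one. -/
def cplx {m : Type*} (N : Matrix m m ℝ) : Matrix m m ℂ := N.map (fun r : ℝ => (r : ℂ))

/-! ### The traveling-wave equation and its periodic solutions -/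

/-- The right-hand side `B(u)⁻¹ (f(u) - f(v) - s (u - v))` of the traveling-wave equation with
rest point `v` and speed `s`. -/
def field (f : (Fin n → ℝ) → (Fin n → ℝ)) (B : (Fin n → ℝ) → Matrix (Fin n) (Fin n) ℝ)
    (v : Fin n → ℝ) (s : ℝ) (u : Fin n → ℝ) : Fin n → ℝ :=
  (B u)⁻¹ *ᵥ (f u - f v - s • (u - v))

/-- `ubar` is a nonconstant stationary (speed `0`) solution, of period `T`, of the traveling-wave
equation with rest point `um`. -/
structure IsPeriodicProfile (f : (Fin n → ℝ) → (Fin n → ℝ))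
    (B : (Fin n → ℝ) → Matrix (Fin n) (Fin n) ℝ) (T : ℝ) (um : Fin n → ℝ)
    (ubar : ℝ → Fin n → ℝ) : Prop where
  period_pos : 0 < T
  periodic : ∀ x, ubar (x + T) = ubar x
  nonconstant : ∃ x, ubar x ≠ ubar 0
  ode : ∀ x, HasDerivAt ubar (field f B um 0 (ubar x)) x

/-- `u` solves, on `[0, T]`, the traveling-wave equation with rest point `v`, speed `s` and
initial value `a`. -/
def SolvesOn (f : (Fin n → ℝ) → (Fin n → ℝ)) (B : (Fin n → ℝ) → Matrix (Fin n) (Fin n) ℝ)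
    (T : ℝ) (v a : Fin n → ℝ) (s : ℝ) (u : ℝ → Fin n → ℝ) : Prop :=
  u 0 = a ∧ ∀ x ∈ Set.Icc 0 T, HasDerivWithinAt u (field f B v s (u x)) (Set.Icc 0 T) x

open Classical in
/-- The solution on `[0, T]` with parameters `(v, a, s)`: rest point, initial value, speed. For
parameters close to those of a periodic profile it exists and is unique on `[0, T]`; only such
parameters matter below. -/
def flow (f : (Fin n → ℝ) → (Fin n → ℝ)) (B : (Fin n → ℝ) → Matrix (Fin n) (Fin n) ℝ)
    (T : ℝ) (v a : Fin n → ℝ) (s : ℝ) : ℝ → Fin n → ℝ :=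
  if h : ∃ u, SolvesOn f B T v a s u then h.choose else fun _ => a

/-- The separation function `d(v, a, s)`: the increment over `[0, T]` of the solution. It
vanishes when the solution is `T`-periodic. -/
def separation (f : (Fin n → ℝ) → (Fin n → ℝ)) (B : (Fin n → ℝ) → Matrix (Fin n) (Fin n) ℝ)
    (T : ℝ) (v a : Fin n → ℝ) (s : ℝ) : Fin n → ℝ :=
  flow f B T v a s T - flow f B T v a s 0

/-- Transversality of the profile: the `n × (n + 1)` derivative of the separation function with
respect to (initial value, speed), at fixed rest point, has full rank `n`. -/
def IsTransversal (f : (Fin n → ℝ) → (Fin n → ℝ))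
    (B : (Fin n → ℝ) → Matrix (Fin n) (Fin n) ℝ) (T : ℝ) (um : Fin n → ℝ)
    (ubar : ℝ → Fin n → ℝ) : Prop :=
  Function.Surjective
    (fderiv ℝ (fun q : (Fin n → ℝ) × ℝ => separation f B T um q.1 q.2) (ubar 0, 0))

/-- `N` is the derivative at `um` of the mass map `v ↦ ∫₀ᵀ u^{(v, a(v), s(v))}`, where
`(a(v), s(v))` is the (locally unique) selection, through `(ubar 0, 0)`, of initial value and
speed that makes the solution `T`-periodic, with the component of the initial value in the
direction `ubar' 0` held fixed to remove translations. -/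
def IsMassJacobian (f : (Fin n → ℝ) → (Fin n → ℝ))
    (B : (Fin n → ℝ) → Matrix (Fin n) (Fin n) ℝ) (T : ℝ) (um : Fin n → ℝ)
    (ubar : ℝ → Fin n → ℝ) (N : Matrix (Fin n) (Fin n) ℝ) : Prop :=
  ∃ (a : (Fin n → ℝ) → (Fin n → ℝ)) (s : (Fin n → ℝ) → ℝ),
    a um = ubar 0 ∧ s um = 0 ∧ ContinuousAt a um ∧ ContinuousAt s um ∧
    (∀ᶠ v in 𝓝 um,
      (a v - ubar 0) ⬝ᵥ deriv ubar 0 = 0 ∧ separation f B T v (a v) (s v) = 0) ∧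
    HasFDerivAt (fun v => ∫ x in (0 : ℝ)..T, flow f B T v (a v) (s v) x)
      (LinearMap.toContinuousLinearMap (Matrix.toLin' N)) um

/-- The traveling-wave equation, at speed `0`, is quasi-Hamiltonian near the profile: it has a
`C¹` integral of motion `H(v, u)`, for rest points `v` near `um` and states `u` near the orbit,
which is nondegenerate in `u` on the orbit (a constant is not an integral of motion). -/
def IsQuasiHamiltonian (f : (Fin n → ℝ) → (Fin n → ℝ))
    (B : (Fin n → ℝ) → Matrix (Fin n) (Fin n) ℝ) (um : Fin n → ℝ)
    (ubar : ℝ → Fin n → ℝ) : Prop :=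
  ∃ (U : Set ((Fin n → ℝ) × (Fin n → ℝ))) (H : (Fin n → ℝ) × (Fin n → ℝ) → ℝ),
    IsOpen U ∧ (∀ x, (um, ubar x) ∈ U) ∧ ContDiffOn ℝ 1 H U ∧
    (∀ (v : Fin n → ℝ) (u : ℝ → Fin n → ℝ) (b : ℝ),
      (∀ x ∈ Set.Icc 0 b, (v, u x) ∈ U ∧
        HasDerivWithinAt u (field f B v 0 (u x)) (Set.Icc 0 b) x) →
      ∀ x ∈ Set.Icc 0 b, H (v, u x) = H (v, u 0)) ∧
    fderiv ℝ (fun u => H (um, u)) (ubar 0) ≠ 0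

/-! ### The linearized operator `L w = (B w')' - (A w)'` and its spectrum -/

/-- The viscosity coefficient `B(ubar x)` of the linearized operator. -/
def coeffB (B : (Fin n → ℝ) → Matrix (Fin n) (Fin n) ℝ) (ubar : ℝ → Fin n → ℝ) (x : ℝ) :
    Matrix (Fin n) (Fin n) ℝ :=
  B (ubar x)

/-- The convection coefficient `A(x) w = df(ubar x) w - (dB(ubar x) w) ubar'(x)`, that is the
Jacobian at `ubar x` of `u ↦ f(u) - B(u) ubar'(x)`. -/
def coeffA (f : (Fin n → ℝ) → (Fin n → ℝ)) (B : (Fin n → ℝ) → Matrix (Fin n) (Fin n) ℝ)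
    (ubar : ℝ → Fin n → ℝ) (x : ℝ) : Matrix (Fin n) (Fin n) ℝ :=
  jac (fun u => f u - B u *ᵥ deriv ubar x) (ubar x)

/-- Entrywise derivative of a matrix function. -/
def matDeriv (N : ℝ → Matrix (Fin n) (Fin n) ℝ) (x : ℝ) : Matrix (Fin n) (Fin n) ℝ :=
  Matrix.of fun i j => deriv (fun y => N y i j) x

/-- The linearized flux `B w' - A w`, whose derivative is `L w`; here `w₁` stands for `w'`. -/
def linFlux (f : (Fin n → ℝ) → (Fin n → ℝ)) (B : (Fin n → ℝ) → Matrix (Fin n) (Fin n) ℝ)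
    (ubar : ℝ → Fin n → ℝ) (w w₁ : ℝ → Fin n → ℂ) (x : ℝ) : Fin n → ℂ :=
  cplx (coeffB B ubar x) *ᵥ w₁ x - cplx (coeffA f B ubar x) *ᵥ w x

/-- The graph of `L` on `Lᵖ(ℝ; ℂⁿ)` with domain `W^{2,p}`: `w ∈ W^{2,p}`, with derivatives `w₁`
and `w₂`, and `g = L w ∈ Lᵖ`. -/
def LinGraph (f : (Fin n → ℝ) → (Fin n → ℝ)) (B : (Fin n → ℝ) → Matrix (Fin n) (Fin n) ℝ)
    (ubar : ℝ → Fin n → ℝ) (p : ℝ≥0∞) (w g : ℝ → Fin n → ℂ) : Prop :=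
  MemLp w p volume ∧ MemLp g p volume ∧
  ∃ w₁ w₂ : ℝ → Fin n → ℂ, MemLp w₁ p volume ∧ MemLp w₂ p volume ∧
    (∀ x, HasDerivAt w (w₁ x) x) ∧
    (∀ x y, w₁ y - w₁ x = ∫ t in x..y, w₂ t) ∧
    (∀ x y, linFlux f B ubar w w₁ y - linFlux f B ubar w w₁ x = ∫ t in x..y, g t)

/-- `z` is in the resolvent set of `L` on `Lᵖ(ℝ; ℂⁿ)`: `z - L` maps the domain bijectively onto
`Lᵖ`, with bounded inverse. -/
def InResolventSet (f : (Fin n → ℝ) → (Fin n → ℝ))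
    (B : (Fin n → ℝ) → Matrix (Fin n) (Fin n) ℝ)
    (ubar : ℝ → Fin n → ℝ) (p : ℝ≥0∞) (z : ℂ) : Prop :=
  (∃ C : ℝ≥0, ∀ w g, LinGraph f B ubar p w g →
    eLpNorm w p volume ≤ C * eLpNorm (fun x => z • w x - g x) p volume) ∧
  ∀ h : ℝ → Fin n → ℂ, MemLp h p volume →
    ∃ w g, LinGraph f B ubar p w g ∧ (fun x => z • w x - g x) =ᵐ[volume] h

/-- The spectrum of `L` on `Lᵖ(ℝ; ℂⁿ)`. -/
def lpSpectrum (f : (Fin n → ℝ) → (Fin n → ℝ)) (B : (Fin n → ℝ) → Matrix (Fin n) (Fin n) ℝ)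
    (ubar : ℝ → Fin n → ℝ) (p : ℝ≥0∞) : Set ℂ :=
  {z | ¬ InResolventSet f B ubar p z}

/-- Weak spectral stability on `Lᵖ`: the spectrum lies in `Re z ≤ 0`. -/
def IsWeaklyStable (f : (Fin n → ℝ) → (Fin n → ℝ))
    (B : (Fin n → ℝ) → Matrix (Fin n) (Fin n) ℝ)
    (ubar : ℝ → Fin n → ℝ) (p : ℝ≥0∞) : Prop :=
  ∀ z ∈ lpSpectrum f B ubar p, z.re ≤ 0

/-- `z` is a `k`-eigenvalue of `L`: `(B w')' - (A w)' = z w` has a nonzero solution with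
`w(x + T) = e^{ikT} w(x)`. -/
def IsBlochEigenvalue (f : (Fin n → ℝ) → (Fin n → ℝ))
    (B : (Fin n → ℝ) → Matrix (Fin n) (Fin n) ℝ) (T : ℝ)
    (ubar : ℝ → Fin n → ℝ) (k : ℝ) (z : ℂ) : Prop :=
  ∃ w w₁ : ℝ → Fin n → ℂ, w ≠ 0 ∧ (∀ x, HasDerivAt w (w₁ x) x) ∧
    (∀ x, HasDerivAt (linFlux f B ubar w w₁) (z • w x) x) ∧
    ∀ x, w (x + T) = Complex.exp (Complex.I * k * T) • w x

/-! ### The periodic Evans function -/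

/-- The coefficient matrix of the eigenvalue equation `(B w')' = (A w)' + z w`, written as a
first-order system for `(w, w')`. -/
def evansCoeff (f : (Fin n → ℝ) → (Fin n → ℝ)) (B : (Fin n → ℝ) → Matrix (Fin n) (Fin n) ℝ)
    (ubar : ℝ → Fin n → ℝ) (z : ℂ) (x : ℝ) : Matrix (Fin n ⊕ Fin n) (Fin n ⊕ Fin n) ℂ :=
  Matrix.fromBlocks 0 1
    (cplx (coeffB B ubar x)⁻¹ *
      (z • (1 : Matrix (Fin n) (Fin n) ℂ) + cplx (matDeriv (coeffA f B ubar) x)))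
    (cplx (coeffB B ubar x)⁻¹ * cplx (coeffA f B ubar x - matDeriv (coeffB B ubar) x))

/-- `Y` is the fundamental solution of `Y' = 𝔸 Y`, `Y(0) = I`. -/
def IsFundamental {m : Type*} [Fintype m] [DecidableEq m] (𝔸 : ℝ → Matrix m m ℂ)
    (Y : ℝ → Matrix m m ℂ) : Prop :=
  Y 0 = 1 ∧ ∀ x i j, HasDerivAt (fun y => Y y i j) ((𝔸 x * Y x) i j) x

open Classical in
/-- The monodromy matrix: the value at `T` of the fundamental solution (which is unique, and
exists for continuous coefficients). -/
def monodromy {m : Type*} [Fintype m] [DecidableEq m] (T : ℝ) (𝔸 : ℝ → Matrix m m ℂ) :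
    Matrix m m ℂ :=
  if h : ∃ Y, IsFundamental 𝔸 Y then h.choose T else 1

/-- The periodic Evans function `D(k, z) = det (M(z) - e^{ikT})`. -/
def evans (f : (Fin n → ℝ) → (Fin n → ℝ)) (B : (Fin n → ℝ) → Matrix (Fin n) (Fin n) ℝ)
    (T : ℝ) (ubar : ℝ → Fin n → ℝ) (k : ℝ) (z : ℂ) : ℂ :=
  (monodromy T (evansCoeff f B ubar z) -
    Complex.exp (Complex.I * k * T) • (1 : Matrix (Fin n ⊕ Fin n) (Fin n ⊕ Fin n) ℂ)).det

/-! ### Curves of spectrum near the origin -/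

/-- For `|k| < δ` and `|z| < ε` the spectrum of `L` consists exactly of the curves `curve i`:
the `k`-eigenvalues in `|z| < ε` are the `curve i k`, with multiplicity (the order of vanishing
of the Evans function), and they are in the spectrum of `L` on every `Lᵖ`. -/
def SpectrumNearOrigin (f : (Fin n → ℝ) → (Fin n → ℝ))
    (B : (Fin n → ℝ) → Matrix (Fin n) (Fin n) ℝ) (T : ℝ) (ubar : ℝ → Fin n → ℝ) (δ ε : ℝ)
    {ι : Type} [Fintype ι] (curve : ι → ℝ → ℂ) : Prop :=
  ∀ k : ℝ, |k| < δ →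
    (∀ i, ‖curve i k‖ < ε) ∧
    (∀ z : ℂ, ‖z‖ < ε → (IsBlochEigenvalue f B T ubar k z ↔ ∃ i, curve i k = z)) ∧
    (∀ z : ℂ, ‖z‖ < ε →
      analyticOrderAt (evans f B T ubar k) z = (Nat.card {i // curve i k = z} : ℕ∞)) ∧
    ∀ i, ∀ p : ℝ≥0∞, 1 ≤ p → curve i k ∈ lpSpectrum f B ubar p

/-- The curves `lam 0, …, lam r` are smooth on `(-δ, δ)` with `lam 0 (k) = o(k)` and
`lam j (k) = -i α_j k T + o(k)` for `1 ≤ j ≤ r`. Smoothness: `lam 0`, and every `lam j` with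
`α_j` simple, is `C^∞`; a `lam j` with repeated `α_j` is `C¹`, and `C^∞` away from `k = 0`. -/
def SmoothBranches (T δ : ℝ) {r : ℕ} (α : Fin r → ℂ) (lam : Fin (r + 1) → ℝ → ℂ) : Prop :=
  ContDiffOn ℝ ∞ (lam 0) (Set.Ioo (-δ) δ) ∧
  (lam 0 =o[𝓝 0] fun k : ℝ => k) ∧
  ∀ j : Fin r,
    ContDiffOn ℝ 1 (lam j.succ) (Set.Ioo (-δ) δ) ∧
    ContDiffOn ℝ ∞ (lam j.succ) (Set.Ioo (-δ) δ \ {0}) ∧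
    ((∀ i, α i = α j → i = j) → ContDiffOn ℝ ∞ (lam j.succ) (Set.Ioo (-δ) δ)) ∧
    ((fun k : ℝ => lam j.succ k - -(Complex.I * α j * k * T)) =o[𝓝 0] fun k : ℝ => k)

/-- `ν(k) ~ k^e` as `k → 0`: `ν` is continuous on `(-δ, δ)` and, on each side of `0`,
asymptotic to a nonzero constant times `|k|^e`. -/
def PowerBranch (δ : ℝ) (ν : ℝ → ℂ) (e : ℚ) : Prop :=
  ContinuousOn ν (Set.Ioo (-δ) δ) ∧
  (∃ c : ℂ, c ≠ 0 ∧ Tendsto (fun k : ℝ => ν k / ((|k| ^ (e : ℝ) : ℝ) : ℂ)) (𝓝[>] 0) (𝓝 c)) ∧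
  ∃ c : ℂ, c ≠ 0 ∧ Tendsto (fun k : ℝ => ν k / ((|k| ^ (e : ℝ) : ℝ) : ℂ)) (𝓝[<] 0) (𝓝 c)

end PeriodicWave

end

open PeriodicWave

open scoped BoundedContinuousFunction

noncomputable section

namespace PeriodicWave

/-! For `w` together with its flux `z = B w' - A w`, the eigenvalue equation is the system `w' = B⁻¹
(A w + z)`, `z' = λ w`, whose coefficients are affine in `λ`. The monodromy `M(λ)` is therefore
entire, and `D(k, λ) = det (M(λ) - e^{ikT})` extends to an analytic function of two complex
variables (`evans_eq`, `analyticAt_evansC`). The curves are found from the way `D` vanishes at the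
origin.

At `λ = 0` the flux is a constant of integration, and `w` solves the variational equation of the
travelling-wave ODE in which the rest point moves by `v`, with `z = -df(u₋) v`; since `df(u₋)` is
invertible, every constant flux arises so. Thus `M(0) - 1` is expressed through the derivative of
the period map. By transversality its kernel is spanned by `(ū'(0), 0)` and by the `n` variations of
the periodic orbit with its rest point. The gradient `ℓ` of the integral of motion is preserved by
the linearized period map, so the range of `M(0) - 1` lies in the common kernel of `ℓ` and of the
flux component. Kernel and cokernel both have dimension `n + 1`. Moreover `ℓ` shows that the speed
of the nearby periodic orbits is stationary at `u₋`, so the mass derivative `N` is the integral of a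
variation at speed zero, and this integral is the flux gained over a period at first order in `λ`. A
Lyapunov–Schmidt reduction (`exists_tendsto_det_add_smul`) then gives `D(k, kμ) / k^(n+1) → C μ det
(μ N + i T df(u₋))` with `C ≠ 0` (`exists_tendsto_evansC`).

An energy estimate in a variable Lyapunov inner product shows that `D(0, ·)` is not identically zero
(`exists_evans_ne_zero`), so the Newton–Puiseux theorem writes `D(t^q, λ)` as `∏ (λ - φ_i(t))` times
a unit (`exists_puiseux_factorization`). Comparison with the limit above at `λ = kμ` shows that the
branches of size `O(k)` have as slopes exactly the roots of the limit polynomial, that the others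
behave like `k^(p/q)` with `0 < p < q`, and that all these orders add up to `n + 1`
(`exists_branch_factorization`). If `det N ≠ 0`, the polynomial has degree `n + 1` and leaves no
room for fractional branches; if `det N = 0`, its degree is `r + 1 ≤ n` and at least `n - r` of them
remain. A branch with simple slope is unchanged when `t` is rotated by a `q`-th root of unity, hence
analytic in `k`.

A nonreal `α_j` drives its branch into the right half plane for one sign of `k`. A fractional branch
has, over the two half axes, the leading coefficients `η^p c` with `η^(2q) = 1`; these sum to zero
and are not all imaginary, so one has positive real part (`exists_re_pos`). Bloch waves, cut off
when `p < ∞`, place every Bloch eigenvalue in the spectrum on `Lᵖ` (`mem_lpSpectrum`). -/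

section

/-! ### Linear Volterra equations on a compact interval containing `0` -/

section Volterra

variable {E : Type*} [NormedAddCommGroup E] {a b : ℝ}

/-- A continuous function on `[a, b]`, extended to the line by constants. -/
def ext (ha : a ≤ 0) (hb : 0 ≤ b) (u : (Set.Icc a b →ᵇ E)) (t : ℝ) : E :=
  u (Set.projIcc a b (ha.trans hb) t)

lemma continuous_ext (ha : a ≤ 0) (hb : 0 ≤ b) (u : (Set.Icc a b →ᵇ E)) :
    Continuous (ext ha hb u) :=
  u.continuous.comp continuous_projIcc

lemma ext_of_mem (ha : a ≤ 0) (hb : 0 ≤ b) (u : (Set.Icc a b →ᵇ E)) {t : ℝ}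
    (ht : t ∈ Set.Icc a b) : ext ha hb u t = u ⟨t, ht⟩ := by
  simp [ext, Set.projIcc_of_mem _ ht]

lemma norm_ext_le (ha : a ≤ 0) (hb : 0 ≤ b) (u : (Set.Icc a b →ᵇ E)) (t : ℝ) :
    ‖ext ha hb u t‖ ≤ ‖u‖ :=
  u.norm_coe_le_norm _

variable {𝕜 : Type*} [RCLike 𝕜] [NormedSpace 𝕜 E]

/-- Pointwise application of a continuous family of operators. -/
def mulOp (K : (Set.Icc a b →ᵇ (E →L[𝕜] E))) : (Set.Icc a b →ᵇ E) →L[𝕜] (Set.Icc a b →ᵇ E) :=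
  LinearMap.mkContinuous
    { toFun := fun u => BoundedContinuousFunction.mkOfCompact ⟨fun x => K x (u x), by fun_prop⟩
      map_add' := fun u v => by ext x; simp
      map_smul' := fun c u => by ext x; simp }
    ‖K‖ fun u => by
      refine (BoundedContinuousFunction.norm_le (by positivity)).2 fun x => ?_
      exact (K x).le_of_opNorm_le_of_le (K.norm_coe_le_norm x) (u.norm_coe_le_norm x)

@[simp] lemma mulOp_apply (K : (Set.Icc a b →ᵇ (E →L[𝕜] E))) (u : (Set.Icc a b →ᵇ E))
    (x : Set.Icc a b) : mulOp K u x = K x (u x) := rfl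

variable [NormedSpace ℝ E]

/-- The primitive `x ↦ ∫₀ˣ u` of a continuous function on `[a, b]`. -/
def prim (ha : a ≤ 0) (hb : 0 ≤ b) (u : (Set.Icc a b →ᵇ E)) : (Set.Icc a b →ᵇ E) :=
  BoundedContinuousFunction.mkOfCompact ⟨fun x => ∫ t in (0 : ℝ)..x, ext ha hb u t,
    (intervalIntegral.continuous_primitive
      (fun _ _ => (continuous_ext ha hb u).intervalIntegrable _ _) 0).comp continuous_subtype_val⟩

lemma prim_apply (ha : a ≤ 0) (hb : 0 ≤ b) (u : (Set.Icc a b →ᵇ E)) (x : Set.Icc a b) :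
    prim ha hb u x = ∫ t in (0 : ℝ)..x, ext ha hb u t := rfl

lemma norm_prim_le (ha : a ≤ 0) (hb : 0 ≤ b) (u : (Set.Icc a b →ᵇ E)) :
    ‖prim ha hb u‖ ≤ (b - a) * ‖u‖ := by
  refine (BoundedContinuousFunction.norm_le (by have := norm_nonneg u; nlinarith)).2 fun x => ?_
  rw [prim_apply]
  refine (intervalIntegral.norm_integral_le_of_norm_le_const
    (fun t _ => norm_ext_le ha hb u t)).trans ?_
  rw [mul_comm]
  refine mul_le_mul_of_nonneg_right ?_ (norm_nonneg _)
  have := x.2.1; have := x.2.2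
  rw [sub_zero, abs_le]; constructor <;> linarith

variable [SMulCommClass ℝ 𝕜 E]

variable (𝕜) in
/-- The primitive as a bounded operator. -/
def primL (ha : a ≤ 0) (hb : 0 ≤ b) : (Set.Icc a b →ᵇ E) →L[𝕜] (Set.Icc a b →ᵇ E) :=
  LinearMap.mkContinuous
    { toFun := prim ha hb
      map_add' := fun u v => by
        ext x
        simp only [BoundedContinuousFunction.add_apply, prim_apply]
        rw [← intervalIntegral.integral_add ((continuous_ext ha hb u).intervalIntegrable _ _)
          ((continuous_ext ha hb v).intervalIntegrable _ _)]
        rfl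
      map_smul' := fun c u => by
        ext x
        simp only [BoundedContinuousFunction.smul_apply, prim_apply, RingHom.id_apply]
        rw [← intervalIntegral.integral_smul]
        rfl }
    (b - a) (norm_prim_le ha hb)

/-- The Volterra operator `u ↦ ∫₀ˣ K u`. -/
def volterra (ha : a ≤ 0) (hb : 0 ≤ b) (K : (Set.Icc a b →ᵇ (E →L[𝕜] E))) :
    (Set.Icc a b →ᵇ E) →L[𝕜] (Set.Icc a b →ᵇ E) :=
  primL 𝕜 ha hb ∘L mulOp K

lemma volterra_apply (ha : a ≤ 0) (hb : 0 ≤ b) (K : (Set.Icc a b →ᵇ (E →L[𝕜] E)))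
    (u : (Set.Icc a b →ᵇ E)) (x : Set.Icc a b) :
    volterra ha hb K u x = ∫ t in (0 : ℝ)..x, ext ha hb K t (ext ha hb u t) := rfl

lemma abs_integral_pow (x : ℝ) (m : ℕ) :
    |∫ t in (0 : ℝ)..x, |t| ^ m| = |x| ^ (m + 1) / (m + 1) := by
  rcases le_total 0 x with hx | hx
  · have : ∫ t in (0 : ℝ)..x, |t| ^ m = ∫ t in (0 : ℝ)..x, t ^ m := by
      refine intervalIntegral.integral_congr fun t ht => ?_
      rw [Set.uIcc_of_le hx] at ht
      simp [abs_of_nonneg ht.1]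
    rw [this, integral_pow, abs_of_nonneg hx, abs_of_nonneg] <;> simp; positivity
  · have : ∫ t in (0 : ℝ)..x, |t| ^ m = ∫ t in (0 : ℝ)..x, (-t) ^ m := by
      refine intervalIntegral.integral_congr fun t ht => ?_
      rw [Set.uIcc_of_ge hx] at ht
      simp [abs_of_nonpos ht.2]
    rw [this, intervalIntegral.integral_comp_neg (fun t => t ^ m), integral_pow, abs_of_nonpos hx]
    have : 0 ≤ (-x) ^ (m + 1) := pow_nonneg (by linarith) _
    simp only [neg_zero, ne_eq, Nat.add_eq_zero_iff, one_ne_zero, and_false, not_false_eq_true,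
      zero_pow, zero_sub, neg_div, abs_neg]
    rw [abs_of_nonneg (by positivity)]

/-- Each iteration integrates the previous bound, turning `|t|^m / m!` into `|x|^(m+1) / (m+1)!`.
The factorial makes a power of the operator contractive on intervals of any length. -/
lemma norm_volterra_pow_apply_le (ha : a ≤ 0) (hb : 0 ≤ b) (K : (Set.Icc a b →ᵇ (E →L[𝕜] E)))
    (u : (Set.Icc a b →ᵇ E)) (m : ℕ) (x : Set.Icc a b) :
    ‖(volterra ha hb K ^ m) u x‖ ≤ ‖K‖ ^ m * |(x : ℝ)| ^ m / m.factorial * ‖u‖ := by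
  induction m generalizing x with
  | zero => simpa using u.norm_coe_le_norm x
  | succ m ih =>
    rw [pow_succ', mul_apply_eq_comp, volterra_apply]
    set C := ‖K‖ ^ (m + 1) / m.factorial * ‖u‖
    have hC : 0 ≤ C := by positivity
    have key : ∀ t ∈ Set.uIoc 0 (x : ℝ),
        ‖ext ha hb K t (ext ha hb ((volterra ha hb K ^ m) u) t)‖ ≤ C * |t| ^ m := by
      intro t ht
      have htm : t ∈ Set.Icc a b := by
        have h1 := x.2.1; have h2 := x.2.2
        rcases le_total 0 (x : ℝ) with h | h
        · rw [Set.uIoc_of_le h] at ht; exact ⟨by linarith [ht.1], by linarith [ht.2]⟩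
        · rw [Set.uIoc_of_ge h] at ht; exact ⟨by linarith [ht.1], by linarith [ht.2]⟩
      have h1 := ih ⟨t, htm⟩
      rw [ext_of_mem ha hb _ htm, ext_of_mem ha hb _ htm]
      refine ((K ⟨t, htm⟩).le_of_opNorm_le_of_le (K.norm_coe_le_norm _) h1).trans (le_of_eq ?_)
      simp only [C]; ring
    have h2 := intervalIntegral.norm_integral_le_abs_of_norm_le (μ := volume) (a := (0 : ℝ)) (b := (x:ℝ))
      (f := fun t => ext ha hb K t (ext ha hb ((volterra ha hb K ^ m) u) t))
      (g := fun t => C * |t| ^ m)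
      ((ae_restrict_mem measurableSet_uIoc).mono key)
      ((by fun_prop : Continuous fun t : ℝ => C * |t| ^ m).intervalIntegrable _ _)
    refine h2.trans (le_of_eq ?_)
    rw [intervalIntegral.integral_const_mul, abs_mul, abs_integral_pow, abs_of_nonneg hC]
    simp only [C, Nat.factorial_succ]; push_cast
    field_simp

/-- Some power `V ^ m` has norm below `1`, so `1 - V ^ m` is invertible by the Neumann series. It
factors as `(1 - V)(1 + V + ⋯ + V ^ (m - 1))` with commuting factors, hence each factor is
invertible. -/
lemma isUnit_one_sub_volterra [CompleteSpace E] (ha : a ≤ 0) (hb : 0 ≤ b)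
    (K : (Set.Icc a b →ᵇ (E →L[𝕜] E))) : IsUnit (1 - volterra ha hb K) := by
  set V := volterra ha hb K
  have hn : ∀ m, ‖V ^ m‖ ≤ (‖K‖ * (b - a)) ^ m / m.factorial := by
    intro m
    have hba : 0 ≤ b - a := by linarith
    refine ContinuousLinearMap.opNorm_le_bound _ (by positivity) fun u => ?_
    refine (BoundedContinuousFunction.norm_le (by positivity)).2 fun x => ?_
    refine (norm_volterra_pow_apply_le ha hb K u m x).trans ?_
    rw [mul_pow]
    have : |(x : ℝ)| ≤ b - a := by
      have := x.2.1; have := x.2.2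
      rw [abs_le]; constructor <;> linarith
    gcongr
  obtain ⟨m, hm⟩ := ((FloorSemiring.tendsto_pow_div_factorial_atTop
    (‖K‖ * (b - a))).eventually_lt_const one_pos).exists
  have h1 : IsUnit (1 - V ^ m) := (Units.oneSub (V ^ m) ((hn m).trans_lt hm)).isUnit
  rw [← mul_neg_geom_sum] at h1
  exact (((Commute.one_left _).sub_left (Commute.sum_right _ _ _
    fun i _ => (Commute.refl V).pow_right i)).isUnit_mul_iff.1 h1).1

end Volterra

/-! ### Differential equations on an interval in integral form -/

section Integral

variable {E : Type*} [NormedAddCommGroup E] [NormedSpace ℝ E] [CompleteSpace E] {a b : ℝ}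

lemma prim_eq_of_hasDerivWithinAt (ha : a ≤ 0) (hb : 0 ≤ b) {y : ℝ → E}
    {u g : (Set.Icc a b →ᵇ E)} (hu : ∀ x : Set.Icc a b, u x = y x)
    (h : ∀ x : Set.Icc a b, HasDerivWithinAt y (g x) (Set.Icc a b) x) :
    u = BoundedContinuousFunction.const _ (y 0) + prim ha hb g := by
  ext x
  have hsub : Set.uIcc (0 : ℝ) x ⊆ Set.Icc a b := by
    intro t ht
    have h1 := x.2.1; have h2 := x.2.2
    rcases le_total 0 (x : ℝ) with h | h
    · rw [Set.uIcc_of_le h] at ht; exact ⟨by linarith [ht.1], by linarith [ht.2]⟩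
    · rw [Set.uIcc_of_ge h] at ht; exact ⟨by linarith [ht.1], by linarith [ht.2]⟩
  have := intervalIntegral.integral_eq_sub_of_hasDeriv_right (f := y) (f' := ext ha hb g)
    (a := 0) (b := x)
    (fun t ht => ((h ⟨t, hsub ht⟩).mono hsub).continuousWithinAt)
    (fun t ht => by
      have htI : t ∈ Set.Icc a b := hsub (Set.Ioo_subset_Icc_self ht)
      rw [ext_of_mem ha hb g htI]
      refine (((h ⟨t, htI⟩).mono hsub).hasDerivAt ?_).hasDerivWithinAt
      exact Icc_mem_nhds ht.1 ht.2)
    ((continuous_ext ha hb g).intervalIntegrable _ _)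
  simp [prim_apply, this, hu]

lemma hasDerivWithinAt_of_eq_prim (ha : a ≤ 0) (hb : 0 ≤ b) {c : E} {u g : (Set.Icc a b →ᵇ E)}
    (h : u = BoundedContinuousFunction.const _ c + prim ha hb g) (x : Set.Icc a b) :
    HasDerivWithinAt (ext ha hb u) (g x) (Set.Icc a b) x := by
  have h1 : HasDerivAt (fun x => c + ∫ t in (0 : ℝ)..x, ext ha hb g t) (ext ha hb g x) x :=
    (intervalIntegral.integral_hasDerivAt_right
      ((continuous_ext ha hb g).intervalIntegrable _ _)
      ((continuous_ext ha hb g).stronglyMeasurableAtFilter _ _)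
      (continuous_ext ha hb g).continuousAt).const_add c
  rw [ext_of_mem ha hb g x.2] at h1
  refine h1.hasDerivWithinAt.congr_of_mem (fun t ht => ?_) x.2
  rw [ext_of_mem ha hb u ht, h]
  simp [prim_apply]

end Integral

end

section

/-! ### Linear differential equations: propagators -/

section Propagator

variable {E : Type*} [NormedAddCommGroup E] {a b : ℝ} {𝕜 : Type*} [RCLike 𝕜] [NormedSpace 𝕜 E]

variable (𝕜 a b) in
/-- Constant functions. -/
def constL : E →L[𝕜] (Set.Icc a b →ᵇ E) :=
  LinearMap.mkContinuous
    { toFun := fun c => BoundedContinuousFunction.const _ c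
      map_add' := fun _ _ => rfl
      map_smul' := fun _ _ => rfl }
    1 fun c => by
      refine (BoundedContinuousFunction.norm_le (by positivity)).2 fun x => ?_
      rw [one_mul]; exact le_rfl

@[simp] lemma constL_apply (c : E) (x : Set.Icc a b) : constL a b 𝕜 c x = c := rfl

variable (𝕜) in
/-- Evaluation at a point. -/
def evalL (x : Set.Icc a b) : (Set.Icc a b →ᵇ E) →L[𝕜] E :=
  LinearMap.mkContinuous
    { toFun := fun u => u x
      map_add' := fun _ _ => rfl
      map_smul' := fun _ _ => rfl }
    1 fun u => by simpa using u.norm_coe_le_norm x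

@[simp] lemma evalL_apply (x : Set.Icc a b) (u : (Set.Icc a b →ᵇ E)) : evalL 𝕜 x u = u x := rfl

/-- The restriction of a function to a compact interval. -/
def restr {F : Type*} [PseudoMetricSpace F] (a b : ℝ) (K : ℝ → F) (hK : Continuous K) :
    (Set.Icc a b →ᵇ F) :=
  BoundedContinuousFunction.mkOfCompact ⟨fun x => K x, by fun_prop⟩

@[simp] lemma restr_apply {F : Type*} [PseudoMetricSpace F] (K : ℝ → F) (hK : Continuous K)
    (x : Set.Icc a b) : restr a b K hK x = K x := rfl

variable [NormedSpace ℝ E] [SMulCommClass ℝ 𝕜 E]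

/-- The solution operator `c ↦ u` of `u' = K u`, `u(0) = c`. -/
def propagator (ha : a ≤ 0) (hb : 0 ≤ b) (K : (Set.Icc a b →ᵇ (E →L[𝕜] E))) :
    E →L[𝕜] (Set.Icc a b →ᵇ E) :=
  Ring.inverse (1 - volterra ha hb K) ∘L constL a b 𝕜

variable [CompleteSpace E]

lemma propagator_eq_iff (ha : a ≤ 0) (hb : 0 ≤ b) (K : (Set.Icc a b →ᵇ (E →L[𝕜] E)))
    (u : (Set.Icc a b →ᵇ E)) (c : E) :
    u = propagator ha hb K c ↔ u = BoundedContinuousFunction.const _ c + prim ha hb (mulOp K u) := by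
  have hU := isUnit_one_sub_volterra ha hb K
  have h1 : (1 - volterra ha hb K) u = u - prim ha hb (mulOp K u) := rfl
  have h2 : constL a b 𝕜 c = BoundedContinuousFunction.const _ c := rfl
  rw [propagator, ContinuousLinearMap.comp_apply, h2, ← sub_eq_iff_eq_add, ← h1]
  constructor
  · rintro h
    rw [h, ← mul_apply_eq_comp, Ring.mul_inverse_cancel _ hU]; rfl
  · intro h
    rw [← h, ← mul_apply_eq_comp, Ring.inverse_mul_cancel _ hU]; rfl

lemma eq_propagator_of_hasDerivWithinAt (ha : a ≤ 0) (hb : 0 ≤ b) (K : (Set.Icc a b →ᵇ (E →L[𝕜] E)))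
    {y : ℝ → E} (h : ∀ x : Set.Icc a b, HasDerivWithinAt y (K x (y x)) (Set.Icc a b) x)
    (x : Set.Icc a b) : y x = propagator ha hb K (y 0) x := by
  let u : (Set.Icc a b →ᵇ E) :=
    BoundedContinuousFunction.mkOfCompact ⟨fun x => y x, by
      have h1 : ContinuousOn y (Set.Icc a b) := fun t ht => (h ⟨t, ht⟩).continuousWithinAt
      exact continuousOn_iff_continuous_domRestrict.1 h1⟩
  have : u = propagator ha hb K (y 0) := by
    rw [propagator_eq_iff]
    exact prim_eq_of_hasDerivWithinAt ha hb (fun _ => rfl) h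
  rw [← this]; rfl

lemma hasDerivWithinAt_propagator (ha : a ≤ 0) (hb : 0 ≤ b) (K : (Set.Icc a b →ᵇ (E →L[𝕜] E)))
    (c : E) (x : Set.Icc a b) :
    HasDerivWithinAt (ext ha hb (propagator ha hb K c)) (K x (propagator ha hb K c x))
      (Set.Icc a b) x :=
  hasDerivWithinAt_of_eq_prim ha hb ((propagator_eq_iff ha hb K _ c).1 rfl) x

lemma propagator_zero_apply (ha : a ≤ 0) (hb : 0 ≤ b) (K : (Set.Icc a b →ᵇ (E →L[𝕜] E))) (c : E) :
    propagator ha hb K c ⟨0, ha, hb⟩ = c := by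
  have := DFunLike.congr_fun ((propagator_eq_iff ha hb K _ c).1 rfl) ⟨0, ha, hb⟩
  rw [this]; simp [prim_apply]

lemma linear_ode_unique {K : ℝ → E →L[𝕜] E} (hK : Continuous K) {y z : ℝ → E}
    (hy : ∀ x, HasDerivAt y (K x (y x)) x) (hz : ∀ x, HasDerivAt z (K x (z x)) x)
    (h0 : y 0 = z 0) : y = z := by
  funext x
  have ha : -|x| ≤ 0 := by simp
  have hb : 0 ≤ |x| := abs_nonneg x
  have h1 := eq_propagator_of_hasDerivWithinAt ha hb (restr _ _ K hK)
    (fun x => (hy x).hasDerivWithinAt) ⟨x, neg_abs_le x, le_abs_self x⟩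
  have h2 := eq_propagator_of_hasDerivWithinAt ha hb (restr _ _ K hK)
    (fun x => (hz x).hasDerivWithinAt) ⟨x, neg_abs_le x, le_abs_self x⟩
  rw [h0] at h1
  exact h1.trans h2.symm

/-- Solutions exist on every `[-R, R]` without smallness, and uniqueness makes them agree on
overlaps, so they glue to a solution on the line. -/
lemma exists_linear_ode {K : ℝ → E →L[𝕜] E} (hK : Continuous K) (c : E) :
    ∃ y : ℝ → E, y 0 = c ∧ ∀ x, HasDerivAt y (K x (y x)) x := by
  let sol : ∀ R : ℝ, 0 ≤ R → ℝ → E := fun R hR =>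
    ext (neg_nonpos.2 hR) hR (propagator (neg_nonpos.2 hR) hR (restr _ _ K hK) c)
  have hsol : ∀ R (hR : 0 ≤ R), ∀ x ∈ Set.Icc (-R) R,
      HasDerivWithinAt (sol R hR) (K x (sol R hR x)) (Set.Icc (-R) R) x := by
    intro R hR x hx
    have := hasDerivWithinAt_propagator (neg_nonpos.2 hR) hR (restr _ _ K hK) c ⟨x, hx⟩
    simp only [sol]
    rw [ext_of_mem _ _ _ hx]
    exact this
  have h0 : ∀ R (hR : 0 ≤ R), sol R hR 0 = c := fun R hR => by
    simp only [sol]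
    rw [ext_of_mem _ _ _ ⟨neg_nonpos.2 hR, hR⟩]
    exact propagator_zero_apply _ _ _ _
  have hcons : ∀ R R' (hR : 0 ≤ R) (hR' : 0 ≤ R'), R ≤ R' → ∀ x ∈ Set.Icc (-R) R,
      sol R' hR' x = sol R hR x := by
    intro R R' hR hR' h x hx
    have hsub : Set.Icc (-R) R ⊆ Set.Icc (-R') R' := Set.Icc_subset_Icc (by linarith) h
    have := eq_propagator_of_hasDerivWithinAt (neg_nonpos.2 hR) hR (restr _ _ K hK)
      (fun x => (hsol R' hR' x (hsub x.2)).mono hsub) ⟨x, hx⟩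
    rw [h0] at this
    rw [this]
    simp only [sol]
    rw [ext_of_mem _ _ _ hx]
  -- The radius depends on `x`; throughout the unit ball about `x` the glued function is the single
  -- solution of radius `|x| + 2`, so it is differentiable there.
  refine ⟨fun x => sol (|x| + 1) (by positivity) x, h0 _ _, fun x => ?_⟩
  have hpos : 0 ≤ |x| + 2 := by positivity
  have hev : (fun x => sol (|x| + 1) (by positivity) x) =ᶠ[𝓝 x] sol (|x| + 2) hpos := by
    filter_upwards [Metric.ball_mem_nhds x one_pos] with t ht
    have ht' : |t| + 1 ≤ |x| + 2 := by
      have := abs_sub_abs_le_abs_sub t x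
      rw [Metric.mem_ball, Real.dist_eq] at ht
      linarith
    refine (hcons _ _ (by positivity) hpos ht' t ⟨?_, ?_⟩).symm
    · linarith [neg_abs_le t]
    · linarith [le_abs_self t]
  have hx : x ∈ Set.Ioo (-(|x| + 2)) (|x| + 2) :=
    ⟨by linarith [neg_abs_le x], by linarith [le_abs_self x]⟩
  have := (hsol _ hpos x (Set.Ioo_subset_Icc_self hx)).hasDerivAt (Icc_mem_nhds hx.1 hx.2)
  rw [← hev.eq_of_nhds] at this
  exact this.congr_of_eventuallyEq hev

end Propagator

/-! ### Analytic dependence on a linear parameter -/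

section Pencil

variable {E : Type*} [NormedAddCommGroup E] {a b : ℝ} [NormedSpace ℂ E]

lemma volterra_add_smul (ha : a ≤ 0) (hb : 0 ≤ b) (K₀ K₁ : (Set.Icc a b →ᵇ (E →L[ℂ] E))) (z : ℂ) :
    volterra ha hb (K₀ + z • K₁) = volterra ha hb K₀ + z • volterra ha hb K₁ := by
  have : mulOp (K₀ + z • K₁) = mulOp K₀ + z • mulOp K₁ := by ext u x; simp
  rw [volterra, this]
  ext u : 1
  simp [volterra]

variable [CompleteSpace E]

/-- The divided difference in `z` of the propagator of `u' = (K₀ + z K₁) u`. -/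
def propagatorSlope (ha : a ≤ 0) (hb : 0 ≤ b) (K₀ K₁ : (Set.Icc a b →ᵇ (E →L[ℂ] E))) (z : ℂ) :
    E →L[ℂ] (Set.Icc a b →ᵇ E) :=
  Ring.inverse (1 - volterra ha hb (K₀ + z • K₁)) ∘L (volterra ha hb K₁ ∘L propagator ha hb K₀)

/-- This is the resolvent identity for `1 - V₀ - z V₁` and `1 - V₀`. It is exact: the slope still
depends on `z`, so no remainder has to be estimated later. -/
lemma propagator_add_smul (ha : a ≤ 0) (hb : 0 ≤ b) (K₀ K₁ : (Set.Icc a b →ᵇ (E →L[ℂ] E))) (z : ℂ) :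
    propagator ha hb (K₀ + z • K₁) =
      propagator ha hb K₀ + z • propagatorSlope ha hb K₀ K₁ z := by
  have hU := isUnit_one_sub_volterra ha hb (K₀ + z • K₁)
  have hU0 := isUnit_one_sub_volterra ha hb K₀
  set W := 1 - volterra ha hb (K₀ + z • K₁) with hW
  have hW' : W = (1 - volterra ha hb K₀) - z • volterra ha hb K₁ := by
    rw [hW, volterra_add_smul]; abel
  have key : Ring.inverse W = Ring.inverse (1 - volterra ha hb K₀) +
      z • (Ring.inverse W * (volterra ha hb K₁ * Ring.inverse (1 - volterra ha hb K₀))) := by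
    have h1 : Ring.inverse W * W * Ring.inverse (1 - volterra ha hb K₀) =
        Ring.inverse (1 - volterra ha hb K₀) := by
      rw [Ring.inverse_mul_cancel _ hU, one_mul]
    have h2 : W * Ring.inverse (1 - volterra ha hb K₀) =
        1 - z • (volterra ha hb K₁ * Ring.inverse (1 - volterra ha hb K₀)) := by
      rw [hW', sub_mul, Ring.mul_inverse_cancel _ hU0, smul_mul_assoc]
    rw [mul_assoc, h2, mul_sub, mul_one, mul_smul_comm, sub_eq_iff_eq_add] at h1
    exact h1
  have h3 := congrArg (fun L => L ∘L constL a b ℂ) key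
  exact h3

/-- The operator inverted is affine in `z` and invertible for every `z`, and inversion is
differentiable at units; so the inverse is entire. -/
lemma analytic_inverse_volterra (ha : a ≤ 0) (hb : 0 ≤ b) (K₀ K₁ : (Set.Icc a b →ᵇ (E →L[ℂ] E))) :
    Differentiable ℂ fun z : ℂ => Ring.inverse (1 - volterra ha hb (K₀ + z • K₁)) := by
  intro z
  obtain ⟨w, hw⟩ := isUnit_one_sub_volterra ha hb (K₀ + z • K₁)
  have h1 : DifferentiableAt ℂ Ring.inverse (1 - volterra ha hb (K₀ + z • K₁)) := by
    rw [← hw]; exact differentiableAt_inverse ⟨w, rfl⟩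
  have h2 : DifferentiableAt ℂ (fun z : ℂ => 1 - volterra ha hb (K₀ + z • K₁)) z := by
    simp_rw [volterra_add_smul]
    exact (differentiableAt_const _).sub ((differentiableAt_const _).add
      (differentiableAt_id.smul_const _))
  exact DifferentiableAt.comp (g := Ring.inverse) z h1 h2

lemma differentiable_propagatorSlope (ha : a ≤ 0) (hb : 0 ≤ b)
    (K₀ K₁ : (Set.Icc a b →ᵇ (E →L[ℂ] E))) :
    Differentiable ℂ fun z : ℂ => propagatorSlope ha hb K₀ K₁ z :=
  (analytic_inverse_volterra ha hb K₀ K₁).clm_comp (differentiable_const _)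

/-- At `z = 0` the divided difference solves the inhomogeneous variational equation. -/
lemma propagatorSlope_zero (ha : a ≤ 0) (hb : 0 ≤ b) (K₀ K₁ : (Set.Icc a b →ᵇ (E →L[ℂ] E))) (c : E) :
    propagatorSlope ha hb K₀ K₁ 0 c = prim ha hb
      (mulOp K₀ (propagatorSlope ha hb K₀ K₁ 0 c) + mulOp K₁ (propagator ha hb K₀ c)) := by
  have hU := isUnit_one_sub_volterra ha hb K₀
  have e : K₀ + (0 : ℂ) • K₁ = K₀ := by ext; simp
  have h : (1 - volterra ha hb K₀) (propagatorSlope ha hb K₀ K₁ 0 c) =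
      volterra ha hb K₁ (propagator ha hb K₀ c) := by
    simp only [propagatorSlope, ContinuousLinearMap.comp_apply]
    rw [e]
    rw [← mul_apply_eq_comp, Ring.mul_inverse_cancel _ hU]; rfl
  have h2 : (1 - volterra ha hb K₀) (propagatorSlope ha hb K₀ K₁ 0 c) =
    propagatorSlope ha hb K₀ K₁ 0 c -
      primL ℂ ha hb (mulOp K₀ (propagatorSlope ha hb K₀ K₁ 0 c)) := rfl
  rw [h2, sub_eq_iff_eq_add] at h
  have h3 : ∀ u v : (Set.Icc a b →ᵇ E), prim ha hb (u + v) = prim ha hb u + prim ha hb v :=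
    fun u v => (primL ℂ ha hb).map_add u v
  rw [h3, add_comm]
  exact h

end Pencil

end

section

/-! ### Differentiable dependence of solutions on parameters and initial values -/

section Nemytskii

set_option linter.unusedSectionVars false

variable {P E : Type*} [NormedAddCommGroup P] [NormedSpace ℝ P] [NormedAddCommGroup E]
  [NormedSpace ℝ E] {T : ℝ}

open Classical in
/-- The superposition operator `(p, u) ↦ g(p, u(·))`. -/
def superpos (T : ℝ) (g : P × E → E) (q : P × (Set.Icc (0 : ℝ) T →ᵇ E)) : Set.Icc (0 : ℝ) T →ᵇ E :=
  if h : Continuous fun x => g (q.1, q.2 x) then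
    BoundedContinuousFunction.mkOfCompact ⟨fun x => g (q.1, q.2 x), h⟩ else 0

lemma superpos_apply {g : P × E → E} {q : P × (Set.Icc (0 : ℝ) T →ᵇ E)}
    (h : Continuous fun x => g (q.1, q.2 x)) (x : Set.Icc (0 : ℝ) T) :
    superpos T g q x = g (q.1, q.2 x) := by
  rw [superpos, dif_pos h]; rfl

/-- Strict differentiability at each point of the curve becomes uniform by compactness of `[0, T]`.
Continuity at nearby points is carried along because `g` is regular only near the curve, and
superposition with a nearby function must again be continuous. -/
lemma exists_uniform_strict {g : P × E → E} {p₀ : P} {u₀ : Set.Icc (0 : ℝ) T →ᵇ E}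
    (hg : ∀ x, ContDiffAt ℝ 1 g (p₀, u₀ x)) {ε : ℝ} (hε : 0 < ε) :
    ∃ δ > 0, ∀ x, ∀ q₁ ∈ Metric.ball (p₀, u₀ x) δ, ContinuousAt g q₁ ∧
      ∀ q₂ ∈ Metric.ball (p₀, u₀ x) δ,
        ‖g q₁ - g q₂ - fderiv ℝ g (p₀, u₀ x) (q₁ - q₂)‖ ≤ ε * ‖q₁ - q₂‖ := by
  suffices h : ∃ δ > 0, ∀ x ∈ (Set.univ : Set (Set.Icc (0 : ℝ) T)),
      ∀ q₁ ∈ Metric.ball (p₀, u₀ x) δ, ContinuousAt g q₁ ∧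
      ∀ q₂ ∈ Metric.ball (p₀, u₀ x) δ,
        ‖g q₁ - g q₂ - fderiv ℝ g (p₀, u₀ x) (q₁ - q₂)‖ ≤ ε * ‖q₁ - q₂‖ by
    simpa using h
  refine isCompact_univ.induction_on (p := fun S : Set (Set.Icc (0 : ℝ) T) => ∃ δ > 0, ∀ x ∈ S,
      ∀ q₁ ∈ Metric.ball (p₀, u₀ x) δ, ContinuousAt g q₁ ∧
      ∀ q₂ ∈ Metric.ball (p₀, u₀ x) δ,
        ‖g q₁ - g q₂ - fderiv ℝ g (p₀, u₀ x) (q₁ - q₂)‖ ≤ ε * ‖q₁ - q₂‖) ?_ ?_ ?_ ?_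
  · exact ⟨1, one_pos, by simp⟩
  · rintro s t hst ⟨δ, hδ, h⟩
    exact ⟨δ, hδ, fun x hx => h x (hst hx)⟩
  · rintro s t ⟨δ, hδ, h⟩ ⟨δ', hδ', h'⟩
    refine ⟨min δ δ', lt_min hδ hδ', ?_⟩
    rintro x (hx | hx) q₁ hq₁
    · have hs := Metric.ball_subset_ball (x := (p₀, u₀ x)) (min_le_left δ δ')
      exact ⟨(h x hx q₁ (hs hq₁)).1, fun q₂ hq₂ => (h x hx q₁ (hs hq₁)).2 q₂ (hs hq₂)⟩
    · have hs := Metric.ball_subset_ball (x := (p₀, u₀ x)) (min_le_right δ δ')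
      exact ⟨(h' x hx q₁ (hs hq₁)).1, fun q₂ hq₂ => (h' x hx q₁ (hs hq₁)).2 q₂ (hs hq₂)⟩
  · intro x₀ _
    have hε2 : 0 < ε / 2 := by positivity
    have h1 := ((hg x₀).hasStrictFDerivAt one_ne_zero).isLittleO.def hε2
    rw [nhds_prod_eq] at h1
    obtain ⟨A, hA, hA'⟩ := eventually_prod_self_iff'.1 h1
    have h2 : ∀ᶠ q in 𝓝 (p₀, u₀ x₀), ContinuousAt g q :=
      ((hg x₀).eventually (by simp)).mono fun q hq => hq.continuousAt
    obtain ⟨δ, hδ, hball⟩ := Metric.nhds_basis_ball.mem_iff.1 (inter_mem hA h2)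
    have hfc : ContinuousAt (fun x => fderiv ℝ g (p₀, u₀ x)) x₀ := by
      have : ContinuousAt (fderiv ℝ g) (p₀, u₀ x₀) :=
        ((hg x₀).fderiv_right (m := 0) le_rfl).continuousAt
      exact ContinuousAt.comp (f := fun x => (p₀, u₀ x)) this (by fun_prop)
    have hN : {x | dist (fderiv ℝ g (p₀, u₀ x)) (fderiv ℝ g (p₀, u₀ x₀)) < ε / 2 ∧
        dist (u₀ x) (u₀ x₀) < δ / 2} ∈ 𝓝 x₀ := by
      refine inter_mem (Metric.tendsto_nhds.1 hfc _ hε2) ?_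
      exact Metric.tendsto_nhds.1 (u₀.continuous.continuousAt (x := x₀)) _ (by positivity)
    refine ⟨_, mem_nhdsWithin_of_mem_nhds hN, δ / 2, by positivity, ?_⟩
    rintro x ⟨hx1, hx2⟩ q₁ hq₁
    have hsub : Metric.ball (p₀, u₀ x) (δ / 2) ⊆ Metric.ball (p₀, u₀ x₀) δ := by
      refine Metric.ball_subset_ball' ?_
      rw [Prod.dist_eq, dist_self, max_eq_right dist_nonneg]
      linarith
    refine ⟨(hball (hsub hq₁)).2, fun q₂ hq₂ => ?_⟩
    have h3 := hA' q₁ (hball (hsub hq₁)).1 q₂ (hball (hsub hq₂)).1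
    -- The linearization in `h3` is frozen at `x₀`; moving it to the nearby `x` costs the other half
    -- of `ε`, by continuity of the derivative along the curve.
    have h4 : ‖(fderiv ℝ g (p₀, u₀ x₀) - fderiv ℝ g (p₀, u₀ x)) (q₁ - q₂)‖ ≤
        ε / 2 * ‖q₁ - q₂‖ := by
      refine ContinuousLinearMap.le_of_opNorm_le _ ?_ _
      rw [dist_comm, dist_eq_norm] at hx1
      exact hx1.le
    have h5 : g q₁ - g q₂ - fderiv ℝ g (p₀, u₀ x) (q₁ - q₂) =
        (g q₁ - g q₂ - fderiv ℝ g (p₀, u₀ x₀) (q₁ - q₂)) +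
        (fderiv ℝ g (p₀, u₀ x₀) - fderiv ℝ g (p₀, u₀ x)) (q₁ - q₂) := by
      simp
    rw [h5]
    refine (norm_add_le _ _).trans ?_
    simp only at h3
    linarith

/-- The derivative of `g` along a curve, as a continuous family of operators. -/
def derivAlong {g : P × E → E} {p₀ : P} {u₀ : Set.Icc (0 : ℝ) T →ᵇ E}
    (hg : ∀ x, ContDiffAt ℝ 1 g (p₀, u₀ x)) : Set.Icc (0 : ℝ) T →ᵇ (P × E →L[ℝ] E) :=
  BoundedContinuousFunction.mkOfCompact ⟨fun x => fderiv ℝ g (p₀, u₀ x), by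
    refine continuous_iff_continuousAt.2 fun x₀ => ?_
    have : ContinuousAt (fderiv ℝ g) (p₀, u₀ x₀) :=
      ((hg x₀).fderiv_right (m := 0) le_rfl).continuousAt
    exact ContinuousAt.comp (f := fun x => (p₀, u₀ x)) this (by fun_prop)⟩

@[simp] lemma derivAlong_apply {g : P × E → E} {p₀ : P} {u₀ : Set.Icc (0 : ℝ) T →ᵇ E}
    (hg : ∀ x, ContDiffAt ℝ 1 g (p₀, u₀ x)) (x : Set.Icc (0 : ℝ) T) :
    derivAlong hg x = fderiv ℝ g (p₀, u₀ x) := rfl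

/-- The derivative of the superposition operator. -/
def superposDeriv (A : Set.Icc (0 : ℝ) T →ᵇ (P × E →L[ℝ] E)) :
    P × (Set.Icc (0 : ℝ) T →ᵇ E) →L[ℝ] (Set.Icc (0 : ℝ) T →ᵇ E) :=
  LinearMap.mkContinuous
    { toFun := fun q => BoundedContinuousFunction.mkOfCompact ⟨fun x => A x (q.1, q.2 x), by
        fun_prop⟩
      map_add' := fun u v => by
        ext x
        have : ((u + v).1, (u + v).2 x) = (u.1, u.2 x) + (v.1, v.2 x) := rfl
        simp only [BoundedContinuousFunction.mkOfCompact_apply, ContinuousMap.coe_mk,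
          BoundedContinuousFunction.add_apply]
        rw [this, map_add]
      map_smul' := fun c u => by
        ext x
        have : ((c • u).1, (c • u).2 x) = c • (u.1, u.2 x) := rfl
        simp only [BoundedContinuousFunction.mkOfCompact_apply, ContinuousMap.coe_mk,
          BoundedContinuousFunction.smul_apply, RingHom.id_apply]
        rw [this, map_smul] }
    ‖A‖ fun q => by
      refine (BoundedContinuousFunction.norm_le (by positivity)).2 fun x => ?_
      refine (A x).le_of_opNorm_le_of_le (A.norm_coe_le_norm x) ?_
      rw [Prod.norm_def, Prod.norm_def]
      exact max_le_max le_rfl (q.2.norm_coe_le_norm x)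

@[simp] lemma superposDeriv_apply (A : Set.Icc (0 : ℝ) T →ᵇ (P × E →L[ℝ] E))
    (q : P × (Set.Icc (0 : ℝ) T →ᵇ E)) (x : Set.Icc (0 : ℝ) T) :
    superposDeriv A q x = A x (q.1, q.2 x) := rfl

lemma mem_ball_pair {p₀ : P} {u₀ : Set.Icc (0 : ℝ) T →ᵇ E} {δ : ℝ}
    {q : P × (Set.Icc (0 : ℝ) T →ᵇ E)} (hq : q ∈ Metric.ball (p₀, u₀) δ) (x : Set.Icc (0 : ℝ) T) :
    (q.1, q.2 x) ∈ Metric.ball (p₀, u₀ x) δ := by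
  rw [Metric.mem_ball, Prod.dist_eq, max_lt_iff] at hq ⊢
  exact ⟨hq.1, (BoundedContinuousFunction.dist_coe_le_dist x).trans_lt hq.2⟩

lemma eventually_continuous_superpos {g : P × E → E} {p₀ : P} {u₀ : Set.Icc (0 : ℝ) T →ᵇ E}
    (hg : ∀ x, ContDiffAt ℝ 1 g (p₀, u₀ x)) :
    ∀ᶠ q : P × (Set.Icc (0 : ℝ) T →ᵇ E) in 𝓝 (p₀, u₀), Continuous fun x => g (q.1, q.2 x) := by
  obtain ⟨δ, hδ, h⟩ := exists_uniform_strict hg one_pos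
  filter_upwards [Metric.ball_mem_nhds _ hδ] with q hq
  refine continuous_iff_continuousAt.2 fun x => ?_
  exact ContinuousAt.comp (f := fun x => (q.1, q.2 x)) (h x _ (mem_ball_pair hq x)).1
    (by fun_prop)

lemma hasStrictFDerivAt_superpos {g : P × E → E} {p₀ : P} {u₀ : Set.Icc (0 : ℝ) T →ᵇ E}
    (hg : ∀ x, ContDiffAt ℝ 1 g (p₀, u₀ x)) :
    HasStrictFDerivAt (superpos T g) (superposDeriv (derivAlong hg)) (p₀, u₀) := by
  refine .of_isLittleO (isLittleO_iff.2 fun ε hε => ?_)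
  obtain ⟨δ, hδ, h⟩ := exists_uniform_strict hg hε
  have hc := eventually_continuous_superpos hg
  rw [nhds_prod_eq]
  have hB : ∀ᶠ q in 𝓝 (p₀, u₀), q ∈ Metric.ball (p₀, u₀) δ := Metric.ball_mem_nhds _ hδ
  filter_upwards [(hc.and hB).prod_mk (hc.and hB)] with ⟨q₁, q₂⟩ ⟨⟨hc₁, hq₁⟩, ⟨hc₂, hq₂⟩⟩
  refine (BoundedContinuousFunction.norm_le (by positivity)).2 fun x => ?_
  simp only [BoundedContinuousFunction.sub_apply, superpos_apply hc₁, superpos_apply hc₂,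
    superposDeriv_apply, derivAlong_apply]
  refine ((h x _ (mem_ball_pair hq₁ x)).2 _ (mem_ball_pair hq₂ x)).trans ?_
  refine mul_le_mul_of_nonneg_left ?_ hε.le
  rw [Prod.norm_def, Prod.norm_def]
  exact max_le_max le_rfl ((q₁.2 - q₂.2).norm_coe_le_norm x)

/-- Near a solution of `u' = g(p₀, u)`, `u(0) = a₀`, the solution of `u' = g(p, u)`, `u(0) = a`
exists and is strictly differentiable in `(p, a)`, with derivative given by the variational
equation. -/
theorem exists_strictDiff_solution [CompleteSpace P] [CompleteSpace E] (hT : 0 ≤ T)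
    {g : P × E → E} {p₀ : P} {u₀ : Set.Icc (0 : ℝ) T →ᵇ E} {a₀ : E}
    (hg : ∀ x, ContDiffAt ℝ 1 g (p₀, u₀ x))
    (hu : u₀ = BoundedContinuousFunction.const _ a₀ + prim le_rfl hT (superpos T g (p₀, u₀))) :
    ∃ (ψ : P × E → (Set.Icc (0 : ℝ) T →ᵇ E)) (ψ' : P × E →L[ℝ] (Set.Icc (0 : ℝ) T →ᵇ E)),
      HasStrictFDerivAt ψ ψ' (p₀, a₀) ∧ ψ (p₀, a₀) = u₀ ∧
      (∀ᶠ q in 𝓝 (p₀, a₀), ψ q ⟨0, le_rfl, hT⟩ = q.2 ∧ ∀ x : Set.Icc (0 : ℝ) T,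
        HasDerivWithinAt (ext le_rfl hT (ψ q)) (g (q.1, ψ q x)) (Set.Icc 0 T) x) ∧
      ∀ q, ψ' q = BoundedContinuousFunction.const _ q.2 +
        prim le_rfl hT (superposDeriv (derivAlong hg) (q.1, ψ' q)) := by
  let J := primL (E := E) ℝ (le_refl (0 : ℝ)) hT
  let X := Set.Icc (0 : ℝ) T →ᵇ E
  let S := superposDeriv (derivAlong hg)
  let F : (P × E) × X → X := fun w => w.2 - constL 0 T ℝ w.1.2 - J (superpos T g (w.1.1, w.2))
  let F' : (P × E) × X →L[ℝ] X :=
    ContinuousLinearMap.snd ℝ (P × E) X -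
      (constL 0 T ℝ ∘L ContinuousLinearMap.snd ℝ P E) ∘L ContinuousLinearMap.fst ℝ (P × E) X -
      J ∘L S ∘L ((ContinuousLinearMap.fst ℝ P E ∘L ContinuousLinearMap.fst ℝ (P × E) X).prod
        (ContinuousLinearMap.snd ℝ (P × E) X))
  have hF : HasStrictFDerivAt F F' ((p₀, a₀), u₀) := by
    have h1 : HasStrictFDerivAt (fun w : (P × E) × X => (w.1.1, w.2))
        ((ContinuousLinearMap.fst ℝ P E ∘L ContinuousLinearMap.fst ℝ (P × E) X).prod
        (ContinuousLinearMap.snd ℝ (P × E) X)) ((p₀, a₀), u₀) :=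
      ((ContinuousLinearMap.fst ℝ P E ∘L ContinuousLinearMap.fst ℝ (P × E) X).prod
        (ContinuousLinearMap.snd ℝ (P × E) X)).hasStrictFDerivAt
    have h2 := J.hasStrictFDerivAt.comp ((p₀, a₀), u₀)
      ((hasStrictFDerivAt_superpos hg).comp ((p₀, a₀), u₀) h1)
    have h3 : HasStrictFDerivAt (fun w : (P × E) × X => constL 0 T ℝ w.1.2)
      ((constL 0 T ℝ ∘L ContinuousLinearMap.snd ℝ P E) ∘L ContinuousLinearMap.fst ℝ (P × E) X)
      ((p₀, a₀), u₀) := ((constL 0 T ℝ ∘L ContinuousLinearMap.snd ℝ P E) ∘L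
        ContinuousLinearMap.fst ℝ (P × E) X).hasStrictFDerivAt
    exact (hasStrictFDerivAt_snd.sub h3).sub h2
  have hF0 : F ((p₀, a₀), u₀) = 0 := by
    change u₀ - BoundedContinuousFunction.const _ a₀ -
      prim le_rfl hT (superpos T g (p₀, u₀)) = 0
    rw [sub_sub, ← hu, sub_self]
  let K : Set.Icc (0 : ℝ) T →ᵇ (E →L[ℝ] E) := BoundedContinuousFunction.mkOfCompact
    ⟨fun x => derivAlong hg x ∘L ContinuousLinearMap.inr ℝ P E, by fun_prop⟩
  -- The zeros of `F` are the solutions of the integral equation. Its partial derivative in the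
  -- unknown function is `1` minus a Volterra operator, hence always invertible, and the implicit
  -- function theorem applies on the whole of `[0, T]`.
  have hinr : F' ∘L ContinuousLinearMap.inr ℝ (P × E) X = 1 - volterra le_rfl hT K := by
    ext w : 1
    change w - constL 0 T ℝ (0 : E) - J (S (0, w)) = w - J (mulOp K w)
    rw [map_zero, sub_zero]
    rfl
  have hinv : (F' ∘L ContinuousLinearMap.inr ℝ (P × E) X).IsInvertible := by
    rw [hinr]
    obtain ⟨w, hw⟩ := isUnit_one_sub_volterra (𝕜 := ℝ) le_rfl hT K
    exact ⟨ContinuousLinearEquiv.unitsEquiv ℝ X w, hw⟩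
  let ψ := hF.implicitFunctionOfProdDomain hinv
  have hψ := hF.hasStrictFDerivAt_implicitFunctionOfProdDomain hinv
  have hψ0 : ψ (p₀, a₀) = u₀ :=
    (hF.eventually_apply_eq_iff_implicitFunctionOfProdDomain hinv).self_of_nhds.1 rfl
  refine ⟨ψ, _, hψ, hψ0, ?_, fun q => ?_⟩
  · have h1 := hF.eventually_apply_implicitFunctionOfProdDomain hinv
    have h2 : ∀ᶠ q : P × E in 𝓝 (p₀, a₀), Continuous fun x => g (q.1, ψ q x) := by
      have h3 : Tendsto (fun q : P × E => (q.1, ψ q)) (𝓝 (p₀, a₀)) (𝓝 (p₀, u₀)) := by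
        have := hψ.continuousAt.tendsto
        change Tendsto ψ _ (𝓝 (ψ (p₀, a₀))) at this
        rw [hψ0] at this
        exact (continuous_fst.tendsto' _ _ rfl).prodMk_nhds this
      exact h3.eventually (eventually_continuous_superpos hg)
    filter_upwards [h1, h2] with q hq hc
    rw [hF0] at hq
    have hq' : ψ q = BoundedContinuousFunction.const _ q.2 +
        prim le_rfl hT (superpos T g (q.1, ψ q)) := by
      change ψ q - BoundedContinuousFunction.const _ q.2 -
        prim le_rfl hT (superpos T g (q.1, ψ q)) = 0 at hq
      rw [sub_sub, sub_eq_zero] at hq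
      exact hq
    refine ⟨?_, fun x => ?_⟩
    · have := DFunLike.congr_fun hq' ⟨0, le_rfl, hT⟩
      rw [this]
      change q.2 + ∫ t in (0 : ℝ)..0, _ = q.2
      rw [intervalIntegral.integral_same, add_zero]
    · have := hasDerivWithinAt_of_eq_prim le_rfl hT hq' x
      rwa [superpos_apply (q := (q.1, ψ q)) hc] at this
  · set ψ' := -(F' ∘L ContinuousLinearMap.inr ℝ (P × E) X).inverse ∘L
      (F' ∘L ContinuousLinearMap.inl ℝ (P × E) X)
    -- The derivative of the implicit function annihilates `F'`; written out, this is the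
    -- variational equation in integral form.
    have h1 : F' (q, ψ' q) = 0 := by
      have h2 : F' (q, ψ' q) = (F' ∘L ContinuousLinearMap.inl ℝ (P × E) X) q +
          (F' ∘L ContinuousLinearMap.inr ℝ (P × E) X) (ψ' q) := by
        simp only [ContinuousLinearMap.comp_apply, ← map_add]
        simp
      obtain ⟨e, he⟩ := hinv
      have h3 : (F' ∘L ContinuousLinearMap.inr ℝ (P × E) X) (ψ' q) =
          -(F' ∘L ContinuousLinearMap.inl ℝ (P × E) X) q := by
        simp only [ψ', ← he, ContinuousLinearMap.inverse_equiv]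
        simp
      rw [h2, h3, add_neg_cancel]
    change ψ' q - BoundedContinuousFunction.const _ q.2 - prim le_rfl hT (S (q.1, ψ' q)) = 0 at h1
    rw [sub_sub, sub_eq_zero] at h1
    exact h1

end Nemytskii

end

/-! ### Uniqueness, the standing hypotheses, and the variational equation -/

section

section ODE

/-- Uniqueness for autonomous equations whose field is `C¹` along one of the solutions. -/
lemma ode_unique_of_contDiffAt {E : Type*} [NormedAddCommGroup E] [NormedSpace ℝ E] {T : ℝ}
    {F : E → E} {y z : ℝ → E}
    (hy : ∀ x ∈ Set.Icc 0 T, HasDerivWithinAt y (F (y x)) (Set.Icc 0 T) x)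
    (hz : ∀ x ∈ Set.Icc 0 T, HasDerivWithinAt z (F (z x)) (Set.Icc 0 T) x)
    (hF : ∀ x ∈ Set.Icc 0 T, ContDiffAt ℝ 1 F (y x)) (h0 : y 0 = z 0) :
    Set.EqOn y z (Set.Icc 0 T) := by
  have hyc : ContinuousOn y (Set.Icc 0 T) := fun x hx => (hy x hx).continuousWithinAt
  have hzc : ContinuousOn z (Set.Icc 0 T) := fun x hx => (hz x hx).continuousWithinAt
  suffices h : Set.Icc 0 T ⊆ {x | y x = z x} from fun x hx => h hx
  -- Continuous induction: the set of agreement is closed, and it extends to the right of each of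
  -- its points because `F` is Lipschitz near the common value there. Regularity of `F` is needed
  -- along `y` only, so `z` may be an arbitrary solution, such as one obtained by choice.
  refine IsClosed.Icc_subset_of_forall_exists_gt ?_ h0 ?_
  · have := (hyc.sub hzc).preimage_isClosed_of_isClosed isClosed_Icc (isClosed_singleton (x := 0))
    convert this using 1
    ext x
    simp [sub_eq_zero, and_comm]
  · rintro x ⟨hx, hxI⟩ t ht
    have hxI' := Set.Ico_subset_Icc_self hxI
    obtain ⟨k, s, hs, hlip⟩ := (hF x hxI').exists_lipschitzOnWith
    have h1 : ∀ᶠ r in 𝓝[Set.Icc 0 T] x, y r ∈ s := (hyc x hxI') hs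
    have h2 : ∀ᶠ r in 𝓝[Set.Icc 0 T] x, z r ∈ s := by
      have : s ∈ 𝓝 (z x) := by rw [← (show y x = z x from hx)]; exact hs
      exact (hzc x hxI') this
    obtain ⟨δ, hδ, hball⟩ := Metric.mem_nhdsWithin_iff.1 (h1.and h2)
    set r := min (min t T) (x + δ / 2) with hr
    have hxr : x < r := by
      simp only [hr, lt_min_iff]; exact ⟨⟨ht, hxI.2⟩, by linarith⟩
    have hrT : r ≤ T := (min_le_left _ _).trans (min_le_right _ _)
    have hrd : r ≤ x + δ / 2 := min_le_right _ _
    have hsub : Set.Icc x r ⊆ Set.Icc 0 T := Set.Icc_subset_Icc hxI.1 hrT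
    have hmem : ∀ q ∈ Set.Ico x r, y q ∈ s ∧ z q ∈ s := by
      intro q hq
      refine hball ⟨?_, hsub (Set.Ico_subset_Icc_self hq)⟩
      rw [Metric.mem_ball, Real.dist_eq, abs_lt]
      constructor <;> linarith [hq.1, hq.2]
    have hder : ∀ {w : ℝ → E}, (∀ x ∈ Set.Icc 0 T,
        HasDerivWithinAt w (F (w x)) (Set.Icc 0 T) x) →
        ∀ q ∈ Set.Ico x r, HasDerivWithinAt w (F (w q)) (Set.Ici q) q := by
      intro w hw q hq
      refine (hw q (hsub (Set.Ico_subset_Icc_self hq))).mono_of_mem_nhdsWithin ?_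
      refine mem_of_superset (Icc_mem_nhdsGE hq.2) ?_
      exact Set.Icc_subset_Icc (hxI.1.trans hq.1) hrT
    have := ODE_solution_unique_of_mem_Icc_right (v := fun _ => F) (s := fun _ => s) (K := k)
      (f := y) (g := z) (a := x) (b := r) (fun _ _ => hlip) (hyc.mono hsub) (hder hy)
      (fun q hq => (hmem q hq).1) (hzc.mono hsub) (hder hz) (fun q hq => (hmem q hq).2) hx
    exact ⟨r, this ⟨hxr.le, le_rfl⟩, hxr, (min_le_left _ _).trans (min_le_left _ _)⟩

/-- The curve is compact, so a whole tube around it lies in `U`. This keeps `det B ≠ 0`, and the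
domain of the integral of motion, along all nearby solutions. -/
lemma eventually_forall_mem {P E : Type*} [NormedAddCommGroup P] [NormedAddCommGroup E] {T : ℝ}
    {U : Set (P × E)} (hU : IsOpen U) {p₀ : P} {u₀ : Set.Icc (0 : ℝ) T →ᵇ E}
    (h : ∀ x, (p₀, u₀ x) ∈ U) :
    ∀ᶠ q : P × (Set.Icc (0 : ℝ) T →ᵇ E) in 𝓝 (p₀, u₀), ∀ x, (q.1, q.2 x) ∈ U := by
  have hK : IsCompact (Set.range fun x => (p₀, u₀ x)) :=
    isCompact_range (by fun_prop)
  obtain ⟨δ, hδ, hsub⟩ := hK.exists_thickening_subset_open hU (by rintro _ ⟨x, rfl⟩; exact h x)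
  filter_upwards [Metric.ball_mem_nhds _ hδ] with q hq x
  refine hsub (Metric.mem_thickening_iff.2 ⟨_, ⟨x, rfl⟩, ?_⟩)
  rw [Metric.mem_ball, Prod.dist_eq, max_lt_iff] at hq
  rw [Prod.dist_eq, max_lt_iff]
  exact ⟨hq.1, (BoundedContinuousFunction.dist_coe_le_dist x).trans_lt hq.2⟩

end ODE

variable {n : ℕ}

/-- The standing hypotheses on the coefficients and on the profile. -/
structure Admissible (f : (Fin n → ℝ) → (Fin n → ℝ)) (B : (Fin n → ℝ) → Matrix (Fin n) (Fin n) ℝ)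
    (T : ℝ) (um : Fin n → ℝ) (ubar : ℝ → Fin n → ℝ) : Prop where
  contDiff_f : ContDiff ℝ 2 f
  contDiff_B : ∀ i j, ContDiff ℝ 2 fun u => B u i j
  profile : IsPeriodicProfile f B T um ubar
  spectrum_pos : ∀ x, ∀ μ ∈ spectrum ℂ (cplx (B (ubar x))), 0 < μ.re
  det_ne : (jac f um).det ≠ 0

lemma det_cplx {m : Type*} [Fintype m] [DecidableEq m] (N : Matrix m m ℝ) :
    (cplx N).det = (N.det : ℂ) := by
  have := (Complex.ofRealHom).map_det N
  exact this.symm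

lemma contDiff_det {k : WithTop ℕ∞} {X : Type*} [NormedAddCommGroup X] [NormedSpace ℝ X]
    {m : Type*} [Fintype m] [DecidableEq m] {M : X → Matrix m m ℝ}
    (h : ∀ i j, ContDiff ℝ k fun u => M u i j) : ContDiff ℝ k fun u => (M u).det := by
  simp_rw [Matrix.det_apply']
  exact ContDiff.sum fun σ _ => contDiff_const.mul (contDiff_prod fun i _ => h _ _)

lemma contDiffAt_inv_entry {k : WithTop ℕ∞} {X : Type*} [NormedAddCommGroup X] [NormedSpace ℝ X]
    {m : Type*} [Fintype m] [DecidableEq m] {M : X → Matrix m m ℝ}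
    (h : ∀ i j, ContDiff ℝ k fun u => M u i j) {u : X} (hu : (M u).det ≠ 0) (i j : m) :
    ContDiffAt ℝ k (fun u => (M u)⁻¹ i j) u := by
  have : (fun u => (M u)⁻¹ i j) = fun u => (M u).det⁻¹ * (M u).adjugate i j := by
    funext u
    rw [Matrix.inv_def, Ring.inverse_eq_inv']; rfl
  rw [this]
  refine ((contDiff_det h).contDiffAt.inv hu).mul (ContDiff.contDiffAt ?_)
  simp_rw [Matrix.adjugate_apply]
  refine contDiff_det fun i' j' => ?_
  by_cases hi : i' = j
  · subst hi; simp only [Matrix.updateRow_self]; exact contDiff_const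
  · simp only [Matrix.updateRow_ne hi]; exact h _ _

/-- The field of the traveling-wave equation as a function of ((rest point, speed), state). -/
def paramField (f : (Fin n → ℝ) → (Fin n → ℝ)) (B : (Fin n → ℝ) → Matrix (Fin n) (Fin n) ℝ)
    (q : ((Fin n → ℝ) × ℝ) × (Fin n → ℝ)) : Fin n → ℝ :=
  field f B q.1.1 q.1.2 q.2

lemma contDiffAt_paramField {f : (Fin n → ℝ) → (Fin n → ℝ)}
    {B : (Fin n → ℝ) → Matrix (Fin n) (Fin n) ℝ} (hf : ContDiff ℝ 2 f)
    (hB : ∀ i j, ContDiff ℝ 2 fun u => B u i j) {q : ((Fin n → ℝ) × ℝ) × (Fin n → ℝ)}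
    (hq : (B q.2).det ≠ 0) : ContDiffAt ℝ 2 (paramField f B) q := by
  rw [contDiffAt_pi]
  intro i
  have : (fun q => paramField f B q i) = fun q => ∑ j, (B q.2)⁻¹ i j *
      (f q.2 j - f q.1.1 j - q.1.2 * (q.2 j - q.1.1 j)) := by
    funext q; rfl
  rw [this]
  refine ContDiffAt.sum fun j _ => ?_
  have hfj : ContDiff ℝ 2 fun u => f u j := contDiff_pi.1 hf j
  refine ((contDiffAt_inv_entry hB hq i j).comp q contDiffAt_snd).mul (ContDiff.contDiffAt ?_)
  have e1 : ContDiff ℝ 2 fun q : ((Fin n → ℝ) × ℝ) × (Fin n → ℝ) => f q.2 j :=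
    hfj.comp contDiff_snd
  have e2 : ContDiff ℝ 2 fun q : ((Fin n → ℝ) × ℝ) × (Fin n → ℝ) => f q.1.1 j :=
    hfj.comp (contDiff_fst.comp contDiff_fst)
  exact (e1.sub e2).sub (by fun_prop)

section Deriv

lemma jac_mulVec (g : (Fin n → ℝ) → (Fin n → ℝ)) (v w : Fin n → ℝ) :
    jac g v *ᵥ w = fderiv ℝ g v w := by
  rw [jac, ← Matrix.toLin'_apply, Matrix.toLin'_toMatrix']; rfl

lemma fderiv_mulVec {B : (Fin n → ℝ) → Matrix (Fin n) (Fin n) ℝ}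
    (hB : ∀ i j, ContDiff ℝ 2 fun u => B u i j) (c u : Fin n → ℝ) :
    HasFDerivAt (fun u => B u *ᵥ c)
      (ContinuousLinearMap.pi fun i => ∑ j, c j • fderiv ℝ (fun u => B u i j) u) u := by
  rw [hasFDerivAt_pi]
  intro i
  have : (fun u => (B u *ᵥ c) i) = fun u => ∑ j, B u i j * c j := rfl
  rw [this]
  exact HasFDerivAt.fun_sum fun j _ =>
    (((hB i j).differentiable (by norm_num)) u).hasFDerivAt.mul_const (c j)

lemma coeffA_mulVec {f : (Fin n → ℝ) → (Fin n → ℝ)} {B : (Fin n → ℝ) → Matrix (Fin n) (Fin n) ℝ}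
    (hf : ContDiff ℝ 2 f) (hB : ∀ i j, ContDiff ℝ 2 fun u => B u i j) (ubar : ℝ → Fin n → ℝ)
    (x : ℝ) (w : Fin n → ℝ) (i : Fin n) :
    (coeffA f B ubar x *ᵥ w) i = fderiv ℝ f (ubar x) w i -
      ∑ j, deriv ubar x j * fderiv ℝ (fun u => B u i j) (ubar x) w := by
  rw [coeffA, jac_mulVec, (((hf.differentiable (by norm_num)) (ubar x)).hasFDerivAt.fun_sub
    (fderiv_mulVec hB (deriv ubar x) (ubar x))).fderiv]
  simp

end Deriv

namespace Admissible

variable {f : (Fin n → ℝ) → (Fin n → ℝ)} {B : (Fin n → ℝ) → Matrix (Fin n) (Fin n) ℝ}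
  {T : ℝ} {um : Fin n → ℝ} {ubar : ℝ → Fin n → ℝ} (h : Admissible f B T um ubar)
include h

lemma det_coeffB (x : ℝ) : (B (ubar x)).det ≠ 0 := by
  intro h0
  have : (0 : ℂ) ∈ spectrum ℂ (cplx (B (ubar x))) := by
    rw [spectrum.zero_mem_iff, Matrix.isUnit_iff_isUnit_det, det_cplx, h0]
    simp
  simpa using h.spectrum_pos x 0 this

lemma deriv_ubar (x : ℝ) : deriv ubar x = field f B um 0 (ubar x) := (h.profile.ode x).deriv

lemma continuous_ubar : Continuous ubar :=
  continuous_iff_continuousAt.2 fun x => (h.profile.ode x).continuousAt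

omit h in
lemma mul_field {q : ((Fin n → ℝ) × ℝ) × (Fin n → ℝ)} (hq : (B q.2).det ≠ 0) :
    B q.2 *ᵥ paramField f B q = f q.2 - f q.1.1 - q.1.2 • (q.2 - q.1.1) := by
  rw [paramField, field, Matrix.mulVec_mulVec, Matrix.mul_nonsing_inv _ (Ne.isUnit hq),
    Matrix.one_mulVec]

lemma eventually_det_ne (x : ℝ) : ∀ᶠ q : ((Fin n → ℝ) × ℝ) × (Fin n → ℝ) in
    𝓝 ((um, 0), ubar x), (B q.2).det ≠ 0 := by
  have hc : Continuous fun q : ((Fin n → ℝ) × ℝ) × (Fin n → ℝ) => (B q.2).det :=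
    (contDiff_det h.contDiff_B).continuous.comp continuous_snd
  exact hc.continuousAt.eventually_ne (h.det_coeffB x)

/-- The variational equation along the profile. -/
lemma fderiv_paramField (x : ℝ) (dv : Fin n → ℝ) (ds : ℝ) (w : Fin n → ℝ) :
    B (ubar x) *ᵥ fderiv ℝ (paramField f B) ((um, 0), ubar x) ((dv, ds), w) =
      coeffA f B ubar x *ᵥ w - jac f um *ᵥ dv - ds • (ubar x - um) := by
  have hF : HasFDerivAt (paramField f B) _ ((um, 0), ubar x) :=
    ((contDiffAt_paramField h.contDiff_f h.contDiff_B
      (q := ((um, 0), ubar x)) (h.det_coeffB x)).differentiableAt (by norm_num)).hasFDerivAt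
  set F' := fderiv ℝ (paramField f B) ((um, 0), ubar x)
  -- Differentiating `B(u) F = f(u) - f(v) - s (u - v)` avoids the derivative of `B⁻¹`; the term
  -- `(dB w) F` equals `(dB w) ū'` on the profile and is exactly the correction contained in
  -- `coeffA`.
  have hev : (fun q => B q.2 *ᵥ paramField f B q) =ᶠ[𝓝 ((um, 0), ubar x)]
      fun q => f q.2 - f q.1.1 - q.1.2 • (q.2 - q.1.1) := by
    filter_upwards [h.eventually_det_ne x] with q hq using mul_field hq
  have hfd := h.contDiff_f.differentiable (by norm_num : (2 : WithTop ℕ∞) ≠ 0)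
  ext i
  let X := ((Fin n → ℝ) × ℝ) × (Fin n → ℝ)
  have a0 : ∀ u, HasFDerivAt (fun u => f u i)
      ((ContinuousLinearMap.proj i : (Fin n → ℝ) →L[ℝ] ℝ) ∘L fderiv ℝ f u) u :=
    fun u => (hasFDerivAt_pi'.1 (hfd u).hasFDerivAt) i
  have b1 : HasFDerivAt (fun q : X => q.1.1) ((ContinuousLinearMap.fst ℝ (Fin n → ℝ) ℝ) ∘L
      ContinuousLinearMap.fst ℝ ((Fin n → ℝ) × ℝ) (Fin n → ℝ)) ((um, 0), ubar x) :=
    hasFDerivAt_fst.fst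
  have b2 : HasFDerivAt (fun q : X => q.2)
      (ContinuousLinearMap.snd ℝ ((Fin n → ℝ) × ℝ) (Fin n → ℝ)) ((um, 0), ubar x) :=
    hasFDerivAt_snd
  have b3 : HasFDerivAt (fun q : X => q.1.2) ((ContinuousLinearMap.snd ℝ (Fin n → ℝ) ℝ) ∘L
      ContinuousLinearMap.fst ℝ ((Fin n → ℝ) × ℝ) (Fin n → ℝ)) ((um, 0), ubar x) :=
    hasFDerivAt_fst.snd
  have a1 : HasFDerivAt (fun q : X => f q.2 i) _ ((um, 0), ubar x) :=
    HasFDerivAt.comp (g := fun u => f u i) (f := fun q : X => q.2) ((um, (0 : ℝ)), ubar x)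
      (a0 (ubar x)) b2
  have a2 : HasFDerivAt (fun q : X => f q.1.1 i) _ ((um, 0), ubar x) :=
    HasFDerivAt.comp (g := fun u => f u i) (f := fun q : X => q.1.1) ((um, (0 : ℝ)), ubar x)
      (a0 um) b1
  have a3 : HasFDerivAt (fun q : X => q.1.2 * (q.2 i - q.1.1 i)) _ ((um, 0), ubar x) :=
    b3.fun_mul (((hasFDerivAt_pi'.1 b2) i).fun_sub ((hasFDerivAt_pi'.1 b1) i))
  have e1 := (a1.fun_sub a2).fun_sub a3
  have a4 : ∀ j, HasFDerivAt (fun q : X => B q.2 i j) _ ((um, 0), ubar x) := fun j =>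
    HasFDerivAt.comp (g := fun u => B u i j) (f := fun q : X => q.2) ((um, (0 : ℝ)), ubar x)
      ((h.contDiff_B i j).differentiable (by norm_num) (ubar x)).hasFDerivAt b2
  have e2 : HasFDerivAt (fun q : X => ∑ j, B q.2 i j * paramField f B q j) _ ((um, 0), ubar x) :=
    HasFDerivAt.fun_sum fun j _ => (a4 j).fun_mul ((hasFDerivAt_pi'.1 hF) j)
  have e3 := e2.unique (e1.congr_of_eventuallyEq (hev.mono fun q hq => congrFun hq i))
  have e4 := DFunLike.congr_fun e3 ((dv, ds), w)
  have hF0 : paramField f B ((um, 0), ubar x) = deriv ubar x := (h.deriv_ubar x).symm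
  simp [Finset.sum_add_distrib, hF0] at e4
  rw [Pi.sub_apply, Pi.sub_apply, coeffA_mulVec h.contDiff_f h.contDiff_B, jac_mulVec]
  simp only [Matrix.mulVec, dotProduct, Pi.smul_apply, Pi.sub_apply, smul_eq_mul]
  linarith

end Admissible

end

/-! ### The derivative of the flow at the profile -/

section

variable {n : ℕ} {f : (Fin n → ℝ) → (Fin n → ℝ)} {B : (Fin n → ℝ) → Matrix (Fin n) (Fin n) ℝ}
  {T : ℝ} {um : Fin n → ℝ} {ubar : ℝ → Fin n → ℝ}

/-- `W` is the derivative at the profile of the solution of the traveling-wave equation with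
respect to ((rest point, speed), initial value); `ψ` is the solution itself. -/
structure IsFlowDeriv (f : (Fin n → ℝ) → (Fin n → ℝ)) (B : (Fin n → ℝ) → Matrix (Fin n) (Fin n) ℝ)
    {T : ℝ} (hT : 0 ≤ T) (um : Fin n → ℝ) (ubar : ℝ → Fin n → ℝ)
    (ψ : ((Fin n → ℝ) × ℝ) × (Fin n → ℝ) → (Set.Icc (0 : ℝ) T →ᵇ (Fin n → ℝ)))
    (W : ((Fin n → ℝ) × ℝ) × (Fin n → ℝ) →L[ℝ] (Set.Icc (0 : ℝ) T →ᵇ (Fin n → ℝ))) : Prop where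
  strict : HasStrictFDerivAt ψ W ((um, 0), ubar 0)
  base : ∀ x, ψ ((um, 0), ubar 0) x = ubar x
  solves : ∀ᶠ q in 𝓝 ((um, 0), ubar 0), ψ q ⟨0, le_rfl, hT⟩ = q.2 ∧
    (∀ x : Set.Icc (0 : ℝ) T,
      HasDerivWithinAt (ext le_rfl hT (ψ q)) (paramField f B (q.1, ψ q x)) (Set.Icc 0 T) x) ∧
    ∀ x ∈ Set.Icc (0 : ℝ) T, flow f B T q.1.1 q.2 q.1.2 x = ext le_rfl hT (ψ q) x
  initial : ∀ q, W q ⟨0, le_rfl, hT⟩ = q.2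
  variational : ∀ q (x : Set.Icc (0 : ℝ) T), HasDerivWithinAt (ext le_rfl hT (W q))
    (fderiv ℝ (paramField f B) ((um, 0), ubar x) (q.1, W q x)) (Set.Icc 0 T) x

namespace Admissible

variable (h : Admissible f B T um ubar)
include h

lemma T_nonneg : 0 ≤ T := h.profile.period_pos.le

/-- The smooth solution family comes from the implicit function theorem, whereas `flow` picks some
solution by choice. Uniqueness identifies the two, once `B` is known to be invertible along every
nearby solution. -/
lemma exists_isFlowDeriv : ∃ ψ W, IsFlowDeriv f B h.T_nonneg um ubar ψ W := by
  have hT := h.T_nonneg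
  let u₀ : Set.Icc (0 : ℝ) T →ᵇ (Fin n → ℝ) := restr 0 T ubar h.continuous_ubar
  have hcd : ∀ x : Set.Icc (0 : ℝ) T, ContDiffAt ℝ 2 (paramField f B) ((um, 0), u₀ x) := fun x =>
    contDiffAt_paramField h.contDiff_f h.contDiff_B (h.det_coeffB x)
  have hg : ∀ x : Set.Icc (0 : ℝ) T, ContDiffAt ℝ 1 (paramField f B) ((um, 0), u₀ x) := fun x =>
    (hcd x).of_le (by norm_num)
  have hcont : Continuous fun x : Set.Icc (0 : ℝ) T => paramField f B ((um, 0), u₀ x) :=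
    continuous_iff_continuousAt.2 fun x =>
      ContinuousAt.comp (f := fun x => ((um, (0 : ℝ)), u₀ x)) (hcd x).continuousAt (by fun_prop)
  have hu : u₀ = BoundedContinuousFunction.const _ (ubar 0) +
      prim le_rfl hT (superpos T (paramField f B) ((um, 0), u₀)) := by
    refine prim_eq_of_hasDerivWithinAt le_rfl hT (fun _ => rfl) fun x => ?_
    rw [superpos_apply hcont]
    exact (h.profile.ode x).hasDerivWithinAt
  obtain ⟨ψ, W, hs, hb, hsol, hvar⟩ := exists_strictDiff_solution hT hg hu
  refine ⟨ψ, W, hs, fun x => by rw [hb]; rfl, ?_, fun q => ?_, fun q x => ?_⟩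
  · have hU : IsOpen {q : ((Fin n → ℝ) × ℝ) × (Fin n → ℝ) | (B q.2).det ≠ 0} :=
      isOpen_ne_fun ((contDiff_det h.contDiff_B).continuous.comp continuous_snd) continuous_const
    have h1 := eventually_forall_mem hU (p₀ := (um, (0 : ℝ))) (u₀ := u₀)
      fun x => h.det_coeffB x
    have h2 : Tendsto (fun q : ((Fin n → ℝ) × ℝ) × (Fin n → ℝ) => (q.1, ψ q))
        (𝓝 ((um, 0), ubar 0)) (𝓝 ((um, 0), u₀)) := by
      have := hs.continuousAt.tendsto
      rw [hb] at this
      exact (continuous_fst.tendsto' _ _ rfl).prodMk_nhds this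
    filter_upwards [hsol, h2.eventually h1] with q hq hq2
    refine ⟨hq.1, hq.2, ?_⟩
    have hex : SolvesOn f B T q.1.1 q.2 q.1.2 (ext le_rfl hT (ψ q)) := by
      refine ⟨?_, fun x hx => ?_⟩
      · rw [ext_of_mem _ _ _ ⟨le_rfl, hT⟩]; exact hq.1
      · have := hq.2 ⟨x, hx⟩
        rw [ext_of_mem _ _ _ hx]; exact this
    have hdef : flow f B T q.1.1 q.2 q.1.2 = (⟨_, hex⟩ : ∃ u, SolvesOn f B T _ _ _ u).choose := by
      rw [flow, dif_pos]
    have hspec := (⟨_, hex⟩ : ∃ u, SolvesOn f B T q.1.1 q.2 q.1.2 u).choose_spec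
    rw [← hdef] at hspec
    refine fun x hx => (ode_unique_of_contDiffAt hex.2 hspec.2 (fun y hy => ?_)
      (hex.1.trans hspec.1.symm) hx).symm
    have h3 : ContDiffAt ℝ 2 (paramField f B) (q.1, ext le_rfl hT (ψ q) y) := by
      refine contDiffAt_paramField h.contDiff_f h.contDiff_B ?_
      rw [ext_of_mem _ _ _ hy]; exact hq2 ⟨y, hy⟩
    exact ContDiffAt.comp (f := fun u => (q.1, u)) _ (h3.of_le (by norm_num)) (by fun_prop)
  · have := DFunLike.congr_fun (hvar q) ⟨0, le_rfl, hT⟩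
    rw [this]
    change q.2 + ∫ t in (0 : ℝ)..0, _ = q.2
    rw [intervalIntegral.integral_same, add_zero]
  · exact hasDerivWithinAt_of_eq_prim le_rfl hT (hvar q) x

/-- The equation is autonomous, so differentiating it in `x` shows that the translation mode solves
the homogeneous variational equation. -/
lemma hasDerivAt_deriv_ubar (x : ℝ) : HasDerivAt (deriv ubar)
    (fderiv ℝ (paramField f B) ((um, 0), ubar x) (0, deriv ubar x)) x := by
  have h1 : deriv ubar = fun x => paramField f B ((um, 0), ubar x) := by
    funext x; exact h.deriv_ubar x
  have h2 : DifferentiableAt ℝ (paramField f B) ((um, 0), ubar x) :=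
    (contDiffAt_paramField h.contDiff_f h.contDiff_B (h.det_coeffB x)).differentiableAt
      (by norm_num)
  have h3 : HasDerivAt (fun x => ((um, (0 : ℝ)), ubar x)) (0, deriv ubar x) x :=
    (hasDerivAt_const x (um, (0 : ℝ))).prodMk (h.profile.ode x).differentiableAt.hasDerivAt
  have h4 := h2.hasFDerivAt.comp_hasDerivAt x h3
  rw [h1] at h4 ⊢
  exact h4

/-- A zero derivative would make `ubar 0` an equilibrium, and uniqueness over one period would make
the profile constant. -/
lemma deriv_ubar_zero_ne : deriv ubar 0 ≠ 0 := by
  intro h0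
  obtain ⟨x, hx⟩ := h.profile.nonconstant
  obtain ⟨y, hy, hxy⟩ := Function.Periodic.exists_mem_Ico₀ (f := ubar) h.profile.periodic
    h.profile.period_pos x
  apply hx
  rw [hxy]
  refine ode_unique_of_contDiffAt (T := T) (F := field f B um 0) (z := fun _ => ubar 0)
    (fun x _ => (h.profile.ode x).hasDerivWithinAt) (fun x _ => ?_) (fun x _ => ?_) rfl
    (Set.Ico_subset_Icc_self hy)
  · rw [← h.deriv_ubar, h0]; exact hasDerivWithinAt_const _ _ _
  · exact ContDiffAt.comp (f := fun u => ((um, (0 : ℝ)), u)) (g := paramField f B) _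
      ((contDiffAt_paramField h.contDiff_f h.contDiff_B (h.det_coeffB x)).of_le (by norm_num))
      (by fun_prop)

lemma periodic_deriv_ubar (x : ℝ) : deriv ubar (x + T) = deriv ubar x := by
  rw [h.deriv_ubar, h.deriv_ubar, h.profile.periodic]

variable {ψ : ((Fin n → ℝ) × ℝ) × (Fin n → ℝ) → (Set.Icc (0 : ℝ) T →ᵇ (Fin n → ℝ))}
  {W : ((Fin n → ℝ) × ℝ) × (Fin n → ℝ) →L[ℝ] (Set.Icc (0 : ℝ) T →ᵇ (Fin n → ℝ))}
  (hψ : IsFlowDeriv f B h.T_nonneg um ubar ψ W)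
include hψ

/-- Solutions of the homogeneous variational equation are determined by the initial value. -/
lemma variational_unique {y : ℝ → Fin n → ℝ}
    (hy : ∀ x ∈ Set.Icc (0 : ℝ) T, HasDerivWithinAt y
      (fderiv ℝ (paramField f B) ((um, 0), ubar x) (0, y x)) (Set.Icc 0 T) x)
    (x : Set.Icc (0 : ℝ) T) : W ((0, 0), y 0) x = y x := by
  have hc : Continuous fun x : Set.Icc (0 : ℝ) T =>
      fderiv ℝ (paramField f B) ((um, 0), ubar x) ∘L ContinuousLinearMap.inr ℝ _ _ := by
    refine Continuous.clm_comp (continuous_iff_continuousAt.2 fun x => ?_) continuous_const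
    have h1 : ContinuousAt (fderiv ℝ (paramField f B)) ((um, 0), ubar x) :=
      ((contDiffAt_paramField h.contDiff_f h.contDiff_B (h.det_coeffB x)).fderiv_right
        (m := 0) (by norm_num)).continuousAt
    exact ContinuousAt.comp (f := fun x : Set.Icc (0 : ℝ) T => ((um, (0 : ℝ)), ubar x)) h1
      (by have := h.continuous_ubar; fun_prop)
  let K : Set.Icc (0 : ℝ) T →ᵇ ((Fin n → ℝ) →L[ℝ] (Fin n → ℝ)) :=
    BoundedContinuousFunction.mkOfCompact ⟨_, hc⟩
  have h1 := eq_propagator_of_hasDerivWithinAt le_rfl h.T_nonneg K (y := y) (fun x => hy x x.2) x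
  have h2 := eq_propagator_of_hasDerivWithinAt le_rfl h.T_nonneg K
    (y := ext le_rfl h.T_nonneg (W ((0, 0), y 0))) (fun x => by
      have := hψ.variational ((0, 0), y 0) x
      rw [ext_of_mem _ _ _ x.2]; exact this) x
  rw [ext_of_mem _ _ _ x.2, ext_of_mem _ _ _ ⟨le_rfl, h.T_nonneg⟩, hψ.initial] at h2
  rw [h1, ← h2]

lemma flowDeriv_deriv_ubar (x : Set.Icc (0 : ℝ) T) : W ((0, 0), deriv ubar 0) x = deriv ubar x :=
  h.variational_unique hψ (fun x _ => (h.hasDerivAt_deriv_ubar x).hasDerivWithinAt) x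

lemma separation_eventually_eq : ∀ᶠ q in 𝓝 ((um, (0 : ℝ)), ubar 0),
    separation f B T q.1.1 q.2 q.1.2 = ψ q ⟨T, h.T_nonneg, le_rfl⟩ - q.2 := by
  filter_upwards [hψ.solves] with q hq
  rw [separation, hq.2.2 T ⟨h.T_nonneg, le_rfl⟩, hq.2.2 0 ⟨le_rfl, h.T_nonneg⟩,
    ext_of_mem _ _ _ ⟨h.T_nonneg, le_rfl⟩, ext_of_mem _ _ _ ⟨le_rfl, h.T_nonneg⟩, hq.1]

lemma transversal_surjective (h3 : IsTransversal f B T um ubar) (y : Fin n → ℝ) :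
    ∃ (a : Fin n → ℝ) (s : ℝ), W ((0, s), a) ⟨T, h.T_nonneg, le_rfl⟩ - a = y := by
  let ι : (Fin n → ℝ) × ℝ → ((Fin n → ℝ) × ℝ) × (Fin n → ℝ) := fun q => ((um, q.2), q.1)
  have hι : HasFDerivAt ι (((0 : (Fin n → ℝ) × ℝ →L[ℝ] (Fin n → ℝ)).prod
      (ContinuousLinearMap.snd ℝ _ _)).prod (ContinuousLinearMap.fst ℝ _ _)) (ubar 0, 0) :=
    ((hasFDerivAt_const um _).prodMk hasFDerivAt_snd).prodMk hasFDerivAt_fst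
  have hd : HasFDerivAt (fun q => ψ (ι q) ⟨T, h.T_nonneg, le_rfl⟩ - q.1) _ (ubar 0, 0) :=
    (((evalL ℝ (E := Fin n → ℝ) ⟨T, h.T_nonneg, le_rfl⟩).hasFDerivAt.comp (ubar 0, (0 : ℝ))
      (HasFDerivAt.comp (g := ψ) (ubar 0, (0 : ℝ)) hψ.strict.hasFDerivAt hι))).fun_sub
      hasFDerivAt_fst
  have hev : (fun q : (Fin n → ℝ) × ℝ => separation f B T um q.1 q.2) =ᶠ[𝓝 (ubar 0, 0)]
      fun q => ψ (ι q) ⟨T, h.T_nonneg, le_rfl⟩ - q.1 :=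
    hι.continuousAt.eventually (h.separation_eventually_eq hψ)
  have hd' := hd.congr_of_eventuallyEq hev
  rw [IsTransversal, hd'.fderiv] at h3
  obtain ⟨⟨a, s⟩, has⟩ := h3 y
  exact ⟨a, s, has⟩

/-- The consequences of an integral of motion for the derivative of the period map. -/
lemma exists_conserved_functional (hH : IsQuasiHamiltonian f B um ubar) :
    ∃ ℓ : (Fin n → ℝ) →L[ℝ] ℝ, ℓ ≠ 0 ∧ ℓ (deriv ubar 0) = 0 ∧
      ∀ v a, ℓ (W ((v, 0), a) ⟨T, h.T_nonneg, le_rfl⟩) = ℓ a := by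
  obtain ⟨U, H, hU, hmem, hHC, hcons, hne⟩ := hH
  have hT := h.T_nonneg
  have hHd : HasFDerivAt H (fderiv ℝ H (um, ubar 0)) (um, ubar 0) :=
    ((hHC.contDiffAt (hU.mem_nhds (hmem 0))).differentiableAt one_ne_zero).hasFDerivAt
  have hHu : HasFDerivAt (fun u => H (um, u))
      (fderiv ℝ H (um, ubar 0) ∘L ContinuousLinearMap.inr ℝ _ _) (ubar 0) :=
    HasFDerivAt.comp (g := H) (ubar 0) hHd (hasFDerivAt_prodMk_right um (ubar 0))
  refine ⟨_, hne, ?_, fun v a => ?_⟩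
  · have h1 : ∀ x ∈ Set.Icc (0 : ℝ) 1, H (um, ubar x) = H (um, ubar 0) :=
      hcons um ubar 1 fun x _ => ⟨hmem x, (h.profile.ode x).hasDerivWithinAt⟩
    have h2 : HasDerivWithinAt (fun x => H (um, ubar x)) 0 (Set.Icc 0 1) 0 :=
      (hasDerivWithinAt_const 0 _ (H (um, ubar 0))).congr h1 rfl
    have h3 := (hHu.comp_hasDerivAt (0 : ℝ)
      (h.profile.ode 0).differentiableAt.hasDerivAt).hasDerivWithinAt (s := Set.Icc 0 1)
    have h4 := (uniqueDiffOn_Icc (zero_lt_one' ℝ) 0 ⟨le_rfl, zero_le_one⟩).eq_deriv _ h3 h2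
    rw [hHu.fderiv]; exact h4
  · rw [hHu.fderiv]
    let ι : (Fin n → ℝ) × (Fin n → ℝ) → ((Fin n → ℝ) × ℝ) × (Fin n → ℝ) := fun q => ((q.1, 0), q.2)
    have hι : HasFDerivAt ι (((ContinuousLinearMap.fst ℝ _ _).prod
        (0 : (Fin n → ℝ) × (Fin n → ℝ) →L[ℝ] ℝ)).prod (ContinuousLinearMap.snd ℝ _ _))
        (um, ubar 0) :=
      (hasFDerivAt_fst.prodMk (hasFDerivAt_const 0 _)).prodMk hasFDerivAt_snd
    have hψι : HasFDerivAt (fun q => ψ (ι q)) _ (um, ubar 0) :=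
      HasFDerivAt.comp (g := ψ) (um, ubar 0) hψ.strict.hasFDerivAt hι
    have hψT : HasFDerivAt (fun q => ψ (ι q) ⟨T, hT, le_rfl⟩) _ (um, ubar 0) :=
      (evalL ℝ (E := Fin n → ℝ) ⟨T, hT, le_rfl⟩).hasFDerivAt.comp (um, ubar 0) hψι
    have hev1 : ∀ᶠ q in 𝓝 (um, ubar 0), ∀ x, (q.1, ψ (ι q) x) ∈ U := by
      have h1 := eventually_forall_mem hU (p₀ := um) (u₀ := ψ ((um, 0), ubar 0))
        fun x => by rw [hψ.base]; exact hmem x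
      have h2 : Tendsto (fun q => (q.1, ψ (ι q))) (𝓝 (um, ubar 0))
          (𝓝 (um, ψ ((um, 0), ubar 0))) :=
        (continuous_fst.tendsto' _ _ rfl).prodMk_nhds hψι.continuousAt.tendsto
      exact h2.eventually h1
    -- Conservation compares `H` at the two ends of the period with the same `v`. By periodicity
    -- both ends have the same base point, so on differentiating the `∂_v H` terms cancel and only
    -- the gradient in `u` is left.
    have hev : (fun q => H (q.1, ψ (ι q) ⟨T, hT, le_rfl⟩)) =ᶠ[𝓝 (um, ubar 0)] H := by
      filter_upwards [hev1, hι.continuousAt.eventually hψ.solves] with q hq1 hq2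
      have h1 := hcons q.1 (ext le_rfl hT (ψ (ι q))) T (fun x hx => by
        rw [ext_of_mem _ _ _ hx]
        exact ⟨hq1 _, hq2.2.1 ⟨x, hx⟩⟩) T ⟨hT, le_rfl⟩
      rw [ext_of_mem _ _ _ ⟨hT, le_rfl⟩, ext_of_mem _ _ _ ⟨le_rfl, hT⟩, hq2.1] at h1
      exact h1
    have hbase : ψ (ι (um, ubar 0)) ⟨T, hT, le_rfl⟩ = ubar 0 := by
      have h1 : ψ ((um, 0), ubar 0) ⟨T, hT, le_rfl⟩ = ubar T := hψ.base ⟨T, hT, le_rfl⟩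
      have h2 := h.profile.periodic 0
      rw [zero_add] at h2
      rw [h2] at h1; exact h1
    have hd1 : HasFDerivAt (fun q => (q.1, ψ (ι q) ⟨T, hT, le_rfl⟩)) _ (um, ubar 0) :=
      HasFDerivAt.prodMk hasFDerivAt_fst hψT
    have hHd' : HasFDerivAt H (fderiv ℝ H (um, ubar 0))
        ((um, ubar 0).1, ψ (ι (um, ubar 0)) ⟨T, hT, le_rfl⟩) := by rw [hbase]; exact hHd
    have hd2 := (HasFDerivAt.comp (g := H) (um, ubar 0) hHd' hd1).unique
      (hHd.congr_of_eventuallyEq hev)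
    have h5 : fderiv ℝ H (um, ubar 0) (v, W ((v, 0), a) ⟨T, hT, le_rfl⟩) =
      fderiv ℝ H (um, ubar 0) (v, a) := DFunLike.congr_fun hd2 (v, a)
    have h6 : ∀ w : Fin n → ℝ, (fderiv ℝ H (um, ubar 0)) (v, w) =
        fderiv ℝ H (um, ubar 0) (v, 0) + fderiv ℝ H (um, ubar 0) (0, w) := fun w => by
      rw [← map_add]; simp
    rw [h6, h6 a] at h5
    simpa using h5

end Admissible

end

/-! ### The family of periodic orbits and the mass map -/

section

variable {n : ℕ} {f : (Fin n → ℝ) → (Fin n → ℝ)} {B : (Fin n → ℝ) → Matrix (Fin n) (Fin n) ℝ}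
  {T : ℝ} {um : Fin n → ℝ} {ubar : ℝ → Fin n → ℝ}

lemma dotProduct_self_ne_zero {e : Fin n → ℝ} (he : e ≠ 0) : e ⬝ᵥ e ≠ 0 := fun h0 =>
  he (dotProduct_self_eq_zero.1 h0)

/-- The linearized period map of the profile and the derivative `N` of the mass map, in terms of
the derivative `W` of the flow: `ℓ` is the derivative of the integral of motion, and `da` the
derivative of the initial value of the periodic solutions with respect to the rest point. -/
structure IsMassDerivative (hT : 0 ≤ T) (ubar : ℝ → Fin n → ℝ)
    (W : ((Fin n → ℝ) × ℝ) × (Fin n → ℝ) →L[ℝ] (Set.Icc (0 : ℝ) T →ᵇ (Fin n → ℝ)))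
    (ℓ : (Fin n → ℝ) →L[ℝ] ℝ) (da : (Fin n → ℝ) →L[ℝ] (Fin n → ℝ))
    (N : Matrix (Fin n) (Fin n) ℝ) : Prop where
  ker_eq : ∀ a, W ((0, 0), a) ⟨T, hT, le_rfl⟩ = a → ∃ c : ℝ, a = c • deriv ubar 0
  functional_deriv : ℓ (deriv ubar 0) = 0
  functional_conserved : ∀ v a, ℓ (W ((v, 0), a) ⟨T, hT, le_rfl⟩) = ℓ a
  functional_speed : ℓ (W ((0, 1), 0) ⟨T, hT, le_rfl⟩) ≠ 0
  periodic : ∀ v, W ((v, 0), da v) ⟨T, hT, le_rfl⟩ = da v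
  mass : ∀ v, N *ᵥ v = ∫ x in (0 : ℝ)..T, ext le_rfl hT (W ((v, 0), da v)) x

namespace Admissible

variable (h : Admissible f B T um ubar)
  {ψ : ((Fin n → ℝ) × ℝ) × (Fin n → ℝ) → (Set.Icc (0 : ℝ) T →ᵇ (Fin n → ℝ))}
  {W : ((Fin n → ℝ) × ℝ) × (Fin n → ℝ) →L[ℝ] (Set.Icc (0 : ℝ) T →ᵇ (Fin n → ℝ))}
  (hψ : IsFlowDeriv f B h.T_nonneg um ubar ψ W)
include h hψ

lemma flowDeriv_period_deriv_ubar :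
    W ((0, 0), deriv ubar 0) ⟨T, h.T_nonneg, le_rfl⟩ = deriv ubar 0 := by
  rw [h.flowDeriv_deriv_ubar hψ]
  have := h.periodic_deriv_ubar 0
  rwa [zero_add] at this

/-- The linearized separation map in `(a, s)` goes from dimension `n + 1` onto dimension `n`, so its
kernel is a line, and `(ubar' 0, 0)` lies on it. -/
lemma ker_of_transversal (h3 : IsTransversal f B T um ubar) {a : Fin n → ℝ}
    (ha : W ((0, 0), a) ⟨T, h.T_nonneg, le_rfl⟩ = a) : ∃ c : ℝ, a = c • deriv ubar 0 := by
  let S : (Fin n → ℝ) × ℝ →ₗ[ℝ] (Fin n → ℝ) :=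
    { toFun := fun q => W ((0, q.2), q.1) ⟨T, h.T_nonneg, le_rfl⟩ - q.1
      map_add' := fun p q => by
        have : (((0 : Fin n → ℝ), (p + q).2), (p + q).1) = ((0, p.2), p.1) + ((0, q.2), q.1) := by
          simp
        rw [this, map_add, BoundedContinuousFunction.add_apply, Prod.fst_add]; abel
      map_smul' := fun c q => by
        have : (((0 : Fin n → ℝ), (c • q).2), (c • q).1) = c • (((0 : Fin n → ℝ), q.2), q.1) := by
          simp
        rw [this, map_smul, BoundedContinuousFunction.smul_apply, Prod.smul_fst, smul_sub]; rfl }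
  have hsurj : Function.Surjective S := fun y => by
    obtain ⟨a, s, has⟩ := h.transversal_surjective hψ h3 y
    exact ⟨(a, s), has⟩
  have hrank := S.finrank_range_add_finrank_ker
  rw [LinearMap.range_eq_top.2 hsurj, finrank_top] at hrank
  simp only [Module.finrank_fin_fun, Module.finrank_prod, Module.finrank_self] at hrank
  have hker : Module.finrank ℝ (LinearMap.ker S) = 1 := by omega
  have he : (deriv ubar 0, (0 : ℝ)) ∈ LinearMap.ker S := by
    simp only [LinearMap.mem_ker, S, LinearMap.coe_mk, AddHom.coe_mk]
    exact sub_eq_zero.2 (h.flowDeriv_period_deriv_ubar hψ)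
  have ha' : (a, (0 : ℝ)) ∈ LinearMap.ker S := by
    simp only [LinearMap.mem_ker, S, LinearMap.coe_mk, AddHom.coe_mk]
    exact sub_eq_zero.2 ha
  have hne : (⟨_, he⟩ : LinearMap.ker S) ≠ 0 := by
    intro h0
    have := congrArg (fun q : LinearMap.ker S => q.1.1) h0
    exact h.deriv_ubar_zero_ne this
  obtain ⟨c, hc⟩ := (finrank_eq_one_iff_of_nonzero' _ hne).1 hker ⟨_, ha'⟩
  exact ⟨c, (congrArg (fun q : LinearMap.ker S => q.1.1) hc).symm⟩

/-- Existence and uniqueness of the mass Jacobian. -/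
theorem exists_mass_derivative (h3 : IsTransversal f B T um ubar)
    (hH : IsQuasiHamiltonian f B um ubar) :
    ∃ (ℓ : (Fin n → ℝ) →L[ℝ] ℝ) (da : (Fin n → ℝ) →L[ℝ] (Fin n → ℝ))
      (N : Matrix (Fin n) (Fin n) ℝ), IsMassDerivative h.T_nonneg ubar W ℓ da N ∧
      IsMassJacobian f B T um ubar N ∧ ∀ N', IsMassJacobian f B T um ubar N' → N' = N := by
  have hT := h.T_nonneg
  obtain ⟨ℓ, hℓ0, hℓe, hℓ⟩ := h.exists_conserved_functional hψ hH
  set e := deriv ubar 0 with he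
  have hee : e ⬝ᵥ e ≠ 0 := dotProduct_self_ne_zero h.deriv_ubar_zero_ne
  let tT : Set.Icc (0 : ℝ) T := ⟨T, hT, le_rfl⟩
  have hsplit : ∀ v s a, W ((v, s), a) tT = W ((v, 0), a) tT + s • W ((0, 1), 0) tT := by
    intro v s a
    have : ((v, s), a) = ((v, (0 : ℝ)), a) + s • (((0 : Fin n → ℝ), (1 : ℝ)), (0 : Fin n → ℝ)) := by
      simp
    rw [this, map_add, map_smul]; rfl
  -- Changes of the initial value do not contribute to `ℓ` of the increment. If the speed did not
  -- either, `ℓ` would vanish on the range of the linearized separation map, which is everything.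
  have hσ : ℓ (W ((0, 1), 0) tT) ≠ 0 := by
    intro h0
    refine hℓ0 (ContinuousLinearMap.ext fun y => ?_)
    obtain ⟨a, s, has⟩ := h.transversal_surjective hψ h3 y
    rw [← has, hsplit]
    simp [map_sub, map_add, map_smul, h0, hℓ, tT]
  -- the periodicity and normalization conditions
  let X := Fin n → ℝ
  let ι : X × (X × ℝ) → (X × ℝ) × X := fun w => ((w.1, w.2.2), w.2.1)
  let ιL : X × (X × ℝ) →L[ℝ] (X × ℝ) × X :=
    ((ContinuousLinearMap.fst ℝ X (X × ℝ)).prod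
      (ContinuousLinearMap.snd ℝ X ℝ ∘L ContinuousLinearMap.snd ℝ X (X × ℝ))).prod
      (ContinuousLinearMap.fst ℝ X ℝ ∘L ContinuousLinearMap.snd ℝ X (X × ℝ))
  let dotL : X →L[ℝ] ℝ := LinearMap.toContinuousLinearMap
    { toFun := fun a => a ⬝ᵥ e
      map_add' := fun a b => add_dotProduct a b e
      map_smul' := fun c a => smul_dotProduct c a e }
  let w₀ : X × (X × ℝ) := (um, (ubar 0, 0))
  let G : X × (X × ℝ) → X × ℝ := fun w => (ψ (ι w) tT - w.2.1, (w.2.1 - ubar 0) ⬝ᵥ e)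
  let pa : X × (X × ℝ) →L[ℝ] X :=
    ContinuousLinearMap.fst ℝ X ℝ ∘L ContinuousLinearMap.snd ℝ X (X × ℝ)
  let G' : X × (X × ℝ) →L[ℝ] X × ℝ :=
    (evalL ℝ tT ∘L W ∘L ιL - pa).prod (dotL ∘L pa)
  have hψι : HasStrictFDerivAt (fun w => ψ (ι w)) (W ∘L ιL) w₀ :=
    HasStrictFDerivAt.comp (g := ψ) (f := ι) w₀ hψ.strict ιL.hasStrictFDerivAt
  have hG : HasStrictFDerivAt G G' w₀ := by
    refine HasStrictFDerivAt.prodMk ?_ ?_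
    · exact ((evalL ℝ (E := X) tT).hasStrictFDerivAt.comp w₀ hψι).sub pa.hasStrictFDerivAt
    · exact dotL.hasStrictFDerivAt.comp w₀ (pa.hasStrictFDerivAt.sub_const (ubar 0))
  have hG0 : G w₀ = 0 := by
    have h1 : ψ ((um, 0), ubar 0) tT = ubar T := hψ.base tT
    have h2 := h.profile.periodic 0
    rw [zero_add] at h2
    rw [h2] at h1
    exact Prod.ext (sub_eq_zero.2 h1) (by simp [G, w₀])
  have hG'apply : ∀ v a s, G' (v, (a, s)) = (W ((v, s), a) tT - a, a ⬝ᵥ e) := fun _ _ _ => rfl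
  -- Three conditions act in turn: `ℓ` forces `s = 0`, transversality then leaves only multiples of
  -- `e`, and the normalization excludes these.
  have hinj : Function.Injective (G' ∘L ContinuousLinearMap.inr ℝ X (X × ℝ)) := by
    refine (injective_iff_map_eq_zero _).2 ?_
    rintro ⟨a, s⟩ has
    have h1 : G' (0, (a, s)) = 0 := has
    rw [hG'apply] at h1
    have h2 : W ((0, s), a) tT = a := sub_eq_zero.1 (congrArg Prod.fst h1)
    have h3' : a ⬝ᵥ e = 0 := congrArg Prod.snd h1
    have hs : s = 0 := by
      have := congrArg ℓ h2
      rw [hsplit, map_add, map_smul, hℓ, smul_eq_mul] at this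
      simpa [hσ] using this
    subst hs
    obtain ⟨c, hc⟩ := h.ker_of_transversal hψ h3 h2
    rw [hc, smul_dotProduct, smul_eq_mul] at h3'
    have hc0 : c = 0 := (mul_eq_zero.1 h3').resolve_right hee
    rw [hc, hc0, zero_smul]; rfl
  have hinv : (G' ∘L ContinuousLinearMap.inr ℝ X (X × ℝ)).IsInvertible := by
    refine ⟨(LinearEquiv.ofInjectiveEndo
      (G' ∘L ContinuousLinearMap.inr ℝ X (X × ℝ)).toLinearMap hinj).toContinuousLinearEquiv, ?_⟩
    exact ContinuousLinearMap.ext fun w => rfl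
  let φ := hG.implicitFunctionOfProdDomain hinv
  have hφd := hG.hasStrictFDerivAt_implicitFunctionOfProdDomain hinv
  set φ' := -(G' ∘L ContinuousLinearMap.inr ℝ X (X × ℝ)).inverse ∘L
    (G' ∘L ContinuousLinearMap.inl ℝ X (X × ℝ)) with hφ'
  change HasStrictFDerivAt φ φ' um at hφd
  have hφ0 : φ um = (ubar 0, 0) :=
    (hG.eventually_apply_eq_iff_implicitFunctionOfProdDomain hinv).self_of_nhds.1 rfl
  have hφev : ∀ᶠ v in 𝓝 um, G (v, φ v) = 0 := by
    have := hG.eventually_apply_implicitFunctionOfProdDomain hinv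
    rwa [hG0] at this
  have hφiff : ∀ᶠ w in 𝓝 w₀, G w = 0 → φ w.1 = w.2 := by
    have := hG.eventually_apply_eq_iff_implicitFunctionOfProdDomain hinv
    rw [hG0] at this
    exact this.mono fun w hw => hw.1
  have hG'φ : ∀ v, G' (v, φ' v) = 0 := by
    intro v
    have h2 : G' (v, φ' v) = (G' ∘L ContinuousLinearMap.inl ℝ X (X × ℝ)) v +
        (G' ∘L ContinuousLinearMap.inr ℝ X (X × ℝ)) (φ' v) := by
      simp only [ContinuousLinearMap.comp_apply, ← map_add]
      simp
    obtain ⟨eq, heq⟩ := hinv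
    have h3 : (G' ∘L ContinuousLinearMap.inr ℝ X (X × ℝ)) (φ' v) =
        -(G' ∘L ContinuousLinearMap.inl ℝ X (X × ℝ)) v := by
      rw [hφ', ← heq]
      simp [ContinuousLinearMap.inverse_equiv]
    rw [h2, h3, add_neg_cancel]
  have hper : ∀ v, W ((v, (φ' v).2), (φ' v).1) tT = (φ' v).1 := fun v =>
    sub_eq_zero.1 (congrArg Prod.fst (hG'φ v))
  -- Applying `ℓ` to the linearized periodicity condition leaves only the speed term. Hence the
  -- derivative of the mass map involves variations at speed zero alone.
  have hs0 : ∀ v, (φ' v).2 = 0 := by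
    intro v
    have := congrArg ℓ (hper v)
    rw [hsplit, map_add, map_smul, hℓ, smul_eq_mul] at this
    simpa [hσ] using this
  let da : X →L[ℝ] X := ContinuousLinearMap.fst ℝ X ℝ ∘L φ'
  have hφ'eq : ∀ v, φ' v = (da v, 0) := fun v => Prod.ext rfl (hs0 v)
  -- the mass map
  let J : (Set.Icc (0 : ℝ) T →ᵇ X) →L[ℝ] X := evalL ℝ tT ∘L primL ℝ le_rfl hT
  let ML : X →L[ℝ] X := J ∘L W ∘L ιL ∘L (ContinuousLinearMap.id ℝ X).prod φ'
  let N : Matrix (Fin n) (Fin n) ℝ := LinearMap.toMatrix' ML.toLinearMap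
  have hNv : ∀ v, N *ᵥ v = ML v := fun v => by
    rw [← Matrix.toLin'_apply, Matrix.toLin'_toMatrix']; rfl
  have hcont : Tendsto (fun v => (v, φ v)) (𝓝 um) (𝓝 w₀) := by
    have := hφd.continuousAt.tendsto
    rw [hφ0] at this
    exact tendsto_id.prodMk_nhds this
  have hιc : Tendsto ι (𝓝 w₀) (𝓝 ((um, 0), ubar 0)) := ιL.continuous.tendsto' _ _ rfl
  have hmass : HasFDerivAt (fun v => ∫ x in (0 : ℝ)..T, flow f B T v (φ v).1 (φ v).2 x) ML um := by
    have h1 : HasFDerivAt (fun v => (v, φ v)) ((ContinuousLinearMap.id ℝ X).prod φ') um :=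
      (hasFDerivAt_id um).prodMk hφd.hasFDerivAt
    have h2 : HasFDerivAt (fun w => ψ (ι w)) (W ∘L ιL) (um, φ um) := by
      rw [hφ0]; exact hψι.hasFDerivAt
    have h4 : HasFDerivAt (fun v => J (ψ (ι (v, φ v)))) ML um :=
      J.hasFDerivAt.comp um (HasFDerivAt.comp (g := fun w => ψ (ι w)) (f := fun v => (v, φ v)) um h2 h1)
    refine h4.congr_of_eventuallyEq ?_
    filter_upwards [(hιc.comp hcont).eventually hψ.solves] with v hv
    refine intervalIntegral.integral_congr fun x hx => ?_
    rw [Set.uIcc_of_le hT] at hx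
    exact hv.2.2 x hx
  have hsepG : ∀ᶠ w in 𝓝 w₀, (separation f B T w.1 w.2.1 w.2.2 = 0 ∧
      (w.2.1 - ubar 0) ⬝ᵥ deriv ubar 0 = 0) ↔ G w = 0 := by
    filter_upwards [hιc.eventually (h.separation_eventually_eq hψ)] with w hw
    have hw' : separation f B T w.1 w.2.1 w.2.2 = ψ (ι w) tT - w.2.1 := hw
    rw [hw', Prod.ext_iff]
    rfl
  refine ⟨ℓ, da, N, ⟨fun a ha => h.ker_of_transversal hψ h3 ha, hℓe, hℓ, hσ, fun v => ?_,
    fun v => ?_⟩, ?_, ?_⟩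
  · have := hper v
    rw [hs0] at this
    exact this
  · rw [hNv]
    change ∫ x in (0 : ℝ)..T, ext le_rfl hT (W ((v, (φ' v).2), (φ' v).1)) x = _
    rw [hs0]; rfl
  · refine ⟨fun v => (φ v).1, fun v => (φ v).2, by simp [hφ0], by simp [hφ0],
      continuous_fst.continuousAt.comp hφd.continuousAt,
      continuous_snd.continuousAt.comp hφd.continuousAt, ?_, ?_⟩
    · filter_upwards [hφev, hcont.eventually hsepG] with v hv hv2
      exact (hv2.2 hv).symm
    · have : LinearMap.toContinuousLinearMap (Matrix.toLin' N) = ML := by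
        ext v : 1; exact hNv v
      rw [this]; exact hmass
  · rintro N' ⟨a, s, ha0, hs0', hac, hsc, hev, hN'⟩
    have hc2 : Tendsto (fun v => (v, (a v, s v))) (𝓝 um) (𝓝 w₀) := by
      have h1 := hac.tendsto
      have h2 := hsc.tendsto
      rw [ha0] at h1
      rw [hs0'] at h2
      exact tendsto_id.prodMk_nhds (h1.prodMk_nhds h2)
    -- Any continuous selection through the base point solves `G = 0`, so it coincides near `um`
    -- with the implicit function; the mass maps have the same germ and the derivative is unique.
    have heq : ∀ᶠ v in 𝓝 um, φ v = (a v, s v) := by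
      filter_upwards [hev, hc2.eventually hsepG, hc2.eventually hφiff] with v h1 h2 h3
      exact h3 (h2.1 h1.symm)
    have h5 : HasFDerivAt (fun v => ∫ x in (0 : ℝ)..T, flow f B T v (a v) (s v) x) ML um := by
      refine hmass.congr_of_eventuallyEq ?_
      filter_upwards [heq] with v hv
      rw [hv]
    have h6 := hN'.unique h5
    have h7 : ∀ v, N' *ᵥ v = N *ᵥ v := fun v => by
      rw [hNv, ← h6]; rfl
    exact Matrix.ext_of_mulVec_single fun i => h7 _

end Admissible

end

/-! ### The linearized operator in flux variables and the Evans function -/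

section

variable {n : ℕ}

section Cplx

set_option linter.unusedSectionVars false

variable {m : Type*} [Fintype m] [DecidableEq m]

lemma cplx_mul (M N : Matrix m m ℝ) : cplx (M * N) = cplx M * cplx N :=
  Matrix.map_mul (f := Complex.ofRealHom)

lemma cplx_one : cplx (1 : Matrix m m ℝ) = 1 :=
  Matrix.map_one _ Complex.ofReal_zero Complex.ofReal_one

lemma cplx_sub (M N : Matrix m m ℝ) : cplx (M - N) = cplx M - cplx N := by
  ext i j; simp [cplx]

lemma cplx_inv_mul_cancel {M : Matrix m m ℝ} (h : M.det ≠ 0) : cplx M⁻¹ * cplx M = 1 := by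
  rw [← cplx_mul, Matrix.nonsing_inv_mul _ (Ne.isUnit h), cplx_one]

lemma cplx_mul_inv_cancel {M : Matrix m m ℝ} (h : M.det ≠ 0) : cplx M * cplx M⁻¹ = 1 := by
  rw [← cplx_mul, Matrix.mul_nonsing_inv _ (Ne.isUnit h), cplx_one]

/-- Product rule for a differentiable real matrix applied to a differentiable complex vector. -/
lemma hasDerivAt_cplx_mulVec {M : ℝ → Matrix m m ℝ} {M' : Matrix m m ℝ} {w : ℝ → m → ℂ}
    {w' : m → ℂ} {x : ℝ} (hM : ∀ i j, HasDerivAt (fun y => M y i j) (M' i j) x)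
    (hw : HasDerivAt w w' x) :
    HasDerivAt (fun y => cplx (M y) *ᵥ w y) (cplx M' *ᵥ w x + cplx (M x) *ᵥ w') x := by
  rw [hasDerivAt_pi] at hw ⊢
  intro i
  have h1 : HasDerivAt (fun y => ∑ j, (M y i j : ℂ) * w y j)
      (∑ j, ((M' i j : ℂ) * w x j + (M x i j : ℂ) * w' j)) x :=
    HasDerivAt.fun_sum fun j _ => ((hM i j).ofReal_comp).mul (hw j)
  rw [Finset.sum_add_distrib] at h1
  exact h1

end Cplx

variable {f : (Fin n → ℝ) → (Fin n → ℝ)} {B : (Fin n → ℝ) → Matrix (Fin n) (Fin n) ℝ}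
  {T : ℝ} {um : Fin n → ℝ} {ubar : ℝ → Fin n → ℝ}

namespace Admissible

variable (h : Admissible f B T um ubar)
include h

lemma coeffA_entry (x : ℝ) (i j : Fin n) : coeffA f B ubar x i j =
    fderiv ℝ f (ubar x) (Pi.single j 1) i -
      ∑ k, deriv ubar x k * fderiv ℝ (fun u => B u i k) (ubar x) (Pi.single j 1) := by
  have := coeffA_mulVec h.contDiff_f h.contDiff_B ubar x (Pi.single j 1) i
  simpa using this

lemma differentiable_fderiv_comp {g : (Fin n → ℝ) → ℝ} (hg : ContDiff ℝ 2 g) (v : Fin n → ℝ) :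
    Differentiable ℝ fun x => fderiv ℝ g (ubar x) v := by
  have h1 : ContDiff ℝ 1 (fderiv ℝ g) := hg.fderiv_right (by norm_num)
  have h2 : Differentiable ℝ ubar := fun x => (h.profile.ode x).differentiableAt
  exact ((h1.differentiable one_ne_zero).comp h2).clm_apply (differentiable_const v)

lemma hasDerivAt_coeffA (x : ℝ) (i j : Fin n) :
    HasDerivAt (fun y => coeffA f B ubar y i j) (matDeriv (coeffA f B ubar) x i j) x := by
  refine DifferentiableAt.hasDerivAt ?_
  simp_rw [h.coeffA_entry]
  have h1 : Differentiable ℝ fun x => fderiv ℝ f (ubar x) (Pi.single j 1) i := by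
    have h2 : ContDiff ℝ 1 (fderiv ℝ f) := h.contDiff_f.fderiv_right (by norm_num)
    have h3 : Differentiable ℝ ubar := fun x => (h.profile.ode x).differentiableAt
    exact differentiable_pi.1
      (((h2.differentiable one_ne_zero).comp h3).clm_apply (differentiable_const _)) i
  refine (h1 x).sub (DifferentiableAt.fun_sum fun k _ => DifferentiableAt.mul ?_ ?_)
  · exact differentiableAt_pi.1 (h.hasDerivAt_deriv_ubar x).differentiableAt k
  · exact h.differentiable_fderiv_comp (h.contDiff_B i k) _ x

lemma hasDerivAt_coeffB (x : ℝ) (i j : Fin n) :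
    HasDerivAt (fun y => coeffB B ubar y i j) (matDeriv (coeffB B ubar) x i j) x := by
  refine DifferentiableAt.hasDerivAt ?_
  exact DifferentiableAt.comp (g := fun u => B u i j) x
    ((h.contDiff_B i j).differentiable (by norm_num) _) (h.profile.ode x).differentiableAt

lemma continuous_coeffA (i j : Fin n) : Continuous fun y => coeffA f B ubar y i j :=
  continuous_iff_continuousAt.2 fun x => (h.hasDerivAt_coeffA x i j).continuousAt

lemma continuous_coeffB_inv (i j : Fin n) : Continuous fun y => (coeffB B ubar y)⁻¹ i j :=
  continuous_iff_continuousAt.2 fun x =>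
    ContinuousAt.comp (g := fun u => (B u)⁻¹ i j)
      (contDiffAt_inv_entry h.contDiff_B (h.det_coeffB x) i j).continuousAt
      h.continuous_ubar.continuousAt

lemma det_coeffB' (x : ℝ) : (coeffB B ubar x).det ≠ 0 := h.det_coeffB x

lemma periodic_coeffB (x : ℝ) : coeffB B ubar (x + T) = coeffB B ubar x := by
  rw [coeffB, coeffB, h.profile.periodic]

lemma periodic_coeffA (x : ℝ) : coeffA f B ubar (x + T) = coeffA f B ubar x := by
  rw [coeffA, coeffA, h.profile.periodic, h.periodic_deriv_ubar]

end Admissible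

/-! ### The eigenvalue equation as a system for the solution and its flux -/

/-- The coefficient `(w, z) ↦ (B⁻¹ (A w + z), 0)` of the eigenvalue equation at `0`, written for
`w` and the flux `z = B w' - A w`. -/
def fluxCoeff (f : (Fin n → ℝ) → (Fin n → ℝ)) (B : (Fin n → ℝ) → Matrix (Fin n) (Fin n) ℝ)
    (ubar : ℝ → Fin n → ℝ) (x : ℝ) : (Fin n → ℂ) × (Fin n → ℂ) →L[ℂ] (Fin n → ℂ) × (Fin n → ℂ) :=
  LinearMap.toContinuousLinearMap
    { toFun := fun y => (cplx (coeffB B ubar x)⁻¹ *ᵥ (cplx (coeffA f B ubar x) *ᵥ y.1 + y.2), 0)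
      map_add' := fun y y' => by
        simp only [Prod.fst_add, Prod.snd_add, Matrix.mulVec_add, Prod.mk_add_mk, add_zero]
        congr 1; abel
      map_smul' := fun c y => by
        simp [Matrix.mulVec_add, Matrix.mulVec_smul] }

lemma fluxCoeff_apply (x : ℝ) (y : (Fin n → ℂ) × (Fin n → ℂ)) : fluxCoeff f B ubar x y =
    (cplx (coeffB B ubar x)⁻¹ *ᵥ (cplx (coeffA f B ubar x) *ᵥ y.1 + y.2), 0) := rfl

variable (n) in
/-- The coefficient `(w, z) ↦ (0, w)` of the spectral parameter. -/
def shiftCoeff : (Fin n → ℂ) × (Fin n → ℂ) →L[ℂ] (Fin n → ℂ) × (Fin n → ℂ) :=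
  (0 : (Fin n → ℂ) × (Fin n → ℂ) →L[ℂ] (Fin n → ℂ)).prod (ContinuousLinearMap.fst ℂ _ _)

@[simp] lemma shiftCoeff_apply (y : (Fin n → ℂ) × (Fin n → ℂ)) : shiftCoeff n y = (0, y.1) := rfl

namespace Admissible

variable (h : Admissible f B T um ubar)
include h

lemma continuous_fluxCoeff : Continuous (fluxCoeff f B ubar) := by
  refine continuous_clm_apply.2 fun y => ?_
  simp_rw [fluxCoeff_apply]
  refine Continuous.prodMk ?_ continuous_const
  refine continuous_pi fun i => ?_
  simp only [Matrix.mulVec, dotProduct, cplx, Matrix.map_apply, Pi.add_apply]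
  have h1 := h.continuous_coeffA
  have h2 := h.continuous_coeffB_inv
  refine continuous_finsetSum _ fun j _ => ?_
  refine (Complex.continuous_ofReal.comp (h2 i j)).mul (Continuous.add ?_ continuous_const)
  exact continuous_finsetSum _ fun k _ => (Complex.continuous_ofReal.comp (h1 j k)).mul
    continuous_const

lemma continuous_fluxCoeff_add (z : ℂ) :
    Continuous fun x => fluxCoeff f B ubar x + z • shiftCoeff n :=
  h.continuous_fluxCoeff.add continuous_const

lemma periodic_fluxCoeff (x : ℝ) : fluxCoeff f B ubar (x + T) = fluxCoeff f B ubar x := by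
  refine ContinuousLinearMap.ext fun y => ?_
  rw [fluxCoeff_apply, fluxCoeff_apply, h.periodic_coeffA, h.periodic_coeffB]

/-- The solution operator over `[0, T]` of the eigenvalue equation, in flux variables. -/
def fluxPropagator (z : ℂ) :
    (Fin n → ℂ) × (Fin n → ℂ) →L[ℂ] (Set.Icc (0 : ℝ) T →ᵇ (Fin n → ℂ) × (Fin n → ℂ)) :=
  propagator le_rfl h.T_nonneg (restr 0 T (fluxCoeff f B ubar) h.continuous_fluxCoeff +
    z • BoundedContinuousFunction.const _ (shiftCoeff n))

/-- The monodromy operator of the eigenvalue equation, in flux variables. -/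
def fluxMonodromy (z : ℂ) : (Fin n → ℂ) × (Fin n → ℂ) →L[ℂ] (Fin n → ℂ) × (Fin n → ℂ) :=
  evalL ℂ ⟨T, h.T_nonneg, le_rfl⟩ ∘L h.fluxPropagator z

lemma eq_fluxMonodromy {z : ℂ} {y : ℝ → (Fin n → ℂ) × (Fin n → ℂ)}
    (hy : ∀ x, HasDerivAt y ((fluxCoeff f B ubar x + z • shiftCoeff n) (y x)) x) :
    y T = h.fluxMonodromy z (y 0) :=
  eq_propagator_of_hasDerivWithinAt le_rfl h.T_nonneg
    (restr 0 T (fluxCoeff f B ubar) h.continuous_fluxCoeff +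
      z • BoundedContinuousFunction.const _ (shiftCoeff n))
    (fun x => (hy x).hasDerivWithinAt) ⟨T, h.T_nonneg, le_rfl⟩

lemma exists_flux_solution (z : ℂ) (c : (Fin n → ℂ) × (Fin n → ℂ)) :
    ∃ y : ℝ → (Fin n → ℂ) × (Fin n → ℂ), y 0 = c ∧
      ∀ x, HasDerivAt y ((fluxCoeff f B ubar x + z • shiftCoeff n) (y x)) x :=
  exists_linear_ode (h.continuous_fluxCoeff_add z) c

lemma flux_unique {z : ℂ} {y y' : ℝ → (Fin n → ℂ) × (Fin n → ℂ)}
    (hy : ∀ x, HasDerivAt y ((fluxCoeff f B ubar x + z • shiftCoeff n) (y x)) x)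
    (hy' : ∀ x, HasDerivAt y' ((fluxCoeff f B ubar x + z • shiftCoeff n) (y' x)) x)
    (h0 : y 0 = y' 0) : y = y' :=
  linear_ode_unique (h.continuous_fluxCoeff_add z) hy hy' h0

/-- Solutions of the eigenvalue equation solve the system in flux variables. -/
lemma hasDerivAt_flux {z : ℂ} {w w₁ : ℝ → Fin n → ℂ} {x : ℝ} (hw : HasDerivAt w (w₁ x) x)
    (hf : HasDerivAt (linFlux f B ubar w w₁) (z • w x) x) :
    HasDerivAt (fun x => (w x, linFlux f B ubar w w₁ x))
      ((fluxCoeff f B ubar x + z • shiftCoeff n) (w x, linFlux f B ubar w w₁ x)) x := by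
  convert hw.prodMk hf using 1
  rw [add_apply, smul_apply, fluxCoeff_apply,
    shiftCoeff_apply]
  have : cplx (coeffA f B ubar x) *ᵥ w x + linFlux f B ubar w w₁ x =
      cplx (coeffB B ubar x) *ᵥ w₁ x := by
    rw [linFlux]; abel
  simp only [this, Matrix.mulVec_mulVec, cplx_inv_mul_cancel (h.det_coeffB' x), Matrix.one_mulVec]
  simp

/-- The derivative of `w` recovered from the flux variables. -/
lemma flux_solution_spec {z : ℂ} {y : ℝ → (Fin n → ℂ) × (Fin n → ℂ)}
    (hy : ∀ x, HasDerivAt y ((fluxCoeff f B ubar x + z • shiftCoeff n) (y x)) x) :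
    ∃ w₁ : ℝ → Fin n → ℂ, (∀ x, HasDerivAt (fun x => (y x).1) (w₁ x) x) ∧
      (∀ x, linFlux f B ubar (fun x => (y x).1) w₁ x = (y x).2) ∧
      ∀ x, HasDerivAt (linFlux f B ubar (fun x => (y x).1) w₁) (z • (y x).1) x := by
  let w₁ : ℝ → Fin n → ℂ := fun x =>
    cplx (coeffB B ubar x)⁻¹ *ᵥ (cplx (coeffA f B ubar x) *ᵥ (y x).1 + (y x).2)
  have hflux : ∀ x, linFlux f B ubar (fun x => (y x).1) w₁ x = (y x).2 := fun x => by
    simp only [linFlux, w₁, Matrix.mulVec_mulVec, cplx_mul_inv_cancel (h.det_coeffB' x),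
      Matrix.one_mulVec]
    abel
  refine ⟨w₁, fun x => ?_, hflux, fun x => ?_⟩
  · have := (hasFDerivAt_fst (𝕜 := ℝ)).comp_hasDerivAt x (hy x)
    refine this.congr_deriv ?_
    simp [fluxCoeff_apply, w₁]
  · have := (hasFDerivAt_snd (𝕜 := ℝ)).comp_hasDerivAt x (hy x)
    rw [funext hflux]
    refine this.congr_deriv ?_
    simp [fluxCoeff_apply]

/-- For the derivative `w₁` of `w`, the second-order form of the eigenvalue equation. -/
lemma hasDerivAt_linFlux_of {z : ℂ} {w w₁ : ℝ → Fin n → ℂ} {x : ℝ}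
    (hw : HasDerivAt w (w₁ x) x)
    (hw₁ : HasDerivAt w₁ (cplx (coeffB B ubar x)⁻¹ *ᵥ (z • w x +
      cplx (matDeriv (coeffA f B ubar) x) *ᵥ w x +
        cplx (coeffA f B ubar x - matDeriv (coeffB B ubar) x) *ᵥ w₁ x)) x) :
    HasDerivAt (linFlux f B ubar w w₁) (z • w x) x := by
  have h1 := (hasDerivAt_cplx_mulVec (h.hasDerivAt_coeffB x) hw₁).sub
    (hasDerivAt_cplx_mulVec (h.hasDerivAt_coeffA x) hw)
  refine h1.congr_deriv ?_
  rw [Matrix.mulVec_mulVec, cplx_mul_inv_cancel (h.det_coeffB' x), Matrix.one_mulVec, cplx_sub,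
    Matrix.sub_mulVec]
  abel

/-- Differentiability of `w₁` is not assumed; it follows from `w₁ = B⁻¹ (flux + A w)`, where every
ingredient is differentiable. The product rule may then be solved for `w₁'`. -/
lemma hasDerivAt_of_linFlux {z : ℂ} {w w₁ : ℝ → Fin n → ℂ} {x : ℝ}
    (hw : HasDerivAt w (w₁ x) x) (hf : HasDerivAt (linFlux f B ubar w w₁) (z • w x) x) :
    HasDerivAt w₁ (cplx (coeffB B ubar x)⁻¹ *ᵥ (z • w x +
      cplx (matDeriv (coeffA f B ubar) x) *ᵥ w x +
        cplx (coeffA f B ubar x - matDeriv (coeffB B ubar) x) *ᵥ w₁ x)) x := by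
  have hd : DifferentiableAt ℝ w₁ x := by
    have h1 : w₁ = fun x => cplx (coeffB B ubar x)⁻¹ *ᵥ
        (linFlux f B ubar w w₁ x + cplx (coeffA f B ubar x) *ᵥ w x) := by
      funext x
      rw [linFlux, sub_add_cancel, Matrix.mulVec_mulVec, cplx_inv_mul_cancel (h.det_coeffB' x),
        Matrix.one_mulVec]
    have h2 : ∀ i j, HasDerivAt (fun y => (coeffB B ubar y)⁻¹ i j)
        (deriv (fun y => (coeffB B ubar y)⁻¹ i j) x) x := fun i j => by
      refine DifferentiableAt.hasDerivAt (DifferentiableAt.comp (g := fun u => (B u)⁻¹ i j) x ?_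
        (h.profile.ode x).differentiableAt)
      exact (contDiffAt_inv_entry h.contDiff_B (h.det_coeffB x) i j).differentiableAt (by norm_num)
    rw [h1]
    exact (hasDerivAt_cplx_mulVec (M' := Matrix.of fun i j => _) h2
      (hf.add (hasDerivAt_cplx_mulVec (h.hasDerivAt_coeffA x) hw))).differentiableAt
  have h1 := (hasDerivAt_cplx_mulVec (h.hasDerivAt_coeffB x) hd.hasDerivAt).sub
    (hasDerivAt_cplx_mulVec (h.hasDerivAt_coeffA x) hw)
  have h2 := hf.unique h1
  refine hd.hasDerivAt.congr_deriv ?_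
  have h3 : z • w x + cplx (matDeriv (coeffA f B ubar) x) *ᵥ w x +
        cplx (coeffA f B ubar x - matDeriv (coeffB B ubar) x) *ᵥ w₁ x =
      cplx (coeffB B ubar x) *ᵥ deriv w₁ x := by
    rw [h2, cplx_sub, Matrix.sub_mulVec]; abel
  rw [h3, Matrix.mulVec_mulVec, cplx_inv_mul_cancel (h.det_coeffB' x), Matrix.one_mulVec]

lemma bloch_flux {k : ℝ} {w w₁ : ℝ → Fin n → ℂ} (hw : ∀ x, HasDerivAt w (w₁ x) x)
    (hper : ∀ x, w (x + T) = Complex.exp (Complex.I * k * T) • w x) (x : ℝ) :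
    w₁ (x + T) = Complex.exp (Complex.I * k * T) • w₁ x ∧
    linFlux f B ubar w w₁ (x + T) =
      Complex.exp (Complex.I * k * T) • linFlux f B ubar w w₁ x := by
  have h1 : w₁ (x + T) = Complex.exp (Complex.I * k * T) • w₁ x := by
    have e1 : HasDerivAt (fun x => w (x + T)) (w₁ (x + T)) x := (hw (x + T)).comp_add_const x T
    have e2 := (hw x).const_smul (Complex.exp (Complex.I * k * T))
    rw [funext hper] at e1
    exact e1.unique e2
  refine ⟨h1, ?_⟩
  rw [linFlux, linFlux, h1, hper, h.periodic_coeffA, h.periodic_coeffB, Matrix.mulVec_smul,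
    Matrix.mulVec_smul, smul_sub]

/-- Floquet multipliers and Bloch eigenvalues. -/
theorem isBlochEigenvalue_iff (k : ℝ) (z : ℂ) : IsBlochEigenvalue f B T ubar k z ↔
    ∃ c, c ≠ 0 ∧ h.fluxMonodromy z c = Complex.exp (Complex.I * k * T) • c := by
  constructor
  · rintro ⟨w, w₁, hw0, hw, hf, hper⟩
    have hy := fun x => h.hasDerivAt_flux (hw x) (hf x)
    refine ⟨(w 0, linFlux f B ubar w w₁ 0), fun h0 => hw0 ?_, ?_⟩
    · have h1 := h.flux_unique hy (y' := fun _ => 0)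
        (fun x => by rw [map_zero]; exact hasDerivAt_const x _) h0
      funext x
      exact congrArg Prod.fst (congrFun h1 x)
    · have h1 : (w T, linFlux f B ubar w w₁ T) = _ := h.eq_fluxMonodromy hy
      rw [← h1]
      have h2 := h.bloch_flux hw hper 0
      have h3 := hper 0
      rw [zero_add] at h2 h3
      rw [h2.2, h3]; rfl
  · rintro ⟨c, hc0, hc⟩
    obtain ⟨y, hy0, hy⟩ := h.exists_flux_solution z c
    obtain ⟨w₁, hw, hfl, hf⟩ := h.flux_solution_spec hy
    -- The coefficients are periodic, so both sides solve the same equation; they agree at `0`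
    -- because `c` is an eigenvector of the monodromy.
    have hper : (fun x => y (x + T)) = fun x => Complex.exp (Complex.I * k * T) • y x := by
      refine h.flux_unique (z := z) (fun x => ?_) (fun x => ?_) ?_
      · have := (hy (x + T)).comp_add_const x T
        rwa [h.periodic_fluxCoeff] at this
      · rw [map_smul]; exact (hy x).fun_const_smul _
      · simp only [zero_add]
        rw [h.eq_fluxMonodromy hy, hy0, hc]
    refine ⟨fun x => (y x).1, w₁, fun h0 => hc0 ?_, hw, hf, fun x => ?_⟩
    · have hw0 : ∀ x, (y x).1 = 0 := fun x => congrFun h0 x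
      have hw1 : ∀ x, w₁ x = 0 := fun x => by
        have e1 := hw x
        simp_rw [hw0] at e1
        exact e1.unique (hasDerivAt_const _ _)
      rw [← hy0]
      refine Prod.ext (hw0 0) ?_
      rw [← hfl 0, linFlux, hw1, hw0]
      simp
    · exact congrArg Prod.fst (congrFun hper x)

/-! ### The Evans function in flux variables -/

/-- The change of variables `(w, w') ↦ (w, B w' - A w)` at `x = 0`. -/
def fluxEquiv : (Fin n ⊕ Fin n → ℂ) ≃ₗ[ℂ] (Fin n → ℂ) × (Fin n → ℂ) where
  toFun u := (u ∘ Sum.inl, cplx (coeffB B ubar 0) *ᵥ (u ∘ Sum.inr) -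
    cplx (coeffA f B ubar 0) *ᵥ (u ∘ Sum.inl))
  map_add' u v := by
    have e1 : (u + v) ∘ Sum.inl = u ∘ Sum.inl + v ∘ Sum.inl := rfl
    have e2 : (u + v) ∘ Sum.inr = u ∘ Sum.inr + v ∘ Sum.inr := rfl
    rw [e1, e2, Matrix.mulVec_add, Matrix.mulVec_add, Prod.mk_add_mk]
    congr 1; abel
  map_smul' c u := by
    have e1 : (c • u) ∘ Sum.inl = c • (u ∘ Sum.inl) := rfl
    have e2 : (c • u) ∘ Sum.inr = c • (u ∘ Sum.inr) := rfl
    rw [e1, e2, Matrix.mulVec_smul, Matrix.mulVec_smul, RingHom.id_apply, Prod.smul_mk, smul_sub]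
  invFun y := Sum.elim y.1 (cplx (coeffB B ubar 0)⁻¹ *ᵥ (cplx (coeffA f B ubar 0) *ᵥ y.1 + y.2))
  left_inv u := by
    have : cplx (coeffA f B ubar 0) *ᵥ (u ∘ Sum.inl) + (cplx (coeffB B ubar 0) *ᵥ (u ∘ Sum.inr) -
        cplx (coeffA f B ubar 0) *ᵥ (u ∘ Sum.inl)) = cplx (coeffB B ubar 0) *ᵥ (u ∘ Sum.inr) := by
      abel
    simp only [this, Matrix.mulVec_mulVec, cplx_inv_mul_cancel (h.det_coeffB' 0),
      Matrix.one_mulVec, Sum.elim_comp_inl_inr]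
  right_inv y := by
    simp only [Sum.elim_comp_inl, Sum.elim_comp_inr, Matrix.mulVec_mulVec,
      cplx_mul_inv_cancel (h.det_coeffB' 0), Matrix.one_mulVec]
    exact Prod.ext rfl (by simp)

omit h in
lemma evansCoeff_mulVec (z : ℂ) (x : ℝ) (u : Fin n ⊕ Fin n → ℂ) :
    evansCoeff f B ubar z x *ᵥ u = Sum.elim (u ∘ Sum.inr)
      (cplx (coeffB B ubar x)⁻¹ *ᵥ (z • (u ∘ Sum.inl) +
        cplx (matDeriv (coeffA f B ubar) x) *ᵥ (u ∘ Sum.inl) +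
        cplx (coeffA f B ubar x - matDeriv (coeffB B ubar) x) *ᵥ (u ∘ Sum.inr))) := by
  rw [evansCoeff, Matrix.fromBlocks_mulVec]
  congr 1
  · simp
  · simp only [← Matrix.mulVec_mulVec, Matrix.mulVec_add, Matrix.add_mulVec, Matrix.smul_mulVec,
      Matrix.one_mulVec]

lemma exists_isFundamental (z : ℂ) : ∃ Y, IsFundamental (evansCoeff f B ubar z) Y := by
  have key : ∀ j : Fin n ⊕ Fin n, ∃ u : ℝ → Fin n ⊕ Fin n → ℂ, u 0 = Pi.single j 1 ∧
      ∀ x, HasDerivAt u (evansCoeff f B ubar z x *ᵥ u x) x := by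
    intro j
    obtain ⟨y, hy0, hy⟩ := h.exists_flux_solution z (h.fluxEquiv (Pi.single j 1))
    obtain ⟨w₁, hw, hfl, hf⟩ := h.flux_solution_spec hy
    refine ⟨fun x => Sum.elim (y x).1 (w₁ x), ?_, fun x => ?_⟩
    · rw [← h.fluxEquiv.symm_apply_apply (Pi.single j 1), ← hy0]
      change _ = Sum.elim (y 0).1 _
      rw [← hfl 0, linFlux, add_sub_cancel, Matrix.mulVec_mulVec,
        cplx_inv_mul_cancel (h.det_coeffB' 0), Matrix.one_mulVec]
    · rw [evansCoeff_mulVec, hasDerivAt_pi]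
      rintro (i | i)
      · exact hasDerivAt_pi.1 (hw x) i
      · exact hasDerivAt_pi.1 (h.hasDerivAt_of_linFlux (hw x) (hf x)) i
  choose u hu0 hu using key
  refine ⟨fun x => Matrix.of fun i j => u j x i, ?_, fun x i j => ?_⟩
  · ext i j
    simp [hu0, Matrix.one_apply, Pi.single_apply]
  · exact hasDerivAt_pi.1 (hu j x) i

/-- The change of variables depends on `x` through `A` and `B` only, so by periodicity it is the
same at `0` and at `T`. The two monodromies are therefore conjugate and have the same characteristic
determinant. -/
lemma fluxEquiv_monodromy {z : ℂ} {Y : ℝ → Matrix (Fin n ⊕ Fin n) (Fin n ⊕ Fin n) ℂ}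
    (hY : IsFundamental (evansCoeff f B ubar z) Y) (c : Fin n ⊕ Fin n → ℂ) :
    h.fluxEquiv (Y T *ᵥ c) = h.fluxMonodromy z (h.fluxEquiv c) := by
  let u : ℝ → Fin n ⊕ Fin n → ℂ := fun x => Y x *ᵥ c
  have hu : ∀ x, HasDerivAt u (evansCoeff f B ubar z x *ᵥ u x) x := by
    intro x
    rw [hasDerivAt_pi]
    intro i
    have h1 : HasDerivAt (fun x => ∑ j, Y x i j * c j)
        (∑ j, (evansCoeff f B ubar z x * Y x) i j * c j) x :=
      HasDerivAt.fun_sum fun j _ => (hY.2 x i j).mul_const (c j)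
    rw [Matrix.mulVec_mulVec]
    exact h1
  have hw : ∀ x, HasDerivAt (fun x => u x ∘ Sum.inl) (u x ∘ Sum.inr) x := by
    intro x
    rw [hasDerivAt_pi]
    intro i
    have := hasDerivAt_pi.1 (hu x) (Sum.inl i)
    rw [evansCoeff_mulVec] at this
    exact this
  have hw₁ : ∀ x, HasDerivAt (fun x => u x ∘ Sum.inr)
      (cplx (coeffB B ubar x)⁻¹ *ᵥ (z • (u x ∘ Sum.inl) +
        cplx (matDeriv (coeffA f B ubar) x) *ᵥ (u x ∘ Sum.inl) +
        cplx (coeffA f B ubar x - matDeriv (coeffB B ubar) x) *ᵥ (u x ∘ Sum.inr))) x := by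
    intro x
    have := hu x
    rw [evansCoeff_mulVec] at this
    rw [hasDerivAt_pi] at this
    exact hasDerivAt_pi.2 fun i => this (Sum.inr i)
  have hf : ∀ x, HasDerivAt (linFlux f B ubar (fun x => u x ∘ Sum.inl) fun x => u x ∘ Sum.inr)
      (z • (u x ∘ Sum.inl)) x := fun x => h.hasDerivAt_linFlux_of (hw x) (hw₁ x)
  have h1 := h.eq_fluxMonodromy fun x => h.hasDerivAt_flux (hw x) (hf x)
  have h2 : u 0 = c := by simp [u, hY.1]
  have hA := h.periodic_coeffA 0
  have hB := h.periodic_coeffB 0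
  rw [zero_add] at hA hB
  have h3 : h.fluxEquiv (u T) = (u T ∘ Sum.inl,
      linFlux f B ubar (fun x => u x ∘ Sum.inl) (fun x => u x ∘ Sum.inr) T) := by
    rw [linFlux, hA, hB]; rfl
  have h4 : h.fluxEquiv c = (u 0 ∘ Sum.inl,
      linFlux f B ubar (fun x => u x ∘ Sum.inl) (fun x => u x ∘ Sum.inr) 0) := by
    rw [linFlux, h2]; rfl
  rw [h4, ← h1]
  exact h3

/-- The Evans function is the characteristic determinant of the monodromy in flux variables. -/
theorem evans_eq (k : ℝ) (z : ℂ) : evans f B T ubar k z =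
    LinearMap.det ((h.fluxMonodromy z).toLinearMap -
      Complex.exp (Complex.I * k * T) • LinearMap.id) := by
  have hex := h.exists_isFundamental z
  have hmon : monodromy T (evansCoeff f B ubar z) = hex.choose T := by
    rw [monodromy, dif_pos hex]
  rw [evans, ← LinearMap.det_toLin', ← LinearMap.det_conj _ h.fluxEquiv]
  congr 1
  refine LinearMap.ext fun y => ?_
  obtain ⟨c, rfl⟩ := h.fluxEquiv.surjective y
  simp only [LinearMap.comp_apply, LinearEquiv.coe_coe, LinearEquiv.symm_apply_apply,
    Matrix.toLin'_apply, map_sub, Matrix.one_mulVec,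
    map_smul, hmon, h.fluxEquiv_monodromy hex.choose_spec, LinearMap.sub_apply,
    LinearMap.smul_apply, LinearMap.id_apply, ContinuousLinearMap.coe_coe]

theorem isBlochEigenvalue_iff_evans (k : ℝ) (z : ℂ) :
    IsBlochEigenvalue f B T ubar k z ↔ evans f B T ubar k z = 0 := by
  rw [h.isBlochEigenvalue_iff, h.evans_eq]
  rw [LinearMap.det_eq_zero_iff_ker_ne_bot, Submodule.ne_bot_iff]
  refine exists_congr fun c => ?_
  rw [LinearMap.mem_ker, LinearMap.sub_apply, sub_eq_zero, and_comm]
  rfl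

end Admissible

end

/-! ### Bloch eigenvalues belong to the spectrum on every Lebesgue space -/

section

section Cutoff

/-- A smooth cut-off function. -/
lemma exists_cutoff : ∃ χ χ₁ χ₂ : ℝ → ℝ, (∀ x, HasDerivAt χ (χ₁ x) x) ∧
    (∀ x, HasDerivAt χ₁ (χ₂ x) x) ∧ Continuous χ₂ ∧ (∀ x, |x| ≤ 1 → χ x = 1) ∧
    (∀ x, 2 < |x| → χ x = 0 ∧ χ₁ x = 0 ∧ χ₂ x = 0) ∧ ∃ M, ∀ x, |χ₁ x| ≤ M ∧ |χ₂ x| ≤ M := by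
  let b : ContDiffBump (0 : ℝ) := ⟨1, 2, one_pos, by norm_num⟩
  have hb : ContDiff ℝ 2 b := b.contDiff
  have hb1 : ContDiff ℝ 1 (deriv b) := by
    have : ContDiff ℝ (1 + 1) b := hb
    exact (contDiff_succ_iff_deriv.1 this).2.2
  have hc : HasCompactSupport b := b.hasCompactSupport
  have ht : tsupport b = Metric.closedBall 0 2 := b.tsupport_eq
  have hout : ∀ x : ℝ, 2 < |x| → x ∉ tsupport b := fun x hx => by
    rw [ht, Metric.mem_closedBall, Real.dist_eq, sub_zero]; exact not_le.2 hx
  have hs1 : tsupport (deriv b) ⊆ tsupport b := closure_minimal support_deriv_subset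
    (isClosed_tsupport _)
  refine ⟨b, deriv b, deriv (deriv b), fun x => (hb.differentiable (by norm_num) x).hasDerivAt,
    fun x => (hb1.differentiable one_ne_zero x).hasDerivAt, hb1.continuous_deriv le_rfl,
    fun x hx => ?_, fun x hx => ⟨?_, ?_, ?_⟩, ?_⟩
  · exact b.one_of_mem_closedBall (by simpa [Real.dist_eq] using hx)
  · exact image_eq_zero_of_notMem_tsupport (hout x hx)
  · exact image_eq_zero_of_notMem_tsupport fun h => hout x hx (hs1 h)
  · exact image_eq_zero_of_notMem_tsupport fun h => hout x hx
      (hs1 (closure_minimal support_deriv_subset (isClosed_tsupport _) h))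
  · obtain ⟨M₁, h1⟩ := hc.deriv.exists_bound_of_continuous hb1.continuous
    obtain ⟨M₂, h2⟩ := hc.deriv.deriv.exists_bound_of_continuous (hb1.continuous_deriv le_rfl)
    exact ⟨max M₁ M₂, fun x => ⟨(h1 x).trans (le_max_left _ _), (h2 x).trans (le_max_right _ _)⟩⟩

lemma exists_bound_of_quasiperiodic {E : Type*} [NormedAddCommGroup E] [NormedSpace ℂ E] {T : ℝ}
    (hT : 0 < T) {v : ℝ → E} (hv : Continuous v) {γ : ℂ} (hγ : ‖γ‖ = 1)
    (hper : ∀ x, v (x + T) = γ • v x) : ∃ M, ∀ x, ‖v x‖ ≤ M := by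
  have hp : Function.Periodic (fun x => ‖v x‖) T := fun x => by
    simp only [hper, norm_smul, hγ, one_mul]
  obtain ⟨M, hM⟩ := isCompact_Icc.exists_bound_of_continuousOn (s := Set.Icc 0 T) hv.continuousOn
  refine ⟨M, fun x => ?_⟩
  obtain ⟨y, hy, hxy⟩ := hp.exists_mem_Ico₀ hT x
  have h1 := hM y (Set.Ico_subset_Icc_self hy)
  have h2 : ‖v x‖ = ‖v y‖ := hxy
  rw [h2]
  exact h1

/-- A function of compact support bounded below on many periods cannot be dominated in `Lᵖ` by
a slowly varying error. -/
lemma eLpNorm_lower {E : Type*} [NormedAddCommGroup E] {p : ℝ≥0∞} (hp : 1 ≤ p) (hp' : p ≠ ⊤)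
    {T η c x₀ : ℝ} (hη : 0 < η) (hηT : 2 * η < T) (hc : 0 ≤ c) (m : ℕ) {u : ℝ → E}
    (hu : ∀ j < m, ∀ x ∈ Set.Ioo (x₀ + j * T - η) (x₀ + j * T + η), c ≤ ‖u x‖) :
    ENNReal.ofReal c * ENNReal.ofReal (2 * η * m) ^ (1 / p.toReal) ≤ eLpNorm u p volume := by
  let S : Set ℝ := ⋃ j ∈ Finset.range m, Set.Ioo (x₀ + j * T - η) (x₀ + j * T + η)
  have hS : MeasurableSet S := Finset.measurableSet_biUnion _ fun _ _ => measurableSet_Ioo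
  have hvol : volume S = ENNReal.ofReal (2 * η * m) := by
    rw [measure_biUnion_finset _ fun _ _ => measurableSet_Ioo]
    · simp only [Real.volume_Ioo]
      have : ∀ j : ℕ, x₀ + j * T + η - (x₀ + j * T - η) = 2 * η := fun j => by ring
      simp only [this, Finset.sum_const, Finset.card_range, nsmul_eq_mul]
      rw [mul_comm, ENNReal.ofReal_mul (by positivity : 0 ≤ 2 * η), ENNReal.ofReal_natCast]
    · intro i _ j _ hij
      refine Set.disjoint_left.2 fun x hx hx' => hij ?_
      rcases lt_trichotomy i j with h | h | h
      · exfalso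
        have : (i : ℝ) + 1 ≤ j := by exact_mod_cast h
        nlinarith [hx.1, hx.2, hx'.1, hx'.2]
      · exact h
      · exfalso
        have : (j : ℝ) + 1 ≤ i := by exact_mod_cast h
        nlinarith [hx.1, hx.2, hx'.1, hx'.2]
  have h1 : eLpNorm (S.indicator fun _ => c) p volume ≤ eLpNorm u p volume := by
    refine eLpNorm_mono fun x => ?_
    by_cases hx : x ∈ S
    · rw [Set.indicator_of_mem hx, Real.norm_of_nonneg hc]
      simp only [S, Set.mem_iUnion, Finset.mem_range] at hx
      obtain ⟨j, hj, hxj⟩ := hx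
      exact hu j hj x hxj
    · rw [Set.indicator_of_notMem hx, norm_zero]; exact norm_nonneg _
  rw [eLpNorm_indicator_const hS (by positivity) hp', hvol, Real.enorm_of_nonneg hc] at h1
  exact h1

lemma eLpNorm_upper {E : Type*} [NormedAddCommGroup E] {p : ℝ≥0∞} (hp : 1 ≤ p) (hp' : p ≠ ⊤)
    {c R : ℝ} (hc : 0 ≤ c) {u : ℝ → E} (hu : ∀ x, ‖u x‖ ≤ c) (hu0 : ∀ x, R < |x| → u x = 0) :
    eLpNorm u p volume ≤ ENNReal.ofReal c * ENNReal.ofReal (2 * R) ^ (1 / p.toReal) := by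
  have h1 : eLpNorm u p volume ≤ eLpNorm ((Set.Icc (-R) R).indicator fun _ => c) p volume := by
    refine eLpNorm_mono fun x => ?_
    by_cases hx : x ∈ Set.Icc (-R) R
    · rw [Set.indicator_of_mem hx, Real.norm_of_nonneg hc]; exact hu x
    · rw [Set.indicator_of_notMem hx, hu0 x, norm_zero, norm_zero]
      rw [Set.mem_Icc, ← abs_le] at hx
      exact not_le.1 hx
  rw [eLpNorm_indicator_const measurableSet_Icc (by positivity) hp', Real.volume_Icc,
    Real.enorm_of_nonneg hc] at h1
  rwa [sub_neg_eq_add, ← two_mul] at h1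

end Cutoff

variable {n : ℕ} {f : (Fin n → ℝ) → (Fin n → ℝ)} {B : (Fin n → ℝ) → Matrix (Fin n) (Fin n) ℝ}
  {T : ℝ} {um : Fin n → ℝ} {ubar : ℝ → Fin n → ℝ}

namespace Admissible

variable (h : Admissible f B T um ubar)
include h

lemma contDiff_ubar : ContDiff ℝ 2 ubar := by
  have hd : Differentiable ℝ ubar := fun x => (h.profile.ode x).differentiableAt
  have hder : deriv ubar = fun x => paramField f B ((um, 0), ubar x) :=
    funext fun x => h.deriv_ubar x
  have step : ∀ k : ℕ, k ≤ 1 → ContDiff ℝ k ubar → ContDiff ℝ k (deriv ubar) := by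
    intro k hk hu
    rw [hder]
    refine contDiff_iff_contDiffAt.2 fun x => ?_
    have h1 := contDiffAt_paramField h.contDiff_f h.contDiff_B (q := ((um, 0), ubar x))
      (h.det_coeffB x)
    have hk2 : (k : WithTop ℕ∞) ≤ 2 := by
      have : k ≤ 2 := by omega
      exact_mod_cast this
    exact (h1.of_le hk2).comp x (contDiffAt_const.prodMk hu.contDiffAt)
  have h1 : ContDiff ℝ (0 + 1) ubar :=
    contDiff_succ_iff_deriv.2 ⟨hd, by simp, step 0 (by norm_num) (contDiff_zero.2 h.continuous_ubar)⟩
  have h2 : ContDiff ℝ (1 + 1) ubar :=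
    contDiff_succ_iff_deriv.2 ⟨hd, by simp, step 1 le_rfl (by simpa using h1)⟩
  exact h2

lemma contDiff_deriv_ubar : ContDiff ℝ 1 (deriv ubar) :=
  (contDiff_succ_iff_deriv.1 (show ContDiff ℝ (1 + 1) ubar from h.contDiff_ubar)).2.2

lemma continuous_matDeriv_coeffA (i j : Fin n) :
    Continuous fun x => matDeriv (coeffA f B ubar) x i j := by
  have h1 : ContDiff ℝ 1 fun x => coeffA f B ubar x i j := by
    simp_rw [h.coeffA_entry]
    have hu : ContDiff ℝ 1 ubar := h.contDiff_ubar.of_le (by norm_num)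
    have e1 : ContDiff ℝ 1 fun x => fderiv ℝ f (ubar x) (Pi.single j 1) :=
      ((h.contDiff_f.fderiv_right (by norm_num)).comp hu).clm_apply contDiff_const
    refine (contDiff_pi.1 e1 i).sub (ContDiff.sum fun k _ => ContDiff.mul ?_ ?_)
    · exact contDiff_pi.1 h.contDiff_deriv_ubar k
    · exact (((h.contDiff_B i k).fderiv_right (by norm_num)).comp hu).clm_apply contDiff_const
  exact h1.continuous_deriv le_rfl

lemma continuous_matDeriv_coeffB (i j : Fin n) :
    Continuous fun x => matDeriv (coeffB B ubar) x i j := by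
  have h1 : ContDiff ℝ 1 fun x => coeffB B ubar x i j :=
    ((h.contDiff_B i j).of_le (by norm_num)).comp (h.contDiff_ubar.of_le (by norm_num))
  exact h1.continuous_deriv le_rfl

lemma continuous_coeffB (i j : Fin n) : Continuous fun y => coeffB B ubar y i j :=
  continuous_iff_continuousAt.2 fun x => (h.hasDerivAt_coeffB x i j).continuousAt

end Admissible

lemma continuous_cplx_mulVec {m : Type*} [Fintype m] {M : ℝ → Matrix m m ℝ} {w : ℝ → m → ℂ}
    (hM : ∀ i j, Continuous fun x => M x i j) (hw : Continuous w) :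
    Continuous fun x => cplx (M x) *ᵥ w x :=
  continuous_pi fun i => continuous_finsetSum _ fun j _ =>
    (Complex.continuous_ofReal.comp (hM i j)).mul ((continuous_apply j).comp hw)

namespace Admissible

variable (h : Admissible f B T um ubar)
include h

omit h in
lemma linFlux_cutoff (χ χ' : ℝ → ℝ) (w w₁ : ℝ → Fin n → ℂ) (x : ℝ) :
    linFlux f B ubar (fun x => χ x • w x) (fun x => χ x • w₁ x + χ' x • w x) x =
      χ x • linFlux f B ubar w w₁ x + χ' x • (cplx (coeffB B ubar x) *ᵥ w x) := by
  simp only [linFlux, Matrix.mulVec_add, Matrix.mulVec_smul, smul_sub]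
  abel

/-- Bloch eigenvalues belong to the spectrum on every `Lᵖ`. -/
theorem mem_lpSpectrum {k : ℝ} {z : ℂ} (hz : IsBlochEigenvalue f B T ubar k z) {p : ℝ≥0∞}
    (hp : 1 ≤ p) : z ∈ lpSpectrum f B ubar p := by
  obtain ⟨w, w₁, hw0, hw, hf, hper⟩ := hz
  have hT := h.profile.period_pos
  set γ := Complex.exp (Complex.I * k * T) with hγ
  have hγ1 : ‖γ‖ = 1 := by
    have : Complex.I * k * T = ((k * T : ℝ) : ℂ) * Complex.I := by push_cast; ring
    rw [hγ, this, Complex.norm_exp_ofReal_mul_I]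
  let w₂ : ℝ → Fin n → ℂ := fun x => cplx (coeffB B ubar x)⁻¹ *ᵥ (z • w x +
      cplx (matDeriv (coeffA f B ubar) x) *ᵥ w x +
        cplx (coeffA f B ubar x - matDeriv (coeffB B ubar) x) *ᵥ w₁ x)
  have hw₁ : ∀ x, HasDerivAt w₁ (w₂ x) x := fun x => h.hasDerivAt_of_linFlux (hw x) (hf x)
  have cw : Continuous w := continuous_iff_continuousAt.2 fun x => (hw x).continuousAt
  have cw₁ : Continuous w₁ := continuous_iff_continuousAt.2 fun x => (hw₁ x).continuousAt
  have cf : Continuous (linFlux f B ubar w w₁) :=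
    continuous_iff_continuousAt.2 fun x => (hf x).continuousAt
  have cw₂ : Continuous w₂ := continuous_cplx_mulVec h.continuous_coeffB_inv
    (((cw.const_smul z).add (continuous_cplx_mulVec h.continuous_matDeriv_coeffA cw)).add
      (continuous_cplx_mulVec (fun i j => (h.continuous_coeffA i j).sub
        (h.continuous_matDeriv_coeffB i j)) cw₁))
  have hw₁per : ∀ x, w₁ (x + T) = γ • w₁ x := fun x => (h.bloch_flux hw hper x).1
  have hfper : ∀ x, linFlux f B ubar w w₁ (x + T) = γ • linFlux f B ubar w w₁ x :=
    fun x => (h.bloch_flux hw hper x).2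
  rintro ⟨⟨C, hC⟩, -⟩
  by_cases hptop : p = ⊤
  -- For bounded functions the Bloch wave is itself in the domain and is annihilated by `z - L`,
  -- against the resolvent bound.
  · subst hptop
    have hw₂per : ∀ x, w₂ (x + T) = γ • w₂ x := fun x => by
      have e1 : HasDerivAt (fun x => w₁ (x + T)) (w₂ (x + T)) x := (hw₁ (x + T)).comp_add_const x T
      rw [funext hw₁per] at e1
      exact e1.unique ((hw₁ x).const_smul γ)
    have bdd : ∀ {v : ℝ → Fin n → ℂ}, Continuous v → (∀ x, v (x + T) = γ • v x) →
        MemLp v (⊤ : ℝ≥0∞) volume := fun hv hvp => by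
      obtain ⟨M, hM⟩ := exists_bound_of_quasiperiodic hT hv hγ1 hvp
      exact memLp_top_of_bound hv.aestronglyMeasurable M (Eventually.of_forall hM)
    have hg := hC w (fun x => z • w x) ⟨bdd cw hper, (bdd cw hper).const_smul z, w₁, w₂,
      bdd cw₁ hw₁per, bdd cw₂ hw₂per, hw,
      fun x y => (intervalIntegral.integral_eq_sub_of_hasDerivAt (fun t _ => hw₁ t)
        (cw₂.intervalIntegrable _ _)).symm,
      fun x y => (intervalIntegral.integral_eq_sub_of_hasDerivAt (fun t _ => hf t)
        ((cw.const_smul z).intervalIntegrable _ _)).symm⟩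
    simp only [sub_self, eLpNorm_zero', mul_zero, nonpos_iff_eq_zero] at hg
    rw [eLpNorm_eq_zero_iff cw.aestronglyMeasurable (by simp)] at hg
    exact hw0 ((Continuous.ae_eq_iff_eq volume cw continuous_const).1 hg)
  · -- a lower bound for `w` on a neighbourhood of the points `x₀ + j T`
    obtain ⟨x₀, hx₀⟩ := Function.ne_iff.1 hw0
    have hx₀' : 0 < ‖w x₀‖ := norm_pos_iff.2 hx₀
    set c := ‖w x₀‖ / 2 with hc
    have hcpos : 0 < c := by positivity
    obtain ⟨η₀, hη₀, hball⟩ := Metric.eventually_nhds_iff.1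
      ((cw.norm.continuousAt (x := x₀)).eventually (lt_mem_nhds (show c < ‖w x₀‖ by linarith)))
    set η := min η₀ (T / 4) with hη
    have hηpos : 0 < η := lt_min hη₀ (by positivity)
    have hηT : 2 * η < T := by have := min_le_right η₀ (T / 4); linarith
    have hnorm : ∀ (j : ℕ) x, ‖w (x + j * T)‖ = ‖w x‖ := by
      intro j x
      induction j with
      | zero => simp
      | succ j ih =>
        have : x + ((j + 1 : ℕ) : ℝ) * T = x + j * T + T := by push_cast; ring
        rw [this, hper, norm_smul, hγ1, one_mul, ih]
    have hlow : ∀ (j : ℕ), ∀ x ∈ Set.Ioo (x₀ + j * T - η) (x₀ + j * T + η), c ≤ ‖w x‖ := by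
      intro j x hx
      have h1 : ‖w x‖ = ‖w (x - j * T)‖ := by
        rw [← hnorm j (x - j * T), sub_add_cancel]
      rw [h1]
      refine (hball ?_).le
      rw [Real.dist_eq, abs_lt]
      have := min_le_left η₀ (T / 4)
      constructor <;> linarith [hx.1, hx.2]
    -- cut-offs
    obtain ⟨χ, χ₁, χ₂, hχ, hχ₁, cχ₂, hone, hzero, Mχ, hMχ⟩ := exists_cutoff
    have cχ : Continuous χ := continuous_iff_continuousAt.2 fun x => (hχ x).continuousAt
    have cχ₁ : Continuous χ₁ := continuous_iff_continuousAt.2 fun x => (hχ₁ x).continuousAt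
    let Bw : ℝ → Fin n → ℂ := fun x => cplx (coeffB B ubar x) *ᵥ w x
    let Bw' : ℝ → Fin n → ℂ := fun x => cplx (matDeriv (coeffB B ubar) x) *ᵥ w x +
      cplx (coeffB B ubar x) *ᵥ w₁ x
    have hBw : ∀ x, HasDerivAt Bw (Bw' x) x := fun x =>
      hasDerivAt_cplx_mulVec (h.hasDerivAt_coeffB x) (hw x)
    have cBw : Continuous Bw := continuous_iff_continuousAt.2 fun x => (hBw x).continuousAt
    have cBw' : Continuous Bw' :=
      (continuous_cplx_mulVec h.continuous_matDeriv_coeffB cw).add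
        (continuous_cplx_mulVec h.continuous_coeffB cw₁)
    have hBwper : ∀ x, Bw (x + T) = γ • Bw x := fun x => by
      simp only [Bw, hper, h.periodic_coeffB, Matrix.mulVec_smul]
    have hBw'per : ∀ x, Bw' (x + T) = γ • Bw' x := fun x => by
      have e1 : HasDerivAt (fun x => Bw (x + T)) (Bw' (x + T)) x := (hBw (x + T)).comp_add_const x T
      rw [funext hBwper] at e1
      exact e1.unique ((hBw x).const_smul γ)
    obtain ⟨M₁, hM₁⟩ := exists_bound_of_quasiperiodic hT
      (v := fun x => linFlux f B ubar w w₁ x + Bw' x) (cf.add cBw') hγ1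
      fun x => by simp only [hfper, hBw'per, smul_add]
    obtain ⟨M₂, hM₂⟩ := exists_bound_of_quasiperiodic hT cBw hγ1 hBwper
    set M := Mχ * M₁ + Mχ * M₂ with hM
    have hMχ0 : 0 ≤ Mχ := (abs_nonneg _).trans (hMχ 0).1
    have hM₁0 : 0 ≤ M₁ := (norm_nonneg _).trans (hM₁ 0)
    have hM₂0 : 0 ≤ M₂ := (norm_nonneg _).trans (hM₂ 0)
    have hM0 : 0 ≤ M := by positivity
    -- Applied to the wave cut off at scale `R`, `z - L` leaves only commutator terms, which contain
    -- a derivative of the cut-off: they are at most `M / R` in size and vanish outside `|x| ≤ 2R`.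
    have main : ∀ R : ℝ, 1 ≤ R → eLpNorm (fun x => χ (x / R) • w x) p volume ≤
        C * (ENNReal.ofReal (M / R) * ENNReal.ofReal (2 * (2 * R)) ^ (1 / p.toReal)) := by
      intro R hR
      have hR0 : 0 < R := by linarith
      have hdiv : ∀ x, HasDerivAt (fun x : ℝ => x / R) (1 / R) x := fun x =>
        (hasDerivAt_id x).div_const R
      let a : ℝ → ℝ := fun x => χ (x / R)
      let a₁ : ℝ → ℝ := fun x => χ₁ (x / R) * (1 / R)
      let a₂ : ℝ → ℝ := fun x => χ₂ (x / R) * (1 / R) * (1 / R)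
      have ha : ∀ x, HasDerivAt a (a₁ x) x := fun x => (hχ _).comp x (hdiv x)
      have ha₁ : ∀ x, HasDerivAt a₁ (a₂ x) x := fun x =>
        ((hχ₁ _).comp x (hdiv x)).mul_const _
      have ca : Continuous a := by fun_prop
      have ca₁ : Continuous a₁ := by fun_prop
      have ca₂ : Continuous a₂ := by fun_prop
      have hout : ∀ x, 2 * R < |x| → a x = 0 ∧ a₁ x = 0 ∧ a₂ x = 0 := by
        intro x hx
        have : 2 < |x / R| := by
          rw [abs_div, abs_of_pos hR0, lt_div_iff₀ hR0]; exact hx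
        obtain ⟨h1, h2, h3⟩ := hzero _ this
        simp [a, a₁, a₂, h1, h2, h3]
      have memLp : ∀ {v : ℝ → Fin n → ℂ}, Continuous v → (∀ x, 2 * R < |x| → v x = 0) →
          MemLp v p volume := by
        intro v hv hv0
        refine hv.memLp_of_hasCompactSupport (HasCompactSupport.intro
          (isCompact_closedBall (0 : ℝ) (2 * R)) fun x hx => hv0 x ?_)
        rw [Metric.mem_closedBall, Real.dist_eq, sub_zero] at hx
        exact not_le.1 hx
      let u : ℝ → Fin n → ℂ := fun x => a x • w x
      let u₁ : ℝ → Fin n → ℂ := fun x => a x • w₁ x + a₁ x • w x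
      let u₂ : ℝ → Fin n → ℂ := fun x => (a x • w₂ x + a₁ x • w₁ x) + (a₁ x • w₁ x + a₂ x • w x)
      let g : ℝ → Fin n → ℂ := fun x => (a x • z • w x + a₁ x • linFlux f B ubar w w₁ x) +
        (a₁ x • Bw' x + a₂ x • Bw x)
      have cu₂ : Continuous u₂ := by fun_prop
      have cg : Continuous g := by fun_prop
      have hu : ∀ x, HasDerivAt u (u₁ x) x := fun x => (ha x).smul (hw x)
      have hu₁ : ∀ x, HasDerivAt u₁ (u₂ x) x := fun x =>
        ((ha x).smul (hw₁ x)).add ((ha₁ x).smul (hw x))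
      have hug : ∀ x, HasDerivAt (linFlux f B ubar u u₁) (g x) x := fun x => by
        have e1 : linFlux f B ubar u u₁ = fun x => a x • linFlux f B ubar w w₁ x + a₁ x • Bw x :=
          funext fun x => linFlux_cutoff a a₁ w w₁ x
        rw [e1]
        exact ((ha x).smul (hf x)).add ((ha₁ x).smul (hBw x))
      have hgraph : LinGraph f B ubar p u g := by
        refine ⟨memLp (by fun_prop) fun x hx => ?_, memLp cg fun x hx => ?_, u₁, u₂,
          memLp (by fun_prop) fun x hx => ?_, memLp cu₂ fun x hx => ?_, hu,
          fun x y => (intervalIntegral.integral_eq_sub_of_hasDerivAt (fun t _ => hu₁ t)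
            (cu₂.intervalIntegrable _ _)).symm,
          fun x y => (intervalIntegral.integral_eq_sub_of_hasDerivAt (fun t _ => hug t)
            (cg.intervalIntegrable _ _)).symm⟩
        all_goals
          obtain ⟨h1, h2, h3⟩ := hout x hx
          simp [u, u₁, u₂, g, h1, h2, h3]
      refine (hC u g hgraph).trans (mul_le_mul_right ?_ _)
      have hdiff : ∀ x, z • u x - g x =
          -(a₁ x • (linFlux f B ubar w w₁ x + Bw' x) + a₂ x • Bw x) := fun x => by
        simp only [u, g, smul_add]
        rw [smul_comm z (a x) (w x)]
        abel
      refine eLpNorm_upper hp hptop (by positivity) (fun x => ?_) fun x hx => ?_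
      · rw [hdiff, norm_neg]
        refine (norm_add_le _ _).trans ?_
        rw [norm_smul, norm_smul, Real.norm_eq_abs, Real.norm_eq_abs]
        have h1 : |a₁ x| ≤ Mχ / R := by
          simp only [a₁]
          rw [abs_mul, abs_of_pos (show 0 < 1 / R by positivity), mul_one_div]
          gcongr; exact (hMχ _).1
        have h2 : |a₂ x| ≤ Mχ / R := by
          simp only [a₂]
          rw [abs_mul, abs_mul, abs_of_pos (show 0 < 1 / R by positivity), mul_one_div (|χ₂ (x / R)|)]
          have h3 : 1 / R ≤ 1 := by rw [div_le_one hR0]; exact hR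
          have h4 : |χ₂ (x / R)| / R ≤ Mχ / R := by gcongr; exact (hMχ _).2
          calc |χ₂ (x / R)| / R * (1 / R) ≤ Mχ / R * 1 := by
                gcongr
            _ = Mχ / R := mul_one _
        have h5 : M / R = Mχ / R * M₁ + Mχ / R * M₂ := by rw [hM]; ring
        rw [h5]
        gcongr
        · exact hM₁ x
        · exact hM₂ x
      · obtain ⟨h1, h2, h3⟩ := hout x hx
        rw [hdiff, h2, h3]; simp
    -- contradiction for large cut-offs
    set R₁ := |x₀| + 2 * T + 1 with hR₁
    have hR₁pos : 0 < R₁ := by positivity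
    set κ := 2 * R₁ / η with hκ
    have hκ1 : 1 ≤ κ := by
      rw [hκ, one_le_div hηpos]
      have := abs_nonneg x₀; linarith
    have hp0 : 0 < p.toReal := ENNReal.toReal_pos (by positivity) hptop
    have hp1 : 1 / p.toReal ≤ 1 := by
      rw [div_le_one hp0]
      simpa using ENNReal.toReal_mono hptop hp
    -- Both norms grow like `m^(1/p)`; after this factor is cancelled, the gain `1 / (R₁ m)` from
    -- the commutator contradicts the fixed lower bound `c`.
    have bound : ∀ m : ℕ, 1 ≤ m → c ≤ C * (M / (R₁ * m)) * κ := by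
      intro m hm
      have hm1 : (1 : ℝ) ≤ m := by exact_mod_cast hm
      have hR : 1 ≤ R₁ * m := by nlinarith [abs_nonneg x₀]
      have hmpos : (0 : ℝ) < m := by linarith
      have h1 := main (R₁ * m) hR
      have h2 := eLpNorm_lower (E := Fin n → ℂ) hp hptop (T := T) (x₀ := x₀) hηpos hηT hcpos.le m
        (u := fun x => χ (x / (R₁ * m)) • w x) (fun j hj x hx => by
          have hj1 : (j : ℝ) + 1 ≤ m := by exact_mod_cast hj
          have hj0 : (0 : ℝ) ≤ j := Nat.cast_nonneg j
          have hx' : |x| ≤ R₁ * m := by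
            rw [abs_le]
            have := neg_abs_le x₀
            have := le_abs_self x₀
            have := abs_nonneg x₀
            constructor <;> nlinarith [hx.1, hx.2]
          have : |x / (R₁ * m)| ≤ 1 := by
            rw [abs_div, abs_of_pos (by positivity : 0 < R₁ * m), div_le_one (by positivity)]
            exact hx'
          rw [hone _ this, one_smul]
          exact hlow j x hx)
      have h3 : (2 * (2 * (R₁ * m)) : ℝ) = (2 * η * m) * κ := by
        rw [hκ]; field_simp
      rw [h3, ENNReal.ofReal_mul (by positivity), ENNReal.mul_rpow_of_nonneg _ _ (by positivity)]
        at h1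
      have h4 : ENNReal.ofReal κ ^ (1 / p.toReal) ≤ ENNReal.ofReal κ := by
        conv_rhs => rw [← ENNReal.rpow_one (ENNReal.ofReal κ)]
        exact ENNReal.rpow_le_rpow_of_exponent_le (ENNReal.one_le_ofReal.2 hκ1) hp1
      set q := ENNReal.ofReal (2 * η * m) ^ (1 / p.toReal) with hq
      have hq0 : q ≠ 0 := by
        rw [hq]
        exact (ENNReal.rpow_pos (ENNReal.ofReal_pos.2 (by positivity)) ENNReal.ofReal_ne_top).ne'
      have hqt : q ≠ ⊤ := ENNReal.rpow_ne_top_of_nonneg (by positivity) ENNReal.ofReal_ne_top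
      have h5 : ENNReal.ofReal c * q ≤
          (C * ENNReal.ofReal (M / (R₁ * m)) * ENNReal.ofReal κ) * q := by
        refine (h2.trans h1).trans ?_
        calc C * (ENNReal.ofReal (M / (R₁ * m)) * (q * ENNReal.ofReal κ ^ (1 / p.toReal)))
            ≤ C * (ENNReal.ofReal (M / (R₁ * m)) * (q * ENNReal.ofReal κ)) := by gcongr
          _ = _ := by ring
      have h6 := (ENNReal.mul_le_mul_iff_left hq0 hqt).1 h5
      rw [← ENNReal.ofReal_coe_nnreal, ← ENNReal.ofReal_mul (by positivity),
        ← ENNReal.ofReal_mul (by positivity)] at h6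
      exact (ENNReal.ofReal_le_ofReal_iff (by positivity)).1 h6
    have hlim : Tendsto (fun m : ℕ => (C : ℝ) * (M / (R₁ * m)) * κ) atTop (𝓝 0) := by
      have h1 : Tendsto (fun m : ℕ => R₁ * (m : ℝ)) atTop atTop :=
        tendsto_natCast_atTop_atTop.const_mul_atTop hR₁pos
      have := ((h1.const_div_atTop M).const_mul (C : ℝ)).mul_const κ
      simpa using this
    exact absurd (ge_of_tendsto hlim (eventually_atTop.2 ⟨1, bound⟩)) (not_le.2 hcpos)

end Admissible

end

/-! ### Lyapunov's theorem for a single matrix -/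

section

section Lyapunov

variable {n : ℕ}

/-- Gelfand's formula turns a spectral radius below `1` into geometric decay of the powers in the
operator norm for row sums, which dominates every entry. -/
lemma exists_pow_entries_lt [Nonempty (Fin n)] {C : Matrix (Fin n) (Fin n) ℂ}
    (hC : ∀ μ ∈ spectrum ℂ C, ‖μ‖ < 1) {ε : ℝ} (hε : 0 < ε) :
    ∃ M : ℕ, ∀ i j, ‖(C ^ (M + 1)) i j‖ < ε := by
  let _ : NormedRing (Matrix (Fin n) (Fin n) ℂ) := Matrix.linftyOpNormedRing
  let _ : NormedAlgebra ℂ (Matrix (Fin n) (Fin n) ℂ) := Matrix.linftyOpNormedAlgebra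
  have : CompleteSpace (Matrix (Fin n) (Fin n) ℂ) := FiniteDimensional.complete ℂ _
  have h1 : spectralRadius ℂ C < ((1 : ℝ≥0) : ℝ≥0∞) :=
    spectrum.spectralRadius_lt_of_forall_lt C fun k hk => by
      rw [← NNReal.coe_lt_coe]; exact hC k hk
  obtain ⟨r, hr1, hr2⟩ := ENNReal.lt_iff_exists_nnreal_btwn.1 h1
  have h2 := (spectrum.pow_nnnorm_pow_one_div_tendsto_nhds_spectralRadius C).eventually
    (gt_mem_nhds hr1)
  have hr : r < 1 := by exact_mod_cast hr2
  have h3 : ∀ᶠ m : ℕ in atTop, r ^ m < ε.toNNReal :=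
    (NNReal.tendsto_pow_atTop_nhds_zero_of_lt_one hr).eventually
      (gt_mem_nhds (Real.toNNReal_pos.2 hε))
  obtain ⟨m, h2, h3, hm⟩ := (h2.and (h3.and (eventually_gt_atTop 0))).exists
  have hm' : (m : ℝ) ≠ 0 := Nat.cast_ne_zero.2 hm.ne'
  have h4 : (‖C ^ m‖₊ : ℝ≥0∞) < (r : ℝ≥0∞) ^ m := by
    have := ENNReal.rpow_lt_rpow h2 (show (0 : ℝ) < m by positivity)
    rwa [← ENNReal.rpow_mul, one_div, inv_mul_cancel₀ hm', ENNReal.rpow_one,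
      ENNReal.rpow_natCast] at this
  have h5 : ‖C ^ m‖₊ < ε.toNNReal := by
    refine lt_trans ?_ h3
    exact_mod_cast h4
  refine ⟨m - 1, fun i j => ?_⟩
  rw [Nat.sub_add_cancel hm]
  have h6 : ‖(C ^ m) i j‖₊ ≤ ‖C ^ m‖₊ := by
    rw [Matrix.linfty_opNNNorm_def]
    refine le_trans ?_ (Finset.le_sup (f := fun i => ∑ j, ‖(C ^ m) i j‖₊) (Finset.mem_univ i))
    exact Finset.single_le_sum (f := fun j => ‖(C ^ m) i j‖₊) (fun _ _ => zero_le) (Finset.mem_univ j)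
  have h7 := h6.trans_lt h5
  rw [← NNReal.coe_lt_coe, Real.coe_toNNReal _ hε.le] at h7
  exact h7

lemma dotProduct_self_pos {x : Fin n → ℝ} (hx : x ≠ 0) : 0 < x ⬝ᵥ x :=
  (Finset.sum_nonneg fun i _ => mul_self_nonneg (x i)).lt_of_ne' (dotProduct_self_ne_zero hx)

/-- By Cauchy–Schwarz in each row, the Euclidean operator norm is at most `n / (n + 1)`. -/
lemma sum_sq_mulVec_lt {P : Matrix (Fin n) (Fin n) ℝ}
    (hP : ∀ i j, |P i j| < 1 / (n + 1)) {x : Fin n → ℝ} (hx : x ≠ 0) :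
    (P *ᵥ x) ⬝ᵥ (P *ᵥ x) < x ⬝ᵥ x := by
  have hxpos : 0 < x ⬝ᵥ x := dotProduct_self_pos hx
  have h1 : ∀ i, (P *ᵥ x) i * (P *ᵥ x) i ≤ (n : ℝ) * (1 / ((n : ℝ) + 1)) ^ 2 * (x ⬝ᵥ x) := by
    intro i
    have h2 := Finset.sum_mul_sq_le_sq_mul_sq Finset.univ (fun j => P i j) x
    have h3 : ∑ j, P i j ^ 2 ≤ (n : ℝ) * (1 / ((n : ℝ) + 1)) ^ 2 := by
      refine (Finset.sum_le_card_nsmul _ _ ((1 / ((n : ℝ) + 1)) ^ 2) fun j _ => ?_).trans (by simp)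
      rw [← sq_abs]
      exact pow_le_pow_left₀ (abs_nonneg _) (hP i j).le 2
    have h4 : ∑ j, x j ^ 2 = x ⬝ᵥ x := by simp [dotProduct, sq]
    rw [h4] at h2
    calc (P *ᵥ x) i * (P *ᵥ x) i = (∑ j, P i j * x j) ^ 2 := by
          simp [Matrix.mulVec, dotProduct, sq]
      _ ≤ _ := h2
      _ ≤ _ := by gcongr
  calc (P *ᵥ x) ⬝ᵥ (P *ᵥ x) ≤ ∑ _i : Fin n, (n : ℝ) * (1 / ((n : ℝ) + 1)) ^ 2 * (x ⬝ᵥ x) :=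
        Finset.sum_le_sum fun i _ => h1 i
    _ = ((n : ℝ) / (n + 1)) ^ 2 * (x ⬝ᵥ x) := by
        rw [Finset.sum_const, Finset.card_univ, Fintype.card_fin, nsmul_eq_mul]; ring
    _ < 1 * (x ⬝ᵥ x) := by
        refine mul_lt_mul_of_pos_right ?_ hxpos
        have : (n : ℝ) / (n + 1) < 1 := by rw [div_lt_one (by positivity)]; linarith
        have h0 : 0 ≤ (n : ℝ) / (n + 1) := by positivity
        nlinarith
    _ = x ⬝ᵥ x := one_mul _

/-- Lyapunov's theorem: a matrix with spectrum in the right half-plane is accretive with respect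
to a suitable inner product. -/
theorem exists_lyapunov {B : Matrix (Fin n) (Fin n) ℝ}
    (hB : ∀ μ ∈ spectrum ℂ (cplx B), 0 < μ.re) :
    ∃ S : Matrix (Fin n) (Fin n) ℝ, (∀ x, x ≠ 0 → 0 < x ⬝ᵥ S *ᵥ x) ∧
      ∀ x, x ≠ 0 → 0 < x ⬝ᵥ S *ᵥ B *ᵥ x := by
  rcases isEmpty_or_nonempty (Fin n) with hn | hn
  · exact ⟨1, fun x hx => absurd (Subsingleton.elim x 0) hx,
      fun x hx => absurd (Subsingleton.elim x 0) hx⟩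
  -- Since `|1 - tμ|² = 1 - 2t Re μ + t²|μ|²`, for small `t > 0` the matrix `C = 1 - tB` has its
  -- spectrum inside the unit disc, so high powers of `C` are small.
  have hsmall : ∀ᶠ t : ℝ in 𝓝[>] 0, ∀ μ ∈ spectrum ℂ (cplx B), ‖1 - (t : ℂ) * μ‖ < 1 := by
    refine (Matrix.finite_spectrum (cplx B)).eventually_all.2 fun μ hμ => ?_
    have h1 : ∀ᶠ t : ℝ in 𝓝[>] 0, t * Complex.normSq μ < 2 * μ.re := by
      have : Tendsto (fun t : ℝ => t * Complex.normSq μ) (𝓝[>] 0) (𝓝 0) := by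
        have : Continuous fun t : ℝ => t * Complex.normSq μ := by fun_prop
        simpa using (this.tendsto 0).mono_left nhdsWithin_le_nhds
      exact this.eventually (gt_mem_nhds (by linarith [hB μ hμ]))
    filter_upwards [h1, self_mem_nhdsWithin] with t ht ht0
    have ht0 : 0 < t := ht0
    rw [← sq_lt_one_iff₀ (norm_nonneg _), ← Complex.normSq_eq_norm_sq, Complex.normSq_apply]
    simp only [Complex.sub_re, Complex.one_re, Complex.mul_re, Complex.ofReal_re, Complex.ofReal_im,
      zero_mul, sub_zero, Complex.sub_im, Complex.one_im, Complex.mul_im, add_zero, zero_sub]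
    rw [Complex.normSq_apply] at ht
    nlinarith
  obtain ⟨t, ht, ht0⟩ := (hsmall.and self_mem_nhdsWithin).exists
  have ht0 : 0 < t := ht0
  have ht0' : (t : ℂ) ≠ 0 := by exact_mod_cast ht0.ne'
  set C : Matrix (Fin n) (Fin n) ℝ := 1 - t • B with hC
  have hCc : cplx C = 1 - (t : ℂ) • cplx B := by
    rw [hC, cplx_sub, cplx_one]
    congr 1
    ext i j; simp [cplx]
  have hspec : ∀ μ ∈ spectrum ℂ (cplx C), ‖μ‖ < 1 := by
    intro k hk
    have h1 : (1 - k) / t ∈ spectrum ℂ (cplx B) := by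
      rw [spectrum.mem_iff] at hk ⊢
      contrapose! hk
      have : algebraMap ℂ (Matrix (Fin n) (Fin n) ℂ) k - cplx C =
          (-(t : ℂ)) • (algebraMap ℂ (Matrix (Fin n) (Fin n) ℂ) ((1 - k) / t) - cplx B) := by
        rw [hCc, Algebra.algebraMap_eq_smul_one, Algebra.algebraMap_eq_smul_one, smul_sub, smul_smul,
          neg_mul, mul_div_cancel₀ _ ht0', neg_smul, neg_smul, sub_smul, one_smul]
        abel
      rw [this]
      exact (isUnit_smul_iff (Units.mk0 (-(t : ℂ)) (neg_ne_zero.2 ht0')) _).2 hk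
    have h2 := ht _ h1
    rwa [mul_div_cancel₀ _ ht0', sub_sub_cancel] at h2
  obtain ⟨M, hM⟩ := exists_pow_entries_lt hspec (show (0 : ℝ) < 1 / (n + 1) by positivity)
  have hpow : ∀ m, cplx C ^ m = cplx (C ^ m) := fun m => by
    induction m with
    | zero => rw [pow_zero, pow_zero, cplx_one]
    | succ m ih => rw [pow_succ, ih, pow_succ, cplx_mul]
  have hM' : ∀ i j, |(C ^ (M + 1)) i j| < 1 / (n + 1) := fun i j => by
    have := hM i j
    rwa [hpow, cplx, Matrix.map_apply, Complex.norm_real, Real.norm_eq_abs] at this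
  -- the inner product `∑_{m ≤ M} (C ^ m x) ⬝ (C ^ m y)`
  let S : Matrix (Fin n) (Fin n) ℝ := ∑ m ∈ Finset.range (M + 1), (C ^ m)ᵀ * C ^ m
  have hS : ∀ x y, x ⬝ᵥ S *ᵥ y = ∑ m ∈ Finset.range (M + 1), (C ^ m *ᵥ x) ⬝ᵥ (C ^ m *ᵥ y) := by
    intro x y
    simp only [S]
    rw [Matrix.sum_mulVec, dotProduct_sum]
    refine Finset.sum_congr rfl fun m _ => ?_
    rw [← Matrix.mulVec_mulVec, Matrix.dotProduct_mulVec, Matrix.vecMul_transpose]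
  have hSpos : ∀ x, x ≠ 0 → 0 < x ⬝ᵥ S *ᵥ x := fun x hx => by
    rw [hS, Finset.sum_range_succ']
    have h1 : 0 < x ⬝ᵥ x := dotProduct_self_pos hx
    have h2 : 0 ≤ ∑ m ∈ Finset.range M, (C ^ (m + 1) *ᵥ x) ⬝ᵥ (C ^ (m + 1) *ᵥ x) :=
      Finset.sum_nonneg fun m _ => Finset.sum_nonneg fun i _ => mul_self_nonneg _
    simp only [pow_zero, Matrix.one_mulVec]
    linarith
  refine ⟨S, hSpos, fun x hx => ?_⟩
  let a : ℕ → Fin n → ℝ := fun m => C ^ m *ᵥ x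
  have h1 : t * (x ⬝ᵥ S *ᵥ B *ᵥ x) = x ⬝ᵥ S *ᵥ x - x ⬝ᵥ S *ᵥ C *ᵥ x := by
    rw [hC, Matrix.sub_mulVec, Matrix.one_mulVec, Matrix.mulVec_sub, Matrix.smul_mulVec,
      Matrix.mulVec_smul, dotProduct_sub, dotProduct_smul, smul_eq_mul]
    ring
  have h2 : ∀ m, C ^ m *ᵥ C *ᵥ x = a (m + 1) := fun m => by
    rw [Matrix.mulVec_mulVec, ← pow_succ]
  have h3 : x ⬝ᵥ S *ᵥ x - x ⬝ᵥ S *ᵥ C *ᵥ x =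
      ∑ m ∈ Finset.range (M + 1), (a m ⬝ᵥ a m - a m ⬝ᵥ a (m + 1)) := by
    rw [hS, hS, ← Finset.sum_sub_distrib]
    simp only [h2]; rfl
  have h4 : ∀ u v : Fin n → ℝ, (u ⬝ᵥ u - v ⬝ᵥ v) / 2 ≤ u ⬝ᵥ u - u ⬝ᵥ v := fun u v => by
    have h5 : 0 ≤ (u - v) ⬝ᵥ (u - v) := Finset.sum_nonneg fun i _ => mul_self_nonneg _
    rw [sub_dotProduct, dotProduct_sub, dotProduct_sub, dotProduct_comm v u] at h5
    linarith
  -- With `a m = C ^ m x`, the form `t ⟨x, B x⟩` is the sum of `a m ⬝ (a m - a (m + 1))`. Each term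
  -- is at least half of `|a m|² - |a (m + 1)|²`, so the sum telescopes to a quantity that is
  -- positive once `|a (M + 1)| < |x|`.
  have h6 : (a 0 ⬝ᵥ a 0 - a (M + 1) ⬝ᵥ a (M + 1)) / 2 ≤
      ∑ m ∈ Finset.range (M + 1), (a m ⬝ᵥ a m - a m ⬝ᵥ a (m + 1)) := by
    rw [← Finset.sum_range_sub' (fun m => a m ⬝ᵥ a m), Finset.sum_div]
    exact Finset.sum_le_sum fun m _ => h4 _ _
  have h7 : a (M + 1) ⬝ᵥ a (M + 1) < x ⬝ᵥ x := sum_sq_mulVec_lt hM' hx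
  have h8 : a 0 = x := by simp [a]
  rw [h8] at h6
  refine pos_of_mul_pos_right ?_ ht0.le
  rw [h1, h3]
  linarith

end Lyapunov

end

/-! ### The energy estimate: the Evans function at zero exponent is not identically zero -/

section

section

variable {n : ℕ} {X : Type*}

lemma continuous_dotProduct_mulVec [TopologicalSpace X] {M : X → Matrix (Fin n) (Fin n) ℝ}
    {u v : X → Fin n → ℝ} (hM : ∀ i j, Continuous fun x => M x i j) (hu : Continuous u)
    (hv : Continuous v) : Continuous fun x => u x ⬝ᵥ M x *ᵥ v x := by
  simp only [dotProduct, Matrix.mulVec]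
  fun_prop

lemma exists_unit_smul {x : Fin n → ℝ} (hx : x ≠ 0) :
    ∃ y ∈ Metric.sphere (0 : Fin n → ℝ) 1, x = ‖x‖ • y := by
  have h0 : ‖x‖ ≠ 0 := norm_ne_zero_iff.2 hx
  refine ⟨‖x‖⁻¹ • x, ?_, ?_⟩
  · rw [mem_sphere_zero_iff_norm, norm_smul, norm_inv, norm_norm, inv_mul_cancel₀ h0]
  · rw [smul_smul, mul_inv_cancel₀ h0, one_smul]

lemma quadForm_smul (M : Matrix (Fin n) (Fin n) ℝ) (c : ℝ) (y : Fin n → ℝ) :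
    (c • y) ⬝ᵥ M *ᵥ (c • y) = c ^ 2 * (y ⬝ᵥ M *ᵥ y) := by
  rw [Matrix.mulVec_smul, dotProduct_smul, smul_dotProduct, smul_eq_mul, smul_eq_mul]; ring

/-- A positive definite matrix function is uniformly so over a compact set. -/
lemma exists_coercive [TopologicalSpace X] {K : Set X} (hK : IsCompact K)
    {M : X → Matrix (Fin n) (Fin n) ℝ} (hM : ∀ i j, Continuous fun x => M x i j)
    (hpos : ∀ x ∈ K, ∀ y, y ≠ 0 → 0 < y ⬝ᵥ M x *ᵥ y) :
    ∃ c > 0, ∀ x ∈ K, ∀ y, c * ‖y‖ ^ 2 ≤ y ⬝ᵥ M x *ᵥ y := by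
  have hcont : Continuous fun q : X × (Fin n → ℝ) => q.2 ⬝ᵥ M q.1 *ᵥ q.2 :=
    continuous_dotProduct_mulVec (fun i j => (hM i j).comp continuous_fst) continuous_snd
      continuous_snd
  have hcomp := hK.prod (isCompact_sphere (0 : Fin n → ℝ) 1)
  obtain ⟨c, hc, hmin⟩ : ∃ c > 0, ∀ q ∈ K ×ˢ Metric.sphere (0 : Fin n → ℝ) 1,
      c ≤ q.2 ⬝ᵥ M q.1 *ᵥ q.2 := by
    rcases (K ×ˢ Metric.sphere (0 : Fin n → ℝ) 1).eq_empty_or_nonempty with he | hne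
    · exact ⟨1, one_pos, fun q hq => by rw [he] at hq; exact hq.elim⟩
    · obtain ⟨q, hq, hmin⟩ := hcomp.exists_isMinOn hne hcont.continuousOn
      refine ⟨_, hpos q.1 hq.1 q.2 ?_, hmin⟩
      rintro h0
      have := mem_sphere_zero_iff_norm.1 hq.2
      rw [h0, norm_zero] at this
      exact zero_ne_one this
  refine ⟨c, hc, fun x hx y => ?_⟩
  rcases eq_or_ne y 0 with rfl | hy
  · simp
  · obtain ⟨z, hz, hyz⟩ := exists_unit_smul hy
    have h1 := hmin (x, z) ⟨hx, hz⟩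
    conv_rhs => rw [hyz, quadForm_smul]
    rw [mul_comm]
    exact mul_le_mul_of_nonneg_left h1 (sq_nonneg _)

lemma exists_bilin_bound [TopologicalSpace X] {K : Set X} (hK : IsCompact K)
    {M : X → Matrix (Fin n) (Fin n) ℝ} (hM : ∀ i j, Continuous fun x => M x i j) :
    ∃ C, 0 ≤ C ∧ ∀ x ∈ K, ∀ y z, |y ⬝ᵥ M x *ᵥ z| ≤ C * (‖y‖ * ‖z‖) := by
  obtain ⟨C, hC⟩ := hK.exists_bound_of_continuousOn (f := fun x => ∑ i, ∑ j, |M x i j|)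
    (by fun_prop)
  refine ⟨max C 0, le_max_right _ _, fun x hx y z => ?_⟩
  have h1 : |y ⬝ᵥ M x *ᵥ z| ≤ ∑ i, ∑ j, |M x i j| * (‖y‖ * ‖z‖) := by
    refine (Finset.abs_sum_le_sum_abs _ _).trans (Finset.sum_le_sum fun i _ => ?_)
    rw [Matrix.mulVec, dotProduct, Finset.mul_sum]
    refine (Finset.abs_sum_le_sum_abs _ _).trans (Finset.sum_le_sum fun j _ => ?_)
    rw [abs_mul, abs_mul]
    have := norm_le_pi_norm y i
    have := norm_le_pi_norm z j
    rw [Real.norm_eq_abs] at *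
    calc |y i| * (|M x i j| * |z j|) = |M x i j| * (|y i| * |z j|) := by ring
      _ ≤ _ := by gcongr
  refine h1.trans ?_
  simp_rw [← Finset.sum_mul]
  gcongr
  exact (le_abs_self _).trans ((hC x hx).trans (le_max_left _ _))

/-- The two positivity conditions on `S` are convex, and a constant `S` that works at `u` works
nearby by compactness of the unit sphere; a partition of unity glues these constants into a `C¹`
family. Off `K` the conditions are void. -/
lemma exists_smooth_lyapunov {B : (Fin n → ℝ) → Matrix (Fin n) (Fin n) ℝ}
    (hB : ∀ i j, Continuous fun u => B u i j) {K : Set (Fin n → ℝ)} (hK : IsCompact K)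
    (hspec : ∀ u ∈ K, ∀ μ ∈ spectrum ℂ (cplx (B u)), 0 < μ.re) :
    ∃ S : (Fin n → ℝ) → Matrix (Fin n) (Fin n) ℝ, (∀ i j, ContDiff ℝ 1 fun u => S u i j) ∧
      ∀ u ∈ K, (∀ x, x ≠ 0 → 0 < x ⬝ᵥ S u *ᵥ x) ∧ ∀ x, x ≠ 0 → 0 < x ⬝ᵥ (S u * B u) *ᵥ x := by
  let t : (Fin n → ℝ) → Set (Fin n → Fin n → ℝ) := fun u => {P | u ∈ K →
    (∀ x, x ≠ 0 → 0 < x ⬝ᵥ Matrix.of P *ᵥ x) ∧ ∀ x, x ≠ 0 → 0 < x ⬝ᵥ (Matrix.of P * B u) *ᵥ x}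
  have ht : ∀ u, Convex ℝ (t u) := by
    intro u P hP Q hQ a b ha hb hab hu
    have key : ∀ (f : Matrix (Fin n) (Fin n) ℝ →ₗ[ℝ] ℝ), 0 < f (Matrix.of P) →
        0 < f (Matrix.of Q) → 0 < f (Matrix.of (a • P + b • Q)) := by
      intro f h1 h2
      have e : Matrix.of (a • P + b • Q) = a • Matrix.of P + b • Matrix.of Q := rfl
      rw [e, map_add, map_smul, map_smul, smul_eq_mul, smul_eq_mul]
      rcases ha.eq_or_lt with rfl | ha
      · have : b = 1 := by linarith
        rw [this]; linarith
      · have := mul_pos ha h1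
        have := mul_nonneg hb h2.le
        linarith
    refine ⟨fun x hx => ?_, fun x hx => ?_⟩
    · exact key { toFun := fun M => x ⬝ᵥ M *ᵥ x
                  map_add' := fun M N => by rw [Matrix.add_mulVec, dotProduct_add]
                  map_smul' := fun c M => by
                    rw [Matrix.smul_mulVec, dotProduct_smul]; rfl } ((hP hu).1 x hx) ((hQ hu).1 x hx)
    · exact key { toFun := fun M => x ⬝ᵥ (M * B u) *ᵥ x
                  map_add' := fun M N => by rw [add_mul, Matrix.add_mulVec, dotProduct_add]
                  map_smul' := fun c M => by
                    rw [smul_mul_assoc, Matrix.smul_mulVec, dotProduct_smul]; rfl }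
        ((hP hu).2 x hx) ((hQ hu).2 x hx)
  have hloc : ∀ u, ∃ c : Fin n → Fin n → ℝ, ∀ᶠ y in 𝓝 u, c ∈ t y := by
    intro u
    by_cases hu : u ∈ K
    · obtain ⟨S, h1, h2⟩ := exists_lyapunov (hspec u hu)
      have hcont : Continuous fun q : (Fin n → ℝ) × (Fin n → ℝ) => q.2 ⬝ᵥ (S * B q.1) *ᵥ q.2 := by
        refine continuous_dotProduct_mulVec (fun i j => ?_) continuous_snd continuous_snd
        simp only [Matrix.mul_apply]
        exact continuous_finsetSum _ fun k _ =>
          continuous_const.mul ((hB k j).comp continuous_fst)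
      have h3 : ∀ᶠ v in 𝓝 u, ∀ y ∈ Metric.sphere (0 : Fin n → ℝ) 1, 0 < y ⬝ᵥ (S * B v) *ᵥ y := by
        refine (isCompact_sphere (0 : Fin n → ℝ) 1).eventually_forall_of_forall_eventually
          fun y hy => ?_
        refine (hcont.tendsto (u, y)).eventually (lt_mem_nhds ?_)
        rw [← Matrix.mulVec_mulVec]
        refine h2 y fun h0 => ?_
        rw [mem_sphere_zero_iff_norm, h0, norm_zero] at hy
        exact zero_ne_one hy
      refine ⟨S, h3.mono fun v hv _ => ⟨h1, fun x hx => ?_⟩⟩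
      obtain ⟨z, hz, hxz⟩ := exists_unit_smul hx
      rw [hxz, quadForm_smul]
      exact mul_pos (pow_pos (norm_pos_iff.2 hx) 2) (hv z hz)
    · exact ⟨0, (hK.isClosed.isOpen_compl.eventually_mem hu).mono fun v hv hv' => absurd hv' hv⟩
  obtain ⟨g, hg⟩ := exists_contMDiffMap_forall_mem_convex_of_local_const (n := 1)
    (modelWithCornersSelf ℝ (Fin n → ℝ)) ht hloc
  have hgs : ContDiff ℝ 1 g := g.contMDiff.contDiff
  exact ⟨fun u => Matrix.of (g u), fun i j => contDiff_pi.1 (contDiff_pi.1 hgs i) j,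
    fun u hu => hg u hu⟩

end

variable {n : ℕ} {f : (Fin n → ℝ) → (Fin n → ℝ)} {B : (Fin n → ℝ) → Matrix (Fin n) (Fin n) ℝ}
  {T : ℝ} {um : Fin n → ℝ} {ubar : ℝ → Fin n → ℝ}

namespace Admissible

variable (h : Admissible f B T um ubar)
include h

lemma isCompact_orbit : IsCompact (Set.range ubar) :=
  Function.Periodic.compact_of_continuous (fun x => h.profile.periodic x)
    h.profile.period_pos.ne' h.continuous_ubar

/-- For large real spectral parameter the eigenvalue equation has no periodic solution. -/
lemma exists_real_uniqueness : ∃ lam : ℝ, ∀ w w₁ z : ℝ → Fin n → ℝ,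
    (∀ x, HasDerivAt w (w₁ x) x) →
    (∀ x, z x = coeffB B ubar x *ᵥ w₁ x - coeffA f B ubar x *ᵥ w x) →
    (∀ x, HasDerivAt z (lam • w x) x) → (∀ x, w (x + T) = w x) → (∀ x, z (x + T) = z x) →
    ∀ x, w x = 0 := by
  obtain ⟨S, hS, hSpos⟩ := exists_smooth_lyapunov
    (fun i j => (h.contDiff_B i j).continuous) h.isCompact_orbit (by
      rintro _ ⟨x, rfl⟩; exact h.spectrum_pos x)
  have hT := h.profile.period_pos
  let Sx : ℝ → Matrix (Fin n) (Fin n) ℝ := fun x => S (ubar x)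
  have cS : ∀ i j, ContDiff ℝ 1 fun x => Sx x i j := fun i j =>
    (hS i j).comp (h.contDiff_ubar.of_le (by norm_num))
  have dS : ∀ x i j, HasDerivAt (fun x => Sx x i j) (matDeriv Sx x i j) x := fun x i j =>
    ((cS i j).differentiable one_ne_zero x).hasDerivAt
  have cS' : ∀ i j, Continuous fun x => matDeriv Sx x i j := fun i j =>
    (cS i j).continuous_deriv le_rfl
  have mulc : ∀ {M N : ℝ → Matrix (Fin n) (Fin n) ℝ}, (∀ i j, Continuous fun x => M x i j) →
      (∀ i j, Continuous fun x => N x i j) → ∀ i j, Continuous fun x => (M x * N x) i j := by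
    intro M N hM hN i j
    simp only [Matrix.mul_apply]
    exact continuous_finsetSum _ fun k _ => (hM i k).mul (hN k j)
  have hSc := fun i j => (cS i j).continuous
  have hper : ∀ x, Sx (x + T) = Sx x := fun x => by simp only [Sx, h.profile.periodic]
  obtain ⟨c₁, hc₁, hc₁'⟩ := exists_coercive (isCompact_Icc (a := 0) (b := T)) hSc
    fun x _ => (hSpos _ ⟨x, rfl⟩).1
  obtain ⟨c₂, hc₂, hc₂'⟩ := exists_coercive (isCompact_Icc (a := 0) (b := T))
    (mulc hSc h.continuous_coeffB) fun x _ => (hSpos _ ⟨x, rfl⟩).2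
  obtain ⟨K₁, hK₁, hK₁'⟩ := exists_bilin_bound (isCompact_Icc (a := 0) (b := T))
    (mulc hSc h.continuous_coeffA)
  obtain ⟨K₂, hK₂, hK₂'⟩ := exists_bilin_bound (isCompact_Icc (a := 0) (b := T))
    (mulc cS' h.continuous_coeffB)
  obtain ⟨K₃, hK₃, hK₃'⟩ := exists_bilin_bound (isCompact_Icc (a := 0) (b := T))
    (mulc cS' h.continuous_coeffA)
  -- The size of `lam` comes from completing the square: the coercive term `c₂ ‖w₁‖²` absorbs the
  -- mixed terms at the cost of `(K₁ + K₂)² / (4 c₂) ‖w‖²`, and `lam c₁` covers this, the term `K₃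
  -- ‖w‖²` and one more `‖w‖²`.
  refine ⟨((K₁ + K₂) ^ 2 / (4 * c₂) + K₃ + 1) / c₁, fun w w₁ z hw hz hz' hwp hzp => ?_⟩
  set lam := ((K₁ + K₂) ^ 2 / (4 * c₂) + K₃ + 1) / c₁ with hlam
  let E : ℝ → ℝ := fun x => w x ⬝ᵥ Sx x *ᵥ z x
  let E' : ℝ → ℝ := fun x => w₁ x ⬝ᵥ Sx x *ᵥ z x +
    w x ⬝ᵥ (matDeriv Sx x *ᵥ z x + Sx x *ᵥ (lam • w x))
  have hmv : ∀ x, HasDerivAt (fun x => Sx x *ᵥ z x)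
      (matDeriv Sx x *ᵥ z x + Sx x *ᵥ (lam • w x)) x := by
    intro x
    rw [hasDerivAt_pi]
    intro i
    have : HasDerivAt (fun x => ∑ j, Sx x i j * z x j)
        (∑ j, (matDeriv Sx x i j * z x j + Sx x i j * (lam • w x) j)) x :=
      HasDerivAt.fun_sum fun j _ => (dS x i j).mul (hasDerivAt_pi.1 (hz' x) j)
    rw [Finset.sum_add_distrib] at this
    exact this
  have hE : ∀ x, HasDerivAt E (E' x) x := by
    intro x
    have : HasDerivAt (fun x => ∑ i, w x i * (Sx x *ᵥ z x) i)
        (∑ i, (w₁ x i * (Sx x *ᵥ z x) i +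
          w x i * (matDeriv Sx x *ᵥ z x + Sx x *ᵥ (lam • w x)) i)) x :=
      HasDerivAt.fun_sum fun i _ => (hasDerivAt_pi.1 (hw x) i).mul (hasDerivAt_pi.1 (hmv x) i)
    rw [Finset.sum_add_distrib] at this
    exact this
  have hEp : ∀ x, E (x + T) = E x := fun x => by simp only [E, hwp, hzp, hper]
  have hE'p : Function.Periodic E' T := fun x => by
    have e1 : HasDerivAt (fun x => E (x + T)) (E' (x + T)) x := (hE (x + T)).comp_add_const x T
    rw [funext hEp] at e1
    exact e1.unique (hE x)
  have hlow : ∀ x ∈ Set.Icc 0 T, ‖w x‖ ^ 2 ≤ E' x := by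
    intro x hx
    have e1 := hc₁' x hx (w x)
    have e2 := hc₂' x hx (w₁ x)
    have e3 := (abs_le.1 (hK₁' x hx (w₁ x) (w x))).2
    have e4 := (abs_le.1 (hK₂' x hx (w x) (w₁ x))).1
    have e5 := (abs_le.1 (hK₃' x hx (w x) (w x))).2
    have e6 : E' x = w₁ x ⬝ᵥ (Sx x * coeffB B ubar x) *ᵥ w₁ x -
        w₁ x ⬝ᵥ (Sx x * coeffA f B ubar x) *ᵥ w x +
        w x ⬝ᵥ (matDeriv Sx x * coeffB B ubar x) *ᵥ w₁ x -
        w x ⬝ᵥ (matDeriv Sx x * coeffA f B ubar x) *ᵥ w x + lam * (w x ⬝ᵥ Sx x *ᵥ w x) := by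
      simp only [E', hz, Matrix.mulVec_sub, Matrix.mulVec_mulVec, dotProduct_sub, dotProduct_add,
        Matrix.mulVec_smul, dotProduct_smul, smul_eq_mul]
      ring
    have e7 : lam * (c₁ * ‖w x‖ ^ 2) ≤ lam * (w x ⬝ᵥ Sx x *ᵥ w x) := by
      refine mul_le_mul_of_nonneg_left e1 ?_
      rw [hlam]; positivity
    have e8 : lam * (c₁ * ‖w x‖ ^ 2) =
        ((K₁ + K₂) ^ 2 / (4 * c₂) + K₃ + 1) * ‖w x‖ ^ 2 := by
      rw [hlam]; field_simp
    have e9 : (K₁ + K₂) * (‖w x‖ * ‖w₁ x‖) ≤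
        c₂ * ‖w₁ x‖ ^ 2 + (K₁ + K₂) ^ 2 / (4 * c₂) * ‖w x‖ ^ 2 := by
      have : c₂ * ‖w₁ x‖ ^ 2 + (K₁ + K₂) ^ 2 / (4 * c₂) * ‖w x‖ ^ 2 -
          (K₁ + K₂) * (‖w x‖ * ‖w₁ x‖) = (2 * c₂ * ‖w₁ x‖ - (K₁ + K₂) * ‖w x‖) ^ 2 / (4 * c₂) := by
        field_simp; ring
      have h0 : 0 ≤ (2 * c₂ * ‖w₁ x‖ - (K₁ + K₂) * ‖w x‖) ^ 2 / (4 * c₂) := by positivity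
      linarith
    rw [e6]
    nlinarith
  have hlow' : ∀ x, ‖w x‖ ^ 2 ≤ E' x := by
    intro x
    have hp : Function.Periodic (fun x => E' x - ‖w x‖ ^ 2) T := fun y => by
      simp only [hE'p y, hwp]
    obtain ⟨y, hy, hxy⟩ := hp.exists_mem_Ico₀ hT x
    have := hlow y (Set.Ico_subset_Icc_self hy)
    have hxy : E' x - ‖w x‖ ^ 2 = E' y - ‖w y‖ ^ 2 := hxy
    linarith
  -- `E` is the pairing of `w` with its flux in the Lyapunov product. It is periodic, and its
  -- derivative is at least `‖w‖²`; so it is both monotone and periodic, hence constant, and `w`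
  -- vanishes.
  have hmono : Monotone E := monotone_of_hasDerivAt_nonneg hE fun x =>
    (sq_nonneg _).trans (hlow' x)
  have hconst : ∀ x y, E x = E y := by
    have hle : ∀ x y, E x ≤ E y := fun x y => by
      obtain ⟨m, hm⟩ := exists_nat_ge ((x - y) / T)
      rw [div_le_iff₀ hT] at hm
      have hEm : ∀ m : ℕ, E (y + m * T) = E y := fun m => by
        induction m with
        | zero => simp
        | succ m ih =>
          have : y + ((m + 1 : ℕ) : ℝ) * T = y + m * T + T := by push_cast; ring
          rw [this, hEp, ih]
      rw [← hEm m]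
      exact hmono (by linarith)
    exact fun x y => le_antisymm (hle x y) (hle y x)
  intro x
  have h1 : E' x = 0 := by
    have : E = fun _ => E 0 := funext fun y => hconst y 0
    exact (hE x).unique (this ▸ hasDerivAt_const x (E 0))
  have h2 := hlow' x
  rw [h1] at h2
  exact norm_eq_zero.1 (pow_eq_zero_iff two_ne_zero |>.1 (le_antisymm h2 (sq_nonneg _)))

/-- For real `lam` the equation has real coefficients, so real and imaginary parts of a periodic
solution fall separately under the real energy estimate. This yields a point where `D(0, ·)` is
nonzero, and so the finite order that Newton–Puiseux requires. -/
theorem exists_not_isBlochEigenvalue : ∃ lam : ℂ, ¬ IsBlochEigenvalue f B T ubar 0 lam := by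
  obtain ⟨lam, hlam⟩ := h.exists_real_uniqueness
  refine ⟨lam, ?_⟩
  rintro ⟨w, w₁, hw0, hw, hf, hper⟩
  have hfl : ∀ x, linFlux f B ubar w w₁ (x + T) = linFlux f B ubar w w₁ x := fun x => by
    simpa using (h.bloch_flux hw hper x).2
  have hper' : ∀ x, w (x + T) = w x := fun x => by simpa using hper x
  -- real and imaginary parts
  have key : ∀ R : ℂ →L[ℝ] ℝ, ∀ x i, R (w x i) = 0 := by
    intro R
    have hR : ∀ (r : ℝ) (c : ℂ), R ((r : ℂ) * c) = r * R c := fun r c => by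
      rw [← Complex.real_smul, map_smul, smul_eq_mul]
    have hmul : ∀ (M : Matrix (Fin n) (Fin n) ℝ) (v : Fin n → ℂ),
        (fun i => R ((cplx M *ᵥ v) i)) = M *ᵥ fun j => R (v j) := fun M v => by
      funext i
      simp only [Matrix.mulVec, dotProduct, map_sum, cplx, Matrix.map_apply, hR]
    have := hlam (fun x i => R (w x i)) (fun x i => R (w₁ x i))
      (fun x i => R (linFlux f B ubar w w₁ x i))
      (fun x => hasDerivAt_pi.2 fun i => R.hasFDerivAt.comp_hasDerivAt x (hasDerivAt_pi.1 (hw x) i))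
      (fun x => by
        rw [← hmul, ← hmul]
        funext i
        simp only [linFlux, Pi.sub_apply, map_sub])
      (fun x => hasDerivAt_pi.2 fun i => by
        have := R.hasFDerivAt.comp_hasDerivAt x (hasDerivAt_pi.1 (hf x) i)
        rw [Pi.smul_apply, smul_eq_mul, hR] at this
        exact this)
      (fun x => by simp only [hper'])
      (fun x => by simp only [hfl])
    exact fun x i => congrFun (this x) i
  refine hw0 (funext fun x => funext fun i => Complex.ext ?_ ?_)
  · exact key Complex.reCLM x i
  · exact key Complex.imCLM x i

theorem exists_evans_ne_zero : ∃ lam : ℂ, evans f B T ubar 0 lam ≠ 0 := by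
  obtain ⟨lam, hlam⟩ := h.exists_not_isBlochEigenvalue
  exact ⟨lam, fun h0 => hlam ((h.isBlochEigenvalue_iff_evans 0 lam).2 h0)⟩

end Admissible

end

/-! ### Determinants of perturbations of a singular operator -/

section

section Det

variable {𝕜 E P : Type*} [Field 𝕜] [AddCommGroup E] [Module 𝕜 E] [FiniteDimensional 𝕜 E]
  [AddCommGroup P] [Module 𝕜 P] [FiniteDimensional 𝕜 P]

lemma det_id_add_comp_comm (f : E →ₗ[𝕜] P) (g : P →ₗ[𝕜] E) :
    LinearMap.det (LinearMap.id + g ∘ₗ f) = LinearMap.det (LinearMap.id + f ∘ₗ g) := by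
  classical
  let b := Module.finBasis 𝕜 E
  let c := Module.finBasis 𝕜 P
  rw [← LinearMap.det_toMatrix b, ← LinearMap.det_toMatrix c, map_add, map_add,
    LinearMap.toMatrix_id, LinearMap.toMatrix_id, LinearMap.toMatrix_comp b c b,
    LinearMap.toMatrix_comp c b c, Matrix.det_one_add_mul_comm]

lemma det_upper_triangular (G : 𝕜 × P →ₗ[𝕜] 𝕜 × P) (α : 𝕜) (ρ : P →ₗ[𝕜] 𝕜) (M : P →ₗ[𝕜] P)
    (hG : ∀ c v, G (c, v) = (α * c + ρ v, M v)) : LinearMap.det G = α * LinearMap.det M := by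
  have h1 : G = (LinearMap.prodMap LinearMap.id M ∘ₗ
      (LinearMap.id + LinearMap.inl 𝕜 𝕜 P ∘ₗ (ρ ∘ₗ LinearMap.snd 𝕜 𝕜 P))) ∘ₗ
      LinearMap.prodMap (α • LinearMap.id) LinearMap.id := by
    refine LinearMap.ext fun ⟨c, v⟩ => ?_
    rw [hG]
    simp
  have h2 : (ρ ∘ₗ LinearMap.snd 𝕜 𝕜 P) ∘ₗ LinearMap.inl 𝕜 𝕜 P = 0 := by
    ext; simp
  rw [h1, LinearMap.det_comp, LinearMap.det_comp, det_id_add_comp_comm, h2, add_zero,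
    LinearMap.det_prodMap, LinearMap.det_prodMap, LinearMap.det_id, LinearMap.det_smul]
  simp [mul_comm]

end Det

section Expansion

variable {E P : Type*} [NormedAddCommGroup E] [NormedSpace ℂ E] [FiniteDimensional ℂ E]
  [NormedAddCommGroup P] [NormedSpace ℂ P] [FiniteDimensional ℂ P]

/-- Leading order of the determinant of a perturbation of a singular operator with kernel `K P`
and range `ker R`. -/
theorem exists_tendsto_det_add_smul {X₀ : E →L[ℂ] E} {K : P →L[ℂ] E} {R : E →L[ℂ] P}
    (hXK : ∀ p, X₀ (K p) = 0) (hRX : ∀ x, R (X₀ x) = 0) (hker : ∀ x, X₀ x = 0 → ∃ p, K p = x)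
    (hK : Function.Injective K) (hR : Function.Surjective R) :
    ∃ C : ℂ, C ≠ 0 ∧ ∀ {Y : ℂ → E →L[ℂ] E} {Y₀ : E →L[ℂ] E}, Tendsto Y (𝓝[≠] 0) (𝓝 Y₀) →
      Tendsto (fun k : ℂ => (X₀ + k • Y k).det / k ^ Module.finrank ℂ P) (𝓝[≠] 0)
        (𝓝 (C * (R ∘L Y₀ ∘L K).det)) := by
  have : CompleteSpace E := FiniteDimensional.complete ℂ E
  obtain ⟨κ', hκ'⟩ := LinearMap.exists_leftInverse_of_injective K.toLinearMap
    (LinearMap.ker_eq_bot.2 hK)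
  obtain ⟨c', hc'⟩ := LinearMap.exists_rightInverse_of_surjective R.toLinearMap
    (LinearMap.range_eq_top.2 hR)
  let κ : E →L[ℂ] P := LinearMap.toContinuousLinearMap κ'
  let c : P →L[ℂ] E := LinearMap.toContinuousLinearMap c'
  have hκ : ∀ p, κ (K p) = p := fun p => LinearMap.congr_fun hκ' p
  have hc : ∀ p, R (c p) = p := fun p => LinearMap.congr_fun hc' p
  -- The operator `X₀` is made invertible by mapping its kernel onto a complement of the range, both
  -- parametrized by `P`. The constant `C = det A` is independent of the perturbation `Y`.
  let A : E →L[ℂ] E := X₀ + c ∘L κ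
  have hAinj : Function.Injective A := by
    refine (injective_iff_map_eq_zero _).2 fun x hx => ?_
    have hx : X₀ x + c (κ x) = 0 := hx
    have h1 : κ x = 0 := by
      have := congrArg R hx
      rwa [map_add, hRX, hc, zero_add, map_zero] at this
    rw [h1, map_zero, add_zero] at hx
    obtain ⟨p, rfl⟩ := hker x hx
    rw [hκ] at h1
    rw [h1, map_zero]
  have hA : IsUnit A := by
    refine ContinuousLinearMap.isUnit_iff_bijective.2 ⟨hAinj, ?_⟩
    exact (LinearMap.injective_iff_surjective (f := A.toLinearMap)).1 hAinj
  have hAdet : A.det ≠ 0 := by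
    intro h0
    have h1 := LinearMap.det_eq_zero_iff_ker_ne_bot.1 h0
    exact h1 (LinearMap.ker_eq_bot.2 hAinj)
  refine ⟨A.det, hAdet, fun {Y Y₀} hY => ?_⟩
  have hY0 : Tendsto (fun k : ℂ => A + k • Y k) (𝓝[≠] 0) (𝓝 A) := by
    have h1 : Tendsto (fun k : ℂ => k) (𝓝[≠] 0) (𝓝 0) := nhdsWithin_le_nhds
    simpa using tendsto_const_nhds.add (h1.smul hY)
  have hunit : ∀ᶠ k in 𝓝[≠] (0 : ℂ), IsUnit (A + k • Y k) :=
    hY0.eventually (Units.isOpen.mem_nhds hA)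
  have hinv : Tendsto (fun k : ℂ => Ring.inverse (A + k • Y k)) (𝓝[≠] 0) (𝓝 (Ring.inverse A)) := by
    obtain ⟨u, hu⟩ := hA
    have := (NormedRing.inverse_continuousAt u).tendsto
    rw [hu] at this
    exact this.comp hY0
  -- This is the Schur complement of the reduction. The perturbed operator is `Q (1 - Q⁻¹ c κ)`,
  -- Sylvester's identity moves the second determinant to `P`, and there `1 - κ Q⁻¹ c` equals `k R Z
  -- K` exactly; taking the determinant produces the power `k ^ dim P`.
  let Z : ℂ → E →L[ℂ] E := fun k => Y k - k • (Y k * (Ring.inverse (A + k • Y k) * Y k))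
  have hZ : Tendsto Z (𝓝[≠] 0) (𝓝 Y₀) := by
    have h1 : Tendsto (fun k : ℂ => k) (𝓝[≠] 0) (𝓝 0) := nhdsWithin_le_nhds
    simpa using hY.sub (h1.smul (hY.mul (hinv.mul hY)))
  have hlim : Tendsto (fun k => (A + k • Y k).det * (R ∘L Z k ∘L K).det) (𝓝[≠] 0)
      (𝓝 (A.det * (R ∘L Y₀ ∘L K).det)) := by
    refine ((ContinuousLinearMap.continuous_det.tendsto _).comp hY0).mul
      ((ContinuousLinearMap.continuous_det.tendsto _).comp ?_)
    have h1 : Continuous fun Z : E →L[ℂ] E => R ∘L Z ∘L K :=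
      continuous_const.clm_comp (continuous_id.clm_comp continuous_const)
    exact (h1.tendsto Y₀).comp hZ
  refine hlim.congr' ?_
  filter_upwards [hunit, self_mem_nhdsWithin] with k hk hk0
  have hk0 : k ≠ 0 := hk0
  rw [eq_div_iff (pow_ne_zero _ hk0)]
  set Q := A + k • Y k with hQ
  have e1 : ∀ x, Q (Ring.inverse Q x) = x := fun x => by
    rw [← mul_apply_eq_comp, Ring.mul_inverse_cancel _ hk]; rfl
  have e2 : ∀ x, Ring.inverse Q (Q x) = x := fun x => by
    rw [← mul_apply_eq_comp, Ring.inverse_mul_cancel _ hk]; rfl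
  have hX : X₀ + k • Y k = Q + -(c ∘L κ) := by
    rw [hQ]; simp only [A]; abel
  have hfac : (X₀ + k • Y k).toLinearMap = Q.toLinearMap ∘ₗ
      (LinearMap.id + (-(Ring.inverse Q ∘L c)).toLinearMap ∘ₗ κ.toLinearMap) := by
    refine LinearMap.ext fun x => ?_
    rw [hX]
    change Q x + -c (κ x) = Q (x + -(Ring.inverse Q (c (κ x))))
    rw [map_add, map_neg, e1]
  have hQK : ∀ p, Q (K p) = c p + k • Y k (K p) := fun p => by
    change X₀ (K p) + c (κ (K p)) + k • Y k (K p) = _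
    rw [hXK, hκ, zero_add]
  have hRQ : ∀ x, R (Q x) = κ x + k • R (Y k x) := fun x => by
    change R (X₀ x + c (κ x) + k • Y k x) = _
    rw [map_add, map_add, hRX, hc, zero_add, map_smul]
  have hsmall : LinearMap.id + κ.toLinearMap ∘ₗ (-(Ring.inverse Q ∘L c)).toLinearMap =
      k • (R ∘L Z k ∘L K).toLinearMap := by
    refine LinearMap.ext fun p => ?_
    change p + κ (-(Ring.inverse Q (c p))) = k • R (Y k (K p) - k • Y k (Ring.inverse Q (Y k (K p))))
    have h1 : Ring.inverse Q (c p) = K p - k • Ring.inverse Q (Y k (K p)) := by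
      have := congrArg (fun x => (Ring.inverse Q : E →L[ℂ] E) x) (hQK p)
      simp only [e2, map_add, map_smul] at this
      exact eq_sub_of_add_eq this.symm
    have h2 : κ (Ring.inverse Q (Y k (K p))) = R (Y k (K p)) -
        k • R (Y k (Ring.inverse Q (Y k (K p)))) := by
      have := hRQ (Ring.inverse Q (Y k (K p)))
      rw [e1] at this
      rw [this]; abel
    rw [h1, map_neg, map_sub, hκ, map_smul, h2, map_sub, map_smul]
    module
  have hdet : (X₀ + k • Y k).det = LinearMap.det (X₀ + k • Y k).toLinearMap := rfl
  rw [hdet, hfac, LinearMap.det_comp, det_id_add_comp_comm, hsmall, LinearMap.det_smul]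
  change Q.det * _ * _ = Q.det * (_ * (R ∘L Z k ∘L K).det)
  ring

end Expansion

end

/-! ### The monodromy and its slope in terms of the flow derivative -/

section

section RealVectors

variable {n : ℕ}

/-- A real vector regarded as a complex one. -/
def cvec : (Fin n → ℝ) →L[ℝ] (Fin n → ℂ) :=
  ContinuousLinearMap.pi fun i => Complex.ofRealCLM ∘L ContinuousLinearMap.proj i

@[simp] lemma cvec_apply (v : Fin n → ℝ) (i : Fin n) : cvec v i = (v i : ℂ) := rfl

lemma cplx_mulVec_cvec (M : Matrix (Fin n) (Fin n) ℝ) (v : Fin n → ℝ) :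
    cplx M *ᵥ cvec v = cvec (M *ᵥ v) := by
  ext i
  simp [Matrix.mulVec, dotProduct, cplx]

lemma linearMap_ext_cvec {V : Type*} [AddCommGroup V] [Module ℂ V]
    {L L' : (Fin n → ℂ) →ₗ[ℂ] V} (hL : ∀ v, L (cvec v) = L' (cvec v)) : L = L' := by
  refine (Pi.basisFun ℂ (Fin n)).ext fun i => ?_
  have : Pi.basisFun ℂ (Fin n) i = cvec (Pi.single i 1) := by
    funext j
    rw [Pi.basisFun_apply, cvec_apply, Pi.single_apply, Pi.single_apply]
    split_ifs <;> simp
  rw [this, hL]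

lemma cvec_ne_zero {v : Fin n → ℝ} (hv : v ≠ 0) : cvec v ≠ 0 := fun h0 => hv <| funext fun i => by
  have := congrFun h0 i
  simpa using this

lemma cplx_mulVec_re (M : Matrix (Fin n) (Fin n) ℝ) (a : Fin n → ℂ) (i : Fin n) :
    ((cplx M *ᵥ a) i).re = (M *ᵥ fun j => (a j).re) i := by
  simp [Matrix.mulVec, dotProduct, cplx]

lemma cplx_mulVec_im (M : Matrix (Fin n) (Fin n) ℝ) (a : Fin n → ℂ) (i : Fin n) :
    ((cplx M *ᵥ a) i).im = (M *ᵥ fun j => (a j).im) i := by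
  simp [Matrix.mulVec, dotProduct, cplx]

end RealVectors

variable {n : ℕ} {f : (Fin n → ℝ) → (Fin n → ℝ)} {B : (Fin n → ℝ) → Matrix (Fin n) (Fin n) ℝ}
  {T : ℝ} {um : Fin n → ℝ} {ubar : ℝ → Fin n → ℝ}

namespace Admissible

section Slope

variable (h : Admissible f B T um ubar)
include h

/-- The divided difference at `0` and `z` of the monodromy operators. -/
def fluxSlope (z : ℂ) : (Fin n → ℂ) × (Fin n → ℂ) →L[ℂ] (Fin n → ℂ) × (Fin n → ℂ) :=
  evalL ℂ ⟨T, h.T_nonneg, le_rfl⟩ ∘L propagatorSlope le_rfl h.T_nonneg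
    (restr 0 T (fluxCoeff f B ubar) h.continuous_fluxCoeff)
    (BoundedContinuousFunction.const _ (shiftCoeff n)) z

lemma fluxPropagator_zero : h.fluxPropagator 0 =
    propagator le_rfl h.T_nonneg (restr 0 T (fluxCoeff f B ubar) h.continuous_fluxCoeff) := by
  rw [fluxPropagator, propagator_add_smul, zero_smul, add_zero]

lemma fluxMonodromy_eq (z : ℂ) : h.fluxMonodromy z = h.fluxMonodromy 0 + z • h.fluxSlope z := by
  rw [fluxMonodromy, fluxMonodromy, fluxPropagator_zero, fluxPropagator, propagator_add_smul,
    ContinuousLinearMap.comp_add, ContinuousLinearMap.comp_smul]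
  rfl

lemma differentiable_fluxSlope : Differentiable ℂ h.fluxSlope :=
  (differentiable_const _).clm_comp (differentiable_propagatorSlope _ _ _ _)

lemma differentiable_fluxMonodromy : Differentiable ℂ h.fluxMonodromy := by
  have : h.fluxMonodromy = fun z => h.fluxMonodromy 0 + z • h.fluxSlope z :=
    funext h.fluxMonodromy_eq
  rw [this]
  exact (differentiable_const _).add (differentiable_id.smul h.differentiable_fluxSlope)

/-- The mass of a solution is the increment of the flux of the slope. -/
lemma fluxSlope_zero_snd (c : (Fin n → ℂ) × (Fin n → ℂ)) : (h.fluxSlope 0 c).2 =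
    ∫ x in (0 : ℝ)..T, (ext le_rfl h.T_nonneg (h.fluxPropagator 0 c) x).1 := by
  have h1 := congrArg (evalL ℂ ⟨T, h.T_nonneg, le_rfl⟩) (propagatorSlope_zero le_rfl h.T_nonneg
    (restr 0 T (fluxCoeff f B ubar) h.continuous_fluxCoeff)
    (BoundedContinuousFunction.const _ (shiftCoeff n)) c)
  have h2 : h.fluxSlope 0 c = _ := h1
  rw [h2, evalL_apply, prim_apply]
  have h3 := (ContinuousLinearMap.snd ℝ (Fin n → ℂ) (Fin n → ℂ)).intervalIntegral_comp_comm
    ((continuous_ext le_rfl h.T_nonneg (mulOp (restr 0 T (fluxCoeff f B ubar) h.continuous_fluxCoeff)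
      (propagatorSlope le_rfl h.T_nonneg (restr 0 T (fluxCoeff f B ubar) h.continuous_fluxCoeff)
    (BoundedContinuousFunction.const _ (shiftCoeff n)) 0 c) +
      mulOp (BoundedContinuousFunction.const _ (shiftCoeff n)) (propagator le_rfl h.T_nonneg
        (restr 0 T (fluxCoeff f B ubar) h.continuous_fluxCoeff) c))).intervalIntegrable
          (μ := volume) 0 T)
  rw [ContinuousLinearMap.coe_snd'] at h3
  rw [← h3, fluxPropagator_zero]
  refine intervalIntegral.integral_congr fun x _ => ?_
  simp [ext, fluxCoeff_apply]

end Slope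

section Flow

variable (h : Admissible f B T um ubar)
  {ψ : ((Fin n → ℝ) × ℝ) × (Fin n → ℝ) → (Set.Icc (0 : ℝ) T →ᵇ (Fin n → ℝ))}
  {W : ((Fin n → ℝ) × ℝ) × (Fin n → ℝ) →L[ℝ] (Set.Icc (0 : ℝ) T →ᵇ (Fin n → ℝ))}
  (hψ : IsFlowDeriv f B h.T_nonneg um ubar ψ W)
include h hψ

/-- Solving the variational equation for the flux shows that a variation of rest point `v` and speed
`s` has the flux `-df(um) v - s (ubar - um)`, so at `s = 0` the flux is constant. -/
lemma hasDerivWithinAt_flowDeriv_cvec (v : Fin n → ℝ) (s : ℝ) (a : Fin n → ℝ)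
    (x : Set.Icc (0 : ℝ) T) :
    HasDerivWithinAt (fun t => cvec (ext le_rfl h.T_nonneg (W ((v, s), a)) t))
      (cplx (coeffB B ubar x)⁻¹ *ᵥ (cplx (coeffA f B ubar x) *ᵥ
        cvec (ext le_rfl h.T_nonneg (W ((v, s), a)) x) +
        cvec (-(jac f um *ᵥ v) - s • (ubar x - um)))) (Set.Icc 0 T) x := by
  have h1 := cvec.hasFDerivAt.comp_hasDerivWithinAt (x : ℝ) (hψ.variational ((v, s), a) x)
  refine h1.congr_deriv (Eq.symm ?_)
  rw [ext_of_mem _ _ _ x.2]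
  have h2 := h.fderiv_paramField x v s (W ((v, s), a) x)
  rw [cplx_mulVec_cvec, ← map_add, cplx_mulVec_cvec]
  congr 1
  have h3 : coeffA f B ubar x *ᵥ W ((v, s), a) x + (-(jac f um *ᵥ v) - s • (ubar x - um)) =
      B (ubar x) *ᵥ fderiv ℝ (paramField f B) ((um, 0), ubar x) ((v, s), W ((v, s), a) x) := by
    rw [h2]; abel
  rw [h3, Matrix.mulVec_mulVec]
  have h4 : (coeffB B ubar x)⁻¹ * B (ubar x) = 1 :=
    Matrix.nonsing_inv_mul _ (Ne.isUnit (h.det_coeffB x))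
  rw [h4, Matrix.one_mulVec]

/-- At spectral parameter `0` a solution of the flux system is a variation of travelling waves with
constant flux. Since `df(um)` is invertible, these cover all initial data. -/
lemma fluxPropagator_flowDeriv (v a : Fin n → ℝ) (x : Set.Icc (0 : ℝ) T) :
    h.fluxPropagator 0 (cvec a, cvec (-(jac f um *ᵥ v))) x =
      (cvec (W ((v, 0), a) x), cvec (-(jac f um *ᵥ v))) := by
  rw [fluxPropagator_zero]
  let y : ℝ → (Fin n → ℂ) × (Fin n → ℂ) := fun t =>
    (cvec (ext le_rfl h.T_nonneg (W ((v, 0), a)) t), cvec (-(jac f um *ᵥ v)))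
  have h0 : y 0 = (cvec a, cvec (-(jac f um *ᵥ v))) := by
    simp only [y]
    rw [ext_of_mem _ _ _ ⟨le_rfl, h.T_nonneg⟩, hψ.initial]
  have h1 := eq_propagator_of_hasDerivWithinAt le_rfl h.T_nonneg
    (restr 0 T (fluxCoeff f B ubar) h.continuous_fluxCoeff) (y := y) (fun x => by
      have h2 := (h.hasDerivWithinAt_flowDeriv_cvec hψ v 0 a x).prodMk
        (hasDerivWithinAt_const (x : ℝ) (Set.Icc 0 T) (cvec (-(jac f um *ᵥ v))))
      rw [zero_smul, sub_zero] at h2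
      exact h2) x
  rw [h0] at h1
  rw [← h1]
  simp only [y]
  rw [ext_of_mem _ _ _ x.2]

lemma fluxMonodromy_flowDeriv (v a : Fin n → ℝ) :
    h.fluxMonodromy 0 (cvec a, cvec (-(jac f um *ᵥ v))) =
      (cvec (W ((v, 0), a) ⟨T, h.T_nonneg, le_rfl⟩), cvec (-(jac f um *ᵥ v))) :=
  h.fluxPropagator_flowDeriv hψ v a _

lemma fluxSlope_snd_flowDeriv (v a : Fin n → ℝ) :
    (h.fluxSlope 0 (cvec a, cvec (-(jac f um *ᵥ v)))).2 =
      cvec (∫ x in (0 : ℝ)..T, ext le_rfl h.T_nonneg (W ((v, 0), a)) x) := by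
  rw [h.fluxSlope_zero_snd, ← ContinuousLinearMap.intervalIntegral_comp_comm _
    ((continuous_ext _ _ _).intervalIntegrable _ _)]
  refine intervalIntegral.integral_congr fun x _ => ?_
  simp only [ext]
  rw [h.fluxPropagator_flowDeriv hψ]

/-- The slope at the translation mode solves the system with `z' = ubar'`, so its flux is `ubar -
ubar 0`. This is the flux of a unit variation of the speed, with sign reversed, up to the constant
`um - ubar 0`, which a suitable variation of the rest point supplies. Periodicity of the profile
makes the flux increment vanish. -/
lemma fluxSlope_deriv_ubar : ∃ v : Fin n → ℝ, h.fluxSlope 0 (cvec (deriv ubar 0), 0) =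
    (cvec (W ((v, 0), 0) ⟨T, h.T_nonneg, le_rfl⟩ - W ((0, 1), 0) ⟨T, h.T_nonneg, le_rfl⟩), 0) := by
  let v : Fin n → ℝ := -((jac f um)⁻¹ *ᵥ (um - ubar 0))
  have hv : -(jac f um *ᵥ v) = um - ubar 0 := by
    rw [Matrix.mulVec_neg, neg_neg, Matrix.mulVec_mulVec,
      Matrix.mul_nonsing_inv _ (Ne.isUnit h.det_ne), Matrix.one_mulVec]
  refine ⟨v, ?_⟩
  let K₀ := restr 0 T (fluxCoeff f B ubar) h.continuous_fluxCoeff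
  let K₁ : Set.Icc (0 : ℝ) T →ᵇ _ := BoundedContinuousFunction.const _ (shiftCoeff n)
  let c : (Fin n → ℂ) × (Fin n → ℂ) := (cvec (deriv ubar 0), 0)
  let g : Set.Icc (0 : ℝ) T →ᵇ _ := mulOp K₁ (propagator le_rfl h.T_nonneg K₀ c)
  have hg : ∀ x : Set.Icc (0 : ℝ) T, g x = (0, cvec (deriv ubar x)) := fun x => by
    have h1 := h.fluxPropagator_flowDeriv hψ 0 (deriv ubar 0) x
    rw [Matrix.mulVec_zero, neg_zero, map_zero, h.flowDeriv_deriv_ubar hψ,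
      fluxPropagator_zero] at h1
    simp only [g, mulOp_apply, K₁, BoundedContinuousFunction.const_apply, shiftCoeff_apply, K₀, c]
    rw [h1]
  let y : ℝ → (Fin n → ℂ) × (Fin n → ℂ) := fun t =>
    (cvec (ext le_rfl h.T_nonneg (W ((v, 0), 0)) t - ext le_rfl h.T_nonneg (W ((0, 1), 0)) t),
      cvec (ubar t - ubar 0))
  have hyc : Continuous y :=
    (cvec.continuous.comp ((continuous_ext _ _ _).sub (continuous_ext _ _ _))).prodMk
      (cvec.continuous.comp (h.continuous_ubar.sub continuous_const))
  have hy0 : y 0 = 0 := by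
    simp only [y]
    rw [ext_of_mem _ _ _ ⟨le_rfl, h.T_nonneg⟩, ext_of_mem _ _ _ ⟨le_rfl, h.T_nonneg⟩, hψ.initial,
      hψ.initial, sub_self, sub_self, map_zero]; rfl
  let u : Set.Icc (0 : ℝ) T →ᵇ _ := restr 0 T y hyc
  have hu : u = BoundedContinuousFunction.const _ 0 + prim le_rfl h.T_nonneg (mulOp K₀ u + g) := by
    rw [← hy0]
    refine prim_eq_of_hasDerivWithinAt le_rfl h.T_nonneg (fun _ => rfl) fun x => ?_
    have h1 := ((h.hasDerivWithinAt_flowDeriv_cvec hψ v 0 0 x).sub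
      (h.hasDerivWithinAt_flowDeriv_cvec hψ 0 1 0 x)).prodMk
      (cvec.hasFDerivAt.comp_hasDerivWithinAt (x : ℝ)
        ((h.profile.ode x).differentiableAt.hasDerivAt.sub_const (ubar 0)).hasDerivWithinAt)
    have h2 : y = fun t => ((fun t => cvec (ext le_rfl h.T_nonneg (W ((v, 0), 0)) t)) t -
      (fun t => cvec (ext le_rfl h.T_nonneg (W ((0, 1), 0)) t)) t, cvec (ubar t - ubar 0)) := by
      funext t
      simp only [y, map_sub]
    rw [BoundedContinuousFunction.add_apply, mulOp_apply, hg]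
    rw [h2]
    refine h1.congr_deriv (Eq.symm ?_)
    have h3 : u x = y x := rfl
    rw [h3, restr_apply, fluxCoeff_apply]
    simp only [y, Prod.mk_add_mk, add_zero, zero_add]
    congr 1
    rw [← Matrix.mulVec_sub, map_sub, Matrix.mulVec_sub, hv, zero_smul, one_smul, sub_zero,
      Matrix.mulVec_zero, neg_zero, zero_sub, map_neg, map_sub, map_sub, map_sub]
    congr 1
    abel
  have hs : propagatorSlope le_rfl h.T_nonneg K₀ K₁ 0 c = u := by
    set d := propagatorSlope le_rfl h.T_nonneg K₀ K₁ 0 c with hd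
    have h1 : d = prim le_rfl h.T_nonneg (mulOp K₀ d + g) := propagatorSlope_zero _ _ _ _ _
    have h2 : d - u = BoundedContinuousFunction.const _ 0 +
        prim le_rfl h.T_nonneg (mulOp K₀ (d - u)) := by
      have e0 : (BoundedContinuousFunction.const (Set.Icc (0 : ℝ) T)
        (0 : (Fin n → ℂ) × (Fin n → ℂ))) = 0 := rfl
      rw [e0, zero_add] at hu ⊢
      have e1 : mulOp K₀ (d - u) = (mulOp K₀ d + g) - (mulOp K₀ u + g) := by
        rw [map_sub]; abel
      have e2 : prim le_rfl h.T_nonneg ((mulOp K₀ d + g) - (mulOp K₀ u + g)) =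
          prim le_rfl h.T_nonneg (mulOp K₀ d + g) - prim le_rfl h.T_nonneg (mulOp K₀ u + g) :=
        (primL ℂ le_rfl h.T_nonneg).map_sub _ _
      rw [e1, e2, ← h1, ← hu]
    rw [← propagator_eq_iff, map_zero] at h2
    exact sub_eq_zero.1 h2
  have h5 : h.fluxSlope 0 c = u ⟨T, h.T_nonneg, le_rfl⟩ := by
    rw [← hs]; rfl
  change h.fluxSlope 0 c = _
  rw [h5]
  simp only [u, restr_apply, y]
  rw [ext_of_mem _ _ _ ⟨h.T_nonneg, le_rfl⟩, ext_of_mem _ _ _ ⟨h.T_nonneg, le_rfl⟩]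
  have h6 := h.profile.periodic 0
  rw [zero_add] at h6
  rw [h6, sub_self, map_zero]

end Flow

end Admissible

end

/-! ### The low-frequency expansion of the Evans function -/

section

variable {n : ℕ} {f : (Fin n → ℝ) → (Fin n → ℝ)} {B : (Fin n → ℝ) → Matrix (Fin n) (Fin n) ℝ}
  {T : ℝ} {um : Fin n → ℝ} {ubar : ℝ → Fin n → ℝ}

lemma exists_eq_cvec_neg_mulVec {M : Matrix (Fin n) (Fin n) ℝ} (hM : M.det ≠ 0)
    (z : Fin n → ℝ) : ∃ v, z = -(M *ᵥ v) :=
  ⟨-(M⁻¹ *ᵥ z), by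
    rw [Matrix.mulVec_neg, neg_neg, Matrix.mulVec_mulVec,
      Matrix.mul_nonsing_inv _ (Ne.isUnit hM), Matrix.one_mulVec]⟩

lemma tendsto_exp_slope (c : ℂ) :
    Tendsto (fun k : ℂ => (Complex.exp (c * k) - 1) / k) (𝓝[≠] 0) (𝓝 c) := by
  have h1 : HasDerivAt (fun k : ℂ => Complex.exp (c * k)) c 0 := by
    simpa using ((hasDerivAt_id (0 : ℂ)).const_mul c).cexp
  have h2 := h1.tendsto_slope
  refine h2.congr fun k => ?_
  simp [slope_def_field]

namespace Admissible

variable (h : Admissible f B T um ubar)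
include h

/-- The Evans function at a complex Floquet exponent. -/
def evansC (k z : ℂ) : ℂ :=
  (h.fluxMonodromy z - Complex.exp (Complex.I * T * k) • ContinuousLinearMap.id ℂ _).det

lemma evans_eq_evansC (k : ℝ) (z : ℂ) : evans f B T ubar k z = h.evansC k z := by
  rw [h.evans_eq, evansC, mul_right_comm]
  rfl

variable {ψ : ((Fin n → ℝ) × ℝ) × (Fin n → ℝ) → (Set.Icc (0 : ℝ) T →ᵇ (Fin n → ℝ))}
  {W : ((Fin n → ℝ) × ℝ) × (Fin n → ℝ) →L[ℝ] (Set.Icc (0 : ℝ) T →ᵇ (Fin n → ℝ))}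
  (hψ : IsFlowDeriv f B h.T_nonneg um ubar ψ W)
  {ℓ : (Fin n → ℝ) →L[ℝ] ℝ} {da : (Fin n → ℝ) →L[ℝ] (Fin n → ℝ)}
  {N : Matrix (Fin n) (Fin n) ℝ} (hN : IsMassDerivative h.T_nonneg ubar W ℓ da N)
include hψ hN

/-- The low-frequency expansion of the Evans function. -/
theorem exists_tendsto_evansC : ∃ C : ℂ, C ≠ 0 ∧ ∀ μ : ℂ,
    Tendsto (fun k : ℂ => h.evansC k (k * μ) / k ^ (n + 1)) (𝓝[≠] 0)
      (𝓝 (C * (μ * (μ • cplx N + (Complex.I * T) • cplx (jac f um)).det))) := by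
  let X := Fin n → ℂ
  set e := deriv ubar 0 with he
  set J := jac f um with hJ
  let Da : Matrix (Fin n) (Fin n) ℝ := LinearMap.toMatrix' da.toLinearMap
  have hDa : ∀ v, Da *ᵥ v = da v := fun v => by
    rw [← Matrix.toLin'_apply, Matrix.toLin'_toMatrix']; rfl
  let tT : Set.Icc (0 : ℝ) T := ⟨T, h.T_nonneg, le_rfl⟩
  -- The kernel of `M(0) - 1` is parametrized by the translation mode and by the variations of the
  -- periodic orbits with the rest point.
  let K : ℂ × X →L[ℂ] X × X := LinearMap.toContinuousLinearMap
    (((LinearMap.toSpanSingleton ℂ X (cvec e)).coprod (Matrix.toLin' (cplx Da))).prod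
      (-(Matrix.toLin' (cplx J)) ∘ₗ LinearMap.snd ℂ ℂ X))
  have hKapply : ∀ c v, K (c, v) = (c • cvec e + cplx Da *ᵥ v, -(cplx J *ᵥ v)) := fun c v => rfl
  have hK1 : K (1, 0) = (cvec e, cvec (-(J *ᵥ 0))) := by
    rw [hKapply]; simp
  have hKv : ∀ v : Fin n → ℝ, K (0, cvec v) = (cvec (da v), cvec (-(J *ᵥ v))) := fun v => by
    rw [hKapply, cplx_mulVec_cvec, cplx_mulVec_cvec, hDa]; simp
  let ℓc : X →ₗ[ℂ] ℂ := ∑ i, (ℓ (Pi.single i 1) : ℂ) • LinearMap.proj i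
  have hℓc : ∀ a, ℓc (cvec a) = (ℓ a : ℂ) := fun a => by
    have h1 : a = ∑ i, a i • Pi.single i (1 : ℝ) := pi_eq_sum_univ' a
    conv_rhs => rw [h1]
    simp only [ℓc, LinearMap.sum_apply, LinearMap.smul_apply,
      smul_eq_mul, map_sum, map_smul, Complex.ofReal_sum, Complex.ofReal_mul]
    exact Finset.sum_congr rfl fun i _ => mul_comm _ _
  -- The range of `M(0) - 1` is annihilated by the integral of motion and by the flux component, the
  -- flux being constant at spectral parameter `0`.
  let R : X × X →L[ℂ] ℂ × X := LinearMap.toContinuousLinearMap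
    ((ℓc ∘ₗ LinearMap.fst ℂ X X).prod (LinearMap.snd ℂ X X))
  have hRapply : ∀ a z, R (a, z) = (ℓc a, z) := fun a z => rfl
  let X₀ : X × X →L[ℂ] X × X := h.fluxMonodromy 0 - ContinuousLinearMap.id ℂ _
  have hX₀ : ∀ v a, X₀ (cvec a, cvec (-(J *ᵥ v))) = (cvec (W ((v, 0), a) tT - a), 0) := by
    intro v a
    have h1 := h.fluxMonodromy_flowDeriv hψ v a
    change h.fluxMonodromy 0 (cvec a, cvec (-(J *ᵥ v))) - (cvec a, cvec (-(J *ᵥ v))) = _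
    rw [h1, Prod.mk_sub_mk, sub_self, ← map_sub]
  have hX₀a : ∀ a, X₀ (cvec a, 0) = (cvec (W ((0, 0), a) tT - a), 0) := fun a => by
    simpa using hX₀ 0 a
  have hXK : ∀ p, X₀ (K p) = 0 := by
    have h1 : (X₀ ∘L K).toLinearMap = 0 := by
      refine LinearMap.prod_ext (LinearMap.ext_ring ?_) (linearMap_ext_cvec fun v => ?_)
      · change X₀ (K (1, 0)) = 0
        rw [hK1, hX₀]
        have := h.flowDeriv_period_deriv_ubar hψ
        rw [this, sub_self, map_zero]; rfl
      · change X₀ (K (0, cvec v)) = 0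
        rw [hKv, hX₀, hN.periodic, sub_self, map_zero]; rfl
    exact fun p => LinearMap.congr_fun h1 p
  have hRX : ∀ x, R (X₀ x) = 0 := by
    have h1 : (R ∘L X₀).toLinearMap = 0 := by
      refine LinearMap.prod_ext (linearMap_ext_cvec fun a => ?_) (linearMap_ext_cvec fun z => ?_)
      · change R (X₀ (cvec a, 0)) = 0
        rw [hX₀a, hRapply, hℓc, map_sub, hN.functional_conserved, sub_self]; rfl
      · change R (X₀ (0, cvec z)) = 0
        obtain ⟨v, rfl⟩ := exists_eq_cvec_neg_mulVec h.det_ne z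
        have := hX₀ v 0
        rw [map_zero] at this
        rw [this, hRapply, hℓc, map_sub, hN.functional_conserved, sub_self]; rfl
    exact fun p => LinearMap.congr_fun h1 p
  have hKinj : Function.Injective K := by
    refine (injective_iff_map_eq_zero _).2 ?_
    rintro ⟨c, v⟩ hcv
    rw [hKapply] at hcv
    have h1 : cplx J *ᵥ v = 0 := neg_eq_zero.1 (congrArg Prod.snd hcv)
    have h2 : v = 0 := by
      have := congrArg (fun x => cplx J⁻¹ *ᵥ x) h1
      have h3 : cplx J⁻¹ * cplx J = 1 := cplx_inv_mul_cancel h.det_ne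
      simpa [Matrix.mulVec_mulVec, h3] using this
    subst h2
    have h3 : c • cvec e + cplx Da *ᵥ 0 = 0 := congrArg Prod.fst hcv
    rw [Matrix.mulVec_zero, add_zero, smul_eq_zero] at h3
    rw [h3.resolve_right (cvec_ne_zero h.deriv_ubar_zero_ne)]; rfl
  have hℓ0 : ∃ a, ℓ a ≠ 0 := ⟨_, hN.functional_speed⟩
  have hRsurj : Function.Surjective R := by
    obtain ⟨a, ha⟩ := hℓ0
    rintro ⟨c, z⟩
    refine ⟨((c / ℓ a) • cvec a, z), ?_⟩
    rw [hRapply, map_smul, hℓc, smul_eq_mul, div_mul_cancel₀ _ (by exact_mod_cast ha)]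
  have hker : ∀ x, X₀ x = 0 → ∃ p, K p = x := by
    rintro ⟨a, z⟩ hx
    -- reduce to the case of vanishing flux
    let v : X := -(cplx J⁻¹ *ᵥ z)
    have hv : -(cplx J *ᵥ v) = z := by
      simp only [v]
      rw [Matrix.mulVec_neg, neg_neg, Matrix.mulVec_mulVec, cplx_mul_inv_cancel h.det_ne,
        Matrix.one_mulVec]
    let a' : X := a - cplx Da *ᵥ v
    have h1 : X₀ (a', 0) = 0 := by
      have : (a', (0 : X)) = (a, z) - K (0, v) := by
        rw [hKapply, hv, zero_smul, zero_add, Prod.mk_sub_mk, sub_self]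
      rw [this, map_sub, hx, hXK, sub_zero]
    let Wm : Matrix (Fin n) (Fin n) ℝ := LinearMap.toMatrix'
      ((evalL ℝ tT ∘L W ∘L ContinuousLinearMap.inr ℝ ((Fin n → ℝ) × ℝ) (Fin n → ℝ)).toLinearMap)
    have hWm : ∀ b, Wm *ᵥ b = W ((0, 0), b) tT := fun b => by
      rw [← Matrix.toLin'_apply, Matrix.toLin'_toMatrix']; rfl
    have h2 : ∀ b : X, X₀ (b, 0) = (cplx Wm *ᵥ b - b, 0) := by
      have h3 : X₀.toLinearMap ∘ₗ LinearMap.inl ℂ X X =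
          LinearMap.inl ℂ X X ∘ₗ (Matrix.toLin' (cplx Wm) - LinearMap.id) :=
        linearMap_ext_cvec fun b => by
          change X₀ (cvec b, 0) = (cplx Wm *ᵥ cvec b - cvec b, 0)
          rw [hX₀a, cplx_mulVec_cvec, hWm, map_sub]
      exact fun b => LinearMap.congr_fun h3 b
    rw [h2] at h1
    -- The period map is real, so its complex fixed vectors are found from their real and imaginary
    -- parts, to which transversality applies.
    have h4 : cplx Wm *ᵥ a' = a' := sub_eq_zero.1 (congrArg Prod.fst h1)
    obtain ⟨c₁, hc₁⟩ := hN.ker_eq (fun i => (a' i).re) (by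
      rw [← hWm]; funext i; rw [← cplx_mulVec_re, h4])
    obtain ⟨c₂, hc₂⟩ := hN.ker_eq (fun i => (a' i).im) (by
      rw [← hWm]; funext i; rw [← cplx_mulVec_im, h4])
    refine ⟨(c₁ + c₂ * Complex.I, v), ?_⟩
    rw [hKapply, hv]
    have h5 : (c₁ + c₂ * Complex.I : ℂ) • cvec e = a' := by
      funext i
      have e1 : (a' i).re = c₁ * e i := congrFun hc₁ i
      have e2 : (a' i).im = c₂ * e i := congrFun hc₂ i
      refine Complex.ext ?_ ?_
      · rw [e1]; simp
      · rw [e2]; simp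
    rw [h5]
    simp only [a']
    rw [sub_add_cancel]
  obtain ⟨C, hC, hlim⟩ := exists_tendsto_det_add_smul hXK hRX hker hKinj hRsurj
  refine ⟨-C * ℓ (W ((0, 1), 0) tT), mul_ne_zero (neg_ne_zero.2 hC)
    (by exact_mod_cast hN.functional_speed), fun μ => ?_⟩
  -- Chosen so that `X₀ + k Y(k) = M(kμ) - e^{iTk}` for `k ≠ 0`.
  let Y : ℂ → X × X →L[ℂ] X × X := fun k => μ • h.fluxSlope (k * μ) -
    ((Complex.exp (Complex.I * T * k) - 1) / k) • ContinuousLinearMap.id ℂ _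
  let Y₀ : X × X →L[ℂ] X × X := μ • h.fluxSlope 0 - (Complex.I * T) • ContinuousLinearMap.id ℂ _
  have hY : Tendsto Y (𝓝[≠] 0) (𝓝 Y₀) := by
    refine Tendsto.sub (Tendsto.const_smul ?_ μ) ((tendsto_exp_slope _).smul_const _)
    have h1 : Continuous fun k : ℂ => h.fluxSlope (k * μ) :=
      h.differentiable_fluxSlope.continuous.comp (by fun_prop)
    have h2 := h1.tendsto 0
    rw [zero_mul] at h2
    exact h2.mono_left nhdsWithin_le_nhds
  -- The reduced matrix is block triangular. The translation mode gains no flux and contributes `-μ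
  -- ℓ(∂_s)`; on the orbit variations the flux increment is the mass `N v`, while the flux itself is
  -- `-df(um) v`, which gives the pencil.
  have hdet : (R ∘L Y₀ ∘L K).det =
      -(μ * ℓ (W ((0, 1), 0) tT)) * (μ • cplx N + (Complex.I * T) • cplx J).det := by
    obtain ⟨v₀, hv₀⟩ := h.fluxSlope_deriv_ubar hψ
    have hY₀ : ∀ x, Y₀ x = μ • h.fluxSlope 0 x - (Complex.I * T) • x := fun x => rfl
    have hN' : ∀ v : X, (h.fluxSlope 0 (K (0, v))).2 = cplx N *ᵥ v := by
      have h1 : LinearMap.snd ℂ X X ∘ₗ (h.fluxSlope 0).toLinearMap ∘ₗ K.toLinearMap ∘ₗ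
          LinearMap.inr ℂ ℂ X = Matrix.toLin' (cplx N) := linearMap_ext_cvec fun v => by
        change (h.fluxSlope 0 (K (0, cvec v))).2 = cplx N *ᵥ cvec v
        rw [hKv, h.fluxSlope_snd_flowDeriv hψ, ← hN.mass, cplx_mulVec_cvec]
      exact fun v => LinearMap.congr_fun h1 v
    have hK10 : K (1, 0) = (cvec e, 0) := by rw [hK1]; simp
    have h1 : R (Y₀ (K (1, 0))) = (-(μ * ℓ (W ((0, 1), 0) tT)), 0) := by
      rw [hK10, hY₀, hv₀, Prod.smul_mk, Prod.smul_mk, Prod.mk_sub_mk, hRapply, map_sub, map_smul,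
        map_smul, hℓc, hℓc, map_sub, hN.functional_conserved, hN.functional_deriv, map_zero]
      simp [tT]
    have h2 : ∀ v, (R (Y₀ (K (0, v)))).2 = (μ • cplx N + (Complex.I * T) • cplx J) *ᵥ v := by
      intro v
      have h3 : (R (Y₀ (K (0, v)))).2 = μ • (h.fluxSlope 0 (K (0, v))).2 -
        (Complex.I * T) • (K (0, v)).2 := rfl
      rw [h3, hN', hKapply, Matrix.add_mulVec, Matrix.smul_mulVec, Matrix.smul_mulVec, smul_neg,
        sub_neg_eq_add]
    have h4 := det_upper_triangular (R ∘L Y₀ ∘L K).toLinearMap (-(μ * ℓ (W ((0, 1), 0) tT)))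
      (LinearMap.fst ℂ ℂ X ∘ₗ (R ∘L Y₀ ∘L K).toLinearMap ∘ₗ LinearMap.inr ℂ ℂ X)
      (Matrix.toLin' (μ • cplx N + (Complex.I * T) • cplx J)) fun c v => by
        change R (Y₀ (K (c, v))) = (_ + (R (Y₀ (K (0, v)))).1, _)
        have h5 : ((c, v) : ℂ × X) = c • (1, 0) + (0, v) := by simp
        rw [h5, map_add, map_add, map_add, map_smul, map_smul, map_smul, h1]
        refine Prod.ext ?_ ?_
        · simp only [Prod.fst_add, Prod.smul_fst, smul_eq_mul]; ring
        · simp only [Prod.snd_add, Prod.smul_snd, smul_zero, zero_add]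
          exact h2 v
    rw [LinearMap.det_toLin'] at h4
    exact h4
  have h6 := hlim hY
  rw [hdet] at h6
  have hfr : Module.finrank ℂ (ℂ × X) = n + 1 := by
    rw [Module.finrank_prod, Module.finrank_self, Module.finrank_fin_fun, add_comm]
  rw [hfr] at h6
  have h7 : C * (-(μ * (ℓ (W ((0, 1), 0) tT) : ℂ)) *
      (μ • cplx N + (Complex.I * T) • cplx J).det) =
      -C * (ℓ (W ((0, 1), 0) tT) : ℂ) * (μ * (μ • cplx N + (Complex.I * T) • cplx J).det) := by
    ring
  rw [h7] at h6
  refine h6.congr' ?_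
  filter_upwards [self_mem_nhdsWithin] with k hk
  have hk : k ≠ 0 := hk
  congr 2
  simp only [X₀, Y]
  rw [h.fluxMonodromy_eq (k * μ), smul_sub, smul_smul, smul_smul, mul_div_cancel₀ _ hk, sub_smul,
    one_smul]
  abel

end Admissible

end

/-! ### Division with remainder for analytic functions -/

section

section Division

variable {𝕜 E G : Type*} [NontriviallyNormedField 𝕜] [NormedAddCommGroup E] [NormedSpace 𝕜 E]
  [NormedAddCommGroup G] [NormedSpace 𝕜 G]

/-- The projection `(x, μ) ↦ (x, 0)`. -/
def projFst : E × 𝕜 →L[𝕜] E × 𝕜 :=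
  ContinuousLinearMap.inl 𝕜 E 𝕜 ∘L ContinuousLinearMap.fst 𝕜 E 𝕜

lemma projFst_apply (y : E × 𝕜) : projFst y = (y.1, (0 : 𝕜)) := rfl

lemma norm_projFst_le : ‖(projFst : E × 𝕜 →L[𝕜] E × 𝕜)‖ ≤ 1 :=
  ContinuousLinearMap.opNorm_le_bound _ zero_le_one fun y => by
    rw [projFst_apply, one_mul, Prod.norm_def, norm_zero]
    exact max_le (le_max_left _ _) (norm_nonneg _)

/-- The power series of the quotient by the second variable. -/
def quotSeries (p : FormalMultilinearSeries 𝕜 (E × 𝕜) G) : FormalMultilinearSeries 𝕜 (E × 𝕜) G :=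
  fun n => ∑ i : Fin (n + 1), ((p (n + 1)).curryMid i ((0 : E), (1 : 𝕜))).compContinuousLinearMap
    fun j => if i.succAbove j < i then ContinuousLinearMap.id 𝕜 _ else projFst

lemma norm_quotSeries_le (p : FormalMultilinearSeries 𝕜 (E × 𝕜) G) (n : ℕ) :
    ‖quotSeries p n‖ ≤ (n + 1) * ‖p (n + 1)‖ := by
  refine (norm_sum_le _ _).trans ?_
  have h1 : ∀ i : Fin (n + 1), ‖((p (n + 1)).curryMid i ((0 : E), (1 : 𝕜))).compContinuousLinearMap
      fun j => if i.succAbove j < i then ContinuousLinearMap.id 𝕜 _ else projFst‖ ≤ ‖p (n + 1)‖ := by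
    intro i
    refine (ContinuousMultilinearMap.norm_compContinuousLinearMap_le _ _).trans ?_
    have h2 : ‖(p (n + 1)).curryMid i ((0 : E), (1 : 𝕜))‖ ≤ ‖p (n + 1)‖ := by
      refine (((p (n + 1)).curryMid i).le_opNorm _).trans ?_
      rw [ContinuousMultilinearMap.norm_curryMid]
      simp [Prod.norm_def]
    refine (mul_le_mul h2 (Finset.prod_le_one (fun _ _ => norm_nonneg _) fun j _ => ?_)
      (Finset.prod_nonneg fun _ _ => norm_nonneg _) (norm_nonneg _)).trans (mul_one _).le
    split_ifs
    · exact ContinuousLinearMap.norm_id_le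
    · exact norm_projFst_le
  refine (Finset.sum_le_card_nsmul _ _ _ fun i _ => h1 i).trans ?_
  simp

/-- The vector `y` is replaced by its projection one slot at a time. Each replacement changes a
single argument by `y.2 • (0, 1)`, and multilinearity extracts the factor `y.2`. -/
lemma quotSeries_apply (p : FormalMultilinearSeries 𝕜 (E × 𝕜) G) (n : ℕ) (y : E × 𝕜) :
    (p (n + 1) fun _ => y) - (p (n + 1) fun _ => projFst y) = y.2 • quotSeries p n fun _ => y := by
  have h1 := (p (n + 1)).toMultilinearMap.map_piecewise_sub_map_piecewise (fun _ => y)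
    (fun _ => projFst y) (fun _ => 0) Finset.univ
  simp only [Finset.piecewise_univ, Finset.mem_univ, if_true] at h1
  refine h1.trans ?_
  rw [quotSeries, sum_apply, Finset.smul_sum]
  refine Finset.sum_congr rfl fun i _ => ?_
  rw [ContinuousMultilinearMap.compContinuousLinearMap_apply, ContinuousMultilinearMap.curryMid_apply]
  have h2 : (fun j => if j < i then y else if j = i then y - projFst y else projFst y) =
      i.insertNth (α := fun _ => E × 𝕜) (y.2 • ((0 : E), (1 : 𝕜))) (fun j =>
        (if i.succAbove j < i then ContinuousLinearMap.id 𝕜 _ else projFst) y) := by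
    refine (Fin.insertNth_eq_iff.2 ⟨?_, ?_⟩).symm
    · simp [projFst_apply, Prod.ext_iff]
    · funext j
      simp only [Fin.removeNth, Fin.succAbove_ne, if_false]
      split_ifs <;> rfl
  change (p (n + 1)) _ = _
  rw [h2, ← Fin.update_insertNth (p := i) (((0 : E), (1 : 𝕜))), ContinuousMultilinearMap.map_update_smul, Fin.update_insertNth]

/-- The `n + 1` terms of the telescoping sum cost a factor `n + 1 ≤ 2 ^ n`, which halving the radius
absorbs. -/
lemma quotSeries_radius_pos {p : FormalMultilinearSeries 𝕜 (E × 𝕜) G} (hp : 0 < p.radius) :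
    0 < (quotSeries p).radius := by
  obtain ⟨r, hr0, hr⟩ := ENNReal.lt_iff_exists_nnreal_btwn.1 hp
  have hr0 : 0 < r := by exact_mod_cast hr0
  obtain ⟨C, hC, hle⟩ := p.norm_mul_pow_le_of_lt_radius hr
  have h1 : ((r / 2 : ℝ≥0) : ℝ≥0∞) ≤ (quotSeries p).radius := by
    refine FormalMultilinearSeries.le_radius_of_bound _ (C / r) fun n => ?_
    have hr' : (0 : ℝ) < r := hr0
    have h2 := norm_quotSeries_le p n
    have h3 := hle (n + 1)
    have h4 : ((n : ℝ) + 1) ≤ 2 ^ n := by exact_mod_cast Nat.lt_two_pow_self (n := n)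
    rw [le_div_iff₀ hr']
    calc ‖quotSeries p n‖ * ((r / 2 : ℝ≥0) : ℝ) ^ n * r
        ≤ (2 ^ n * ‖p (n + 1)‖) * ((r / 2 : ℝ≥0) : ℝ) ^ n * r := by
          gcongr
          exact h2.trans (by gcongr)
      _ = ‖p (n + 1)‖ * (r : ℝ) ^ (n + 1) := by
          push_cast; rw [div_pow]; field_simp; ring
      _ ≤ C := h3
  refine lt_of_lt_of_le ?_ h1
  exact_mod_cast half_pos hr0

variable [CompleteSpace G]

/-- Division with remainder by a coordinate, for analytic functions. -/
theorem exists_analytic_division {F : E × 𝕜 → G} {x₀ : E} (hF : AnalyticAt 𝕜 F (x₀, 0)) :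
    ∃ F₁ : E × 𝕜 → G, AnalyticAt 𝕜 F₁ (x₀, 0) ∧
      ∀ᶠ p in 𝓝 (x₀, (0 : 𝕜)), F p = F (p.1, 0) + p.2 • F₁ p := by
  obtain ⟨p, r, hp⟩ := hF
  have hrad := quotSeries_radius_pos (hp.r_pos.trans_le hp.r_le)
  have hq := (quotSeries p).hasFPowerSeriesOnBall hrad
  refine ⟨fun y => (quotSeries p).sum (y - (x₀, 0)), ?_, ?_⟩
  · have h1 : AnalyticAt 𝕜 (quotSeries p).sum ((x₀, (0 : 𝕜)) - (x₀, 0)) := by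
      rw [sub_self]; exact hq.analyticAt
    exact h1.comp_of_eq (analyticAt_id.sub analyticAt_const) rfl
  · have hb : ∀ᶠ y in 𝓝 (x₀, (0 : 𝕜)), y ∈ Metric.eball (x₀, (0 : 𝕜)) (min r (quotSeries p).radius) :=
      Metric.eball_mem_nhds _ (lt_min hp.r_pos hrad)
    filter_upwards [hb] with y hy
    set z := y - (x₀, (0 : 𝕜)) with hz
    have hyz : y = (x₀, 0) + z := by rw [hz]; abel
    have hzn : ‖z‖ₑ < min r (quotSeries p).radius := by
      rwa [Metric.mem_eball, edist_eq_enorm_sub] at hy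
    have hz2 : z.2 = y.2 := by simp [hz]
    have hmem : ∀ {w : E × 𝕜} {s : ℝ≥0∞}, ‖w‖ₑ < s → w ∈ Metric.eball (0 : E × 𝕜) s := fun {w s} h => by
      rwa [Metric.mem_eball, edist_zero_right]
    have hproj : ‖projFst z‖ₑ ≤ ‖z‖ₑ := by
      have := (projFst : E × 𝕜 →L[𝕜] E × 𝕜).le_of_opNorm_le norm_projFst_le z
      rw [one_mul] at this
      exact enorm_le_iff_norm_le.2 this
    have h1 := hp.hasSum (hmem (hzn.trans_le (min_le_left _ _)))
    have h2 := hp.hasSum (hmem ((hproj.trans_lt hzn).trans_le (min_le_left _ _)))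
    have h3 := hq.hasSum (hmem (hzn.trans_le (min_le_right _ _)))
    have h4 := (hasSum_nat_add_iff' 1).2 (h1.sub h2)
    have e1 : (x₀, (0 : 𝕜)) + projFst z = (y.1, 0) := by
      rw [projFst_apply, hz]; simp
    rw [zero_add] at h3
    have h5 := h3.const_smul z.2
    have h6 : (fun n => (p (n + 1) fun _ => z) - (p (n + 1) fun _ => projFst z)) =
        fun n => z.2 • quotSeries p n fun _ => z := funext fun n => quotSeries_apply p n z
    rw [h6] at h4
    have h7 := h4.unique h5
    have h8 : (p 0 fun _ => z) - (p 0 fun _ => projFst z) = 0 := by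
      rw [sub_eq_zero]; congr 1; funext i; exact i.elim0
    rw [Finset.sum_range_one, h8, sub_zero, e1, ← hyz] at h7
    rw [← hz2, ← h7]; abel

end Division

end

/-! ### Taylor expansion in the second variable -/

section

section Puiseux

lemma analyticAt_mk_left {F : ℂ × ℂ → ℂ} {t s : ℂ} (hF : AnalyticAt ℂ F (t, s)) :
    AnalyticAt ℂ (fun μ => F (t, μ)) s :=
  hF.comp_of_eq (analyticAt_const.prod analyticAt_id) rfl

/-- Repeated division by the second variable; the `k`-th coefficient is the `k`-th quotient
restricted to second variable `0`. -/
lemma exists_taylor_snd {F : ℂ × ℂ → ℂ} (hF : AnalyticAt ℂ F (0, 0)) (k : ℕ) :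
    ∃ (a : ℕ → ℂ → ℂ) (U : ℂ × ℂ → ℂ), (∀ j, AnalyticAt ℂ (a j) 0) ∧ AnalyticAt ℂ U (0, 0) ∧
      ∀ᶠ p in 𝓝 ((0 : ℂ), (0 : ℂ)),
        F p = ∑ j ∈ Finset.range k, a j p.1 * p.2 ^ j + p.2 ^ k * U p := by
  induction k with
  | zero => exact ⟨fun _ _ => 0, F, fun _ => analyticAt_const, hF, by simp⟩
  | succ k ih =>
    obtain ⟨a, U, ha, hU, hE⟩ := ih
    obtain ⟨V, hV, hUV⟩ := exists_analytic_division hU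
    refine ⟨fun j t => if j < k then a j t else U (t, 0), V, fun j => ?_, hV, ?_⟩
    · by_cases hj : j < k
      · simp only [hj, if_true]; exact ha j
      · simp only [hj, if_false]
        exact hU.comp_of_eq (analyticAt_id.prod analyticAt_const) rfl
    · filter_upwards [hE, hUV] with p h1 h2
      rw [h1, h2, Finset.sum_range_succ, if_neg (lt_irrefl k)]
      have : ∑ j ∈ Finset.range k, (if j < k then a j p.1 else U (p.1, 0)) * p.2 ^ j =
          ∑ j ∈ Finset.range k, a j p.1 * p.2 ^ j :=
        Finset.sum_congr rfl fun j hj => by rw [if_pos (Finset.mem_range.1 hj)]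
      rw [this, smul_eq_mul]; ring

lemma iteratedDeriv_of_taylor {g V : ℂ → ℂ} {c : ℕ → ℂ} {k : ℕ} (hV : AnalyticAt ℂ V 0)
    (hg : ∀ᶠ μ in 𝓝 (0 : ℂ), g μ = ∑ j ∈ Finset.range k, c j * μ ^ j + μ ^ k * V μ)
    {i : ℕ} (hi : i < k) : iteratedDeriv i g 0 = i.factorial * c i := by
  have hpow : AnalyticAt ℂ (fun μ : ℂ => μ ^ k * V μ) 0 := by fun_prop
  have hsum : AnalyticAt ℂ (fun μ : ℂ => ∑ j ∈ Finset.range k, c j * μ ^ j) 0 := by fun_prop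
  have h1 : iteratedDeriv i (fun μ : ℂ => μ ^ k * V μ) 0 = 0 :=
    (natCast_le_analyticOrderAt_iff_iteratedDeriv_eq_zero hpow).1
      ((natCast_le_analyticOrderAt hpow).2 ⟨V, hV, by simp⟩) i hi
  have h2 : g =ᶠ[𝓝 0] fun μ => ∑ j ∈ Finset.range k, c j * μ ^ j + μ ^ k * V μ := hg
  rw [h2.iteratedDeriv_eq, iteratedDeriv_fun_add hsum.contDiffAt hpow.contDiffAt, h1, add_zero,
    iteratedDeriv_fun_sum fun j _ => by fun_prop]
  have h3 : ∀ j, iteratedDeriv i (fun μ : ℂ => c j * μ ^ j) 0 = if i = j then j.factorial * c j else 0 := by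
    intro j
    rw [iteratedDeriv_const_mul_field, iteratedDeriv_fun_pow_zero]
    split_ifs <;> simp [mul_comm]
  simp only [h3]
  rw [Finset.sum_ite_eq, if_pos (Finset.mem_range.2 hi)]

/-- An expansion of a function of the given order. -/
lemma taylor_of_order {F : ℂ × ℂ → ℂ} (hF : AnalyticAt ℂ F (0, 0)) {d : ℕ}
    (hd : analyticOrderAt (fun μ => F (0, μ)) 0 = d) {a : ℕ → ℂ → ℂ} {U : ℂ × ℂ → ℂ}
    (hU : AnalyticAt ℂ U (0, 0))
    (hE : ∀ᶠ p in 𝓝 ((0 : ℂ), (0 : ℂ)),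
        F p = ∑ j ∈ Finset.range d, a j p.1 * p.2 ^ j + p.2 ^ d * U p) :
    (∀ j < d, a j 0 = 0) ∧ U (0, 0) ≠ 0 := by
  have hF0 := analyticAt_mk_left hF
  have hU0 := analyticAt_mk_left hU
  have hE0 : ∀ᶠ μ in 𝓝 (0 : ℂ), F (0, μ) =
      ∑ j ∈ Finset.range d, a j 0 * μ ^ j + μ ^ d * U (0, μ) := by
    have : Tendsto (fun μ : ℂ => ((0 : ℂ), μ)) (𝓝 0) (𝓝 (0, 0)) :=
      (Continuous.prodMk_right (0 : ℂ)).tendsto 0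
    exact this.eventually hE
  have ha : ∀ j < d, a j 0 = 0 := fun j hj => by
    have h1 := iteratedDeriv_of_taylor hU0 hE0 hj
    rw [(natCast_le_analyticOrderAt_iff_iteratedDeriv_eq_zero hF0).1 hd.ge j hj] at h1
    exact (mul_eq_zero.1 h1.symm).resolve_left (by exact_mod_cast j.factorial_ne_zero)
  refine ⟨ha, ?_⟩
  have h2 : (fun μ => F (0, μ)) =ᶠ[𝓝 0] fun μ => μ ^ d * U (0, μ) := by
    filter_upwards [hE0] with μ hμ
    rw [hμ, Finset.sum_eq_zero fun j hj => by rw [ha j (Finset.mem_range.1 hj), zero_mul], zero_add]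
  intro h0
  have h3 : 1 ≤ analyticOrderAt (fun μ => U (0, μ)) 0 :=
    Order.one_le_iff_ne_zero.2 (hU0.analyticOrderAt_ne_zero.2 h0)
  have h4 : ((d + 1 : ℕ) : ℕ∞) ≤ analyticOrderAt (fun μ => F (0, μ)) 0 := by
    rw [analyticOrderAt_congr h2]
    obtain ⟨g, hg, hg'⟩ := (natCast_le_analyticOrderAt hU0 (n := 1)).1 (by exact_mod_cast h3)
    refine (natCast_le_analyticOrderAt (by fun_prop)).2 ⟨g, hg, ?_⟩
    filter_upwards [hg'] with μ hμ
    rw [hμ]; simp [pow_succ]; ring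
  rw [hd] at h4
  have : d + 1 ≤ d := by exact_mod_cast h4
  omega

lemma analyticAt_iteratedDeriv_snd {F : ℂ × ℂ → ℂ} {x : ℂ × ℂ} (hF : AnalyticAt ℂ F x) (k : ℕ) :
    AnalyticAt ℂ (fun p : ℂ × ℂ => iteratedDeriv k (fun s => F (p.1, s)) p.2) x := by
  induction k with
  | zero => simpa using hF
  | succ k ih =>
    have h1 : AnalyticAt ℂ (fun p => fderiv ℂ
        (fun p : ℂ × ℂ => iteratedDeriv k (fun s => F (p.1, s)) p.2) p ((0 : ℂ), (1 : ℂ))) x :=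
      ((ContinuousLinearMap.apply ℂ ℂ ((0 : ℂ), (1 : ℂ))).analyticAt _).comp (AnalyticAt.fderiv ih)
    refine h1.congr ?_
    filter_upwards [ih.eventually_analyticAt] with p hp
    rw [iteratedDeriv_succ]
    have h2 := hp.differentiableAt.hasFDerivAt
    have h3 : HasDerivAt (fun s : ℂ => (p.1, s)) ((0 : ℂ), (1 : ℂ)) p.2 :=
      (hasDerivAt_const _ _).prodMk (hasDerivAt_id _)
    exact (HasFDerivAt.comp_hasDerivAt (f := fun s => (p.1, s)) p.2 h2 h3).deriv.symm

/-- The zero near the origin of the derivative of order `d - 1` of a function of order `d`. -/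
lemma exists_center {F : ℂ × ℂ → ℂ} (hF : AnalyticAt ℂ F (0, 0)) {d : ℕ}
    (hd : analyticOrderAt (fun μ => F (0, μ)) 0 = (d + 1 : ℕ)) :
    ∃ c : ℂ → ℂ, AnalyticAt ℂ c 0 ∧ c 0 = 0 ∧
      ∀ᶠ t in 𝓝 0, iteratedDeriv d (fun s => F (t, s)) (c t) = 0 := by
  let G : ℂ × ℂ → ℂ := fun p => iteratedDeriv d (fun s => F (p.1, s)) p.2
  have hG : AnalyticAt ℂ G (0, 0) := analyticAt_iteratedDeriv_snd hF d
  have hF0 := analyticAt_mk_left hF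
  have hG0 : G (0, 0) = 0 :=
    (natCast_le_analyticOrderAt_iff_iteratedDeriv_eq_zero hF0).1 hd.ge d (Nat.lt_succ_self d)
  have hG1 : fderiv ℂ G (0, 0) ((0 : ℂ), (1 : ℂ)) = iteratedDeriv (d + 1) (fun s => F (0, s)) 0 := by
    have h3 : HasDerivAt (fun s : ℂ => ((0 : ℂ), s)) ((0 : ℂ), (1 : ℂ)) 0 :=
      (hasDerivAt_const _ _).prodMk (hasDerivAt_id _)
    rw [iteratedDeriv_succ]
    exact (HasFDerivAt.comp_hasDerivAt (f := fun s => ((0 : ℂ), s)) (0 : ℂ)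
      hG.differentiableAt.hasFDerivAt h3).deriv.symm
  -- The partial derivative is the derivative of order `d + 1` at the origin, which is nonzero
  -- because the order is exactly `d + 1`; hence the zero set of `G` is a graph.
  have hne : fderiv ℂ G (0, 0) ((0 : ℂ), (1 : ℂ)) ≠ 0 := by
    rw [hG1]
    intro h0
    have h1 : ((d + 1 + 1 : ℕ) : ℕ∞) ≤ analyticOrderAt (fun μ => F (0, μ)) 0 := by
      refine (natCast_le_analyticOrderAt_iff_iteratedDeriv_eq_zero hF0).2 fun i hi => ?_
      rcases Nat.lt_succ_iff_lt_or_eq.1 hi with h | rfl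
      · exact (natCast_le_analyticOrderAt_iff_iteratedDeriv_eq_zero hF0).1 hd.ge i h
      · exact h0
    rw [hd] at h1
    have : d + 1 + 1 ≤ d + 1 := by exact_mod_cast h1
    omega
  have hinv : (fderiv ℂ G (0, 0) ∘L .inr ℂ ℂ ℂ).IsInvertible := by
    refine ⟨(LinearEquiv.smulOfNeZero ℂ ℂ _ hne).toContinuousLinearEquiv, ?_⟩
    ext
    simp
  have hcd : ContDiffAt ℂ ω G (0, 0) := hG.contDiffAt
  refine ⟨hcd.implicitFunction (by simp) hinv, ?_, ?_, ?_⟩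
  · exact (hcd.contDiffAt_implicitFunction (by simp) hinv).analyticAt
  · exact hcd.implicitFunction_apply_self (by simp) hinv
  · have := hcd.eventually_apply_implicitFunction (by simp) hinv
    rw [hG0] at this
    exact this

lemma analyticOrderAt_polynomial {g : Polynomial ℂ} (hg : g ≠ 0) (ν : ℂ) :
    analyticOrderAt (fun μ => g.eval (ν + μ)) 0 = g.rootMultiplicity ν := by
  obtain ⟨r, hr, hnd⟩ := g.exists_eq_pow_rootMultiplicity_mul_and_not_dvd hg ν
  have ha : AnalyticAt ℂ (fun μ => g.eval (ν + μ)) 0 :=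
    (AnalyticOnNhd.eval_polynomial g _ trivial).comp_of_eq (by fun_prop) rfl
  have hb : AnalyticAt ℂ (fun μ => r.eval (ν + μ)) 0 :=
    (AnalyticOnNhd.eval_polynomial r _ trivial).comp_of_eq (by fun_prop) rfl
  refine ha.analyticOrderAt_eq_natCast.2 ⟨fun μ => r.eval (ν + μ), hb, ?_, Eventually.of_forall
    fun μ => ?_⟩
  · change r.eval (ν + 0) ≠ 0
    rw [add_zero]
    exact fun h0 => hnd (Polynomial.dvd_iff_isRoot.2 h0)
  · conv_lhs => rw [hr]
    simp

end Puiseux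

end

/-! ### The Newton–Puiseux theorem -/

section

section Puiseux

/-- A root of multiplicity `d` would make the polynomial `u (X - ν)^d`. The vanishing coefficient of
degree `d - 1` forces `ν = 0`, and then no lower coefficient survives. This makes the order drop in
the induction. -/
lemma rootMultiplicity_lt_of_coeff {g : Polynomial ℂ} {d j : ℕ} (hdeg : g.natDegree = d)
    (h1 : g.coeff (d - 1) = 0) (hj : j < d) (hgj : g.coeff j ≠ 0) (ν : ℂ) :
    g.rootMultiplicity ν < d := by
  have hg : g ≠ 0 := fun h => hgj (by simp [h])
  by_contra! hge
  obtain ⟨r, hr⟩ := (pow_dvd_pow _ hge).trans (g.pow_rootMultiplicity_dvd ν)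
  have hr0 : r ≠ 0 := by rintro rfl; exact hg (by simpa using hr)
  have hX : ((Polynomial.X - Polynomial.C ν) ^ d).Monic := (Polynomial.monic_X_sub_C ν).pow d
  have hrd : r.natDegree = 0 := by
    have := hX.natDegree_mul' hr0
    rw [← hr, hdeg, (Polynomial.monic_X_sub_C ν).natDegree_pow, Polynomial.natDegree_X_sub_C] at this
    omega
  obtain ⟨u, rfl⟩ := Polynomial.natDegree_eq_zero.1 hrd
  have hu : u ≠ 0 := by rintro rfl; simp at hr0
  have hc : ∀ i, g.coeff i = (-ν) ^ (d - i) * d.choose i * u := fun i => by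
    rw [hr, Polynomial.coeff_mul_C, sub_eq_add_neg, ← Polynomial.C_neg,
      Polynomial.coeff_X_add_C_pow]
  have hd : d - (d - 1) = 1 := by omega
  rw [hc, hd, pow_one, Nat.choose_symm_of_eq_add (show d = (d - 1) + 1 by omega),
    Nat.choose_one_right] at h1
  have hν : ν = 0 := by
    have : (d : ℂ) ≠ 0 := by exact_mod_cast (by omega : d ≠ 0)
    simpa [this, hu] using h1
  apply hgj
  rw [hc, hν, neg_zero, zero_pow (by omega)]; simp

/-- For a function vanishing near `0` the order is infinite; the default `m = 0` with `b` the zero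
function lets that case be recognized by `b 0 = 0`. -/
lemma exists_monomial_factor {a : ℂ → ℂ} (ha : AnalyticAt ℂ a 0) :
    ∃ (m : ℕ) (b : ℂ → ℂ), AnalyticAt ℂ b 0 ∧ (∀ᶠ t in 𝓝 0, a t = t ^ m * b t) ∧
      (b 0 = 0 → b = 0) := by
  by_cases h : ∀ᶠ t in 𝓝 0, a t = 0
  · exact ⟨0, 0, analyticAt_const, by simpa using h, fun _ => rfl⟩
  · obtain ⟨m, b, hb, hb0, hE⟩ := (ha.exists_eventuallyEq_pow_smul_nonzero_iff).2 h
    exact ⟨m, b, hb, by simpa using hE, fun h => absurd h hb0⟩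

/-- A function of order `d` in its second variable has a zero `μ = φ(k ^ (1 / q))`. -/
def RootStatement (d : ℕ) : Prop :=
  ∀ F : ℂ × ℂ → ℂ, AnalyticAt ℂ F (0, 0) → analyticOrderAt (fun μ => F (0, μ)) 0 = d →
    ∃ (q : ℕ) (φ : ℂ → ℂ), 1 ≤ q ∧ AnalyticAt ℂ φ 0 ∧ φ 0 = 0 ∧ ∀ᶠ t in 𝓝 0, F (t ^ q, φ t) = 0

/-- The Newton polygon step. -/
lemma exists_root_of_centered {d : ℕ} (hd : 1 ≤ d) (IH : ∀ d' < d, 1 ≤ d' → RootStatement d')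
    {F U : ℂ × ℂ → ℂ} {a : ℕ → ℂ → ℂ} (ha : ∀ j, AnalyticAt ℂ (a j) 0)
    (hU : AnalyticAt ℂ U (0, 0)) (hU0 : U (0, 0) ≠ 0) (ha0 : ∀ j < d, a j 0 = 0)
    (had : ∀ᶠ t in 𝓝 0, a (d - 1) t = 0)
    (hE : ∀ᶠ p in 𝓝 ((0 : ℂ), (0 : ℂ)),
        F p = ∑ j ∈ Finset.range d, a j p.1 * p.2 ^ j + p.2 ^ d * U p) :
    ∃ (q : ℕ) (φ : ℂ → ℂ), 1 ≤ q ∧ AnalyticAt ℂ φ 0 ∧ φ 0 = 0 ∧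
      ∀ᶠ t in 𝓝 0, F (t ^ q, φ t) = 0 := by
  choose m b hb hab hb0 using fun j => exists_monomial_factor (ha j)
  have hbd : b (d - 1) 0 = 0 := by
    by_contra hne
    have h1 : ∀ᶠ t in 𝓝[≠] (0 : ℂ), b (d - 1) t ≠ 0 :=
      ((hb (d - 1)).continuousAt.eventually_ne hne).filter_mono nhdsWithin_le_nhds
    obtain ⟨t, ⟨⟨h2, h3⟩, h4⟩, h5⟩ := (((had.and (hab (d - 1))).filter_mono
      nhdsWithin_le_nhds).and h1 |>.and self_mem_nhdsWithin).exists
    rw [h2] at h3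
    exact (mul_ne_zero (pow_ne_zero _ h5) h4) h3.symm
  by_cases hall : ∀ j < d, b j 0 = 0
  · refine ⟨1, fun _ => 0, le_rfl, analyticAt_const, rfl, ?_⟩
    have h1 : Tendsto (fun t : ℂ => (t, (0 : ℂ))) (𝓝 0) (𝓝 (0, 0)) :=
      (Continuous.prodMk_left (0 : ℂ)).tendsto 0
    have h2 : ∀ᶠ t in 𝓝 (0 : ℂ), ∀ j ∈ Finset.range d, a j t = 0 :=
      (Finset.eventually_all _).2 fun j hj => by
        filter_upwards [hab j] with t ht
        rw [ht, hb0 j (hall j (Finset.mem_range.1 hj))]; simp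
    filter_upwards [h1.eventually hE, h2] with t ht ht2
    rw [pow_one, ht, Finset.sum_eq_zero fun j hj => by rw [ht2 j hj, zero_mul]]
    simp [show d ≠ 0 by omega]
  push Not at hall
  obtain ⟨j1, hj1, hbj1⟩ := hall
  -- `j0` is a vertex on the edge of the Newton polygon through the vertex of degree `d`; its slope
  -- `p / q` is the order of the root to be found.
  obtain ⟨j0, hj0, hmin⟩ := ((Finset.range d).filter fun j => b j 0 ≠ 0).exists_min_image
    (fun j => (m j : ℚ) / ((d - j : ℕ) : ℚ)) ⟨j1, by simp [hj1, hbj1]⟩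
  rw [Finset.mem_filter, Finset.mem_range] at hj0
  obtain ⟨hj0d, hbj0⟩ := hj0
  obtain ⟨q, hq⟩ : ∃ q, q = d - j0 := ⟨_, rfl⟩
  obtain ⟨p, hp⟩ : ∃ p, p = m j0 := ⟨_, rfl⟩
  have hq1 : 1 ≤ q := by omega
  have hp1 : 1 ≤ p := by
    rw [hp]
    by_contra h0
    have := (hab j0).self_of_nhds
    rw [ha0 j0 hj0d, show m j0 = 0 by omega] at this
    exact hbj0 (by simpa using this.symm)
  have hexp : ∀ j < d, b j 0 ≠ 0 → p * d ≤ q * m j + p * j := by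
    intro j hj hbj
    have h1 := hmin j (by simp [hj, hbj])
    rw [div_le_div_iff₀ (by exact_mod_cast (by omega)) (by exact_mod_cast (by omega)), ← hp, ← hq]
      at h1
    have h2 : p * (d - j) ≤ m j * q := by exact_mod_cast h1
    have h3 : p * d = p * (d - j) + p * j := by rw [← mul_add]; congr 1; omega
    rw [h3, mul_comm q]; omega
  -- Coefficients after substituting `τ ^ q` for the first variable, `τ ^ p ν` for the second, and
  -- dividing by `τ ^ (p d)`. Minimality of the slope makes the truncated subtraction genuine
  -- whenever `b j` is nonzero; otherwise `c j` vanishes anyway.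
  let c : ℕ → ℂ → ℂ := fun j τ => τ ^ (q * m j + p * j - p * d) * b j (τ ^ q)
  have hc : ∀ j, AnalyticAt ℂ (c j) 0 := fun j => by
    have : AnalyticAt ℂ (fun τ : ℂ => b j (τ ^ q)) 0 :=
      (hb j).comp_of_eq (by fun_prop) (by simp [show q ≠ 0 by omega])
    exact (analyticAt_id.pow _).mul this
  have hpowq : Tendsto (fun τ : ℂ => τ ^ q) (𝓝 0) (𝓝 0) := by
    have : Continuous fun τ : ℂ => τ ^ q := by fun_prop
    simpa [show q ≠ 0 by omega] using this.tendsto 0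
  have hac : ∀ᶠ τ in 𝓝 (0 : ℂ), ∀ j ∈ Finset.range d,
      a j (τ ^ q) * τ ^ (p * j) = τ ^ (p * d) * c j τ := by
    refine (Finset.eventually_all _).2 fun j hj => ?_
    filter_upwards [hpowq.eventually (hab j)] with τ hτ
    rw [hτ]
    by_cases h0 : b j 0 = 0
    · simp [c, hb0 j h0]
    · have := hexp j (Finset.mem_range.1 hj) h0
      have h2 : τ ^ (p * d) * τ ^ (q * m j + p * j - p * d) = (τ ^ q) ^ m j * τ ^ (p * j) := by
        rw [← pow_add, ← pow_mul, ← pow_add]; congr 1; omega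
      simp only [c]
      rw [← mul_assoc, h2]; ring
  let g : Polynomial ℂ := ∑ j ∈ Finset.range d, Polynomial.C (c j 0) * Polynomial.X ^ j +
    Polynomial.C (U (0, 0)) * Polynomial.X ^ d
  have hgc : ∀ i, i < d → g.coeff i = c i 0 := by
    intro i hi
    simp only [g, Polynomial.coeff_add, Polynomial.finsetSum_coeff, Polynomial.coeff_C_mul_X_pow]
    rw [Finset.sum_ite_eq, if_pos (Finset.mem_range.2 hi), if_neg (by omega), add_zero]
  have hgd : g.coeff d = U (0, 0) := by
    simp only [g, Polynomial.coeff_add, Polynomial.finsetSum_coeff, Polynomial.coeff_C_mul_X_pow]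
    rw [Finset.sum_ite_eq, if_neg (by simp)]; simp
  have hdeg : g.natDegree = d := by
    refine le_antisymm ?_ (Polynomial.le_natDegree_of_ne_zero (by rw [hgd]; exact hU0))
    refine Polynomial.natDegree_add_le_of_degree_le (Polynomial.natDegree_sum_le_of_forall_le _ _
      fun j hj => (Polynomial.natDegree_C_mul_X_pow_le _ _).trans (Finset.mem_range.1 hj).le) ?_
    exact Polynomial.natDegree_C_mul_X_pow_le _ _
  have hg0 : g ≠ 0 := by
    intro h; rw [h] at hdeg; simp at hdeg; omega
  have hcd : c (d - 1) 0 = 0 := by simp [c, hb0 _ hbd]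
  have hcj0 : c j0 0 ≠ 0 := by
    have : q * m j0 + p * j0 - p * d = 0 := by
      have : p * d = p * q + p * j0 := by rw [← mul_add]; congr 1; omega
      rw [this, ← hp, mul_comm q]; omega
    simp only [c]
    rw [this]
    simpa [show q ≠ 0 by omega] using hbj0
  obtain ⟨ν₀, hν₀⟩ := IsAlgClosed.exists_root g
    (by rw [Polynomial.degree_eq_natDegree hg0, hdeg]; exact_mod_cast (by omega : d ≠ 0))
  let G : ℂ × ℂ → ℂ := fun x => ∑ j ∈ Finset.range d, c j x.1 * (ν₀ + x.2) ^ j +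
    (ν₀ + x.2) ^ d * U (x.1 ^ q, x.1 ^ p * (ν₀ + x.2))
  have hpt : ((0 : ℂ) ^ q, (0 : ℂ) ^ p * (ν₀ + 0)) = (0, 0) := by
    simp [show q ≠ 0 by omega, show p ≠ 0 by omega]
  have hG : AnalyticAt ℂ G (0, 0) := by
    have h1 : AnalyticAt ℂ (fun x : ℂ × ℂ => U (x.1 ^ q, x.1 ^ p * (ν₀ + x.2))) (0, 0) :=
      hU.comp_of_eq ((analyticAt_fst.pow q).prod ((analyticAt_fst.pow p).mul
        (analyticAt_const.add analyticAt_snd))) hpt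
    have h2 : ∀ j, AnalyticAt ℂ (fun x : ℂ × ℂ => c j x.1) (0, 0) := fun j =>
      (hc j).comp_of_eq analyticAt_fst rfl
    have h3 : AnalyticAt ℂ (fun x : ℂ × ℂ => ν₀ + x.2) (0, 0) := analyticAt_const.add analyticAt_snd
    refine AnalyticAt.add (Finset.analyticAt_fun_sum _ fun j _ => (h2 j).mul (h3.pow j)) ((h3.pow d).mul h1)
  have hG0 : (fun μ => G (0, μ)) = fun μ => g.eval (ν₀ + μ) := by
    funext μ
    simp only [G, g, Polynomial.eval_add, Polynomial.eval_finsetSum, Polynomial.eval_mul,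
      Polynomial.eval_C, Polynomial.eval_pow, Polynomial.eval_X]
    rw [zero_pow (by omega : q ≠ 0), zero_pow (by omega : p ≠ 0), zero_mul, mul_comm (U (0, 0))]
  have hord := analyticOrderAt_polynomial hg0 ν₀
  rw [← hG0] at hord
  -- `g` is the rescaled function at `τ = 0`. Its coefficient of degree `d - 1` vanishes while that
  -- of degree `j0` does not, so the multiplicity of `ν₀` is below `d` and the induction hypothesis
  -- applies to `G`.
  obtain ⟨q', φ, hq', hφ, hφ0, hroot⟩ := IH _
    (rootMultiplicity_lt_of_coeff hdeg (by rw [hgc _ (by omega)]; exact hcd) hj0d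
      (by rw [hgc _ hj0d]; exact hcj0) ν₀)
    ((Polynomial.rootMultiplicity_pos hg0).2 hν₀) G hG hord
  have hqp : q' * p ≠ 0 := mul_ne_zero (by omega) (by omega)
  refine ⟨q' * q, fun s => s ^ (q' * p) * (ν₀ + φ s), Nat.mul_pos hq' hq1, by fun_prop,
    by simp [show q' ≠ 0 by omega, show p ≠ 0 by omega], ?_⟩
  have hlim : Tendsto (fun s : ℂ => (s ^ (q' * q), s ^ (q' * p) * (ν₀ + φ s))) (𝓝 0)
      (𝓝 (0, 0)) := by
    have : ContinuousAt (fun s : ℂ => (s ^ (q' * q), s ^ (q' * p) * (ν₀ + φ s))) 0 := by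
      have := hφ.continuousAt
      fun_prop
    simpa [ContinuousAt, show q' ≠ 0 by omega, show p ≠ 0 by omega, show q ≠ 0 by omega]
      using this
  have hpowq' : Tendsto (fun τ : ℂ => τ ^ q') (𝓝 0) (𝓝 0) := by
    have : Continuous fun τ : ℂ => τ ^ q' := by fun_prop
    simpa [show q' ≠ 0 by omega] using this.tendsto 0
  filter_upwards [hlim.eventually hE, hroot, hpowq'.eventually hac] with s h1 h2 h3
  rw [h1]
  have h4 : ∀ j ∈ Finset.range d, a j (s ^ (q' * q)) * (s ^ (q' * p) * (ν₀ + φ s)) ^ j =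
      s ^ (q' * p * d) * (c j (s ^ q') * (ν₀ + φ s) ^ j) := fun j hj => by
    have h5 := h3 j hj
    rw [← pow_mul, ← pow_mul, ← pow_mul] at h5
    rw [mul_pow, ← pow_mul, mul_assoc q' p j, mul_assoc q' p d, ← mul_assoc, h5]; ring
  rw [Finset.sum_congr rfl h4, ← Finset.mul_sum, mul_pow, ← pow_mul]
  simp only [G] at h2
  rw [← pow_mul, ← pow_mul] at h2
  linear_combination s ^ (q' * p * d) * h2

/-- The second variable is shifted by the zero of the derivative of order one less than the order.
This Tschirnhaus shift removes the next-to-leading Taylor coefficient, as the Newton polygon step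
requires. -/
lemma exists_root (d : ℕ) (hd : 1 ≤ d) : RootStatement d := by
  induction d using Nat.strong_induction_on with
  | _ d IH =>
  intro F hF hord
  obtain ⟨d, rfl⟩ : ∃ e, d = e + 1 := ⟨d - 1, by omega⟩
  obtain ⟨c, hc, hc0, hcen⟩ := exists_center hF hord
  let G : ℂ × ℂ → ℂ := fun p => F (p.1, p.2 + c p.1)
  have hc' : AnalyticAt ℂ (fun p : ℂ × ℂ => c p.1) (0, 0) := hc.comp_of_eq analyticAt_fst rfl
  have hG : AnalyticAt ℂ G (0, 0) :=
    hF.comp_of_eq (analyticAt_fst.prod (analyticAt_snd.add hc')) (by simp [hc0])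
  obtain ⟨a, U, ha, hU, hE⟩ := exists_taylor_snd hG (d + 1)
  have hG0 : (fun μ => G (0, μ)) = fun μ => F (0, μ) := by simp [G, hc0]
  obtain ⟨ha0, hU0⟩ := taylor_of_order hG (by rw [hG0]; exact hord) hU hE
  have had : ∀ᶠ t in 𝓝 0, a d t = 0 := by
    have hE' := hE
    rw [nhds_prod_eq] at hE'
    have h1 : Tendsto (fun t : ℂ => (t, (0 : ℂ))) (𝓝 0) (𝓝 (0, 0)) :=
      (Continuous.prodMk_left (0 : ℂ)).tendsto 0
    filter_upwards [hE'.curry, h1.eventually hU.eventually_analyticAt, hcen] with t h2 h3 h4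
    have h5 := iteratedDeriv_of_taylor (c := fun j => a j t) (analyticAt_mk_left h3) h2
      (Nat.lt_succ_self d)
    have h6 := congrFun (iteratedDeriv_comp_add_const d (fun s => F (t, s)) (c t)) 0
    rw [zero_add, h4] at h6
    exact (mul_eq_zero.1 (h5.symm.trans h6)).resolve_left (by exact_mod_cast d.factorial_ne_zero)
  obtain ⟨q, φ, hq, hφ, hφ0, hr⟩ := exists_root_of_centered hd IH ha hU hU0 ha0 had hE
  have h1 : AnalyticAt ℂ (fun t : ℂ => c (t ^ q)) 0 :=
    hc.comp_of_eq (by fun_prop) (by simp [show q ≠ 0 by omega])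
  refine ⟨q, fun t => φ t + c (t ^ q), hq, hφ.add h1, ?_, hr⟩
  simp [hφ0, hc0, show q ≠ 0 by omega]

/-- The Newton–Puiseux theorem. -/
theorem exists_puiseux_factorization (d : ℕ) : ∀ F : ℂ × ℂ → ℂ, AnalyticAt ℂ F (0, 0) →
    analyticOrderAt (fun μ => F (0, μ)) 0 = d →
    ∃ (q : ℕ) (φ : Fin d → ℂ → ℂ) (U : ℂ × ℂ → ℂ), 1 ≤ q ∧ (∀ i, AnalyticAt ℂ (φ i) 0) ∧
      (∀ i, φ i 0 = 0) ∧ AnalyticAt ℂ U (0, 0) ∧ U (0, 0) ≠ 0 ∧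
      ∀ᶠ p in 𝓝 ((0 : ℂ), (0 : ℂ)), F (p.1 ^ q, p.2) = (∏ i, (p.2 - φ i p.1)) * U p := by
  induction d with
  | zero =>
    intro F hF hord
    refine ⟨1, fun i => i.elim0, F, le_rfl, fun i => i.elim0, fun i => i.elim0, hF, ?_, by simp⟩
    exact (analyticAt_mk_left hF).analyticOrderAt_eq_zero.1 hord
  | succ d ih =>
    intro F hF hord
    obtain ⟨q₀, φ₀, hq₀, hφ₀, hφ₀0, hroot⟩ := exists_root (d + 1) (by omega) F hF hord
    let F₁ : ℂ × ℂ → ℂ := fun p => F (p.1 ^ q₀, p.2 + φ₀ p.1)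
    have hφ' : AnalyticAt ℂ (fun p : ℂ × ℂ => φ₀ p.1) (0, 0) := hφ₀.comp_of_eq analyticAt_fst rfl
    have hF₁ : AnalyticAt ℂ F₁ (0, 0) :=
      hF.comp_of_eq ((analyticAt_fst.pow q₀).prod (analyticAt_snd.add hφ'))
        (by simp [hφ₀0, show q₀ ≠ 0 by omega])
    -- Once the root is moved to `0`, the function vanishes there identically and is divisible by
    -- the second variable; the quotient has order one less.
    obtain ⟨F₂, hF₂, hdiv⟩ := exists_analytic_division hF₁
    let F₃ : ℂ × ℂ → ℂ := fun p => F₂ (p.1, p.2 - φ₀ p.1)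
    have hF₃ : AnalyticAt ℂ F₃ (0, 0) :=
      hF₂.comp_of_eq (analyticAt_fst.prod (analyticAt_snd.sub hφ')) (by simp [hφ₀0])
    have hshift : Tendsto (fun p : ℂ × ℂ => (p.1, p.2 - φ₀ p.1)) (𝓝 (0, 0)) (𝓝 (0, 0)) := by
      have : ContinuousAt (fun p : ℂ × ℂ => (p.1, p.2 - φ₀ p.1)) (0, 0) :=
        (analyticAt_fst.prod (analyticAt_snd.sub hφ')).continuousAt
      simpa [ContinuousAt, hφ₀0] using this
    have hfac : ∀ᶠ p in 𝓝 ((0 : ℂ), (0 : ℂ)), F (p.1 ^ q₀, p.2) = (p.2 - φ₀ p.1) * F₃ p := by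
      have h1 : Tendsto (fun p : ℂ × ℂ => p.1) (𝓝 (0, 0)) (𝓝 0) := continuous_fst.tendsto _
      filter_upwards [hshift.eventually hdiv, h1.eventually hroot] with p h2 h3
      simp only [F₁, sub_add_cancel, zero_add, h3, smul_eq_mul] at h2
      exact h2
    have hord₃ : analyticOrderAt (fun μ => F₃ (0, μ)) 0 = d := by
      have h1 : Tendsto (fun μ : ℂ => ((0 : ℂ), μ)) (𝓝 0) (𝓝 (0, 0)) :=
        (Continuous.prodMk_right (0 : ℂ)).tendsto 0
      have h2 : (fun μ => F (0, μ)) =ᶠ[𝓝 0] id * fun μ => F₃ (0, μ) := by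
        filter_upwards [h1.eventually hfac] with μ hμ
        simpa [hφ₀0, show q₀ ≠ 0 by omega] using hμ
      rw [analyticOrderAt_congr h2, analyticOrderAt_mul analyticAt_id (analyticAt_mk_left hF₃)] at hord
      have h3 : analyticOrderAt (id : ℂ → ℂ) 0 = 1 := by
        exact (AnalyticAt.analyticOrderAt_eq_natCast (n := 1) analyticAt_id).2
          ⟨fun _ => 1, analyticAt_const, one_ne_zero, by simp⟩
      rw [h3, Nat.cast_succ, add_comm] at hord
      exact (ENat.add_left_injective_of_ne_top ENat.one_ne_top) hord
    obtain ⟨q, φ, U, hq, hφ, hφ0, hU, hU0, hE⟩ := ih F₃ hF₃ hord₃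
    refine ⟨q₀ * q, Fin.cons (fun t => φ₀ (t ^ q)) φ, U, Nat.mul_pos hq₀ hq, ?_, ?_, hU, hU0, ?_⟩
    · refine Fin.cases ?_ fun i => ?_
      · exact hφ₀.comp_of_eq (by fun_prop) (by simp [show q ≠ 0 by omega])
      · simpa using hφ i
    · refine Fin.cases ?_ fun i => ?_
      · simp [hφ₀0, show q ≠ 0 by omega]
      · simpa using hφ0 i
    · have h1 : Tendsto (fun p : ℂ × ℂ => (p.1 ^ q, p.2)) (𝓝 (0, 0)) (𝓝 (0, 0)) := by
        have : Continuous (fun p : ℂ × ℂ => (p.1 ^ q, p.2)) := by fun_prop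
        simpa [show q ≠ 0 by omega] using this.tendsto (0, 0)
      filter_upwards [h1.eventually hfac, hE] with p h2 h3
      rw [mul_comm q₀, pow_mul, h2, h3, Fin.prod_univ_succ, mul_assoc]
      rfl

end Puiseux

end

/-! ### Sorting the branches by their order -/

section

section Branches

lemma exists_equiv_of_map_univ_eq {ι κ X : Type} [Fintype ι] [Fintype κ] {f : ι → X} {g : κ → X}
    (h : Finset.univ.val.map f = Finset.univ.val.map g) : ∃ e : ι ≃ κ, ∀ i, g (e i) = f i := by
  classical
  have hcard : ∀ x, Fintype.card {i // f i = x} = Fintype.card {j // g j = x} := by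
    intro x
    have h1 := congrArg (Multiset.count x) h
    simp only [Multiset.count_map] at h1
    rw [Fintype.card_subtype, Fintype.card_subtype]
    simpa [Finset.card, eq_comm] using h1
  refine ⟨(Equiv.sigmaFiberEquiv f).symm.trans ((Equiv.sigmaCongrRight fun x =>
    Fintype.equivOfCardEq (hcard x)).trans (Equiv.sigmaFiberEquiv g)), fun i => ?_⟩
  exact (Fintype.equivOfCardEq (hcard (f i)) ⟨i, rfl⟩).2

lemma eq_of_tendsto_pow_div {E M : ℕ} {h : ℂ → ℂ} {a b : ℂ} (ha : a ≠ 0) (hb : b ≠ 0)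
    (hh : Tendsto h (𝓝[≠] 0) (𝓝 a))
    (hlim : Tendsto (fun t : ℂ => t ^ E * h t / t ^ M) (𝓝[≠] 0) (𝓝 b)) : E = M := by
  have hz : ∀ {j : ℕ}, j ≠ 0 → Tendsto (fun t : ℂ => t ^ j) (𝓝[≠] 0) (𝓝 0) := fun {j} hj => by
    have : Continuous fun t : ℂ => t ^ j := by fun_prop
    simpa [hj] using (this.tendsto 0).mono_left nhdsWithin_le_nhds
  have hquot : Tendsto (fun t : ℂ => t ^ E * h t / t ^ M / h t) (𝓝[≠] 0) (𝓝 (b / a)) :=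
    hlim.div hh ha
  have hne : ∀ᶠ t in 𝓝[≠] (0 : ℂ), h t ≠ 0 ∧ t ≠ 0 :=
    (hh.eventually_ne ha).and self_mem_nhdsWithin
  rcases lt_trichotomy E M with hlt | heq | hgt
  · exfalso
    have h1 := hquot.mul (hz (show M - E ≠ 0 by omega))
    have h2 : Tendsto (fun _ : ℂ => (1 : ℂ)) (𝓝[≠] 0) (𝓝 (b / a * 0)) := by
      refine h1.congr' ?_
      filter_upwards [hne] with t ht
      have : t ^ M = t ^ E * t ^ (M - E) := by rw [← pow_add]; congr 1; omega
      rw [this]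
      have h3 := ht.1
      have h4 := ht.2
      field_simp
    have := tendsto_nhds_unique h2 tendsto_const_nhds
    simp at this
  · exact heq
  · exfalso
    have h1 := hz (show E - M ≠ 0 by omega)
    have h2 := tendsto_nhds_unique (hquot.congr' ?_) h1
    · exact div_ne_zero hb ha h2
    · filter_upwards [hne] with t ht
      have : t ^ E = t ^ M * t ^ (E - M) := by rw [← pow_add]; congr 1; omega
      rw [this]
      have h3 := ht.1
      have h4 := ht.2
      field_simp

lemma exists_scaled_root {φ : ℂ → ℂ} (hφ : AnalyticAt ℂ φ 0) (hφ0 : φ 0 = 0) (q : ℕ) :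
    (∃ ψ : ℂ → ℂ, AnalyticAt ℂ ψ 0 ∧ ∀ᶠ t in 𝓝 0, φ t = t ^ q * ψ t) ∨
    ∃ (p : ℕ) (b : ℂ → ℂ), 1 ≤ p ∧ p < q ∧ AnalyticAt ℂ b 0 ∧ b 0 ≠ 0 ∧
      ∀ᶠ t in 𝓝 0, φ t = t ^ p * b t := by
  obtain ⟨p, b, hb, hE, h0⟩ := exists_monomial_factor hφ
  by_cases hb0 : b 0 = 0
  · left
    refine ⟨fun _ => 0, analyticAt_const, ?_⟩
    filter_upwards [hE] with t ht
    rw [ht, h0 hb0]; simp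
  rcases le_or_gt q p with h | h
  · left
    refine ⟨fun t => t ^ (p - q) * b t, by fun_prop, ?_⟩
    filter_upwards [hE] with t ht
    rw [ht, ← mul_assoc, ← pow_add]; congr 2; omega
  · right
    refine ⟨p, b, ?_, h, hb, hb0, hE⟩
    by_contra hp
    have := hE.self_of_nhds
    rw [hφ0, show p = 0 by omega] at this
    exact hb0 (by simpa using this.symm)

/-- The zeros of `D(k, ·)` near the origin split into those that are `O(k)`, with slopes the roots
of the polynomial `Q`, and those of lower order in `k`. -/
theorem exists_branch_factorization {D : ℂ × ℂ → ℂ} (hD : AnalyticAt ℂ D (0, 0)) {d : ℕ}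
    (hord : analyticOrderAt (fun μ => D (0, μ)) 0 = d) {N : ℕ} {Q : Polynomial ℂ} (hQ : Q ≠ 0)
    (hlim : ∀ μ : ℂ, Tendsto (fun k : ℂ => D (k, k * μ) / k ^ N) (𝓝[≠] 0) (𝓝 (Q.eval μ))) :
    ∃ (ι κ : Type) (_ : Fintype ι) (_ : Fintype κ) (q : ℕ) (ψ : ι → ℂ → ℂ) (p : κ → ℕ)
      (b : κ → ℂ → ℂ) (U : ℂ × ℂ → ℂ), 1 ≤ q ∧ (∀ i, AnalyticAt ℂ (ψ i) 0) ∧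
      (∀ i, 1 ≤ p i ∧ p i < q ∧ AnalyticAt ℂ (b i) 0 ∧ b i 0 ≠ 0) ∧
      AnalyticAt ℂ U (0, 0) ∧ U (0, 0) ≠ 0 ∧
      (∀ᶠ x in 𝓝 ((0 : ℂ), (0 : ℂ)), D (x.1 ^ q, x.2) =
        (∏ i, (x.2 - x.1 ^ q * ψ i x.1)) * (∏ i, (x.2 - x.1 ^ p i * b i x.1)) * U x) ∧
      q * Fintype.card ι + ∑ i, p i = q * N ∧
      Q.roots = Finset.univ.val.map (fun i => ψ i 0) := by
  obtain ⟨q, φ, U, hq, hφ, hφ0, hU, hU0, hfac⟩ := exists_puiseux_factorization d D hD hord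
  -- In terms of the exponent `t ^ q`, these are the branches of size `O(k)`; the others have order
  -- `p / q` with `0 < p < q`.
  let P : Fin d → Prop := fun i => ∃ ψ : ℂ → ℂ, AnalyticAt ℂ ψ 0 ∧ ∀ᶠ t in 𝓝 0, φ i t = t ^ q * ψ t
  classical
  have hA : ∀ i : {i // P i}, ∃ ψ : ℂ → ℂ, AnalyticAt ℂ ψ 0 ∧ ∀ᶠ t in 𝓝 0, φ i t = t ^ q * ψ t :=
    fun i => i.2
  have hB : ∀ i : {i // ¬ P i}, ∃ (p : ℕ) (b : ℂ → ℂ), 1 ≤ p ∧ p < q ∧ AnalyticAt ℂ b 0 ∧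
      b 0 ≠ 0 ∧ ∀ᶠ t in 𝓝 0, φ i t = t ^ p * b t :=
    fun i => (exists_scaled_root (hφ i) (hφ0 i) q).resolve_left i.2
  choose ψ hψ hψE using hA
  choose p b hp1 hpq hb hb0 hbE using hB
  have hφall : ∀ᶠ t in 𝓝 (0 : ℂ), (∀ i : {i // P i}, φ i t = t ^ q * ψ i t) ∧
      ∀ i : {i // ¬ P i}, φ i t = t ^ p i * b i t :=
    (eventually_all.2 hψE).and (eventually_all.2 hbE)
  have hfst : Tendsto (fun x : ℂ × ℂ => x.1) (𝓝 (0, 0)) (𝓝 0) := continuous_fst.tendsto _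
  have hfac' : ∀ᶠ x in 𝓝 ((0 : ℂ), (0 : ℂ)), D (x.1 ^ q, x.2) =
      (∏ i, (x.2 - x.1 ^ q * ψ i x.1)) * (∏ i, (x.2 - x.1 ^ p i * b i x.1)) * U x := by
    filter_upwards [hfac, hfst.eventually hφall] with x h1 h2
    rw [h1, ← Fintype.prod_subtype_mul_prod_subtype P]
    congr 2
    · exact Finset.prod_congr rfl fun i _ => by rw [h2.1 i]
    · exact Finset.prod_congr rfl fun i _ => by rw [h2.2 i]
  let c : ℂ := (∏ i, (-(b i 0))) * U (0, 0)
  have hc : c ≠ 0 := mul_ne_zero (Finset.prod_ne_zero_iff.2 fun i _ => neg_ne_zero.2 (hb0 i)) hU0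
  let R : Polynomial ℂ := ∏ i, (Polynomial.X - Polynomial.C (ψ i 0))
  have hR : R.Monic := Polynomial.monic_prod_X_sub_C _ _
  let E : ℕ := q * Fintype.card {i // P i} + ∑ i, p i
  let h : ℂ → ℂ → ℂ := fun μ t => (∏ i, (μ - ψ i t)) * (∏ i, (t ^ (q - p i) * μ - b i t)) *
    U (t, t ^ q * μ)
  have hq0 : q ≠ 0 := by omega
  have hh : ∀ μ, Tendsto (h μ) (𝓝[≠] 0) (𝓝 (R.eval μ * c)) := by
    intro μ
    have hU' : AnalyticAt ℂ (fun t : ℂ => U (t, t ^ q * μ)) 0 :=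
      hU.comp_of_eq (by fun_prop) (by simp [hq0])
    have h1 : ContinuousAt (h μ) 0 := by
      have h2 := fun i => (hψ i).continuousAt
      have h3 := fun i => (hb i).continuousAt
      have h4 := hU'.continuousAt
      refine ContinuousAt.mul (ContinuousAt.mul ?_ ?_) h4
      · exact tendsto_finsetProd _ fun i _ => continuousAt_const.sub (h2 i)
      · exact tendsto_finsetProd _ fun i _ => (ContinuousAt.sub (by fun_prop) (h3 i))
    have h5 : h μ 0 = R.eval μ * c := by
      have : ∀ i, q - p i ≠ 0 := fun i => by have := hpq i; omega
      simp [h, R, c, Polynomial.eval_prod, this, hq0, mul_assoc]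
    rw [← h5]
    exact h1.tendsto.mono_left nhdsWithin_le_nhds
  have hpow : Tendsto (fun t : ℂ => t ^ q) (𝓝[≠] 0) (𝓝[≠] 0) := by
    refine tendsto_nhdsWithin_iff.2 ⟨?_, ?_⟩
    · have : Continuous fun t : ℂ => t ^ q := by fun_prop
      simpa [hq0] using (this.tendsto 0).mono_left nhdsWithin_le_nhds
    · filter_upwards [self_mem_nhdsWithin] with t ht using pow_ne_zero _ ht
  have hlim' : ∀ μ, Tendsto (fun t : ℂ => t ^ E * h μ t / t ^ (q * N)) (𝓝[≠] 0) (𝓝 (Q.eval μ)) := by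
    intro μ
    refine ((hlim μ).comp hpow).congr' ?_
    have h1 : Tendsto (fun t : ℂ => (t, t ^ q * μ)) (𝓝[≠] 0) (𝓝 (0, 0)) := by
      have : Continuous fun t : ℂ => (t, t ^ q * μ) := by fun_prop
      simpa [hq0] using (this.tendsto 0).mono_left nhdsWithin_le_nhds
    filter_upwards [h1.eventually hfac'] with t ht
    simp only [Function.comp_apply, h, E]
    rw [ht, ← pow_mul, pow_add, pow_mul t q (Fintype.card _), ← Finset.prod_pow_eq_pow_sum]
    congr 1
    have h2 : ∏ i, (t ^ q * μ - t ^ q * ψ i t) =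
        (t ^ q) ^ Fintype.card {i // P i} * ∏ i, (μ - ψ i t) := by
      rw [Fintype.card, ← Finset.prod_const, ← Finset.prod_mul_distrib]
      exact Finset.prod_congr rfl fun i _ => by ring
    have h3 : ∏ i, (t ^ q * μ - t ^ p i * b i t) =
        (∏ i, t ^ p i) * ∏ i, (t ^ (q - p i) * μ - b i t) := by
      rw [← Finset.prod_mul_distrib]
      refine Finset.prod_congr rfl fun i _ => ?_
      have : t ^ q = t ^ p i * t ^ (q - p i) := by
        rw [← pow_add]; congr 1; have := hpq i; omega
      rw [this]; ring
    rw [h2, h3]; ring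
  -- At a `μ` that is a root of neither `Q` nor `R` both limits are finite and nonzero, which forces
  -- equal powers of `t`. The limits for all `μ` then show that `Q` is a constant multiple of `R`.
  have hE : E = q * N := by
    obtain ⟨μ, hμ⟩ := (Q * R).exists_eval_ne_zero_of_natDegree_lt_card
      (mul_ne_zero hQ hR.ne_zero) (by
        exact (Cardinal.natCast_lt_aleph0).trans_le (Cardinal.aleph0_le_mk ℂ))
    rw [Polynomial.eval_mul] at hμ
    exact eq_of_tendsto_pow_div (mul_ne_zero (right_ne_zero_of_mul hμ) hc)
      (left_ne_zero_of_mul hμ) (hh μ) (hlim' μ)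
  have hQR : Q = Polynomial.C c * R := by
    refine Polynomial.funext fun μ => ?_
    rw [Polynomial.eval_mul, Polynomial.eval_C, mul_comm]
    refine tendsto_nhds_unique (hlim' μ) ((hh μ).congr' ?_)
    filter_upwards [self_mem_nhdsWithin] with t ht
    rw [hE, mul_div_cancel_left₀ _ (pow_ne_zero _ ht)]
  refine ⟨{i // P i}, {i // ¬ P i}, inferInstance, inferInstance, q, ψ, p, b, U, hq, hψ,
    fun i => ⟨hp1 i, hpq i, hb i, hb0 i⟩, hU, hU0, hfac', hE, ?_⟩
  rw [hQR, Polynomial.roots_C_mul _ hc, Polynomial.roots_prod _ _ hR.ne_zero]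
  simp [Multiset.bind_singleton]

/-- A function of `t` near `0` that is invariant under `t ↦ η t` for a primitive root of unity
is a function of `t ^ q`. -/
lemma exists_eq_comp_pow {ψ : ℂ → ℂ} (hψ : AnalyticAt ℂ ψ 0) {q : ℕ} (hq : 1 ≤ q) {η : ℂ}
    (hη : IsPrimitiveRoot η q) (hinv : ∀ᶠ t in 𝓝 0, ψ (η * t) = ψ t) :
    ∃ g : ℂ → ℂ, AnalyticAt ℂ g 0 ∧ ∀ᶠ t in 𝓝 0, ψ t = g (t ^ q) := by
  obtain ⟨P, hP⟩ := hψ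
  have hs := hasFPowerSeriesAt_iff.1 hP
  simp only [zero_add, smul_eq_mul] at hs
  have hmul : Tendsto (fun t : ℂ => η * t) (𝓝 0) (𝓝 0) := by
    have : Continuous fun t : ℂ => η * t := by fun_prop
    simpa using this.tendsto 0
  let P' : FormalMultilinearSeries ℂ ℂ ℂ := .ofScalars ℂ fun j => η ^ j * P.coeff j
  have hP' : HasFPowerSeriesAt ψ P' 0 := by
    rw [hasFPowerSeriesAt_iff]
    filter_upwards [hmul.eventually hs, hinv] with t h1 h2
    rw [h2] at h1
    simpa [P', FormalMultilinearSeries.coeff_ofScalars, mul_pow, mul_assoc, mul_left_comm] using h1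
  -- Invariance multiplies the `j`-th coefficient by `η ^ j`; by uniqueness of the power series only
  -- multiples of `q` survive.
  have hcoeff : ∀ j, ¬ q ∣ j → P.coeff j = 0 := by
    intro j hj
    have h1 : P.coeff j = η ^ j * P.coeff j := by
      conv_lhs => rw [hP.eq_formalMultilinearSeries hP']
      simp [P', FormalMultilinearSeries.coeff_ofScalars]
    by_contra h0
    exact hj ((hη.pow_eq_one_iff_dvd j).1 (mul_right_cancel₀ h0 (by rw [one_mul]; exact h1.symm)))
  have hs' : ∀ᶠ t in 𝓝 (0 : ℂ), HasSum (fun j => (t ^ q) ^ j * P.coeff (q * j)) (ψ t) := by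
    filter_upwards [hs] with t ht
    have hinj : Function.Injective fun j : ℕ => q * j := fun a b h =>
      Nat.eq_of_mul_eq_mul_left (by omega) h
    have := (hinj.hasSum_iff (f := fun j => t ^ j * P.coeff j) (a := ψ t) fun j hj => by
      rw [hcoeff j fun ⟨i, hi⟩ => hj ⟨i, hi.symm⟩, mul_zero]).2 ht
    simpa [Function.comp_def, pow_mul] using this
  -- The principal root jumps across the cut, but only its convergence to `0` at `0` is needed: the
  -- series in `t ^ q` does not depend on the choice of root.
  have hroot : Tendsto (fun s : ℂ => s ^ ((q : ℂ)⁻¹)) (𝓝 0) (𝓝 0) := by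
    have hre : 0 < ((q : ℂ)⁻¹).re := by
      rw [← Complex.ofReal_natCast, ← Complex.ofReal_inv, Complex.ofReal_re]
      exact inv_pos.2 (by exact_mod_cast hq)
    have h1 := (Complex.continuousAt_cpow_const_of_re_pos (z := 0) (Or.inl le_rfl) hre).tendsto
    rwa [Complex.zero_cpow fun h => by simp [h] at hre] at h1
  have hpowroot : ∀ s : ℂ, (s ^ ((q : ℂ)⁻¹)) ^ q = s := fun s =>
    Complex.cpow_nat_inv_pow s (by omega)
  refine ⟨fun s => ψ (s ^ ((q : ℂ)⁻¹)), ⟨.ofScalars ℂ fun j => P.coeff (q * j), ?_⟩, ?_⟩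
  · rw [hasFPowerSeriesAt_iff]
    filter_upwards [hroot.eventually hs'] with s h1
    simpa [hpowroot, FormalMultilinearSeries.coeff_ofScalars] using h1
  · have hpow : Tendsto (fun t : ℂ => t ^ q) (𝓝 0) (𝓝 0) := by
      have : Continuous fun t : ℂ => t ^ q := by fun_prop
      simpa [show q ≠ 0 by omega] using this.tendsto 0
    filter_upwards [hs', (hroot.comp hpow).eventually hs'] with t h1 h2
    simp only [Function.comp_apply, hpowroot] at h2
    exact h1.unique h2

end Branches

end

/-! ### Branches over real Floquet exponents -/

section

section RealBranches

/-- The principal `q`-th root of a real number. -/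
def realRoot (q : ℕ) (k : ℝ) : ℂ := (k : ℂ) ^ ((q : ℂ)⁻¹)

variable {q : ℕ}

lemma realRoot_pow (hq : 1 ≤ q) (k : ℝ) : realRoot q k ^ q = k :=
  Complex.cpow_nat_inv_pow _ (by omega)

lemma realRoot_zero (hq : 1 ≤ q) : realRoot q 0 = 0 := by
  rw [realRoot, Complex.ofReal_zero, Complex.zero_cpow]
  exact inv_ne_zero (by exact_mod_cast (by omega : q ≠ 0))

lemma continuous_realRoot (hq : 1 ≤ q) : Continuous (realRoot q) := by
  refine Complex.continuous_ofReal_cpow_const ?_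
  rw [← Complex.ofReal_natCast, ← Complex.ofReal_inv, Complex.ofReal_re]
  exact inv_pos.2 (by exact_mod_cast hq)

lemma tendsto_realRoot (hq : 1 ≤ q) : Tendsto (realRoot q) (𝓝 0) (𝓝 0) := by
  simpa [realRoot_zero hq] using (continuous_realRoot hq).tendsto 0

lemma realRoot_of_pos {k : ℝ} (hk : 0 < k) : realRoot q k = ((|k| ^ ((q : ℝ)⁻¹) : ℝ) : ℂ) := by
  rw [abs_of_pos hk, Complex.ofReal_cpow hk.le, realRoot]; simp

lemma realRoot_of_neg {k : ℝ} (hk : k < 0) :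
    realRoot q k = ((|k| ^ ((q : ℝ)⁻¹) : ℝ) : ℂ) * Complex.exp (Real.pi * Complex.I * (q : ℂ)⁻¹) := by
  rw [abs_of_neg hk, Complex.ofReal_cpow (by linarith), realRoot,
    Complex.ofReal_cpow_of_nonpos hk.le]; simp

lemma contDiffAt_realRoot {k : ℝ} (hk : k ≠ 0) : ContDiffAt ℝ ∞ (realRoot q) k := by
  have key : ∀ k : ℝ, 0 < k → ContDiffAt ℝ ∞ (fun k : ℝ => (k : ℂ) ^ ((q : ℂ)⁻¹)) k := by
    intro k hk
    have h1 : AnalyticAt ℂ (fun z : ℂ => z ^ ((q : ℂ)⁻¹)) (k : ℂ) :=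
      analyticAt_id.cpow analyticAt_const (Complex.ofReal_mem_slitPlane.2 hk)
    exact (h1.contDiffAt.restrict_scalars ℝ).comp k Complex.ofRealCLM.contDiff.contDiffAt
  rcases lt_or_gt_of_ne hk with h | h
  · have h1 : ContDiffAt ℝ ∞ (fun k : ℝ => ((-k : ℝ) : ℂ) ^ ((q : ℂ)⁻¹) *
        Complex.exp (Real.pi * Complex.I * (q : ℂ)⁻¹)) k :=
      ((key (-k) (by linarith)).comp k contDiffAt_id.neg).mul contDiffAt_const
    refine h1.congr_of_eventuallyEq ?_
    filter_upwards [gt_mem_nhds h] with x hx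
    rw [realRoot, Complex.ofReal_cpow_of_nonpos hx.le]; simp
  · exact key k h

lemma hasDerivAt_realRoot (hq : 1 ≤ q) {k : ℝ} (hk : k ≠ 0) :
    HasDerivAt (realRoot q) (realRoot q k / (q * k)) k := by
  have h1 : HasDerivAt (realRoot q) (deriv (realRoot q) k) k :=
    ((contDiffAt_realRoot hk).differentiableAt (by simp)).hasDerivAt
  have h2 := h1.pow q
  have h3 : HasDerivAt (fun k : ℝ => (k : ℂ)) 1 k := Complex.ofRealCLM.hasDerivAt
  have h4 : (realRoot q) ^ q = fun k : ℝ => (k : ℂ) := funext fun k => realRoot_pow hq k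
  rw [h4] at h2
  have h5 := h2.unique h3
  refine h1.congr_deriv ?_
  have h6 : (k : ℂ) ≠ 0 := by exact_mod_cast hk
  have h7 : (q : ℂ) ≠ 0 := by exact_mod_cast (by omega : q ≠ 0)
  have h8 : realRoot q k ^ (q - 1) * realRoot q k = k := by
    rw [← pow_succ, show q - 1 + 1 = q by omega, realRoot_pow hq]
  rw [eq_div_iff (mul_ne_zero h7 h6), ← h8]
  linear_combination realRoot q k * h5

variable {ψ : ℂ → ℂ}

lemma contDiffAt_comp_realRoot {k : ℝ} (hk : k ≠ 0) (hψ : AnalyticAt ℂ ψ (realRoot q k)) :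
    ContDiffAt ℝ ∞ (fun k => ψ (realRoot q k)) k :=
  (hψ.contDiffAt.restrict_scalars ℝ).comp k (contDiffAt_realRoot hk)

/-- The root has a singular derivative at `0`, but in the product the factor `k` cancels it: that
term of the derivative is `root · ψ'(root) / q`, which is continuous through `0`. -/
lemma contDiffOn_one_mul_comp_realRoot (hq : 1 ≤ q) {δ : ℝ}
    (hψ : ∀ k ∈ Set.Ioo (-δ) δ, AnalyticAt ℂ ψ (realRoot q k)) :
    ContDiffOn ℝ 1 (fun k : ℝ => (k : ℂ) * ψ (realRoot q k)) (Set.Ioo (-δ) δ) := by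
  have hd : ∀ k ∈ Set.Ioo (-δ) δ, HasDerivAt (fun k : ℝ => (k : ℂ) * ψ (realRoot q k))
      (ψ (realRoot q k) + realRoot q k * deriv ψ (realRoot q k) / q) k := by
    intro k hk
    have h3 : HasDerivAt (fun k : ℝ => (k : ℂ)) 1 k := Complex.ofRealCLM.hasDerivAt
    by_cases h0 : k = 0
    · subst h0
      rw [realRoot_zero hq, zero_mul, zero_div, add_zero, hasDerivAt_iff_tendsto_slope]
      have h1 : Tendsto (fun k : ℝ => ψ (realRoot q k)) (𝓝[≠] 0) (𝓝 (ψ 0)) := by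
        have := (hψ 0 hk).continuousAt.tendsto
        rw [realRoot_zero hq] at this
        exact (this.comp (tendsto_realRoot hq)).mono_left nhdsWithin_le_nhds
      refine h1.congr' ?_
      filter_upwards [self_mem_nhdsWithin] with t ht
      have : (t : ℂ) ≠ 0 := by exact_mod_cast ht
      simp [slope, this]
    · have h6 : (k : ℂ) ≠ 0 := by exact_mod_cast h0
      have h7 : (q : ℂ) ≠ 0 := by exact_mod_cast (by omega : q ≠ 0)
      refine (h3.mul ((hψ k hk).differentiableAt.hasDerivAt.comp k (hasDerivAt_realRoot hq h0))).congr_deriv ?_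
      simp only [Function.comp_apply]
      field_simp
  rw [show (1 : WithTop ℕ∞) = 0 + 1 by simp, contDiffOn_succ_iff_deriv_of_isOpen isOpen_Ioo]
  refine ⟨fun k hk => (hd k hk).differentiableAt.differentiableWithinAt, by simp, ?_⟩
  rw [contDiffOn_zero]
  have h1 : ContinuousOn (fun k : ℝ => ψ (realRoot q k) +
      realRoot q k * deriv ψ (realRoot q k) / q) (Set.Ioo (-δ) δ) := by
    intro k hk
    have h2 := (continuous_realRoot hq).continuousAt (x := k)
    have h3 : ContinuousAt (fun k => ψ (realRoot q k)) k :=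
      ContinuousAt.comp (g := ψ) (hψ k hk).continuousAt h2
    have h4 : ContinuousAt (fun k => deriv ψ (realRoot q k)) k :=
      ContinuousAt.comp (g := deriv ψ) (hψ k hk).deriv.continuousAt h2
    exact (h3.add ((h2.mul h4).div_const _)).continuousWithinAt
  exact h1.congr fun k hk => (hd k hk).deriv

lemma contDiffOn_infty_mul_comp_realRoot {δ : ℝ}
    (hψ : ∀ k ∈ Set.Ioo (-δ) δ, AnalyticAt ℂ ψ (realRoot q k)) :
    ContDiffOn ℝ ∞ (fun k : ℝ => (k : ℂ) * ψ (realRoot q k)) (Set.Ioo (-δ) δ \ {0}) :=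
  fun k hk => (Complex.ofRealCLM.contDiff.contDiffAt.mul
    (contDiffAt_comp_realRoot hk.2 (hψ k hk.1))).contDiffWithinAt

lemma isLittleO_mul_comp_realRoot (hq : 1 ≤ q) (hψ : AnalyticAt ℂ ψ 0) :
    (fun k : ℝ => (k : ℂ) * ψ (realRoot q k) - k * ψ 0) =o[𝓝 0] fun k : ℝ => k := by
  have h1 : Tendsto (fun k : ℝ => ψ (realRoot q k) - ψ 0) (𝓝 0) (𝓝 0) := by
    have := (hψ.continuousAt.tendsto.comp (tendsto_realRoot hq)).sub_const (ψ 0)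
    simpa using this
  have h2 : (fun k : ℝ => (k : ℂ)) =O[𝓝 0] fun k : ℝ => k :=
    IsBigO.of_bound 1 (Eventually.of_forall fun k => by simp)
  have h3 := h2.mul_isLittleO ((isLittleO_one_iff ℝ).2 h1)
  refine (h3.congr (fun k => ?_) fun k => ?_)
  · ring
  · simp

/-- The principal root of a negative `k` is the root of `|k|` times `e^{iπ/q}`, so the two one-sided
constants differ by the factor `e^{iπp/q}`. -/
lemma powerBranch_realRoot (hq : 1 ≤ q) {δ : ℝ} (hδ : 0 < δ) {b : ℂ → ℂ} (p : ℕ)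
    (hb : ∀ k ∈ Set.Ioo (-δ) δ, AnalyticAt ℂ b (realRoot q k)) (hb0 : b 0 ≠ 0) :
    PowerBranch δ (fun k => realRoot q k ^ p * b (realRoot q k)) (p / q) := by
  have hpow : ∀ k : ℝ, |k| ^ (((p / q : ℚ)) : ℝ) = (|k| ^ ((q : ℝ)⁻¹)) ^ p := fun k => by
    rw [← Real.rpow_natCast, ← Real.rpow_mul (abs_nonneg k)]
    push_cast
    congr 1
    field_simp
  have hlim : Tendsto (fun k : ℝ => b (realRoot q k)) (𝓝 0) (𝓝 (b 0)) := by
    have := (hb 0 ⟨by linarith, hδ⟩).continuousAt.tendsto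
    rw [realRoot_zero hq] at this
    exact this.comp (tendsto_realRoot hq)
  have hne : ∀ k : ℝ, k ≠ 0 → ((|k| ^ ((q : ℝ)⁻¹) : ℝ) : ℂ) ≠ 0 := fun k hk => by
    exact_mod_cast (Real.rpow_pos_of_pos (abs_pos.2 hk) _).ne'
  refine ⟨fun k hk => ?_, ⟨b 0, hb0, ?_⟩,
    ⟨Complex.exp (Real.pi * Complex.I * (q : ℂ)⁻¹) ^ p * b 0,
      mul_ne_zero (pow_ne_zero _ (Complex.exp_ne_zero _)) hb0, ?_⟩⟩
  · have h2 := (continuous_realRoot hq).continuousAt (x := k)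
    exact ((h2.pow p).mul
      (ContinuousAt.comp (g := b) (hb k hk).continuousAt h2)).continuousWithinAt
  · refine (hlim.mono_left nhdsWithin_le_nhds).congr' ?_
    filter_upwards [self_mem_nhdsWithin] with k hk
    have := hne k (ne_of_gt hk)
    rw [hpow, Complex.ofReal_pow, ← realRoot_of_pos hk]
    rw [← realRoot_of_pos hk] at this
    field_simp
  · refine ((hlim.const_mul _).mono_left nhdsWithin_le_nhds).congr' ?_
    filter_upwards [self_mem_nhdsWithin] with k hk
    have := hne k (ne_of_lt hk)
    rw [hpow, Complex.ofReal_pow]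
    generalize b (realRoot q k) = y
    rw [realRoot_of_neg hk, mul_pow, eq_div_iff (pow_ne_zero _ this)]
    ring

/-- Among the products of a nonzero number with the powers of `e^{iπp/q}`, `0 < p < q`, some
have positive real part. -/
lemma exists_re_pos {p : ℕ} (hp : 1 ≤ p) (hpq : p < q) {c : ℂ} (hc : c ≠ 0) :
    ∃ η : ℂ, (η ^ q = 1 ∨ η ^ q = -1) ∧ 0 < (η ^ p * c).re := by
  let ζ : ℂ := Complex.exp (2 * Real.pi * Complex.I / ((2 * q : ℕ) : ℂ))
  have hζ : IsPrimitiveRoot ζ (2 * q) := Complex.isPrimitiveRoot_exp _ (by omega)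
  have hζq : ζ ^ q = 1 ∨ ζ ^ q = -1 := by
    have h1 : (ζ ^ q - 1) * (ζ ^ q + 1) = 0 := by
      have := hζ.pow_eq_one
      rw [mul_comm, pow_mul] at this
      linear_combination this
    exact (mul_eq_zero.1 h1).imp sub_eq_zero.1 eq_neg_of_add_eq_zero_left
  by_contra! hneg
  have h1 : ∀ j : ℕ, ((ζ ^ p) ^ j * c).re ≤ 0 := fun j => by
    have := hneg (ζ ^ j) (by
      rw [← pow_mul, mul_comm, pow_mul]
      rcases hζq with h | h <;> rw [h]
      · simp
      · exact neg_one_pow_eq_or ℂ j)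
    rwa [← pow_mul, mul_comm, mul_comm j p, pow_mul, mul_comm] at this
  have hx : ζ ^ p ≠ 1 := fun h => by
    have := Nat.le_of_dvd (by omega) ((hζ.pow_eq_one_iff_dvd p).1 h); omega
  have hx2 : (ζ ^ p) ^ 2 ≠ 1 := fun h => by
    rw [← pow_mul] at h
    have := Nat.le_of_dvd (by omega) ((hζ.pow_eq_one_iff_dvd _).1 h); omega
  have hxn : ‖ζ ^ p‖ = 1 := by rw [norm_pow, hζ.norm'_eq_one (by omega), one_pow]
  have hsum : ∑ j ∈ Finset.range (2 * q), (ζ ^ p) ^ j * c = 0 := by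
    rw [← Finset.sum_mul]
    have := mul_neg_geom_sum (ζ ^ p) (2 * q)
    rw [← pow_mul, mul_comm p, pow_mul, hζ.pow_eq_one, one_pow, sub_self] at this
    rw [(mul_eq_zero.1 this).resolve_left (sub_ne_zero.2 hx.symm), zero_mul]
  -- The products sum to zero, so if all real parts are nonpositive they all vanish. The cases `j =
  -- 0` and `j = 1` then make `ζ ^ p` real, against `(ζ ^ p)² ≠ 1`, which holds because `0 < 2p <
  -- 2q`.
  have hre : ∀ j ∈ Finset.range (2 * q), ((ζ ^ p) ^ j * c).re = 0 := by
    refine (Finset.sum_eq_zero_iff_of_nonpos fun j _ => h1 j).1 ?_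
    rw [← Complex.re_sum, hsum, Complex.zero_re]
  have h2 := hre 0 (by simp; omega)
  have h3 := hre 1 (by simp; omega)
  rw [pow_zero, one_mul] at h2
  rw [pow_one, Complex.mul_re, h2, mul_zero, zero_sub, neg_eq_zero, mul_eq_zero] at h3
  have h4 : (ζ ^ p).im = 0 := h3.resolve_right fun h => hc (Complex.ext h2 h)
  apply hx2
  have h5 : Complex.normSq (ζ ^ p) = 1 := by rw [Complex.normSq_eq_norm_sq, hxn, one_pow]
  rw [Complex.normSq_apply, h4] at h5
  apply Complex.ext
  · rw [pow_two, Complex.mul_re, h4, Complex.one_re]; linarith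
  · rw [pow_two, Complex.mul_im, h4]; simp

end RealBranches

end

/-! ### Assembling the curves of zeros -/

section

section BranchTheorem

lemma analyticOrderAt_of_eventually_eq_prod {ι : Type} [Fintype ι] (c : ι → ℂ) {g V : ℂ → ℂ} {z : ℂ}
    (hV : AnalyticAt ℂ V z) (hVz : V z ≠ 0) (hg : ∀ᶠ w in 𝓝 z, g w = (∏ i, (w - c i)) * V w) :
    analyticOrderAt g z = (Nat.card {i // c i = z} : ℕ∞) := by
  classical
  rw [analyticOrderAt_congr (hg : g =ᶠ[𝓝 z] _)]
  have hp : AnalyticAt ℂ (fun w => ∏ i : {i // ¬ c i = z}, (w - c i)) z := by fun_prop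
  refine (AnalyticAt.analyticOrderAt_eq_natCast (by fun_prop)).2
    ⟨fun w => (∏ i : {i // ¬ c i = z}, (w - c i)) * V w, hp.mul hV, ?_, Eventually.of_forall
    fun w => ?_⟩
  · exact mul_ne_zero (Finset.prod_ne_zero_iff.2 fun i _ => sub_ne_zero.2 (Ne.symm i.2)) hVz
  · rw [← Fintype.prod_subtype_mul_prod_subtype (fun i => c i = z), smul_eq_mul, ← mul_assoc,
      Nat.card_eq_fintype_card]
    congr 2
    rw [Fintype.card, ← Finset.prod_const]
    exact Finset.prod_congr rfl fun i _ => by rw [i.2]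

/-- The zeros `curve i k` of `D(k, ·)` near the origin, for small real `k`. -/
def ZerosNearOrigin (D : ℂ × ℂ → ℂ) (δ ε : ℝ) {ι : Type} [Fintype ι] (curve : ι → ℝ → ℂ) : Prop :=
  ∀ k : ℝ, |k| < δ → (∀ i, ‖curve i k‖ < ε) ∧ ∀ z : ℂ, ‖z‖ < ε →
    ∃ V : ℂ → ℂ, AnalyticAt ℂ V z ∧ V z ≠ 0 ∧
      ∀ᶠ w in 𝓝 z, D ((k : ℂ), w) = (∏ i, (w - curve i k)) * V w

/-- A branch whose slope is simple is single-valued. -/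
lemma eventually_mul_unity {η : ℂ} {D U : ℂ × ℂ → ℂ} {ι κ : Type} [Fintype ι]
    [Fintype κ] {q : ℕ} {Ψ : ι → ℂ → ℂ} {p : κ → ℕ} {b : κ → ℂ → ℂ}
    (hq : 1 ≤ q) (hΨ : ∀ i, AnalyticAt ℂ (Ψ i) 0)
    (hb : ∀ i, 1 ≤ p i ∧ p i < q ∧ AnalyticAt ℂ (b i) 0 ∧ b i 0 ≠ 0)
    (hU : AnalyticAt ℂ U (0, 0)) (hU0 : U (0, 0) ≠ 0)
    (hfac : ∀ᶠ x in 𝓝 ((0 : ℂ), (0 : ℂ)), D (x.1 ^ q, x.2) =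
        (∏ i, (x.2 - x.1 ^ q * Ψ i x.1)) * (∏ i, (x.2 - x.1 ^ p i * b i x.1)) * U x)
    (i : ι) (hi : ∀ j, Ψ j 0 = Ψ i 0 → j = i) (hη : η ^ q = 1) :
    ∀ᶠ t in 𝓝 0, Ψ i (η * t) = Ψ i t := by
  have hq0 : q ≠ 0 := by omega
  have hmul : Tendsto (fun t : ℂ => η * t) (𝓝 0) (𝓝 0) := by
    have : Continuous fun t : ℂ => η * t := by fun_prop
    simpa using this.tendsto 0
  have hc : ContinuousAt (fun t => Ψ i (η * t)) 0 := by
    have h1 : ContinuousAt (fun t : ℂ => η * t) 0 := by fun_prop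
    exact ContinuousAt.comp_of_eq (hΨ i).continuousAt h1 (by simp)
  have ht1 : Tendsto (fun t : ℂ => (t, t ^ q * Ψ i (η * t))) (𝓝 0) (𝓝 (0, 0)) := by
    have : ContinuousAt (fun t : ℂ => (t, t ^ q * Ψ i (η * t))) 0 :=
      continuousAt_id.prodMk ((continuousAt_id.pow q).mul hc)
    simpa [ContinuousAt, hq0] using this
  have ht2 : Tendsto (fun t : ℂ => (η * t, t ^ q * Ψ i (η * t))) (𝓝 0) (𝓝 (0, 0)) := by
    have : ContinuousAt (fun t : ℂ => (η * t, t ^ q * Ψ i (η * t))) 0 :=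
      (continuousAt_const.mul continuousAt_id).prodMk ((continuousAt_id.pow q).mul hc)
    simpa [ContinuousAt, hq0] using this
  have hA : ∀ᶠ t in 𝓝 (0 : ℂ), ∀ j, j ≠ i → Ψ i (η * t) - Ψ j t ≠ 0 := by
    refine eventually_all.2 fun j => ?_
    by_cases hj : j = i
    · simp [hj]
    · have h1 : ContinuousAt (fun t => Ψ i (η * t) - Ψ j t) 0 := hc.sub (hΨ j).continuousAt
      filter_upwards [h1.eventually_ne (y := 0) (by
        simpa using sub_ne_zero.2 fun h => hj (hi j h.symm))] with t ht _ using ht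
  have hB : ∀ᶠ t in 𝓝 (0 : ℂ), ∀ j, t ^ (q - p j) * Ψ i (η * t) - b j t ≠ 0 := by
    refine eventually_all.2 fun j => ?_
    have h1 : ContinuousAt (fun t => t ^ (q - p j) * Ψ i (η * t) - b j t) 0 :=
      ((continuousAt_id.pow _).mul hc).sub (hb j).2.2.1.continuousAt
    refine h1.eventually_ne ?_
    have : q - p j ≠ 0 := by have := (hb j).2.1; omega
    simp [this, (hb j).2.2.2]
  have hUne : ∀ᶠ x in 𝓝 ((0 : ℂ), (0 : ℂ)), U x ≠ 0 := hU.continuousAt.eventually_ne hU0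
  -- The points `t` and `η t` have the same `q`-th power, so the `i`-th root at `η t` is one of the
  -- roots at `t`. The fractional branches are larger and the other `O(k)` branches have different
  -- slopes; only the `i`-th branch can match.
  filter_upwards [ht1.eventually hfac, ht2.eventually hfac, hA, hB, ht1.eventually hUne]
    with t h1 h2 h3 h4 h5
  by_cases ht : t = 0
  · simp [ht]
  rw [mul_pow, hη, one_mul] at h2
  rw [h2, Finset.prod_eq_zero (Finset.mem_univ i) (sub_self _), zero_mul, zero_mul] at h1
  have h6 := (mul_eq_zero.1 h1.symm).resolve_right h5
  have h7 : ∏ j, (t ^ q * Ψ i (η * t) - t ^ p j * b j t) ≠ 0 := by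
    refine Finset.prod_ne_zero_iff.2 fun j _ => ?_
    have h8 : t ^ q = t ^ p j * t ^ (q - p j) := by
      rw [← pow_add]; congr 1; have := (hb j).2.1; omega
    rw [h8, mul_assoc, ← mul_sub]
    exact mul_ne_zero (pow_ne_zero _ ht) (h4 j)
  obtain ⟨j, -, hj⟩ := Finset.prod_eq_zero_iff.1 ((mul_eq_zero.1 h6).resolve_right h7)
  rw [← mul_sub] at hj
  have h9 := (mul_eq_zero.1 hj).resolve_left (pow_ne_zero _ ht)
  have h10 : j = i := by
    by_contra h
    exact h3 j h h9
  rw [h10] at h9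
  exact sub_eq_zero.1 h9

/-- The zeros near the origin of a function `D` with `D(k, kμ) ~ C k ^ (n + 1) μ ∏ (μ + i T α_j)`. -/
theorem exists_branches {D : ℂ × ℂ → ℂ} (hD : AnalyticAt ℂ D (0, 0)) {d : ℕ}
    (hord : analyticOrderAt (fun μ => D (0, μ)) 0 = d) {n r : ℕ} {T : ℝ} (hT : T ≠ 0)
    {α : Fin r → ℂ} (hα : ∀ j, α j ≠ 0) {C : ℂ} (hC : C ≠ 0)
    (hlim : ∀ μ : ℂ, Tendsto (fun k : ℂ => D (k, k * μ) / k ^ (n + 1)) (𝓝[≠] 0)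
      (𝓝 (C * (μ * ∏ j, (μ + Complex.I * T * α j))))) :
    ∃ δ > 0, ∃ ε > 0, ∃ lam : Fin (r + 1) → ℝ → ℂ, ∃ (m : ℕ) (ν : Fin m → ℝ → ℂ) (e : Fin m → ℚ),
      n ≤ r + m ∧ (r = n → m = 0) ∧ ZerosNearOrigin D δ ε (Sum.elim lam ν) ∧
      SmoothBranches T δ α lam ∧ (∀ i, 0 < e i ∧ e i < 1 ∧ PowerBranch δ (ν i) (e i)) ∧
      (m ≠ 0 → ∃ (k : ℝ) (z : ℂ), 0 < z.re ∧ D ((k : ℂ), z) = 0) := by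
  let Q : Polynomial ℂ := Polynomial.C C * (Polynomial.X *
    ∏ j, (Polynomial.X - Polynomial.C (-(Complex.I * T * α j))))
  let R : Polynomial ℂ := ∏ j, (Polynomial.X - Polynomial.C (-(Complex.I * T * α j)))
  have hR : R.Monic := Polynomial.monic_prod_X_sub_C _ _
  have hXR : Polynomial.X * R ≠ 0 := mul_ne_zero Polynomial.X_ne_zero hR.ne_zero
  have hQ : Q ≠ 0 := mul_ne_zero (Polynomial.C_ne_zero.2 hC) hXR
  have hQe : ∀ μ, Q.eval μ = C * (μ * ∏ j, (μ + Complex.I * T * α j)) := fun μ => by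
    simp [Q, Polynomial.eval_prod]
  let root : Fin (r + 1) → ℂ := Fin.cons 0 fun j => -(Complex.I * T * α j)
  have hQroots : Q.roots = Finset.univ.val.map root := by
    have h1 : R.roots = Finset.univ.val.map fun j => -(Complex.I * T * α j) := by
      rw [Polynomial.roots_prod _ _ hR.ne_zero]
      simp only [Polynomial.roots_X_sub_C, Multiset.bind_singleton]
    change (Polynomial.C C * (Polynomial.X * R)).roots = _
    rw [Polynomial.roots_C_mul _ hC, Polynomial.roots_mul hXR, Polynomial.roots_X, h1,
      Fin.univ_succ]
    simp [root]
  obtain ⟨ι, κ, _, _, q, Ψ', p', b', U, hq, hΨ', hb', hU, hU0, hfac', hcount, hroots⟩ :=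
    exists_branch_factorization hD hord hQ (N := n + 1) fun μ => by rw [hQe]; exact hlim μ
  obtain ⟨eA, heA⟩ := exists_equiv_of_map_univ_eq (hQroots.symm.trans hroots)
  let eB : Fin (Fintype.card κ) ≃ κ := (Fintype.equivFin κ).symm
  obtain ⟨m, hm⟩ : ∃ m, m = Fintype.card κ := ⟨_, rfl⟩
  rw [← hm] at eB
  let Ψ : Fin (r + 1) → ℂ → ℂ := fun i => Ψ' (eA i)
  let p : Fin m → ℕ := fun i => p' (eB i)
  let b : Fin m → ℂ → ℂ := fun i => b' (eB i)
  have hΨ : ∀ i, AnalyticAt ℂ (Ψ i) 0 := fun i => hΨ' _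
  have hΨ0 : ∀ i, Ψ i 0 = root i := heA
  have hb : ∀ i, 1 ≤ p i ∧ p i < q ∧ AnalyticAt ℂ (b i) 0 ∧ b i 0 ≠ 0 := fun i => hb' _
  have hfac : ∀ᶠ x in 𝓝 ((0 : ℂ), (0 : ℂ)), D (x.1 ^ q, x.2) =
      (∏ i, (x.2 - x.1 ^ q * Ψ i x.1)) * (∏ i, (x.2 - x.1 ^ p i * b i x.1)) * U x := by
    filter_upwards [hfac'] with x hx
    rw [hx, ← Equiv.prod_comp eA, ← Equiv.prod_comp eB]
  have hcount' : q * (r + 1) + ∑ i, p i = q * (n + 1) := by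
    rw [← hcount, ← Equiv.sum_comp eB, ← Fintype.card_congr eA, Fintype.card_fin]
  clear_value Ψ p b
  have hq0 : q ≠ 0 := by omega
  have hIT : Complex.I * (T : ℂ) ≠ 0 := mul_ne_zero Complex.I_ne_zero (by exact_mod_cast hT)
  have hroot0 : root 0 = 0 := rfl
  have hrootS : ∀ j, root (Fin.succ j) = -(Complex.I * T * α j) := fun j => rfl
  have hrootS0 : ∀ j, root (Fin.succ j) ≠ 0 := fun j => by
    rw [hrootS]; exact neg_ne_zero.2 (mul_ne_zero hIT (hα j))
  have hsimple0 : ∀ j, Ψ j 0 = Ψ 0 0 → j = 0 := by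
    intro j hj
    rw [hΨ0, hΨ0, hroot0] at hj
    refine Fin.cases (fun _ => rfl) (fun l hl => absurd hl (hrootS0 l)) j hj
  have hsimpleS : ∀ i : Fin r, (∀ l, α l = α i → l = i) → ∀ j, Ψ j 0 = Ψ i.succ 0 → j = i.succ := by
    intro i hi j hj
    rw [hΨ0, hΨ0] at hj
    refine Fin.cases (fun h => absurd h.symm (hrootS0 i)) (fun l hl => ?_) j hj
    rw [hrootS, hrootS] at hl
    rw [hi l (mul_left_cancel₀ hIT (neg_injective hl))]
  have hg : ∀ i, ∃ g : ℂ → ℂ, (∀ j, Ψ j 0 = Ψ i 0 → j = i) →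
      AnalyticAt ℂ g 0 ∧ ∀ᶠ t in 𝓝 0, Ψ i t = g (t ^ q) := by
    intro i
    by_cases hi : ∀ j, Ψ j 0 = Ψ i 0 → j = i
    · have hη := Complex.isPrimitiveRoot_exp q hq0
      obtain ⟨g, h1, h2⟩ := exists_eq_comp_pow (hΨ i) hq hη
        (eventually_mul_unity hq hΨ hb hU hU0 hfac i hi hη.pow_eq_one)
      exact ⟨g, fun _ => ⟨h1, h2⟩⟩
    · exact ⟨0, fun h => absurd h hi⟩
  choose g hg using hg
  obtain ⟨ε, hε, hball⟩ := Metric.eventually_nhds_iff.1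
    (hfac.and (hU.eventually_analyticAt.and (hU.continuousAt.eventually_ne hU0)))
  have hpow : Tendsto (fun t : ℂ => t ^ q) (𝓝 0) (𝓝 0) := by
    have : Continuous fun t : ℂ => t ^ q := by fun_prop
    simpa [hq0] using this.tendsto 0
  have hΨev : ∀ i, ∀ᶠ t in 𝓝 (0 : ℂ), AnalyticAt ℂ (Ψ i) t ∧ ‖t ^ q * Ψ i t‖ < ε ∧
      ((∀ j, Ψ j 0 = Ψ i 0 → j = i) → AnalyticAt ℂ (g i) (t ^ q) ∧ Ψ i t = g i (t ^ q)) := by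
    intro i
    have h1 : ContinuousAt (fun t => ‖t ^ q * Ψ i t‖) 0 := by
      have := (hΨ i).continuousAt
      fun_prop
    refine (hΨ i).eventually_analyticAt.and ((h1.eventually_lt_const (by simpa [hq0] using hε)).and ?_)
    by_cases hi : ∀ j, Ψ j 0 = Ψ i 0 → j = i
    · filter_upwards [hpow.eventually (hg i hi).1.eventually_analyticAt, (hg i hi).2] with t h2 h3 _
        using ⟨h2, h3⟩
    · exact Eventually.of_forall fun t h => absurd h hi
  have hbev : ∀ i, ∀ᶠ t in 𝓝 (0 : ℂ), AnalyticAt ℂ (b i) t ∧ ‖t ^ p i * b i t‖ < ε := by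
    intro i
    have h1 : ContinuousAt (fun t => ‖t ^ p i * b i t‖) 0 := by
      have := (hb i).2.2.1.continuousAt
      fun_prop
    have : p i ≠ 0 := by have := (hb i).1; omega
    exact (hb i).2.2.1.eventually_analyticAt.and
      (h1.eventually_lt_const (by simpa [this] using hε))
  have hnorm : ∀ᶠ t in 𝓝 (0 : ℂ), ‖t‖ < ε := by
    filter_upwards [Metric.ball_mem_nhds (0 : ℂ) hε] with t ht using mem_ball_zero_iff.1 ht
  obtain ⟨δ, hδ, hall⟩ := Metric.eventually_nhds_iff.1 ((tendsto_realRoot hq).eventually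
    (hnorm.and ((eventually_all.2 hΨev).and (eventually_all.2 hbev))))
  have hall' : ∀ k ∈ Set.Ioo (-δ) δ, _ := fun k hk => hall (y := k) (by
    rw [Real.dist_eq, sub_zero]; exact abs_lt.2 hk)
  let lam : Fin (r + 1) → ℝ → ℂ := fun i k => k * Ψ i (realRoot q k)
  let ν : Fin m → ℝ → ℂ := fun i k => realRoot q k ^ p i * b i (realRoot q k)
  have hsmooth : ∀ i, (∀ j, Ψ j 0 = Ψ i 0 → j = i) → ContDiffOn ℝ ∞ (lam i) (Set.Ioo (-δ) δ) := by
    intro i hi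
    have h1 : ContDiffOn ℝ ∞ (fun k : ℝ => (k : ℂ) * g i k) (Set.Ioo (-δ) δ) := by
      intro k hk
      have h2 := (((hall' k hk).2.1 i).2.2 hi).1
      rw [realRoot_pow hq] at h2
      exact (Complex.ofRealCLM.contDiff.contDiffAt.mul ((h2.contDiffAt.restrict_scalars ℝ).comp k
        Complex.ofRealCLM.contDiff.contDiffAt)).contDiffWithinAt
    refine h1.congr fun k hk => ?_
    have h2 := (((hall' k hk).2.1 i).2.2 hi).2
    rw [realRoot_pow hq] at h2
    simp only [lam, h2]
  have hlittle : ∀ i, (fun k : ℝ => lam i k - k * root i) =o[𝓝 0] fun k : ℝ => k := fun i => by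
    simpa only [hΨ0 i] using isLittleO_mul_comp_realRoot hq (hΨ i)
  refine ⟨δ, hδ, ε, hε, lam, m, ν, fun i => p i / q, ?_, ?_, ?_, ⟨hsmooth 0 hsimple0, ?_, fun j =>
    ⟨contDiffOn_one_mul_comp_realRoot hq fun k hk => ((hall' k hk).2.1 _).1,
      contDiffOn_infty_mul_comp_realRoot fun k hk => ((hall' k hk).2.1 _).1,
      fun hj => hsmooth _ (hsimpleS j hj), ?_⟩⟩, fun i => ⟨?_, ?_, ?_⟩, ?_⟩
  -- The orders satisfy `q (r + 1) + ∑ p i = q (n + 1)`. From `p i < q` comes `n ≤ r + m`; if `r =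
  -- n`, then `1 ≤ p i` leaves no fractional branch.
  · have h1 : ∑ i, p i ≤ q * m := by
      calc ∑ i, p i ≤ ∑ _i : Fin m, q := Finset.sum_le_sum fun i _ => (hb i).2.1.le
        _ = q * m := by simp [mul_comm]
    have h2 : q * (n + 1) ≤ q * (r + 1 + m) := by rw [mul_add q (r + 1)]; omega
    have := Nat.le_of_mul_le_mul_left h2 (by omega)
    omega
  · rintro rfl
    by_contra hm0
    have h1 : ∑ i, p i = 0 := by omega
    have h2 := Finset.sum_eq_zero_iff.1 h1 ⟨0, by omega⟩ (Finset.mem_univ _)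
    have := (hb ⟨0, by omega⟩).1
    omega
  · intro k hk
    have hk' := hall' k (abs_lt.1 hk)
    refine ⟨?_, fun z hz => ⟨fun w => U (realRoot q k, w), ?_, ?_, ?_⟩⟩
    · rintro (i | i)
      · have := (hk'.2.1 i).2.1
        rw [realRoot_pow hq] at this
        exact this
      · exact (hk'.2.2 i).2
    · have h1 : dist (realRoot q k, z) ((0 : ℂ), (0 : ℂ)) < ε := by
        simpa [Prod.dist_eq, dist_eq_norm] using ⟨hk'.1, hz⟩
      exact analyticAt_mk_left (hball h1).2.1
    · have h1 : dist (realRoot q k, z) ((0 : ℂ), (0 : ℂ)) < ε := by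
        simpa [Prod.dist_eq, dist_eq_norm] using ⟨hk'.1, hz⟩
      exact (hball h1).2.2
    · have h2 : ∀ᶠ w in 𝓝 z, ‖w‖ < ε := continuous_norm.continuousAt.eventually_lt_const hz
      filter_upwards [h2] with w hw
      have h1 : dist (realRoot q k, w) ((0 : ℂ), (0 : ℂ)) < ε := by
        simpa [Prod.dist_eq, dist_eq_norm] using ⟨hk'.1, hw⟩
      have h3 := (hball h1).1
      simp only [realRoot_pow hq] at h3
      rw [h3, Fintype.prod_sum_type]
      rfl
  · simpa [hroot0] using hlittle 0
  · refine (hlittle j.succ).congr_left fun k => ?_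
    rw [hrootS]; ring
  · exact div_pos (by exact_mod_cast (hb i).1) (by exact_mod_cast hq)
  · exact (div_lt_one (by exact_mod_cast hq)).2 (by exact_mod_cast (hb i).2.1)
  · exact powerBranch_realRoot hq hδ (p i) (fun k hk => ((hall' k hk).2.2 i).1) (hb i).2.2.2
  · intro hm0
    obtain ⟨i⟩ : Nonempty (Fin m) := ⟨⟨0, by omega⟩⟩
    obtain ⟨hp1, hpq, hbi, hb0⟩ := hb i
    -- The factorization holds for all small complex `t`, not just principal roots. With `t = η τ`
    -- and `η ^ q = ±1` the exponent `t ^ q` is real, so every determination of the branch gives a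
    -- zero of `D` at a real `k`.
    obtain ⟨η, hη, hre⟩ := exists_re_pos hp1 hpq hb0
    have h0 : Tendsto (fun τ : ℝ => η * (τ : ℂ)) (𝓝[>] 0) (𝓝 0) := by
      have : Continuous fun τ : ℝ => η * (τ : ℂ) := by fun_prop
      simpa using (this.tendsto 0).mono_left nhdsWithin_le_nhds
    have h1 : Tendsto (fun τ : ℝ => (η ^ p i * b i (η * τ)).re) (𝓝[>] 0)
        (𝓝 (η ^ p i * b i 0).re) :=
      (Complex.continuous_re.tendsto _).comp ((hbi.continuousAt.tendsto.comp h0).const_mul _)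
    have h2 : Tendsto (fun t : ℂ => (t, t ^ p i * b i t)) (𝓝 0) (𝓝 (0, 0)) := by
      have : ContinuousAt (fun t : ℂ => (t, t ^ p i * b i t)) 0 := by
        have := hbi.continuousAt
        fun_prop
      simpa [ContinuousAt, show p i ≠ 0 by omega] using this
    obtain ⟨τ, ⟨h3, h4⟩, h5⟩ := ((h1.eventually_const_lt hre).and
      ((h2.comp h0).eventually hfac)).and self_mem_nhdsWithin |>.exists
    obtain ⟨k, hk⟩ : ∃ k : ℝ, (k : ℂ) = (η * τ) ^ q := by
      rcases hη with h | h
      · exact ⟨τ ^ q, by rw [mul_pow, h]; simp⟩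
      · exact ⟨-τ ^ q, by rw [mul_pow, h]; simp⟩
    refine ⟨k, (η * τ) ^ p i * b i (η * τ), ?_, ?_⟩
    · have h6 : (η * τ) ^ p i * b i (η * τ) = ((τ ^ p i : ℝ) : ℂ) * (η ^ p i * b i (η * τ)) := by
        push_cast; ring
      rw [h6, Complex.re_ofReal_mul]
      exact mul_pos (pow_pos h5 _) h3
    · rw [hk]
      simp only [Function.comp_apply] at h4
      rw [h4, Finset.prod_eq_zero (f := fun j => (η * τ) ^ p i * b i (η * τ) -
        (η * τ) ^ p j * b j (η * τ)) (Finset.mem_univ i) (sub_self _)]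
      ring

end BranchTheorem

end

/-! ### The matrix pencil and the spectral branches -/

section

section Algebra

variable {n : ℕ}

lemma analyticAt_det {V : Type*} [NormedAddCommGroup V] [NormedSpace ℂ V] [FiniteDimensional ℂ V]
    (A₀ : V →L[ℂ] V) : AnalyticAt ℂ (fun A : V →L[ℂ] V => A.det) A₀ := by
  let b := Module.finBasis ℂ V
  have hb : (fun A : V →L[ℂ] V => A.det) = fun A => ∑ σ : Equiv.Perm (Fin (Module.finrank ℂ V)),
      ((Equiv.Perm.sign σ : ℤ) : ℂ) * ∏ i, b.coord (σ i) (A (b i)) := by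
    funext A
    rw [ContinuousLinearMap.det, ← LinearMap.det_toMatrix b, Matrix.det_apply']
    simp only [LinearMap.toMatrix_apply, Module.Basis.coord_apply, ContinuousLinearMap.coe_coe]
  rw [hb]
  refine Finset.analyticAt_fun_sum _ fun σ _ => analyticAt_const.mul
    (Finset.analyticAt_fun_prod _ fun i _ => ?_)
  exact (((LinearMap.toContinuousLinearMap (b.coord (σ i))) ∘L
    ContinuousLinearMap.apply ℂ V (b i)).analyticAt A₀)

lemma det_smul_one_add_smul (M : Matrix (Fin n) (Fin n) ℂ) (x y : ℂ) :
    (x • (1 : Matrix (Fin n) (Fin n) ℂ) + y • M).det =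
      (M.charpoly.roots.map fun κ => x + y * κ).prod := by
  have hsplit : M.charpoly.Splits := IsAlgClosed.splits _
  have hcard : M.charpoly.roots.card = n := by
    rw [← hsplit.natDegree_eq_card_roots, M.charpoly_natDegree_eq_dim, Fintype.card_fin]
  by_cases hy : y = 0
  · simp [hy, hcard]
  · have h1 : x • (1 : Matrix (Fin n) (Fin n) ℂ) + y • M =
        (-y) • (Matrix.scalar (Fin n) (-x / y) - M) := by
      ext i j
      by_cases hij : i = j
      · subst hij
        simp
        field_simp
        ring
      · simp [hij]
    have h2 : (fun κ => x + y * κ) = fun κ => -y * (-x / y - κ) := by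
      funext κ
      field_simp
      ring
    rw [h1, Matrix.det_smul, ← Matrix.eval_charpoly, hsplit.eval_eq_prod_roots_of_monic
      M.charpoly_monic, h2, Multiset.prod_map_mul, Multiset.map_const', Multiset.prod_replicate,
      hcard, Fintype.card_fin]

lemma prod_map_univ {r : ℕ} (α : Fin r → ℂ) (g : ℂ → ℂ) :
    ((Finset.univ.val.map α).map g).prod = ∏ j, g (α j) := by
  rw [Multiset.map_map]; rfl

lemma exists_eq_map_univ {X : Type*} (s : Multiset X) {r : ℕ} (hs : s.card = r) :
    ∃ α : Fin r → X, s = Finset.univ.val.map α := by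
  obtain ⟨l, rfl⟩ : ∃ l : List X, (l : Multiset X) = s := ⟨s.toList, s.coe_toList⟩
  obtain rfl : l.length = r := hs
  exact ⟨l.get, by rw [Fin.univ_val_map, List.ofFn_get]⟩

variable {N J : Matrix (Fin n) (Fin n) ℝ}

lemma det_pencil_of_det_ne_zero (hN : N.det ≠ 0) {α : Fin n → ℂ}
    (hα : (cplx (J * N⁻¹)).charpoly.roots = Finset.univ.val.map α) (c μ : ℂ) :
    (μ • cplx N + c • cplx J).det = N.det * ∏ j, (μ + c * α j) := by
  have h1 : μ • cplx N + c • cplx J =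
      (μ • (1 : Matrix (Fin n) (Fin n) ℂ) + c • cplx (J * N⁻¹)) * cplx N := by
    rw [add_mul, smul_mul_assoc, smul_mul_assoc, one_mul, cplx_mul, mul_assoc,
      cplx_inv_mul_cancel hN, mul_one]
  rw [h1, Matrix.det_mul, det_smul_one_add_smul, hα, prod_map_univ, det_cplx, mul_comm]

lemma ne_zero_of_roots (hN : N.det ≠ 0) (hJ : J.det ≠ 0) {α : Fin n → ℂ}
    (hα : (cplx (J * N⁻¹)).charpoly.roots = Finset.univ.val.map α) (j : Fin n) : α j ≠ 0 := by
  intro h0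
  have h1 := det_pencil_of_det_ne_zero hN hα 1 0
  rw [zero_smul, zero_add, one_smul, det_cplx, Finset.prod_eq_zero (Finset.mem_univ j)
    (by simp [h0]), mul_zero] at h1
  exact hJ (by exact_mod_cast h1)

/-- Factoring out `J` leaves `det (c + μ N J⁻¹)`, the product of `c + μ κ` over the eigenvalues `κ`.
Zero eigenvalues contribute the constant `c` and lower the degree; the others give the roots `-c /
β`. -/
lemma exists_det_pencil_of_nonzero_roots (hJ : J.det ≠ 0) {r : ℕ} {β : Fin r → ℂ}
    (hβ : (cplx (N * J⁻¹)).charpoly.roots.filter (· ≠ 0) = Finset.univ.val.map β) {c : ℂ}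
    (hc : c ≠ 0) : ∃ C : ℂ, C ≠ 0 ∧ ∀ μ : ℂ,
      (μ • cplx N + c • cplx J).det = C * ∏ j, (μ + c * (β j)⁻¹) := by
  have hβ0 : ∀ j, β j ≠ 0 := fun j => by
    have h1 : β j ∈ (cplx (N * J⁻¹)).charpoly.roots.filter (· ≠ 0) := by
      rw [hβ]; exact Multiset.mem_map_of_mem _ (Finset.mem_univ_val j)
    exact (Multiset.mem_filter.1 h1).2
  have hJc : (cplx J).det ≠ 0 := by rw [det_cplx]; exact_mod_cast hJ
  set s := (cplx (N * J⁻¹)).charpoly.roots with hs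
  refine ⟨c ^ (s.filter fun κ => ¬ κ ≠ 0).card * (∏ j, β j) * (cplx J).det,
    mul_ne_zero (mul_ne_zero (pow_ne_zero _ hc) (Finset.prod_ne_zero_iff.2 fun j _ => hβ0 j)) hJc,
    fun μ => ?_⟩
  have h1 : μ • cplx N + c • cplx J =
      (c • (1 : Matrix (Fin n) (Fin n) ℂ) + μ • cplx (N * J⁻¹)) * cplx J := by
    rw [add_mul, smul_mul_assoc, smul_mul_assoc, one_mul, cplx_mul, mul_assoc,
      cplx_inv_mul_cancel hJ, mul_one, add_comm]
  have h2 : ((s.filter fun κ => ¬ κ ≠ 0).map fun κ => c + μ * κ).prod =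
      c ^ (s.filter fun κ => ¬ κ ≠ 0).card := by
    rw [Multiset.map_congr rfl (g := fun _ => c) fun κ hκ => ?_, Multiset.map_const',
      Multiset.prod_replicate]
    rw [not_not.1 (Multiset.mem_filter.1 hκ).2, mul_zero, add_zero]
  have h3 : ∏ j, (c + μ * β j) = (∏ j, β j) * ∏ j, (μ + c * (β j)⁻¹) := by
    rw [← Finset.prod_mul_distrib]
    refine Finset.prod_congr rfl fun j _ => ?_
    have := hβ0 j
    field_simp
    ring
  have h4 : (s.map fun κ => c + μ * κ).prod =
      ((s.filter (· ≠ 0)).map fun κ => c + μ * κ).prod *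
        ((s.filter fun κ => ¬ κ ≠ 0).map fun κ => c + μ * κ).prod := by
    rw [← Multiset.prod_add, ← Multiset.map_add, Multiset.filter_add_not]
  rw [h1, Matrix.det_mul, det_smul_one_add_smul, ← hs, h4, hβ, prod_map_univ, h2, h3]
  ring

lemma lt_of_nonzero_roots (hN : N.det = 0) {r : ℕ} {β : Fin r → ℂ}
    (hβ : (cplx (N * J⁻¹)).charpoly.roots.filter (· ≠ 0) = Finset.univ.val.map β) : r < n := by
  set M := cplx (N * J⁻¹) with hM
  have hsplit : M.charpoly.Splits := IsAlgClosed.splits _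
  have hcard : M.charpoly.roots.card = n := by
    rw [← hsplit.natDegree_eq_card_roots, M.charpoly_natDegree_eq_dim, Fintype.card_fin]
  have h0 : (0 : ℂ) ∈ M.charpoly.roots := by
    rw [Polynomial.mem_roots M.charpoly_monic.ne_zero, Polynomial.IsRoot, Matrix.eval_charpoly]
    simp [Matrix.det_neg, hM, cplx_mul, det_cplx, hN]
  have h1 : M.charpoly.roots.filter (· ≠ 0) < M.charpoly.roots := by
    refine lt_of_le_of_ne (Multiset.filter_le _ _) fun h => ?_
    exact (Multiset.filter_eq_self.1 h) 0 h0 rfl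
  have h2 := Multiset.card_lt_card h1
  rw [hβ, hcard] at h2
  simpa using h2

end Algebra

namespace Admissible

variable {n : ℕ} {f : (Fin n → ℝ) → (Fin n → ℝ)} {B : (Fin n → ℝ) → Matrix (Fin n) (Fin n) ℝ}
  {T : ℝ} {um : Fin n → ℝ} {ubar : ℝ → Fin n → ℝ} (h : Admissible f B T um ubar)
include h

lemma analyticAt_evansC (x : ℂ × ℂ) : AnalyticAt ℂ (fun p : ℂ × ℂ => h.evansC p.1 p.2) x := by
  have h1 : AnalyticAt ℂ (fun p : ℂ × ℂ => h.fluxMonodromy p.2) x :=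
    (h.differentiable_fluxMonodromy.analyticAt x.2).comp_of_eq analyticAt_snd rfl
  have h2 : AnalyticAt ℂ (fun p : ℂ × ℂ => Complex.exp (Complex.I * T * p.1)) x :=
    (analyticAt_const.mul analyticAt_fst).cexp
  exact (analyticAt_det _).comp_of_eq (h1.sub (h2.smul analyticAt_const)) rfl

/-- If the order at `0` were infinite, the entire function `D(0, ·)` would vanish identically,
against the energy estimate. -/
lemma exists_analyticOrderAt_evansC :
    ∃ d : ℕ, analyticOrderAt (fun μ => h.evansC 0 μ) 0 = d := by
  have ha : AnalyticOnNhd ℂ (fun μ => h.evansC 0 μ) Set.univ := fun μ _ =>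
    analyticAt_mk_left (F := fun p : ℂ × ℂ => h.evansC p.1 p.2) (h.analyticAt_evansC (0, μ))
  refine (ENat.ne_top_iff_exists.1 fun htop => ?_).imp fun d hd => hd.symm
  obtain ⟨lam, hlam⟩ := h.exists_evans_ne_zero
  rw [h.evans_eq_evansC, Complex.ofReal_zero] at hlam
  have h0 := analyticOrderAt_eq_top.1 htop
  exact hlam (congrFun (ha.eq_of_eventuallyEq (g := fun _ => 0) (fun μ _ => analyticAt_const) h0) lam)

lemma spectrumNearOrigin_of_zeros {δ ε : ℝ} {ι : Type} [Fintype ι] {curve : ι → ℝ → ℂ}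
    (hz : ZerosNearOrigin (fun p : ℂ × ℂ => h.evansC p.1 p.2) δ ε curve) :
    SpectrumNearOrigin f B T ubar δ ε curve := by
  intro k hk
  obtain ⟨hε, hfac⟩ := hz k hk
  have hev : evans f B T ubar k = fun z => h.evansC k z := funext fun z => h.evans_eq_evansC k z
  have hbloch : ∀ z : ℂ, ‖z‖ < ε → (IsBlochEigenvalue f B T ubar k z ↔ ∃ i, curve i k = z) := by
    intro z hzε
    obtain ⟨V, -, hV0, hE⟩ := hfac z hzε
    have hE' : h.evansC k z = (∏ i, (z - curve i k)) * V z := hE.self_of_nhds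
    rw [h.isBlochEigenvalue_iff_evans, h.evans_eq_evansC, hE', mul_eq_zero,
      or_iff_left hV0, Finset.prod_eq_zero_iff]
    simp [sub_eq_zero, eq_comm]
  refine ⟨hε, hbloch, fun z hzε => ?_, fun i p hp => ?_⟩
  · obtain ⟨V, hV, hV0, hE⟩ := hfac z hzε
    rw [hev]
    exact analyticOrderAt_of_eventually_eq_prod (fun i => curve i k) hV hV0 hE
  · exact h.mem_lpSpectrum ((hbloch _ (hε i)).2 ⟨i, rfl⟩) hp

variable {ψ : ((Fin n → ℝ) × ℝ) × (Fin n → ℝ) → (Set.Icc (0 : ℝ) T →ᵇ (Fin n → ℝ))}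
  {W : ((Fin n → ℝ) × ℝ) × (Fin n → ℝ) →L[ℝ] (Set.Icc (0 : ℝ) T →ᵇ (Fin n → ℝ))}
  (hψ : IsFlowDeriv f B h.T_nonneg um ubar ψ W)
  {ℓ : (Fin n → ℝ) →L[ℝ] ℝ} {da : (Fin n → ℝ) →L[ℝ] (Fin n → ℝ)}
  {N : Matrix (Fin n) (Fin n) ℝ} (hN : IsMassDerivative h.T_nonneg ubar W ℓ da N)
include hψ hN

/-- The curves of spectrum near the origin, for a given factorization of `det (μ N + i T df)`. -/
theorem exists_spectral_branches {r : ℕ} {α : Fin r → ℂ} (hα : ∀ j, α j ≠ 0) {C : ℂ} (hC : C ≠ 0)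
    (hdet : ∀ μ : ℂ, (μ • cplx N + (Complex.I * T) • cplx (jac f um)).det =
      C * ∏ j, (μ + Complex.I * T * α j)) :
    ∃ δ > 0, ∃ ε > 0, ∃ lam : Fin (r + 1) → ℝ → ℂ, ∃ (m : ℕ) (ν : Fin m → ℝ → ℂ) (e : Fin m → ℚ),
      n ≤ r + m ∧ (r = n → m = 0) ∧ SpectrumNearOrigin f B T ubar δ ε (Sum.elim lam ν) ∧
      SmoothBranches T δ α lam ∧ (∀ i, 0 < e i ∧ e i < 1 ∧ PowerBranch δ (ν i) (e i)) ∧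
      (m ≠ 0 → ∀ p : ℝ≥0∞, 1 ≤ p → ¬ IsWeaklyStable f B ubar p) := by
  obtain ⟨d, hd⟩ := h.exists_analyticOrderAt_evansC
  obtain ⟨C', hC', hlim⟩ := h.exists_tendsto_evansC hψ hN
  obtain ⟨δ, hδ, ε, hε, lam, m, ν, e, h1, h2, h3, h4, h5, h6⟩ :=
    exists_branches (h.analyticAt_evansC (0, 0)) hd (n := n) h.profile.period_pos.ne' hα
      (mul_ne_zero hC' hC) fun μ => by
        have := hlim μ
        rw [hdet] at this
        rwa [show C' * C * (μ * ∏ j, (μ + Complex.I * T * α j)) =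
          C' * (μ * (C * ∏ j, (μ + Complex.I * T * α j))) by ring]
  refine ⟨δ, hδ, ε, hε, lam, m, ν, e, h1, h2, h.spectrumNearOrigin_of_zeros h3, h4, h5,
    fun hm p hp hst => ?_⟩
  obtain ⟨k, z, hre, hz⟩ := h6 hm
  have hb : IsBlochEigenvalue f B T ubar k z := by
    rw [h.isBlochEigenvalue_iff_evans, h.evans_eq_evansC]; exact hz
  exact absurd (hst z (h.mem_lpSpectrum hb hp)) (not_le.2 hre)

end Admissible

/-- A nonreal `α_j` forces a branch into the right half plane. -/
lemma SmoothBranches.exists_re_pos {T δ : ℝ} (hT : 0 < T) (hδ : 0 < δ) {r : ℕ} {α : Fin r → ℂ}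
    {lam : Fin (r + 1) → ℝ → ℂ} (hs : SmoothBranches T δ α lam) {j : Fin r} (hj : (α j).im ≠ 0) :
    ∃ k : ℝ, |k| < δ ∧ 0 < (lam j.succ k).re := by
  have h1 := (hs.2.2 j).2.2.2
  have hpos : 0 < |(α j).im| * T := mul_pos (abs_pos.2 hj) hT
  have h2 := h1.def (half_pos hpos)
  -- The real part of `-i α_j k T` is `Im α_j · k T`; the sign of `k` is chosen to make it positive,
  -- and the error `o(k)` is kept below half of it.
  obtain ⟨σ, hσ, hσj⟩ : ∃ σ : ℝ, |σ| = 1 ∧ σ * (α j).im = |(α j).im| := by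
    rcases lt_or_gt_of_ne hj with h | h
    · exact ⟨-1, by simp, by rw [abs_of_neg h]; ring⟩
    · exact ⟨1, by simp, by rw [abs_of_pos h]; ring⟩
  have h3 : Tendsto (fun t : ℝ => σ * t) (𝓝[>] 0) (𝓝 0) := by
    have : Continuous fun t : ℝ => σ * t := by fun_prop
    simpa using (this.tendsto 0).mono_left nhdsWithin_le_nhds
  have h4 : ∀ᶠ k : ℝ in 𝓝 0, |k| < δ := by
    filter_upwards [Metric.ball_mem_nhds (0 : ℝ) hδ] with k hk using by simpa using hk
  obtain ⟨t, ⟨h5, h6⟩, ht⟩ := ((h3.eventually h2).and (h3.eventually h4)).and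
    self_mem_nhdsWithin |>.exists
  have ht : 0 < t := ht
  refine ⟨σ * t, h6, ?_⟩
  have h7 := (Complex.abs_re_le_norm _).trans h5
  rw [Real.norm_eq_abs, abs_mul, hσ, one_mul, abs_of_pos ht] at h7
  have h8 : (lam j.succ (σ * t) - -(Complex.I * α j * ((σ * t : ℝ) : ℂ) * T)).re =
      (lam j.succ (σ * t)).re - |(α j).im| * T * t := by
    rw [← hσj]
    simp
    ring
  rw [h8] at h7
  have h9 := (abs_le.1 h7).1
  nlinarith [mul_pos hpos ht]

/-- Absence of curves of lower order. -/
lemma SpectrumNearOrigin.of_sum_elim {n : ℕ} {f : (Fin n → ℝ) → (Fin n → ℝ)}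
    {B : (Fin n → ℝ) → Matrix (Fin n) (Fin n) ℝ} {T : ℝ} {ubar : ℝ → Fin n → ℝ} {δ ε : ℝ}
    {ι κ : Type} [Fintype ι] [Fintype κ] [IsEmpty κ] {lam : ι → ℝ → ℂ} {ν : κ → ℝ → ℂ}
    (hs : SpectrumNearOrigin f B T ubar δ ε (Sum.elim lam ν)) :
    SpectrumNearOrigin f B T ubar δ ε lam := by
  intro k hk
  obtain ⟨h1, h2, h3, h4⟩ := hs k hk
  refine ⟨fun i => h1 (.inl i), fun z hz => ?_, fun z hz => ?_, fun i => h4 (.inl i)⟩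
  · rw [h2 z hz]; simp
  · rw [h3 z hz]
    congr 1
    exact Nat.card_congr ((Equiv.sumEmpty ι κ).subtypeEquiv fun i => by
      rcases i with i | i
      · simp
      · exact isEmptyElim i)

end

end PeriodicWave

end

/-! ### The theorem -/

theorem corollary6p2 {n : ℕ} (f : (Fin n → ℝ) → (Fin n → ℝ))
    (B : (Fin n → ℝ) → Matrix (Fin n) (Fin n) ℝ) (T : ℝ) (um : Fin n → ℝ)
    (ubar : ℝ → Fin n → ℝ)
    (h0f : ContDiff ℝ 2 f) (h0B : ∀ i j, ContDiff ℝ 2 (fun u => B u i j))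
    (hprofile : IsPeriodicProfile f B T um ubar)
    (h1 : ∀ x, ∀ μ ∈ spectrum ℂ (cplx (B (ubar x))), 0 < μ.re)
    (h2 : (jac f um).det ≠ 0)
    (h3 : IsTransversal f B T um ubar)
    (hH : IsQuasiHamiltonian f B um ubar) :
    ∃ N : Matrix (Fin n) (Fin n) ℝ,
      IsMassJacobian f B T um ubar N ∧
      (∀ N', IsMassJacobian f B T um ubar N' → N' = N) ∧
      (N.det ≠ 0 →
        (∀ α : Fin n → ℂ,
          (cplx (jac f um * N⁻¹)).charpoly.roots = Finset.univ.val.map α →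
          ∃ δ > 0, ∃ ε > 0, ∃ lam : Fin (n + 1) → ℝ → ℂ,
            SpectrumNearOrigin f B T ubar δ ε lam ∧ SmoothBranches T δ α lam) ∧
        ∀ p : ℝ≥0∞, 1 ≤ p → IsWeaklyStable f B ubar p →
          ∀ μ ∈ spectrum ℂ (cplx (jac f um * N⁻¹)), μ.im = 0) ∧
      (N.det = 0 →
        (∀ (r : ℕ) (β : Fin r → ℂ),
          (cplx (N * (jac f um)⁻¹)).charpoly.roots.filter (· ≠ 0) = Finset.univ.val.map β →
          ∃ δ > 0, ∃ ε > 0, ∃ lam : Fin (r + 1) → ℝ → ℂ,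
            ∃ (m : ℕ) (ν : Fin m → ℝ → ℂ) (e : Fin m → ℚ),
              n ≤ r + m ∧
              SpectrumNearOrigin f B T ubar δ ε (Sum.elim lam ν) ∧
              SmoothBranches T δ (fun j => (β j)⁻¹) lam ∧
              ∀ i, 0 < e i ∧ e i < 1 ∧ PowerBranch δ (ν i) (e i)) ∧
        ∀ p : ℝ≥0∞, 1 ≤ p → ¬ IsWeaklyStable f B ubar p) := by
  have h : Admissible f B T um ubar := ⟨h0f, h0B, hprofile, h1, h2⟩
  have hT : 0 < T := hprofile.period_pos
  have hIT : Complex.I * (T : ℂ) ≠ 0 :=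
    mul_ne_zero Complex.I_ne_zero (by exact_mod_cast hT.ne')
  obtain ⟨ψ, W, hψ⟩ := h.exists_isFlowDeriv
  obtain ⟨ℓ, da, N, hN, hNJ, hNu⟩ := h.exists_mass_derivative hψ h3 hH
  refine ⟨N, hNJ, hNu, fun hdet => ?_, fun hdet => ?_⟩
  · have key : ∀ α : Fin n → ℂ,
        (cplx (jac f um * N⁻¹)).charpoly.roots = Finset.univ.val.map α →
        ∃ δ > 0, ∃ ε > 0, ∃ lam : Fin (n + 1) → ℝ → ℂ,
          SpectrumNearOrigin f B T ubar δ ε lam ∧ SmoothBranches T δ α lam := by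
      intro α hα
      have hNC : (N.det : ℂ) ≠ 0 := by exact_mod_cast hdet
      obtain ⟨δ, hδ, ε, hε, lam, m, ν, e, -, hm, hs, hsm, -, -⟩ := h.exists_spectral_branches hψ hN
        (ne_zero_of_roots hdet h2 hα) hNC fun μ => det_pencil_of_det_ne_zero hdet hα _ μ
      -- With nonzero determinant the pencil has all `n` roots, so the count of orders excludes
      -- fractional branches.
      obtain rfl := hm rfl
      exact ⟨δ, hδ, ε, hε, lam, hs.of_sum_elim, hsm⟩
    refine ⟨key, fun p hp hst μ hμ => ?_⟩
    set M := cplx (jac f um * N⁻¹) with hM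
    have hcard : M.charpoly.roots.card = n := by
      rw [← (IsAlgClosed.splits M.charpoly).natDegree_eq_card_roots, M.charpoly_natDegree_eq_dim,
        Fintype.card_fin]
    obtain ⟨α, hα⟩ := exists_eq_map_univ M.charpoly.roots hcard
    have hμ' : μ ∈ M.charpoly.roots :=
      (Polynomial.mem_roots M.charpoly_monic.ne_zero).2 (Matrix.mem_spectrum_iff_isRoot_charpoly.1 hμ)
    rw [hα] at hμ'
    obtain ⟨j, -, rfl⟩ := Multiset.mem_map.1 hμ'
    by_contra hj
    obtain ⟨δ, hδ, ε, hε, lam, hs, hsm⟩ := key α hα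
    obtain ⟨k, hk, hre⟩ := hsm.exists_re_pos hT hδ hj
    exact absurd (hst _ ((hs k hk).2.2.2 _ p hp)) (not_le.2 hre)
  · have key : ∀ (r : ℕ) (β : Fin r → ℂ),
        (cplx (N * (jac f um)⁻¹)).charpoly.roots.filter (· ≠ 0) = Finset.univ.val.map β →
        ∃ δ > 0, ∃ ε > 0, ∃ lam : Fin (r + 1) → ℝ → ℂ,
          ∃ (m : ℕ) (ν : Fin m → ℝ → ℂ) (e : Fin m → ℚ), n ≤ r + m ∧
            SpectrumNearOrigin f B T ubar δ ε (Sum.elim lam ν) ∧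
            SmoothBranches T δ (fun j => (β j)⁻¹) lam ∧
            (∀ i, 0 < e i ∧ e i < 1 ∧ PowerBranch δ (ν i) (e i)) ∧
            (m ≠ 0 → ∀ p : ℝ≥0∞, 1 ≤ p → ¬ IsWeaklyStable f B ubar p) := by
      intro r β hβ
      have hβ0 : ∀ j, (β j)⁻¹ ≠ 0 := fun j => by
        have h1 : β j ∈ (cplx (N * (jac f um)⁻¹)).charpoly.roots.filter (· ≠ 0) := by
          rw [hβ]; exact Multiset.mem_map_of_mem _ (Finset.mem_univ_val j)
        exact inv_ne_zero (Multiset.mem_filter.1 h1).2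
      obtain ⟨C, hC, hpencil⟩ := exists_det_pencil_of_nonzero_roots h2 hβ hIT
      obtain ⟨δ, hδ, ε, hε, lam, m, ν, e, hn, -, hs, hsm, hpow, hun⟩ :=
        h.exists_spectral_branches hψ hN hβ0 hC hpencil
      exact ⟨δ, hδ, ε, hε, lam, m, ν, e, hn, hs, hsm, hpow, hun⟩
    refine ⟨fun r β hβ => ?_, ?_⟩
    · obtain ⟨δ, hδ, ε, hε, lam, m, ν, e, hn, hs, hsm, hpow, -⟩ := key r β hβ
      exact ⟨δ, hδ, ε, hε, lam, m, ν, e, hn, hs, hsm, hpow⟩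
    · obtain ⟨β, hβ⟩ := exists_eq_map_univ
        ((cplx (N * (jac f um)⁻¹)).charpoly.roots.filter (· ≠ 0)) rfl
      obtain ⟨δ, hδ, ε, hε, lam, m, ν, e, hn, -, -, -, hun⟩ := key _ β hβ
      have := lt_of_nonzero_roots hdet hβ
      -- Singularity of `N` gives fewer than `n` nonzero eigenvalues, so `n ≤ r + m` leaves at least
      -- one fractional branch.
      exact hun (by omega)
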